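/- Setting. Vectors of $\mathbb C^p$, $\mathbb C^m$ are rows and matrices act on them from the right; $M^*$ is the conjugate transpose; $(\cdot,\cdot)$ is linear in its first argument. Let $\Delta=[a,b]$ with $a<b$ (for instance $\Delta=[-l,l]$), $m=r+s$, $J_1=\begin{pmatrix}I_r&0\\0&0\end{pmatrix}$, $J_2=\begin{pmatrix}0&0\\0&I_s\end{pmatrix}$, $S=\begin{pmatrix}0&0\\ \widehat S&0\end{pmatrix}$ with an arbitrary $s\times r$ matrix $\widehat S$, and $L=J_1-J_2+S+S^*$. Let $\Pi(w)$ be a measurable $p\times m$ matrix function on $\Delta$ and put $\widetilde\Pi=\Pi^*\Pi$. Assume that on $\Delta$: $\operatorname{tr}\widetilde\Pi(w)=1$, $\widetilde\Pi(w)J_1=J_1\widetilde\Pi(w)$, $\widetilde\Pi$ is Hölder continuous with some exponent in $(0,1]$, and there is a continuously differentiable $m\times p$ matrix function $Q$ with $\Pi(w)Q(w)=I$. On $H=L^2(\Delta;\mathbb C^p)$ let $B$ be the triangular model $$Bf(w)=wf(w)-i\int_a^w f(\xi)\Pi(\xi)S^*\Pi^*(w)\,d\xi+i\int_w^b f(\xi)\Pi(\xi)S\Pi^*(w)\,d\xi+i\int_a^w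 f(\xi)\Pi(\xi)L\Pi^*(w)\,d\xi ,$$ and let $\Phi f=\int_a^b f(w)\Pi(w)\,dw\in\mathbb C^m$, $\widetilde\Phi=(\Phi,\ \Phi B^*,\ \Phi B^{*2}):H\to E=\mathbb C^{3m}$, $\sigma_B=\operatorname{diag}(L,0,0)$, $\widehat H=\overline{\operatorname{span}}\{B^n\widetilde\Phi^*e:\ n\ge 0,\ e\in E\}$. For $h\in\widehat H$ let $v_h(\xi)=\widetilde\Phi e^{i\xi B}h$ ($\xi\in\mathbb R$), and let $\widetilde H=\{v_h:h\in\widehat H\}$ and $\widetilde U:\widehat H\to\widetilde H$, $\widetilde Uh=v_h$. The operator $\widetilde S_+$. Put $\widetilde\Pi_k=J_k\widetilde\Pi J_k$ and $\Gamma(I+A)=\int_0^\infty e^{-x}e^{A\ln x}\,dx$ for a matrix $A$. Let $\overset{\curvearrowright}{\int}$ and $\overset{\curvearrowleft}{\int}$ denote the multiplicative integrals whose factors are ordered from left to right, respectively from right to left, as $v$ increases. For $a<w<b$ and $k=1,2$, with $c_1=i$, $c_2=-i$, put $$P_k(\xi,w)=\overset{\curvearrowleft}{\int_a^{\xi}}e^{\frac{c_k\widetilde\Pi_k(v)}{v-w}dv}\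 (a\le\xi<w),\qquad U_k(w)=\lim_{\delta\to0+}\ \overset{\curvearrowright}{\int_a^{w-\delta}}e^{-\frac{c_k\widetilde\Pi_k(v)}{v-w}dv}\ e^{c_k\int_a^{w-\delta}\frac{\widetilde\Pi_k(w)}{v-w}dv},\qquad F_\xi(w)=\lim_{\varepsilon\to0+}\ \overset{\curvearrowright}{\int_\xi^{b}}e^{\frac{i\widetilde\Pi_2(v)}{v-(w-i\varepsilon)}dv},$$ $$T_+(w)=\Big(J_1U_1(w)(w-a)^{i\widetilde\Pi_1(w)}e^{-\frac\pi2\widetilde\Pi_1(w)}\Gamma^{-1}(I+i\widetilde\Pi_1(w))J_1+J_2U_2(w)(w-a)^{-i\widetilde\Pi_2(w)}e^{\frac\pi2\widetilde\Pi_2(w)}\Gamma^{-1}(I-i\widetilde\Pi_2(w))J_2\Big)\Pi^*(w).$$ For $f\in C_c^\infty((a,b);\mathbb C^p)$ and $\widetilde f=fQ^*$ put $$\widetilde S_+f(w)=\Big(\int_a^w\widetilde f'(\xi)P_1(\xi,w)\,d\xi\,J_1+\int_a^w\widetilde f'(\xi)P_2(\xi,w)\,d\xi\,J_2-\int_a^b\widetilde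 f'(\xi)F_\xi(w)\,d\xi\,S\Big)T_+(w).$$ Theorem. The operator $\widetilde S_+$ extends from $C_c^\infty((a,b);\mathbb C^p)$ to a bounded linear operator on $H$, again denoted $\widetilde S_+$. For all $h,g\in\widehat H$ the limit $\lim_{\xi\to+\infty}(e^{i\xi B}h,e^{i\xi B}g)$ exists and equals $(\widetilde S_+h,\widetilde S_+g)$, and $\xi\mapsto(\sigma_Bv_h(\xi),v_g(\xi))$ is integrable on $(0,\infty)$. The relation $$\langle v_h,v_g\rangle=\lim_{\xi\to+\infty}(e^{i\xi B}h,e^{i\xi B}g)+\int_0^\infty(\sigma_Bv_h(\xi),v_g(\xi))\,d\xi=(\widetilde S_+h,\widetilde S_+g)+\int_0^\infty(\sigma_Bv_h(\xi),v_g(\xi))\,d\xi$$ is a well-defined scalar product on $\widetilde H$ (a positive definite Hermitian sesquilinear form), and $\widetilde U$ is an isometry of $\widehat H$ onto $\widetilde H$: $\langle\widetilde Uh,\widetilde Ug\rangle=(h,g)$ for all $h,g\in\widehat H$. -/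

import Mathlib

open MeasureTheory Filter Topology Matrix

noncomputable section

/-- A scalar product on a complex vector space, linear in the first argument:
a positive definite Hermitian sesquilinear form. -/
structure IsScalarProduct {V : Type*} [AddCommGroup V] [Module ℂ V] (ip : V → V → ℂ) : Prop where
  add_left : ∀ x y z, ip (x + y) z = ip x z + ip y z
  smul_left : ∀ (c : ℂ) x y, ip (c • x) y = c * ip x y
  conj_symm : ∀ x y, ip y x = starRingEnd ℂ (ip x y)
  nonneg : ∀ x, 0 ≤ (ip x x).re
  definite : ∀ x, ip x x = 0 → x = 0

/-! ### Multiplicative integrals and the matrix Gamma function -/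

section MatrixFunctions

variable {n : Type*} [Fintype n] [DecidableEq n]

open Classical in
/-- The multiplicative integral of `e ^ (M v dv)` over `[a, b]` with factors ordered from left to
right as `v` increases, for a continuous matrix function `M` and `a ≤ b`: the value at `b` of the
fundamental solution of `Y' = Y M`, `Y a = 1`. -/
def mulIntRight (M : ℝ → Matrix n n ℂ) (a b : ℝ) : Matrix n n ℂ :=
  if h : ∃ Y : ℝ → Matrix n n ℂ, Y a = 1 ∧ ∀ v ∈ Set.Icc a b, ∀ i j,
      HasDerivWithinAt (fun u => Y u i j) ((Y v * M v) i j) (Set.Icc a b) v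
  then h.choose b else 0

open Classical in
/-- The multiplicative integral of `e ^ (M v dv)` over `[a, b]` with factors ordered from right to
left as `v` increases: the value at `b` of the fundamental solution of `Y' = M Y`, `Y a = 1`. -/
def mulIntLeft (M : ℝ → Matrix n n ℂ) (a b : ℝ) : Matrix n n ℂ :=
  if h : ∃ Y : ℝ → Matrix n n ℂ, Y a = 1 ∧ ∀ v ∈ Set.Icc a b, ∀ i j,
      HasDerivWithinAt (fun u => Y u i j) ((M v * Y v) i j) (Set.Icc a b) v
  then h.choose b else 0

/-- The finite dimensional Gamma function `Γ(1 + A) = ∫₀^∞ e^{-x} e^{A ln x} dx`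
(entrywise integral). -/
def gammaOneAdd (A : Matrix n n ℂ) : Matrix n n ℂ :=
  Matrix.of fun i j => ∫ x in Set.Ioi (0 : ℝ),
    (Real.exp (-x) : ℂ) * (NormedSpace.exp ((Real.log x : ℂ) • A)) i j

end MatrixFunctions

/-! ### The triangular model -/

/-- The matrix `J₁`, the projection onto the first `r` coordinates. -/
def blockJ₁ (r s : ℕ) : Matrix (Fin r ⊕ Fin s) (Fin r ⊕ Fin s) ℂ := Matrix.fromBlocks 1 0 0 0

/-- The matrix `J₂`, the projection onto the last `s` coordinates. -/
def blockJ₂ (r s : ℕ) : Matrix (Fin r ⊕ Fin s) (Fin r ⊕ Fin s) ℂ := Matrix.fromBlocks 0 0 0 1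

/-- The data of a triangular model: an interval `Δ = [a, b]`, the `p × m` matrix function `Π` with
`m = r + s`, the block `Ŝ` of the matrix `S`, and a smooth right inverse `Q` of `Π`.
Elements of `ℂ ^ p`, `ℂ ^ m` are row vectors; matrices act on them from the right. -/
structure TriangularModel (p r s : ℕ) where
  a : ℝ
  b : ℝ
  a_lt_b : a < b
  Pi : ℝ → Matrix (Fin p) (Fin r ⊕ Fin s) ℂ
  Shat : Matrix (Fin s) (Fin r) ℂ
  Q : ℝ → Matrix (Fin r ⊕ Fin s) (Fin p) ℂ
  measurable_Pi : ∀ i j,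
    AEStronglyMeasurable (fun w => Pi w i j) (volume.restrict (Set.Icc a b))
  trace_eq_one : ∀ w ∈ Set.Icc a b, ((Pi w)ᴴ * Pi w).trace = 1
  commute_J₁ : ∀ w ∈ Set.Icc a b, Commute ((Pi w)ᴴ * Pi w) (blockJ₁ r s)
  holder : ∃ C > (0 : ℝ), ∃ α : ℝ, 0 < α ∧ α ≤ 1 ∧
    ∀ w₁ ∈ Set.Icc a b, ∀ w₂ ∈ Set.Icc a b, ∀ i j,
      ‖((Pi w₁)ᴴ * Pi w₁) i j - ((Pi w₂)ᴴ * Pi w₂) i j‖ ≤ C * |w₁ - w₂| ^ α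
  smooth_Q : ∀ i j, ContDiffOn ℝ 1 (fun w => Q w i j) (Set.Icc a b)
  Pi_mul_Q : ∀ w ∈ Set.Icc a b, Pi w * Q w = 1

namespace TriangularModel

variable {p r s : ℕ} (D : TriangularModel p r s)

/-- The matrix `S`. -/
def S : Matrix (Fin r ⊕ Fin s) (Fin r ⊕ Fin s) ℂ := Matrix.fromBlocks 0 0 D.Shat 0

/-- The matrix `L = J₁ - J₂ + S + S*`. -/
def L : Matrix (Fin r ⊕ Fin s) (Fin r ⊕ Fin s) ℂ := blockJ₁ r s - blockJ₂ r s + D.S + D.Sᴴ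

/-- Lebesgue measure on `Δ`. -/
abbrev μ : Measure ℝ := volume.restrict (Set.Icc D.a D.b)

/-- The Hilbert space `H = L²(Δ; ℂ^p)`. -/
abbrev H : Type := Lp (EuclideanSpace ℂ (Fin p)) 2 D.μ

/-- `∫_c^d f(ξ) Π(ξ) dξ`, a row vector in `ℂ ^ m`. -/
def channelInt (f : ℝ → EuclideanSpace ℂ (Fin p)) (c d : ℝ) : Fin r ⊕ Fin s → ℂ :=
  ∫ ξ in c..d, (f ξ).ofLp ᵥ* D.Pi ξ

/-- The function `B f` of the triangular model:
`w f(w) - i ∫_a^w f Π S* Π*(w) dξ + i ∫_w^b f Π S Π*(w) dξ + i ∫_a^w f Π L Π*(w) dξ`. -/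
def modelFun (f : ℝ → EuclideanSpace ℂ (Fin p)) (w : ℝ) : EuclideanSpace ℂ (Fin p) :=
  (w : ℂ) • f w
    - Complex.I • WithLp.toLp 2 (D.channelInt f D.a w ᵥ* (D.Sᴴ * (D.Pi w)ᴴ))
    + Complex.I • WithLp.toLp 2 (D.channelInt f w D.b ᵥ* (D.S * (D.Pi w)ᴴ))
    + Complex.I • WithLp.toLp 2 (D.channelInt f D.a w ᵥ* (D.L * (D.Pi w)ᴴ))

/-! Boundedness of the model operator. -/

lemma norm_Pi_le {w : ℝ} (hw : w ∈ Set.Icc D.a D.b) (i : Fin p) (j : Fin r ⊕ Fin s) :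
    ‖D.Pi w i j‖ ≤ 1 := by
  have h := congrArg Complex.re (D.trace_eq_one w hw)
  have h1 : ∑ j, ∑ i, ‖D.Pi w i j‖ ^ 2 = 1 := by
    rw [← Complex.one_re, ← h]
    simp only [Matrix.trace, Matrix.diag, Matrix.mul_apply, Complex.re_sum,
      Matrix.conjTranspose_apply]
    refine Finset.sum_congr rfl fun j _ => Finset.sum_congr rfl fun i _ => ?_
    rw [← Complex.normSq_eq_norm_sq, Complex.normSq_apply]
    simp [Complex.mul_re]
  have h2 : ‖D.Pi w i j‖ ^ 2 ≤ 1 := by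
    rw [← h1]
    refine le_trans ?_ (Finset.single_le_sum (f := fun j => ∑ i, ‖D.Pi w i j‖ ^ 2)
      (fun j _ => Finset.sum_nonneg fun i _ => sq_nonneg _) (Finset.mem_univ j))
    exact Finset.single_le_sum (f := fun i => ‖D.Pi w i j‖ ^ 2)
      (fun i _ => sq_nonneg _) (Finset.mem_univ i)
  nlinarith [norm_nonneg (D.Pi w i j)]

lemma norm_vecMul_Pi_le {w : ℝ} (hw : w ∈ Set.Icc D.a D.b) (x : EuclideanSpace ℂ (Fin p)) :
    ‖x.ofLp ᵥ* D.Pi w‖ ≤ p * ‖x‖ := by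
  refine (pi_norm_le_iff_of_nonneg (by positivity)).2 fun j => ?_
  simp only [Matrix.vecMul, dotProduct]
  refine (norm_sum_le _ _).trans ?_
  calc ∑ i, ‖x.ofLp i * D.Pi w i j‖ ≤ ∑ _i : Fin p, ‖x‖ := by
        refine Finset.sum_le_sum fun i _ => ?_
        rw [norm_mul]
        calc ‖x.ofLp i‖ * ‖D.Pi w i j‖ ≤ ‖x‖ * 1 := by
              gcongr
              · exact PiLp.norm_apply_le x i
              · exact D.norm_Pi_le hw i j
          _ = ‖x‖ := mul_one _
    _ = p * ‖x‖ := by simp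

lemma integrable_Lp (f : D.H) : Integrable (f : ℝ → EuclideanSpace ℂ (Fin p)) D.μ :=
  (Lp.memLp f).integrable (by norm_num)

lemma integrable_vecMul (f : D.H) :
    Integrable (fun ξ => ((f : ℝ → EuclideanSpace ℂ (Fin p)) ξ).ofLp ᵥ* D.Pi ξ) D.μ := by
  refine Integrable.mono' ((D.integrable_Lp f).norm.const_mul (p : ℝ)) ?_ ?_
  · refine (aemeasurable_pi_lambda _ fun j => ?_).aestronglyMeasurable
    simp only [Matrix.vecMul, dotProduct]
    refine Finset.aemeasurable_fun_sum _ fun i _ => ?_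
    refine AEMeasurable.mul ?_ (D.measurable_Pi i j).aemeasurable
    exact ((EuclideanSpace.proj (𝕜 := ℂ) i).continuous.comp_aestronglyMeasurable
      (Lp.memLp f).aestronglyMeasurable).aemeasurable
  · filter_upwards [ae_restrict_mem measurableSet_Icc] with w hw
    exact D.norm_vecMul_Pi_le hw _

lemma intervalIntegrable_vecMul (f : D.H) {c d : ℝ} (hc : c ∈ Set.Icc D.a D.b)
    (hd : d ∈ Set.Icc D.a D.b) :
    IntervalIntegrable (fun ξ => ((f : ℝ → EuclideanSpace ℂ (Fin p)) ξ).ofLp ᵥ* D.Pi ξ)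
      volume c d := by
  rw [intervalIntegrable_iff]
  exact IntegrableOn.mono_set (D.integrable_vecMul f)
    (Set.uIoc_subset_uIcc.trans (Set.uIcc_subset_Icc hc hd))

lemma norm_channelInt_le (f : D.H) {c d : ℝ} (hc : c ∈ Set.Icc D.a D.b)
    (hd : d ∈ Set.Icc D.a D.b) :
    ‖D.channelInt f c d‖ ≤ p * ∫ ξ, ‖(f : ℝ → EuclideanSpace ℂ (Fin p)) ξ‖ ∂D.μ := by
  have hsub : Set.uIoc c d ⊆ Set.Icc D.a D.b :=
    Set.uIoc_subset_uIcc.trans (Set.uIcc_subset_Icc hc hd)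
  calc ‖D.channelInt f c d‖
      ≤ ∫ ξ in Set.uIoc c d, ‖((f : ℝ → EuclideanSpace ℂ (Fin p)) ξ).ofLp ᵥ* D.Pi ξ‖ :=
        intervalIntegral.norm_integral_le_integral_norm_uIoc
    _ ≤ ∫ ξ in Set.Icc D.a D.b, ‖((f : ℝ → EuclideanSpace ℂ (Fin p)) ξ).ofLp ᵥ* D.Pi ξ‖ :=
        setIntegral_mono_set (D.integrable_vecMul f).norm
          (Eventually.of_forall fun _ => norm_nonneg _) hsub.eventuallyLE
    _ ≤ ∫ ξ in Set.Icc D.a D.b, p * ‖(f : ℝ → EuclideanSpace ℂ (Fin p)) ξ‖ := by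
        refine integral_mono_ae (D.integrable_vecMul f).norm
          ((D.integrable_Lp f).norm.const_mul _) ?_
        filter_upwards [ae_restrict_mem measurableSet_Icc] with w hw
        exact D.norm_vecMul_Pi_le hw _
    _ = _ := integral_const_mul _ _

lemma integral_norm_le (f : D.H) : ∃ C : ℝ, C = D.μ.real Set.univ ^ ((1 : ℝ) / 2) ∧
    ∫ ξ, ‖(f : ℝ → EuclideanSpace ℂ (Fin p)) ξ‖ ∂D.μ ≤ C * ‖f‖ := by
  refine ⟨_, rfl, ?_⟩
  have h := integral_mul_le_Lp_mul_Lq_of_nonneg (μ := D.μ) (p := 2) (q := 2)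
    (f := fun _ => (1 : ℝ)) (g := fun ξ => ‖(f : ℝ → EuclideanSpace ℂ (Fin p)) ξ‖)
    (by constructor <;> norm_num) (Eventually.of_forall fun _ => zero_le_one)
    (Eventually.of_forall fun _ => norm_nonneg _) (memLp_const _)
    (by simpa using (Lp.memLp f).norm)
  simp only [one_mul, Real.one_rpow, integral_const, smul_eq_mul, mul_one] at h
  refine h.trans (le_of_eq ?_)
  congr 1
  rw [Lp.norm_def, (Lp.memLp f).eLpNorm_eq_integral_rpow_norm (by norm_num) (by norm_num)]
  rw [ENNReal.toReal_ofReal (by positivity)]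
  norm_num

lemma norm_toLp_vecMul_le (K : Matrix (Fin r ⊕ Fin s) (Fin r ⊕ Fin s) ℂ) :
    ∃ C : ℝ, 0 ≤ C ∧ ∀ w ∈ Set.Icc D.a D.b, ∀ c : Fin r ⊕ Fin s → ℂ,
      ‖(WithLp.toLp 2 (c ᵥ* (K * (D.Pi w)ᴴ)) : EuclideanSpace ℂ (Fin p))‖ ≤ C * ‖c‖ := by
  refine ⟨∑ _i : Fin p, ∑ j, ∑ k, ‖K j k‖, by positivity, fun w hw c => ?_⟩
  have h1 : ∀ x : EuclideanSpace ℂ (Fin p), ‖x‖ ≤ ∑ i, ‖x i‖ := fun x => by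
    rw [EuclideanSpace.norm_eq]
    refine Real.sqrt_le_iff.2 ⟨by positivity, ?_⟩
    exact Finset.sum_sq_le_sq_sum_of_nonneg fun i _ => norm_nonneg _
  refine (h1 _).trans ?_
  rw [Finset.sum_mul]
  refine Finset.sum_le_sum fun i _ => ?_
  simp only [Matrix.vecMul, dotProduct, Matrix.mul_apply, Matrix.conjTranspose_apply]
  refine (norm_sum_le _ _).trans ?_
  rw [Finset.sum_mul]
  refine Finset.sum_le_sum fun j _ => ?_
  rw [norm_mul, mul_comm]
  gcongr
  · refine (norm_sum_le _ _).trans (Finset.sum_le_sum fun k _ => ?_)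
    rw [norm_mul, norm_star]
    exact mul_le_of_le_one_right (norm_nonneg _) (D.norm_Pi_le hw i k)
  · exact norm_le_pi_norm c j

lemma modelFun_bound : ∃ C₁ C₂ : ℝ, 0 ≤ C₁ ∧ 0 ≤ C₂ ∧ ∀ f : D.H, ∀ w ∈ Set.Icc D.a D.b,
    ‖D.modelFun f w‖ ≤ C₁ * ‖(f : ℝ → EuclideanSpace ℂ (Fin p)) w‖ + C₂ * ‖f‖ := by
  obtain ⟨A, hA, hA'⟩ := D.norm_toLp_vecMul_le D.Sᴴ
  obtain ⟨A₂, hA₂, hA₂'⟩ := D.norm_toLp_vecMul_le D.S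
  obtain ⟨A₃, hA₃, hA₃'⟩ := D.norm_toLp_vecMul_le D.L
  set κ : ℝ := p * D.μ.real Set.univ ^ ((1 : ℝ) / 2) with hκ
  have hκ0 : 0 ≤ κ := by positivity
  have key : ∀ f : D.H, ∀ c ∈ Set.Icc D.a D.b, ∀ d ∈ Set.Icc D.a D.b,
      ‖D.channelInt f c d‖ ≤ κ * ‖f‖ := fun f c hc d hd => by
    obtain ⟨C, rfl, hC⟩ := D.integral_norm_le f
    refine (D.norm_channelInt_le f hc hd).trans ?_
    rw [hκ, mul_assoc]
    gcongr
  refine ⟨|D.a| + |D.b|, (A + A₂ + A₃) * κ, by positivity, by positivity, fun f w hw => ?_⟩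
  have ha : D.a ∈ Set.Icc D.a D.b := ⟨le_rfl, D.a_lt_b.le⟩
  have hb : D.b ∈ Set.Icc D.a D.b := ⟨D.a_lt_b.le, le_rfl⟩
  have e0 : ‖(w : ℂ) • (f : ℝ → EuclideanSpace ℂ (Fin p)) w‖ ≤
      (|D.a| + |D.b|) * ‖(f : ℝ → EuclideanSpace ℂ (Fin p)) w‖ := by
    rw [norm_smul, Complex.norm_real, Real.norm_eq_abs]
    gcongr
    exact (abs_le_max_abs_abs hw.1 hw.2).trans
      (max_le (le_add_of_nonneg_right (abs_nonneg _)) (le_add_of_nonneg_left (abs_nonneg _)))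
  have e : ∀ x : EuclideanSpace ℂ (Fin p), ‖Complex.I • x‖ = ‖x‖ := fun x => by
    rw [norm_smul, Complex.norm_I, one_mul]
  have e1 := (hA' w hw (D.channelInt f D.a w)).trans
    (mul_le_mul_of_nonneg_left (key f _ ha _ hw) hA)
  have e2 := (hA₂' w hw (D.channelInt f w D.b)).trans
    (mul_le_mul_of_nonneg_left (key f _ hw _ hb) hA₂)
  have e3 := (hA₃' w hw (D.channelInt f D.a w)).trans
    (mul_le_mul_of_nonneg_left (key f _ ha _ hw) hA₃)
  unfold modelFun
  refine (norm_add_le _ _).trans ?_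
  refine (add_le_add_left ((norm_add_le _ _).trans
    (add_le_add_left (norm_sub_le _ _) _)) _).trans ?_
  rw [e, e, e]
  nlinarith

lemma memLp_modelFun (f : D.H) : MemLp (D.modelFun f) 2 D.μ := by
  have ha : D.a ∈ Set.Icc D.a D.b := ⟨le_rfl, D.a_lt_b.le⟩
  have hb : D.b ∈ Set.Icc D.a D.b := ⟨D.a_lt_b.le, le_rfl⟩
  have huIcc : Set.uIcc D.a D.b = Set.Icc D.a D.b := Set.uIcc_of_le D.a_lt_b.le
  have hint := D.intervalIntegrable_vecMul f ha hb
  have c1 : AEStronglyMeasurable (fun w => D.channelInt f D.a w) D.μ := by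
    have := intervalIntegral.continuousOn_primitive_interval' hint (a := D.a)
      (by rw [huIcc]; exact ha)
    rw [huIcc] at this
    exact this.aestronglyMeasurable measurableSet_Icc
  have c2 : AEStronglyMeasurable (fun w => D.channelInt f w D.b) D.μ := by
    have h : (fun w => D.channelInt f w D.b) =ᵐ[D.μ]
        fun w => D.channelInt f D.a D.b - D.channelInt f D.a w := by
      filter_upwards [ae_restrict_mem measurableSet_Icc] with w hw
      exact (intervalIntegral.integral_interval_sub_left hint
        (D.intervalIntegrable_vecMul f ha hw)).symm
    exact (aestronglyMeasurable_const.sub c1).congr h.symm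
  have hK : ∀ (K : Matrix (Fin r ⊕ Fin s) (Fin r ⊕ Fin s) ℂ) (c : ℝ → Fin r ⊕ Fin s → ℂ),
      AEStronglyMeasurable c D.μ → AEStronglyMeasurable
        (fun w => (WithLp.toLp 2 (c w ᵥ* (K * (D.Pi w)ᴴ)) : EuclideanSpace ℂ (Fin p))) D.μ := by
    intro K c hc
    refine (PiLp.continuous_toLp 2 _).comp_aestronglyMeasurable ?_
    refine (aemeasurable_pi_lambda _ fun i => ?_).aestronglyMeasurable
    simp only [Matrix.vecMul, dotProduct, Matrix.mul_apply, Matrix.conjTranspose_apply]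
    refine Finset.aemeasurable_fun_sum _ fun j _ => ?_
    refine AEMeasurable.mul ?_ (Finset.aemeasurable_fun_sum _ fun k _ => ?_)
    · exact (aemeasurable_pi_iff.1 hc.aemeasurable) j
    · refine AEMeasurable.mul aemeasurable_const ?_
      exact (continuous_star.comp_aestronglyMeasurable (D.measurable_Pi i k)).aemeasurable
  obtain ⟨C₁, C₂, -, -, hC⟩ := D.modelFun_bound
  refine MemLp.mono' (g := fun w => C₁ * ‖(f : ℝ → EuclideanSpace ℂ (Fin p)) w‖ + C₂ * ‖f‖)
    (((Lp.memLp f).norm.const_mul C₁).add (memLp_const _)) ?_ ?_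
  · unfold modelFun
    refine AEStronglyMeasurable.add (AEStronglyMeasurable.add (AEStronglyMeasurable.sub ?_ ?_) ?_) ?_
    · exact Complex.continuous_ofReal.aestronglyMeasurable.smul (Lp.memLp f).aestronglyMeasurable
    · exact (hK D.Sᴴ _ c1).const_smul Complex.I
    · exact (hK D.S _ c2).const_smul Complex.I
    · exact (hK D.L _ c1).const_smul Complex.I
  · filter_upwards [ae_restrict_mem measurableSet_Icc] with w hw using hC f w hw

lemma channelInt_add (f g : D.H) {c d : ℝ} (hc : c ∈ Set.Icc D.a D.b)
    (hd : d ∈ Set.Icc D.a D.b) :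
    D.channelInt ((f + g : D.H) : ℝ → EuclideanSpace ℂ (Fin p)) c d =
      D.channelInt f c d + D.channelInt g c d := by
  unfold channelInt
  rw [← intervalIntegral.integral_add (D.intervalIntegrable_vecMul f hc hd)
    (D.intervalIntegrable_vecMul g hc hd)]
  refine intervalIntegral.integral_congr_ae ?_
  have h := (ae_restrict_iff' measurableSet_Icc).1 (Lp.coeFn_add f g)
  filter_upwards [h] with w hw hw'
  rw [hw ((Set.uIoc_subset_uIcc.trans (Set.uIcc_subset_Icc hc hd)) hw')]
  simp [Matrix.add_vecMul]

lemma channelInt_smul (k : ℂ) (f : D.H) {c d : ℝ} (hc : c ∈ Set.Icc D.a D.b)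
    (hd : d ∈ Set.Icc D.a D.b) :
    D.channelInt ((k • f : D.H) : ℝ → EuclideanSpace ℂ (Fin p)) c d =
      k • D.channelInt f c d := by
  unfold channelInt
  rw [← intervalIntegral.integral_smul]
  refine intervalIntegral.integral_congr_ae ?_
  have h := (ae_restrict_iff' measurableSet_Icc).1 (Lp.coeFn_smul k f)
  filter_upwards [h] with w hw hw'
  rw [hw ((Set.uIoc_subset_uIcc.trans (Set.uIcc_subset_Icc hc hd)) hw')]
  simp [Matrix.smul_vecMul]

/-- The triangular model `B`, a bounded linear operator on `L²(Δ; ℂ^p)`. -/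
def B : D.H →L[ℂ] D.H :=
  LinearMap.mkContinuousOfExistsBound
    { toFun := fun f => (D.memLp_modelFun f).toLp (D.modelFun f)
      map_add' := fun f g => by
        rw [← MemLp.toLp_add]
        refine MemLp.toLp_congr _ _ ?_
        have ha : D.a ∈ Set.Icc D.a D.b := ⟨le_rfl, D.a_lt_b.le⟩
        have hb : D.b ∈ Set.Icc D.a D.b := ⟨D.a_lt_b.le, le_rfl⟩
        filter_upwards [Lp.coeFn_add f g, ae_restrict_mem measurableSet_Icc] with w h hw
        simp only [modelFun, Pi.add_apply, D.channelInt_add f g ha hw, D.channelInt_add f g hw hb,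
          Matrix.add_vecMul, WithLp.toLp_add, smul_add, h]
        abel
      map_smul' := fun k f => by
        rw [RingHom.id_apply, ← MemLp.toLp_const_smul]
        refine MemLp.toLp_congr _ _ ?_
        have ha : D.a ∈ Set.Icc D.a D.b := ⟨le_rfl, D.a_lt_b.le⟩
        have hb : D.b ∈ Set.Icc D.a D.b := ⟨D.a_lt_b.le, le_rfl⟩
        filter_upwards [Lp.coeFn_smul k f, ae_restrict_mem measurableSet_Icc] with w h hw
        simp only [modelFun, Pi.smul_apply, D.channelInt_smul k f ha hw,
          D.channelInt_smul k f hw hb, Matrix.smul_vecMul, WithLp.toLp_smul, smul_add, smul_sub, h]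
        simp only [smul_comm k] }
    (by
      obtain ⟨C₁, C₂, h1, h2, hC⟩ := D.modelFun_bound
      refine ⟨C₁ + C₂ * (D.μ.real Set.univ ^ ((1 : ℝ) / 2)), fun f => ?_⟩
      set G : Lp ℝ 2 D.μ := C₁ • (Lp.memLp f).norm.toLp _ +
        Lp.const 2 D.μ (C₂ * ‖f‖) with hG
      have hle : ‖(D.memLp_modelFun f).toLp (D.modelFun f)‖ ≤ ‖G‖ := by
        refine Lp.norm_le_norm_of_ae_le ?_
        filter_upwards [(D.memLp_modelFun f).coeFn_toLp, ae_restrict_mem measurableSet_Icc,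
          Lp.coeFn_add (C₁ • (Lp.memLp f).norm.toLp _) (Lp.const 2 D.μ (C₂ * ‖f‖)),
          Lp.coeFn_smul C₁ ((Lp.memLp f).norm.toLp _), (Lp.memLp f).norm.coeFn_toLp,
          Lp.coeFn_const (p := 2) (μ := D.μ) (C₂ * ‖f‖)] with w a1 a2 a3 a4 a5 a6
        rw [a1, hG, a3, Pi.add_apply, a4, Pi.smul_apply, a5, a6]
        exact (hC f w a2).trans (le_abs_self _)
      refine hle.trans ((norm_add_le _ _).trans ?_)
      rw [norm_smul, Real.norm_eq_abs, abs_of_nonneg h1, Lp.norm_toLp, eLpNorm_norm,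
        ← Lp.norm_def, add_mul]
      gcongr
      refine (Lp.norm_const_le (p := 2) (μ := D.μ) _).trans (le_of_eq ?_)
      rw [Real.norm_eq_abs, abs_of_nonneg (by positivity)]
      simp only [ENNReal.toReal_ofNat]
      ring)

lemma B_apply (f : D.H) : (D.B f : ℝ → EuclideanSpace ℂ (Fin p)) =ᵐ[D.μ] D.modelFun f :=
  (D.memLp_modelFun f).coeFn_toLp

/-- The channel operator `Φ f = ∫_a^b f(w) Π(w) dw`, from `H` to `ℂ ^ m`. -/
def Phi : D.H →L[ℂ] EuclideanSpace ℂ (Fin r ⊕ Fin s) :=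
  (PiLp.continuousLinearEquiv 2 ℂ (fun _ : Fin r ⊕ Fin s => ℂ)).symm.toContinuousLinearMap ∘L
    LinearMap.mkContinuousOfExistsBound
      { toFun := fun f => D.channelInt f D.a D.b
        map_add' := fun f g =>
          D.channelInt_add f g ⟨le_rfl, D.a_lt_b.le⟩ ⟨D.a_lt_b.le, le_rfl⟩
        map_smul' := fun k f =>
          D.channelInt_smul k f ⟨le_rfl, D.a_lt_b.le⟩ ⟨D.a_lt_b.le, le_rfl⟩ }
      ⟨p * D.μ.real Set.univ ^ ((1 : ℝ) / 2), fun f => by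
        obtain ⟨C, rfl, hC⟩ := D.integral_norm_le f
        refine (D.norm_channelInt_le f ⟨le_rfl, D.a_lt_b.le⟩ ⟨D.a_lt_b.le, le_rfl⟩).trans ?_
        rw [mul_assoc]
        gcongr⟩

/-- The space `E = ℂ ^ (3m)`, as three blocks of length `m = r + s`. -/
abbrev E (_D : TriangularModel p r s) : Type := EuclideanSpace ℂ (Fin 3 × (Fin r ⊕ Fin s))

/-- `Φ̃ = (Φ, Φ B*, Φ B*²)`, from `H` to `E`. -/
def PhiTilde : D.H →L[ℂ] D.E :=
  (PiLp.continuousLinearEquiv 2 ℂ (fun _ : Fin 3 × (Fin r ⊕ Fin s) => ℂ)).symm.toContinuousLinearMap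
    ∘L ContinuousLinearMap.pi fun x =>
      EuclideanSpace.proj x.2 ∘L D.Phi ∘L (ContinuousLinearMap.adjoint D.B ^ (x.1 : ℕ))

/-- The block matrix `σ_B = diag(L, 0, 0)`. -/
def sigmaB : Matrix (Fin 3 × (Fin r ⊕ Fin s)) (Fin 3 × (Fin r ⊕ Fin s)) ℂ :=
  Matrix.of fun x y => if x.1 = 0 ∧ y.1 = 0 then D.L x.2 y.2 else 0

/-- `σ_B v` for a row vector `v` in `E`. -/
def sigmaBApply (v : D.E) : D.E := WithLp.toLp 2 (v.ofLp ᵥ* D.sigmaB)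

/-- The bounded operator `e^{iξB}`. -/
def expB (ξ : ℝ) : D.H →L[ℂ] D.H := NormedSpace.exp ((Complex.I * (ξ : ℂ)) • D.B)

/-- The principal subspace: the closed linear span of all `B^n Φ̃* E`, `n ≥ 0`. -/
def principal : Submodule ℂ D.H :=
  (Submodule.span ℂ {h : D.H | ∃ (n : ℕ) (e : D.E),
    h = (D.B ^ n) (ContinuousLinearMap.adjoint D.PhiTilde e)}).topologicalClosure

/-- The linear map `h ↦ v_h`, where `v_h(ξ) = Φ̃ e^{iξB} h` is the mode of `h`. -/
def mode : D.H →ₗ[ℂ] (ℝ → D.E) where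
  toFun h := fun ξ => D.PhiTilde (D.expB ξ h)
  map_add' h g := by ext1 ξ; simp
  map_smul' c h := by ext1 ξ; simp

/-- The space of modes `{v_h : h in the principal subspace}`. -/
def modeSpace : Submodule ℂ (ℝ → D.E) := D.principal.map D.mode

/-- The operator `Ũ h = v_h` from the principal subspace to the space of modes. -/
def U : D.principal →ₗ[ℂ] D.modeSpace := D.mode.submoduleMap D.principal

/-! ### The explicit operator `S̃₊` -/

/-- `Π̃(w) = Π*(w) Π(w)`. -/
def PiSq (w : ℝ) : Matrix (Fin r ⊕ Fin s) (Fin r ⊕ Fin s) ℂ := (D.Pi w)ᴴ * D.Pi w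

/-- `Π̃₁(w) = J₁ Π̃(w) J₁`. -/
def PiSq₁ (w : ℝ) : Matrix (Fin r ⊕ Fin s) (Fin r ⊕ Fin s) ℂ :=
  blockJ₁ r s * D.PiSq w * blockJ₁ r s

/-- `Π̃₂(w) = J₂ Π̃(w) J₂`. -/
def PiSq₂ (w : ℝ) : Matrix (Fin r ⊕ Fin s) (Fin r ⊕ Fin s) ℂ :=
  blockJ₂ r s * D.PiSq w * blockJ₂ r s

/-- The left multiplicative integral of `e^{c N(v) / (v - w) dv}` over `[a, ξ]`, for `ξ < w`. -/
def leftFactor (c : ℂ) (N : ℝ → Matrix (Fin r ⊕ Fin s) (Fin r ⊕ Fin s) ℂ) (ξ w : ℝ) :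
    Matrix (Fin r ⊕ Fin s) (Fin r ⊕ Fin s) ℂ :=
  mulIntLeft (fun v => (c / ((v : ℂ) - w)) • N v) D.a ξ

/-- The limit as `δ → 0+` of the right multiplicative integral of `e^{-c N(v) / (v - w) dv}` over
`[a, w - δ]` times `exp (c ∫_a^{w-δ} N(w) / (v - w) dv)`. -/
def regFactor (c : ℂ) (N : ℝ → Matrix (Fin r ⊕ Fin s) (Fin r ⊕ Fin s) ℂ) (w : ℝ) :
    Matrix (Fin r ⊕ Fin s) (Fin r ⊕ Fin s) ℂ :=
  limUnder (𝓝[>] (0 : ℝ)) fun δ : ℝ =>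
    mulIntRight (fun v => (-c / ((v : ℂ) - w)) • N v) D.a (w - δ) *
      NormedSpace.exp ((c * ∫ v in D.a..(w - δ), 1 / ((v : ℂ) - w)) • N w)

/-- The boundary value at `λ = w - i0` of the right multiplicative integral of
`e^{i Π̃₂(v) / (v - λ) dv}` over `[ξ, b]`. -/
def boundaryFactor (ξ w : ℝ) : Matrix (Fin r ⊕ Fin s) (Fin r ⊕ Fin s) ℂ :=
  limUnder (𝓝[>] (0 : ℝ)) fun ε : ℝ =>
    mulIntRight (fun v => (Complex.I / ((v : ℂ) - ((w : ℂ) - Complex.I * ε))) • D.PiSq₂ v) ξ D.b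

/-- The `m × p` matrix `T₊(w)`; it acts on row vectors `h` in `ℂ ^ m` by `h ↦ h T₊(w)`. -/
def Tplus (w : ℝ) : Matrix (Fin r ⊕ Fin s) (Fin p) ℂ :=
  (blockJ₁ r s * D.regFactor Complex.I D.PiSq₁ w
      * NormedSpace.exp ((Complex.I * (Real.log (w - D.a) : ℂ)) • D.PiSq₁ w)
      * NormedSpace.exp ((-(Real.pi : ℂ) / 2) • D.PiSq₁ w)
      * (gammaOneAdd (Complex.I • D.PiSq₁ w))⁻¹ * blockJ₁ r s
    + blockJ₂ r s * D.regFactor (-Complex.I) D.PiSq₂ w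
      * NormedSpace.exp ((-Complex.I * (Real.log (w - D.a) : ℂ)) • D.PiSq₂ w)
      * NormedSpace.exp (((Real.pi : ℂ) / 2) • D.PiSq₂ w)
      * (gammaOneAdd (-Complex.I • D.PiSq₂ w))⁻¹ * blockJ₂ r s) * (D.Pi w)ᴴ

/-- `f̃(ξ) = f(ξ) Q*(ξ)`. -/
def tilde (f : ℝ → Fin p → ℂ) (ξ : ℝ) : Fin r ⊕ Fin s → ℂ := f ξ ᵥ* (D.Q ξ)ᴴ

/-- `Ŝ₊ f = S̃₁₁ f + S̃₂₂ f + S̃₁₂⁺ f`. -/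
def hatSplus (f : ℝ → Fin p → ℂ) (w : ℝ) : Fin r ⊕ Fin s → ℂ :=
  (∫ ξ in D.a..w, deriv (D.tilde f) ξ ᵥ* D.leftFactor Complex.I D.PiSq₁ ξ w) ᵥ* blockJ₁ r s
    + (∫ ξ in D.a..w, deriv (D.tilde f) ξ ᵥ* D.leftFactor (-Complex.I) D.PiSq₂ ξ w) ᵥ* blockJ₂ r s
    - (∫ ξ in D.a..D.b, deriv (D.tilde f) ξ ᵥ* D.boundaryFactor ξ w) ᵥ* D.S

/-- `T` is the bounded operator `S̃₊`: it is given by `(S̃₊ f)(w) = (Ŝ₊ f)(w) T₊(w)` on the dense set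
of smooth functions `f` with compact support inside the interval. -/
def IsSplus (T : D.H →L[ℂ] D.H) : Prop :=
  ∀ (f : ℝ → Fin p → ℂ), ContDiff ℝ ((⊤ : ℕ∞) : WithTop ℕ∞) f → HasCompactSupport f →
    tsupport f ⊆ Set.Ioo D.a D.b →
    ∀ F : D.H, (F : ℝ → EuclideanSpace ℂ (Fin p)) =ᵐ[D.μ] (fun w => WithLp.toLp 2 (f w)) →
      (T F : ℝ → EuclideanSpace ℂ (Fin p)) =ᵐ[D.μ]
        fun w => WithLp.toLp 2 (D.hatSplus f w ᵥ* D.Tplus w)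

end TriangularModel

end

noncomputable section

set_option linter.unusedSectionVars false
set_option linter.unusedVariables false

set_option linter.style.haveILetI false

/-! ### Linear differential equations in Banach algebras -/

section LinearODE

open Set intervalIntegral

variable {A : Type*} [NormedRing A] [NormedAlgebra ℝ A] [CompleteSpace A]

/-! The operator `B` is selfadjoint up to a term that factors through the channel: `B - B* = i Φ* L
Φ` (`B_sub_adjoint`). Hence (e^{iξB}h, e^{iξB}g) has the derivative -(L Φ e^{iξB}h, Φ e^{iξB}g). As
soon as ξ ↦ Φ e^{iξB}h is square integrable on (0, ∞), integration yields the limit and shows that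
limit plus integral is (h, g) (`tendsto_inner_flow`). The isometry is thus conservation of energy,
and definiteness on the modes is injectivity of h ↦ v_h on the principal subspace
(`eq_zero_of_mode_eq_zero`). What has to be proved is the square integrability and the formula for
the limit.

Both are read off from the resolvent in the lower half-plane, which is the Laplace transform of the
group. The norm of e^{ixB} grows subexponentially (`subexpGrowth_B`), so Plancherel's theorem
applies on every line Im z = -ε. At elements g Π* the resolvent is explicit (`B_resolvent`): it is
(w - z)⁻¹ Ψ(w) Π*(w), with Ψ built from the fundamental matrix of Y' = -Y G / (w - z), where G = i
Π̃ J and J = J₁ - J₂. Since G is skew-Hermitian with numerical radius at most one, only Im (w - z)⁻¹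
drives the growth of Y. Its integral has modulus at most π, and Y and its inverse are bounded
uniformly in z (`sum_sq_fundY_le`).

Square integrability follows by comparison. Up to a term i Φ* K Φ, `B` is an operator D with D - D*
= i Φ* Φ, for which the energy identity gives ∫ ‖Φ e^{ixD}h‖² ≤ ‖h‖². The bound for Y bounds the
transfer function Φ (B - z)⁻¹ Φ* (`exists_transfer_bound`). So Φ (B - z)⁻¹ is dominated by Φ (D -
z)⁻¹, and Plancherel's theorem carries the estimate back to the groups
(`exists_observability_bound`).

For the limit, Abel means and Plancherel's theorem express lim ‖e^{ixB}f‖² as the limit of (ε/π) ∫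
‖(B - τ + iε)⁻¹ f‖² dτ (`tendsto_resolvent_mean`). For a test function f the substitution τ = w + εσ
makes this a Poisson average over σ of the Π̃-form of Ψ at z = w + ε(σ - i) (`resolvent_mean_eq`).
Hölder continuity shows that Ψ(w) e^{log(w - z) G(w)} has a limit x that is independent of σ
(`tendsto_fundR_mul_exp`, `exists_tendsto_resPsi`). The form of Ψ then depends on σ only through the
phase arg(i - σ). The Poisson average of the phases is e^{-πiG} times Γ⁻¹(I + G) times its adjoint
(`isUnit_gammaOneAdd_and_integral`), by ∫ e^{2μ arctan t} / (1 + t²) dt and the reflection formula.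
This is the origin of the Gamma function in T₊.

Consequently ‖S̃₊ f‖ = lim ‖e^{ixB} f‖ on test functions. Boundedness of S̃₊ comes from the uniform
boundedness principle for the group on x ≥ 0, not from an estimate of the singular integrals;
density and polarization do the rest. -/

/-- The Picard iterates of the equation `Y' = Y M`, `Y a = 1`. -/
def picardIter (M : ℝ → A) (a : ℝ) : ℕ → ℝ → A
  | 0 => fun _ => 1
  | k + 1 => fun t => ∫ s in a..t, picardIter M a k s * M s

lemma continuous_picardIter {M : ℝ → A} (hM : Continuous M) (a : ℝ) (k : ℕ) :
    Continuous (picardIter M a k) := by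
  induction k with
  | zero => exact continuous_const
  | succ k ih =>
    exact continuous_primitive (fun _ _ => (ih.mul hM).intervalIntegrable _ _) a

/-- Against the weight exp (2 K (t - a)), integration with a coefficient of norm at most `K` halves
the size, so the Picard series is dominated by a geometric one on an interval of any length. -/
lemma norm_picardIter_le {M : ℝ → A} (hM : Continuous M) {K : ℝ} (hK : 0 < K)
    (hMK : ∀ t, ‖M t‖ ≤ K) (a : ℝ) (k : ℕ) {t : ℝ} (ht : a ≤ t) :
    ‖picardIter M a k t‖ ≤ ‖(1 : A)‖ * (1 / 2) ^ k * Real.exp (2 * K * (t - a)) := by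
  induction k generalizing t with
  | zero =>
    simp only [picardIter, pow_zero, mul_one]
    exact le_mul_of_one_le_right (norm_nonneg _) (Real.one_le_exp (by nlinarith))
  | succ k ih =>
    set c := ‖(1 : A)‖ * (1 / 2) ^ k with hc
    have hc0 : 0 ≤ c := by positivity
    have h1 : ‖picardIter M a (k + 1) t‖ ≤ ∫ s in a..t, c * Real.exp (2 * K * (s - a)) * K := by
      refine norm_integral_le_of_norm_le ht ?_ ?_
      · refine Eventually.of_forall fun s hs => (norm_mul_le _ _).trans ?_
        gcongr
        · exact ih hs.1.le
        · exact hMK s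
      · exact Continuous.intervalIntegrable (by fun_prop) _ _
    have hd : ∀ s : ℝ, HasDerivAt (fun s => c / 2 * Real.exp (2 * K * (s - a)))
        (c * Real.exp (2 * K * (s - a)) * K) s := fun s => by
      have h := (((hasDerivAt_id s).sub_const a).const_mul (2 * K)).exp.const_mul (c / 2)
      convert! h using 1
      simp; ring
    rw [integral_eq_sub_of_hasDerivAt (fun s _ => hd s)
      (Continuous.intervalIntegrable (by fun_prop) _ _)] at h1
    refine h1.trans ?_
    have : ‖(1 : A)‖ * (1 / 2) ^ (k + 1) = c / 2 := by rw [hc, pow_succ]; ring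
    rw [this]
    have : 0 ≤ c / 2 * Real.exp (2 * K * (a - a)) := by positivity
    linarith

/-- Linear differential equations with continuous coefficients have global solutions. -/
theorem exists_linearODE_solution {M : ℝ → A} {a b : ℝ} (hab : a ≤ b)
    (hM : ContinuousOn M (Icc a b)) :
    ∃ Y : ℝ → A, Y a = 1 ∧ ∀ v ∈ Icc a b, HasDerivWithinAt Y (Y v * M v) (Icc a b) v := by
  -- The coefficient is extended by its end values, so that all iterates are continuous on the whole
  -- line.
  set N : ℝ → A := IccExtend hab ((Icc a b).domRestrict M) with hN
  have hNc : Continuous N := (continuousOn_iff_continuous_domRestrict.1 hM).Icc_extend'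
  have hNM : ∀ v ∈ Icc a b, N v = M v := fun v hv => by
    rw [hN, IccExtend_of_mem hab _ hv]; rfl
  obtain ⟨K, hK0, hK⟩ : ∃ K > 0, ∀ t, ‖N t‖ ≤ K := by
    obtain ⟨C, hC⟩ := isCompact_Icc.exists_bound_of_continuousOn hM
    refine ⟨max C 1, by positivity, fun t => ?_⟩
    exact (hC _ (projIcc a b hab t).2).trans (le_max_left _ _)
  have hsum : ∀ T : ℝ, Summable fun k : ℕ => ‖(1 : A)‖ * (1 / 2 : ℝ) ^ k *
      Real.exp (2 * K * T) := fun T => by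
    exact ((summable_geometric_of_lt_one (by norm_num) (by norm_num)).mul_left _).mul_right _
  set Y : ℝ → A := fun t => ∑' k, picardIter N a k t with hY
  have hbd : ∀ k, ∀ t ∈ Icc a b, ‖picardIter N a k t‖ ≤
      ‖(1 : A)‖ * (1 / 2) ^ k * Real.exp (2 * K * (b - a)) := fun k t ht => by
    refine (norm_picardIter_le hNc hK0 hK a k ht.1).trans ?_
    have := ht.2
    gcongr
  have hYc : ContinuousOn Y (Icc a b) :=
    continuousOn_tsum (fun k => (continuous_picardIter hNc a k).continuousOn) (hsum _) hbd
  have hYint : ∀ t ∈ Icc a b, Y t = 1 + ∫ s in a..t, Y s * N s := fun t ht => by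
    have h1 : HasSum (fun k => ∫ s in a..t, picardIter N a k s * N s)
        (∫ s in a..t, Y s * N s) := by
      refine hasSum_integral_of_dominated_convergence
        (fun k _ => ‖(1 : A)‖ * (1 / 2 : ℝ) ^ k * Real.exp (2 * K * (b - a)) * K) (fun k => ?_)
        (fun k => Eventually.of_forall fun s hs => ?_) (Eventually.of_forall fun s hs => ?_)
        ?_ (Eventually.of_forall fun s hs => ?_)
      · exact ((continuous_picardIter hNc a k).mul hNc).aestronglyMeasurable
      · rw [uIoc_of_le ht.1] at hs
        refine (norm_mul_le _ _).trans ?_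
        gcongr
        · exact hbd k s ⟨hs.1.le, hs.2.trans ht.2⟩
        · exact hK s
      · exact (hsum _).mul_right _
      · exact intervalIntegrable_const
      · rw [uIoc_of_le ht.1] at hs
        refine HasSum.mul_right _ (Summable.hasSum ?_)
        exact Summable.of_norm_bounded (hsum (b - a)) fun k => hbd k s ⟨hs.1.le, hs.2.trans ht.2⟩
    have h2 : Summable fun k => picardIter N a k t :=
      Summable.of_norm_bounded (hsum (b - a)) fun k => hbd k t ht
    rw [hY]
    simp only
    rw [h2.tsum_eq_zero_add, ← h1.tsum_eq]
    rfl
  refine ⟨Y, ?_, fun v hv => ?_⟩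
  · rw [hYint a ⟨le_rfl, hab⟩]; simp
  · have hc : ContinuousOn (fun s => Y s * N s) (Icc a b) := hYc.mul hNc.continuousOn
    have : Fact (v ∈ Icc a b) := ⟨hv⟩
    have h := integral_hasDerivWithinAt_right (a := a) (b := v) (s := Icc a b) (t := Icc a b)
      (f := fun s => Y s * N s)
      ((hc.mono (by rw [uIcc_of_le hv.1]; exact Icc_subset_Icc_right hv.2)).intervalIntegrable)
      (hc.stronglyMeasurableAtFilter_nhdsWithin measurableSet_Icc v) (hc v hv)
    rw [hNM v hv] at h
    exact (h.const_add 1).congr (fun t ht => hYint t ht) (hYint v hv)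

/-- Derivatives that vanish inside an interval. -/
lemma eq_of_hasDerivWithinAt_zero {E : Type*} [NormedAddCommGroup E] [NormedSpace ℝ E]
    {f : ℝ → E} {a b : ℝ} (hf : ∀ v ∈ Icc a b, HasDerivWithinAt f 0 (Icc a b) v) :
    ∀ v ∈ Icc a b, f v = f a := by
  refine constant_of_has_deriv_right_zero (fun v hv => (hf v hv).continuousWithinAt)
    fun v hv => ?_
  exact (hf v ⟨hv.1, hv.2.le⟩).mono_of_mem_nhdsWithin (Icc_mem_nhdsGE_of_mem hv)

end LinearODE

/-! ### Multiplicative integrals -/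

section MulInt

open Set
open scoped Matrix.Norms.Operator

variable {n : Type*} [Fintype n] [DecidableEq n]

lemma Matrix.hasDerivWithinAt_iff {m n : Type*} [Fintype m] [Fintype n]
    {Y : ℝ → Matrix m n ℂ} {Y' : Matrix m n ℂ} {s : Set ℝ}
    {v : ℝ} : HasDerivWithinAt Y Y' s v ↔ ∀ i j, HasDerivWithinAt (fun u => Y u i j) (Y' i j) s v :=
  (hasDerivWithinAt_pi (E' := fun _ : m => n → ℂ)).trans
    (forall_congr' fun _ => hasDerivWithinAt_pi)

lemma Matrix.hasDerivWithinAt_conjTranspose {Y : ℝ → Matrix n n ℂ} {Y' : Matrix n n ℂ}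
    {s : Set ℝ} {v : ℝ} (h : HasDerivWithinAt Y Y' s v) :
    HasDerivWithinAt (fun u => (Y u)ᴴ) Y'ᴴ s v := by
  rw [Matrix.hasDerivWithinAt_iff] at h ⊢
  exact fun i j => (h j i).star

/-- A solution of the right equation and a solution of the adjoint left equation are inverse. -/
lemma mul_eq_one_of_ode {M Y Z : ℝ → Matrix n n ℂ} {a b : ℝ} (hYa : Y a = 1) (hZa : Z a = 1)
    (hY : ∀ v ∈ Icc a b, HasDerivWithinAt Y (Y v * M v) (Icc a b) v)
    (hZ : ∀ v ∈ Icc a b, HasDerivWithinAt Z (-M v * Z v) (Icc a b) v) :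
    ∀ v ∈ Icc a b, Y v * Z v = 1 := by
  intro v hv
  have h := eq_of_hasDerivWithinAt_zero (f := fun v => Y v * Z v) (a := a) (b := b)
    (fun v hv => by
      have h := (hY v hv).mul (hZ v hv)
      convert! h using 1
      simp [mul_assoc]) v hv
  rw [h, hYa, hZa, one_mul]

/-- Conjugate transposition exchanges the left and the right equation. -/
lemma exists_left_solution {M : ℝ → Matrix n n ℂ} {a b : ℝ} (hab : a ≤ b)
    (hM : ContinuousOn M (Icc a b)) : ∃ Y : ℝ → Matrix n n ℂ, Y a = 1 ∧
      ∀ v ∈ Icc a b, HasDerivWithinAt Y (M v * Y v) (Icc a b) v := by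
  obtain ⟨Y, hYa, hY⟩ := exists_linearODE_solution (M := fun v => (M v)ᴴ) hab
    (continuous_id.matrix_conjTranspose.comp_continuousOn hM)
  refine ⟨fun v => (Y v)ᴴ, by simp [hYa], fun v hv => ?_⟩
  convert! Matrix.hasDerivWithinAt_conjTranspose (hY v hv) using 1
  simp

/-- A solution `Z` of `Z' = -M Z`, `Z a = 1` makes `Y Z` constant for every solution `Y` of the
right equation. Since `Z` is invertible, its inverse being the fundamental solution `W`, the initial
value determines `Y`. -/
lemma right_solution_unique {M Y Y₂ : ℝ → Matrix n n ℂ} {a b : ℝ}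
    (hM : ContinuousOn M (Icc a b)) (hYa : Y a = Y₂ a)
    (hY : ∀ v ∈ Icc a b, HasDerivWithinAt Y (Y v * M v) (Icc a b) v)
    (hY₂ : ∀ v ∈ Icc a b, HasDerivWithinAt Y₂ (Y₂ v * M v) (Icc a b) v) :
    ∀ v ∈ Icc a b, Y v = Y₂ v := by
  intro v hv
  have hab : a ≤ b := hv.1.trans hv.2
  obtain ⟨W, hWa, hW⟩ := exists_linearODE_solution hab hM
  obtain ⟨Z, hZa, hZ⟩ := exists_left_solution (M := fun v => -M v) hab hM.neg
  have h : ∀ Y : ℝ → Matrix n n ℂ,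
      (∀ v ∈ Icc a b, HasDerivWithinAt Y (Y v * M v) (Icc a b) v) → Y v * Z v = Y a := by
    intro Y hY
    have h := eq_of_hasDerivWithinAt_zero (f := fun v => Y v * Z v) (a := a) (b := b)
      (fun v hv => by
        have h := (hY v hv).mul (hZ v hv)
        convert! h using 1
        simp [mul_assoc]) v hv
    rw [h, hZa, mul_one]
  have hu : Z v * W v = 1 := mul_eq_one_comm.1 (mul_eq_one_of_ode hWa hZa hW hZ v hv)
  calc Y v = Y v * Z v * W v := by rw [mul_assoc, hu, mul_one]
    _ = Y₂ v * Z v * W v := by rw [h Y hY, h Y₂ hY₂, hYa]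
    _ = Y₂ v := by rw [mul_assoc, hu, mul_one]

lemma left_solution_unique {M Y Y₂ : ℝ → Matrix n n ℂ} {a b : ℝ}
    (hM : ContinuousOn M (Icc a b)) (hYa : Y a = Y₂ a)
    (hY : ∀ v ∈ Icc a b, HasDerivWithinAt Y (M v * Y v) (Icc a b) v)
    (hY₂ : ∀ v ∈ Icc a b, HasDerivWithinAt Y₂ (M v * Y₂ v) (Icc a b) v) :
    ∀ v ∈ Icc a b, Y v = Y₂ v := by
  intro v hv
  have h := right_solution_unique (M := fun v => (M v)ᴴ) (Y := fun v => (Y v)ᴴ)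
    (Y₂ := fun v => (Y₂ v)ᴴ) (a := a) (b := b) (continuous_id.matrix_conjTranspose.comp_continuousOn hM)
    (by simp [hYa])
    (fun v hv => by convert! Matrix.hasDerivWithinAt_conjTranspose (hY v hv) using 1; simp)
    (fun v hv => by convert! Matrix.hasDerivWithinAt_conjTranspose (hY₂ v hv) using 1; simp) v hv
  exact Matrix.conjTranspose_injective h

/-- The right multiplicative integral is the value of any solution of `Y' = Y M`. -/
lemma mulIntRight_eq {M Y : ℝ → Matrix n n ℂ} {a b : ℝ} (hab : a ≤ b)
    (hM : ContinuousOn M (Icc a b)) (hYa : Y a = 1)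
    (hY : ∀ v ∈ Icc a b, HasDerivWithinAt Y (Y v * M v) (Icc a b) v) :
    mulIntRight M a b = Y b := by
  have hex : ∃ Y : ℝ → Matrix n n ℂ, Y a = 1 ∧ ∀ v ∈ Icc a b, ∀ i j,
      HasDerivWithinAt (fun u => Y u i j) ((Y v * M v) i j) (Icc a b) v :=
    ⟨Y, hYa, fun v hv => Matrix.hasDerivWithinAt_iff.1 (hY v hv)⟩
  rw [mulIntRight, dif_pos hex]
  refine right_solution_unique hM (hex.choose_spec.1.trans hYa.symm)
    (fun v hv => Matrix.hasDerivWithinAt_iff.2 (hex.choose_spec.2 v hv)) hY b ⟨hab, le_rfl⟩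

/-- The left multiplicative integral is the value of any solution of `Y' = M Y`. -/
lemma mulIntLeft_eq {M Y : ℝ → Matrix n n ℂ} {a b : ℝ} (hab : a ≤ b)
    (hM : ContinuousOn M (Icc a b)) (hYa : Y a = 1)
    (hY : ∀ v ∈ Icc a b, HasDerivWithinAt Y (M v * Y v) (Icc a b) v) :
    mulIntLeft M a b = Y b := by
  have hex : ∃ Y : ℝ → Matrix n n ℂ, Y a = 1 ∧ ∀ v ∈ Icc a b, ∀ i j,
      HasDerivWithinAt (fun u => Y u i j) ((M v * Y v) i j) (Icc a b) v :=
    ⟨Y, hYa, fun v hv => Matrix.hasDerivWithinAt_iff.1 (hY v hv)⟩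
  rw [mulIntLeft, dif_pos hex]
  refine left_solution_unique hM (hex.choose_spec.1.trans hYa.symm)
    (fun v hv => Matrix.hasDerivWithinAt_iff.2 (hex.choose_spec.2 v hv)) hY b ⟨hab, le_rfl⟩

lemma mulIntRight_self (M : ℝ → Matrix n n ℂ) (a : ℝ) : mulIntRight M a a = 1 := by
  have hM : ContinuousOn M (Icc a a) := by simp
  obtain ⟨Y, hYa, hY⟩ := exists_linearODE_solution le_rfl hM
  rw [mulIntRight_eq le_rfl hM hYa hY, hYa]

lemma mulIntLeft_self (M : ℝ → Matrix n n ℂ) (a : ℝ) : mulIntLeft M a a = 1 := by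
  have hM : ContinuousOn M (Icc a a) := by simp
  obtain ⟨Y, hYa, hY⟩ := exists_left_solution le_rfl hM
  rw [mulIntLeft_eq le_rfl hM hYa hY, hYa]

/-- The definition of `mulIntRight` chooses a solution anew for every upper limit. By uniqueness a
single solution on `[a, b]` represents all these values, and it can be differentiated. -/
lemma hasDerivWithinAt_mulIntRight {M : ℝ → Matrix n n ℂ} {a b : ℝ}
    (hM : ContinuousOn M (Icc a b)) {v : ℝ} (hv : v ∈ Icc a b) :
    HasDerivWithinAt (fun w => mulIntRight M a w) (mulIntRight M a v * M v) (Icc a b) v := by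
  obtain ⟨Y, hYa, hY⟩ := exists_linearODE_solution (hv.1.trans hv.2) hM
  have h : ∀ w ∈ Icc a b, mulIntRight M a w = Y w := fun w hw =>
    mulIntRight_eq hw.1 (hM.mono (Icc_subset_Icc_right hw.2)) hYa fun u hu =>
      (hY u ⟨hu.1, hu.2.trans hw.2⟩).mono (Icc_subset_Icc_right hw.2)
  rw [h v hv]
  exact (hY v hv).congr h (h v hv)

lemma hasDerivWithinAt_mulIntLeft {M : ℝ → Matrix n n ℂ} {a b : ℝ}
    (hM : ContinuousOn M (Icc a b)) {v : ℝ} (hv : v ∈ Icc a b) :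
    HasDerivWithinAt (fun w => mulIntLeft M a w) (M v * mulIntLeft M a v) (Icc a b) v := by
  obtain ⟨Y, hYa, hY⟩ := exists_left_solution (hv.1.trans hv.2) hM
  have h : ∀ w ∈ Icc a b, mulIntLeft M a w = Y w := fun w hw =>
    mulIntLeft_eq hw.1 (hM.mono (Icc_subset_Icc_right hw.2)) hYa fun u hu =>
      (hY u ⟨hu.1, hu.2.trans hw.2⟩).mono (Icc_subset_Icc_right hw.2)
  rw [h v hv]
  exact (hY v hv).congr h (h v hv)

lemma mulIntRight_mul_mulIntLeft {M : ℝ → Matrix n n ℂ} {a b : ℝ} (hab : a ≤ b)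
    (hM : ContinuousOn M (Icc a b)) :
    mulIntRight M a b * mulIntLeft (fun v => -M v) a b = 1 :=
  mul_eq_one_of_ode (M := M) (Y := fun w => mulIntRight M a w)
    (Z := fun w => mulIntLeft (fun v => -M v) a w)
    (mulIntRight_self _ _) (mulIntLeft_self _ _)
    (fun _ hv => hasDerivWithinAt_mulIntRight hM hv)
    (fun _ hv => hasDerivWithinAt_mulIntLeft hM.neg hv) b ⟨hab, le_rfl⟩

/-- The multiplicative integral over a subinterval. -/
lemma mulIntRight_eq_mul {M : ℝ → Matrix n n ℂ} {a b ξ : ℝ} (hξ : ξ ∈ Icc a b)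
    (hM : ContinuousOn M (Icc a b)) :
    mulIntRight M ξ b = mulIntLeft (fun v => -M v) a ξ * mulIntRight M a b := by
  refine mulIntRight_eq (Y := fun w => mulIntLeft (fun v => -M v) a ξ * mulIntRight M a w) hξ.2
    (hM.mono (Icc_subset_Icc_left hξ.1)) ?_ fun v hv => ?_
  · exact mul_eq_one_comm.1
      (mulIntRight_mul_mulIntLeft hξ.1 (hM.mono (Icc_subset_Icc_right hξ.2)))
  · rw [mul_assoc]
    exact ((hasDerivWithinAt_mulIntRight hM ⟨hξ.1.trans hv.1, hv.2⟩).mono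
      (Icc_subset_Icc_left hξ.1)).const_mul _

/-- A matrix that intertwines two coefficient functions intertwines the multiplicative integrals. -/
lemma mul_mulIntRight_eq_of_intertwine {J : Matrix n n ℂ} {M N : ℝ → Matrix n n ℂ} {a b : ℝ}
    (hab : a ≤ b) (hM : ContinuousOn M (Icc a b)) (hN : ContinuousOn N (Icc a b))
    (hJ : ∀ v ∈ Icc a b, M v * J = J * N v) :
    mulIntRight M a b * J = J * mulIntRight N a b := by
  refine right_solution_unique (M := N) (Y := fun w => mulIntRight M a w * J)
    (Y₂ := fun w => J * mulIntRight N a w) hN ?_ (fun v hv => ?_) (fun v hv => ?_) b ⟨hab, le_rfl⟩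
  · simp [mulIntRight_self]
  · rw [mul_assoc, ← hJ v hv, ← mul_assoc]
    exact (hasDerivWithinAt_mulIntRight hM hv).mul_const J
  · rw [mul_assoc]
    exact (hasDerivWithinAt_mulIntRight hN hv).const_mul J

lemma mul_mulIntLeft_eq_of_intertwine {J : Matrix n n ℂ} {M N : ℝ → Matrix n n ℂ} {a b : ℝ}
    (hab : a ≤ b) (hM : ContinuousOn M (Icc a b)) (hN : ContinuousOn N (Icc a b))
    (hJ : ∀ v ∈ Icc a b, M v * J = J * N v) :
    mulIntLeft M a b * J = J * mulIntLeft N a b := by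
  refine left_solution_unique (M := M) (Y := fun w => mulIntLeft M a w * J)
    (Y₂ := fun w => J * mulIntLeft N a w) hM ?_ (fun v hv => ?_) (fun v hv => ?_) b ⟨hab, le_rfl⟩
  · simp [mulIntLeft_self]
  · rw [← mul_assoc]
    exact (hasDerivWithinAt_mulIntLeft hM hv).mul_const J
  · rw [← mul_assoc, hJ v hv, mul_assoc]
    exact (hasDerivWithinAt_mulIntLeft hN hv).const_mul J

end MulInt

/-! ### Fundamental matrices with a Cauchy kernel, bounded uniformly in the spectral parameter -/

section Fundamental

open Set
open scoped Matrix.Norms.Operator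

variable {n : Type*} [Fintype n] [DecidableEq n]

lemma integral_eq_sub_of_hasDerivWithinAt_Icc {E : Type*} [NormedAddCommGroup E] [NormedSpace ℝ E]
    [CompleteSpace E] {F f : ℝ → E} {a b : ℝ}
    (hF : ∀ v ∈ Icc a b, HasDerivWithinAt F (f v) (Icc a b) v) (hf : ContinuousOn f (Icc a b))
    {ξ w : ℝ} (hξ : ξ ∈ Icc a b) (hw : w ∈ Icc a b) : ∫ v in ξ..w, f v = F w - F ξ := by
  have key : ∀ w ∈ Icc a b, ∫ v in a..w, f v = F w - F a := fun w hw => by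
    have hsub : Icc a w ⊆ Icc a b := Icc_subset_Icc_right hw.2
    refine intervalIntegral.integral_eq_sub_of_hasDerivAt_of_le hw.1
      (fun v hv => ((hF v (hsub hv)).continuousWithinAt).mono hsub) (fun v hv => ?_) ?_
    · exact (hF v (hsub (Ioo_subset_Icc_self hv))).hasDerivAt
        (Icc_mem_nhds hv.1 (hv.2.trans_le hw.2))
    · exact (hf.mono (by rw [uIcc_of_le hw.1]; exact hsub)).intervalIntegrable
  have ha : a ∈ Icc a b := ⟨le_rfl, hw.1.trans hw.2⟩
  have hint : ∀ w ∈ Icc a b, IntervalIntegrable f volume a w := fun w hw =>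
    (hf.mono (by rw [uIcc_of_le hw.1]; exact Icc_subset_Icc_right hw.2)).intervalIntegrable
  rw [← intervalIntegral.integral_interval_sub_left (hint w hw) (hint ξ hξ), key w hw, key ξ hξ]
  abel

/-- A continuous skew-Hermitian matrix function on `[a, b]` with numerical radius at most one. -/
structure IsSkewKernel (G : ℝ → Matrix n n ℂ) (a b : ℝ) : Prop where
  cont : ContinuousOn G (Icc a b)
  skew : ∀ w ∈ Icc a b, (G w)ᴴ = -G w
  bound : ∀ w ∈ Icc a b, ∀ x : n → ℂ, ‖(x ᵥ* G w) ⬝ᵥ star x‖ ≤ ∑ j, ‖x j‖ ^ 2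

lemma IsSkewKernel.mono {G : ℝ → Matrix n n ℂ} {a b c : ℝ} (h : IsSkewKernel G a b) (hc : c ≤ b) :
    IsSkewKernel G a c :=
  ⟨h.cont.mono (Icc_subset_Icc_right hc), fun w hw => h.skew w (Icc_subset_Icc_right hc hw),
    fun w hw => h.bound w (Icc_subset_Icc_right hc hw)⟩

/-- The solution of `Y' = - Y G / (w - z)`, `Y a = 1`. -/
def fundY (G : ℝ → Matrix n n ℂ) (a : ℝ) (z : ℂ) (w : ℝ) : Matrix n n ℂ :=
  mulIntRight (fun v => -(((v : ℂ) - z)⁻¹ • G v)) a w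

/-- The solution of `Z' = G Z / (w - z)`, `Z a = 1`; it is the inverse of `fundY`. -/
def fundZ (G : ℝ → Matrix n n ℂ) (a : ℝ) (z : ℂ) (w : ℝ) : Matrix n n ℂ :=
  mulIntLeft (fun v => ((v : ℂ) - z)⁻¹ • G v) a w

variable {G : ℝ → Matrix n n ℂ} {a b : ℝ} {z : ℂ}

lemma continuousOn_cauchyKernel (hz : ∀ v ∈ Icc a b, (v : ℂ) ≠ z) :
    ContinuousOn (fun v : ℝ => ((v : ℂ) - z)⁻¹) (Icc a b) :=
  ContinuousOn.inv₀ (by fun_prop) fun v hv => sub_ne_zero.2 (hz v hv)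

lemma continuousOn_cauchyKernel_smul (hG : ContinuousOn G (Icc a b))
    (hz : ∀ v ∈ Icc a b, (v : ℂ) ≠ z) :
    ContinuousOn (fun v : ℝ => ((v : ℂ) - z)⁻¹ • G v) (Icc a b) :=
  (continuousOn_cauchyKernel hz).smul hG

lemma ofReal_ne_of_im_ne_zero (hz : z.im ≠ 0) (v : ℝ) : (v : ℂ) ≠ z := by
  rintro rfl; simp at hz

lemma fundY_self (G : ℝ → Matrix n n ℂ) (a : ℝ) (z : ℂ) : fundY G a z a = 1 := mulIntRight_self _ _

lemma fundZ_self (G : ℝ → Matrix n n ℂ) (a : ℝ) (z : ℂ) : fundZ G a z a = 1 := mulIntLeft_self _ _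

lemma hasDerivWithinAt_fundY (hG : ContinuousOn G (Icc a b)) (hz : ∀ v ∈ Icc a b, (v : ℂ) ≠ z)
    {v : ℝ} (hv : v ∈ Icc a b) :
    HasDerivWithinAt (fundY G a z) (-(((v : ℂ) - z)⁻¹ • (fundY G a z v * G v))) (Icc a b) v := by
  have h := hasDerivWithinAt_mulIntRight (M := fun v => -(((v : ℂ) - z)⁻¹ • G v))
    (continuousOn_cauchyKernel_smul hG hz).neg hv
  convert! h using 1
  simp [fundY]

lemma hasDerivWithinAt_fundZ (hG : ContinuousOn G (Icc a b)) (hz : ∀ v ∈ Icc a b, (v : ℂ) ≠ z)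
    {v : ℝ} (hv : v ∈ Icc a b) :
    HasDerivWithinAt (fundZ G a z) (((v : ℂ) - z)⁻¹ • (G v * fundZ G a z v)) (Icc a b) v := by
  have h := hasDerivWithinAt_mulIntLeft (continuousOn_cauchyKernel_smul hG hz) hv
  convert! h using 1
  simp [fundZ]

lemma continuousOn_fundY (hG : ContinuousOn G (Icc a b)) (hz : ∀ v ∈ Icc a b, (v : ℂ) ≠ z) :
    ContinuousOn (fundY G a z) (Icc a b) :=
  fun _ hv => (hasDerivWithinAt_fundY hG hz hv).continuousWithinAt

lemma continuousOn_fundZ (hG : ContinuousOn G (Icc a b)) (hz : ∀ v ∈ Icc a b, (v : ℂ) ≠ z) :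
    ContinuousOn (fundZ G a z) (Icc a b) :=
  fun _ hv => (hasDerivWithinAt_fundZ hG hz hv).continuousWithinAt

lemma fundY_mul_fundZ (hG : ContinuousOn G (Icc a b)) (hz : ∀ v ∈ Icc a b, (v : ℂ) ≠ z)
    {v : ℝ} (hv : v ∈ Icc a b) : fundY G a z v * fundZ G a z v = 1 := by
  have h := mulIntRight_mul_mulIntLeft (M := fun v => -(((v : ℂ) - z)⁻¹ • G v)) hv.1
    ((continuousOn_cauchyKernel_smul hG hz).neg.mono (Icc_subset_Icc_right hv.2))
  simpa [fundY, fundZ] using h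

lemma fundZ_mul_fundY (hG : ContinuousOn G (Icc a b)) (hz : ∀ v ∈ Icc a b, (v : ℂ) ≠ z)
    {v : ℝ} (hv : v ∈ Icc a b) : fundZ G a z v * fundY G a z v = 1 :=
  mul_eq_one_comm.1 (fundY_mul_fundZ hG hz hv)

/-- Taking adjoints in the equation of `fundY` replaces `z` by its conjugate and, as `G` is skew,
restores the sign in the equation of `fundZ`. This transfers bounds from the fundamental matrix to
its inverse. -/
lemma fundZ_eq_conjTranspose (hG : IsSkewKernel G a b) (hz : ∀ v ∈ Icc a b, (v : ℂ) ≠ z)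
    {v : ℝ} (hv : v ∈ Icc a b) :
    fundZ G a z v = (fundY G a (starRingEnd ℂ z) v)ᴴ := by
  have hz' : ∀ v ∈ Icc a b, (v : ℂ) ≠ starRingEnd ℂ z := fun v hv h => hz v hv (by
    rw [← Complex.conj_conj z, ← h, Complex.conj_ofReal])
  refine left_solution_unique (Y := fundZ G a z)
    (Y₂ := fun v => (fundY G a (starRingEnd ℂ z) v)ᴴ)
    (continuousOn_cauchyKernel_smul hG.cont hz) ?_ (fun v hv => ?_) (fun v hv => ?_) v hv
  · simp [fundY_self, fundZ_self]
  · rw [Matrix.smul_mul]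
    exact hasDerivWithinAt_fundZ hG.cont hz hv
  · convert! Matrix.hasDerivWithinAt_conjTranspose (hasDerivWithinAt_fundY hG.cont hz' hv) using 1
    simp [hG.skew v hv]

lemma skew_form_re {M : Matrix n n ℂ} (hM : Mᴴ = -M) (x : n → ℂ) :
    ((x ᵥ* M) ⬝ᵥ star x).re = 0 := by
  have h : star ((x ᵥ* M) ⬝ᵥ star x) = -((x ᵥ* M) ⬝ᵥ star x) := by
    rw [← Matrix.star_dotProduct_star, star_star, Matrix.star_vecMul, hM, Matrix.neg_mulVec,
      dotProduct_neg, Matrix.dotProduct_mulVec]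
  have := congrArg Complex.re h
  simp only [Complex.star_def, Complex.conj_re, Complex.neg_re] at this
  linarith

/-- A primitive of `2 |Im z| / |w - z|²` with oscillation at most `2π`. -/
lemma hasDerivAt_arctan_weight (hz : z.im ≠ 0) (w : ℝ) :
    HasDerivAt (fun w : ℝ => 2 * Real.arctan ((w - z.re) / |z.im|))
      (2 * |(((w : ℂ) - z)⁻¹).im|) w := by
  have h0 : 0 < |z.im| := abs_pos.2 hz
  have h := ((((hasDerivAt_id w).sub_const z.re).div_const |z.im|).arctan).const_mul 2
  convert! h using 1
  have h1 : Complex.normSq ((w : ℂ) - z) = (w - z.re) ^ 2 + |z.im| ^ 2 := by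
    rw [Complex.normSq_apply, sq_abs]; simp; ring
  have h2 : 0 < (w - z.re) ^ 2 + |z.im| ^ 2 := by positivity
  rw [Complex.inv_im, h1, abs_div, abs_of_pos h2]
  simp only [id, Complex.sub_im, Complex.ofReal_im, zero_sub, neg_neg]
  have h3 : 0 < 1 + ((w - z.re) / |z.im|) ^ 2 := by positivity
  field_simp
  ring

/-- The form `q` of a skew matrix is purely imaginary, so the derivative of the squared row norm `φ`
is 2 Im((v - z)⁻¹) Im q, of modulus at most 2 |Im (v - z)⁻¹| φ. This weight is a Poisson kernel
whose integral is at most 2π whatever `z` is. Hence the bound depends neither on `z` nor on the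
interval. -/
lemma sum_sq_fundY_le (hG : IsSkewKernel G a b) (hz : ∀ v ∈ Icc a b, (v : ℂ) ≠ z)
    {w : ℝ} (hw : w ∈ Icc a b) (i : n) :
    ∑ j, ‖fundY G a z w i j‖ ^ 2 ≤ Real.exp (2 * Real.pi) := by
  obtain ⟨k, hk, hk1⟩ : ∃ k : ℝ → ℝ, (∀ v ∈ Icc a b,
      HasDerivAt k (2 * |(((v : ℂ) - z)⁻¹).im|) v) ∧ ∀ v w, k v - k w ≤ 2 * Real.pi := by
    -- For real `z` the kernel is real and the row norm is conserved; otherwise `k` is the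
    -- arctangent primitive of the weight.
    by_cases him : z.im = 0
    · refine ⟨fun _ => 0, fun v _ => ?_, fun v w => by simpa using Real.pi_pos.le⟩
      have : (((v : ℂ) - z)⁻¹).im = 0 := by rw [Complex.inv_im]; simp [him]
      rw [this]
      simpa using hasDerivAt_const v (0 : ℝ)
    · refine ⟨_, fun v _ => hasDerivAt_arctan_weight him v, fun v w => ?_⟩
      have h1 := Real.arctan_lt_pi_div_two ((v - z.re) / |z.im|)
      have h2 := Real.neg_pi_div_two_lt_arctan ((w - z.re) / |z.im|)
      linarith
  set φ : ℝ → ℝ := fun w => ∑ j, ‖fundY G a z w i j‖ ^ 2 with hφ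
  set q : ℝ → ℂ := fun v => ((fun j => fundY G a z v i j) ᵥ* G v) ⬝ᵥ
    star (fun j => fundY G a z v i j) with hq
  have hφ0 : ∀ v, 0 ≤ φ v := fun v => Finset.sum_nonneg fun j _ => sq_nonneg _
  have hd : ∀ v ∈ Icc a b,
      HasDerivWithinAt φ (2 * ((((v : ℂ) - z)⁻¹).im * (q v).im)) (Icc a b) v := by
    intro v hv
    have h : ∀ j ∈ Finset.univ, HasDerivWithinAt (fun u => ‖fundY G a z u i j‖ ^ 2)
        (2 * inner ℝ (fundY G a z v i j) ((-(((v : ℂ) - z)⁻¹ • (fundY G a z v * G v))) i j))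
        (Icc a b) v := fun j _ =>
      (Matrix.hasDerivWithinAt_iff.1 (hasDerivWithinAt_fundY hG.cont hz hv) i j).norm_sq
    have h2 := HasDerivWithinAt.fun_sum h
    convert! h2 using 1
    rw [← Finset.mul_sum]
    congr 1
    have e : ∑ j, inner ℝ (fundY G a z v i j)
        ((-(((v : ℂ) - z)⁻¹ • (fundY G a z v * G v))) i j) = (-((v : ℂ) - z)⁻¹ * q v).re := by
      simp only [hq, dotProduct, Finset.mul_sum, Complex.re_sum]
      refine Finset.sum_congr rfl fun j _ => ?_
      rw [Complex.inner, Matrix.neg_apply, Matrix.smul_apply, smul_eq_mul, Matrix.mul_apply]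
      simp only [Matrix.vecMul, dotProduct, Pi.star_apply, Complex.star_def]
      congr 1
      ring
    rw [e, Complex.mul_re, skew_form_re (hG.skew v hv)]
    simp
  have hq' : ∀ v ∈ Icc a b, |(q v).im| ≤ φ v := fun v hv =>
    (Complex.abs_im_le_norm _).trans (hG.bound v hv _)
  -- Gronwall's inequality, with exp (-k) as integrating factor.
  have hanti : AntitoneOn (fun v => φ v * Real.exp (-k v)) (Icc a b) := by
    have hd' : ∀ v ∈ Icc a b, HasDerivWithinAt (fun v => φ v * Real.exp (-k v))
        (2 * ((((v : ℂ) - z)⁻¹).im * (q v).im) * Real.exp (-k v) +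
          φ v * (Real.exp (-k v) * (-(2 * |(((v : ℂ) - z)⁻¹).im|)))) (Icc a b) v := fun v hv =>
      (hd v hv).mul ((hk v hv).hasDerivWithinAt.neg.exp)
    refine antitoneOn_of_hasDerivWithinAt_nonpos (convex_Icc a b)
      (fun v hv => (hd' v hv).continuousWithinAt)
      (fun v hv => (hd' v (interior_subset hv)).mono interior_subset) fun v hv => ?_
    have h1 := hq' v (interior_subset hv)
    have h2 : (((v : ℂ) - z)⁻¹).im * (q v).im ≤ |(((v : ℂ) - z)⁻¹).im| * φ v := by
      refine (le_abs_self _).trans ?_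
      rw [abs_mul]
      gcongr
    have h3 := Real.exp_pos (-k v)
    nlinarith
  have ha : a ∈ Icc a b := ⟨le_rfl, hw.1.trans hw.2⟩
  have h := hanti ha hw hw.1
  have hφa : φ a = 1 := by
    simp only [hφ, fundY_self]
    rw [Finset.sum_eq_single i (fun j _ hj => by simp [Matrix.one_apply_ne hj.symm]) (by simp)]
    simp
  simp only [hφa, one_mul] at h
  calc φ w = φ w * Real.exp (-k w) * Real.exp (k w) := by
        rw [mul_assoc, ← Real.exp_add]; simp
    _ ≤ Real.exp (-k a) * Real.exp (k w) := by gcongr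
    _ = Real.exp (k w - k a) := by rw [← Real.exp_add]; congr 1; ring
    _ ≤ _ := Real.exp_le_exp.2 (hk1 _ _)

lemma norm_fundY_apply_le (hG : IsSkewKernel G a b) (hz : ∀ v ∈ Icc a b, (v : ℂ) ≠ z)
    {w : ℝ} (hw : w ∈ Icc a b) (i j : n) : ‖fundY G a z w i j‖ ≤ Real.exp Real.pi := by
  have h := (Finset.single_le_sum (f := fun j => ‖fundY G a z w i j‖ ^ 2)
    (fun _ _ => sq_nonneg _) (Finset.mem_univ j)).trans (sum_sq_fundY_le hG hz hw i)
  refine abs_le_of_sq_le_sq' ?_ (Real.exp_pos _).le |>.2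
  rw [← Real.exp_nat_mul]
  exact_mod_cast h

lemma Matrix.norm_le_of_forall_apply_le {M : Matrix n n ℂ} {c : ℝ} (hc : 0 ≤ c)
    (h : ∀ i j, ‖M i j‖ ≤ c) : ‖M‖ ≤ Fintype.card n * c := by
  lift c to NNReal using hc
  rw [Matrix.linfty_opNorm_def]
  have : (Finset.univ.sup fun i => ∑ j, ‖M i j‖₊) ≤ Fintype.card n * c := by
    refine Finset.sup_le fun i _ => ?_
    refine (Finset.sum_le_card_nsmul _ _ c fun j _ => h i j).trans (by simp)
  exact_mod_cast this

/-- A common bound for the fundamental solutions. -/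
def fundBound (n : Type*) [Fintype n] : ℝ := Fintype.card n * Real.exp Real.pi

lemma fundBound_nonneg : 0 ≤ fundBound n := by unfold fundBound; positivity

lemma norm_fundY_le (hG : IsSkewKernel G a b) (hz : ∀ v ∈ Icc a b, (v : ℂ) ≠ z)
    {w : ℝ} (hw : w ∈ Icc a b) : ‖fundY G a z w‖ ≤ fundBound n :=
  Matrix.norm_le_of_forall_apply_le (Real.exp_pos _).le (norm_fundY_apply_le hG hz hw)

lemma norm_fundZ_le (hG : IsSkewKernel G a b) (hz : ∀ v ∈ Icc a b, (v : ℂ) ≠ z)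
    {w : ℝ} (hw : w ∈ Icc a b) : ‖fundZ G a z w‖ ≤ fundBound n := by
  have hz' : ∀ v ∈ Icc a b, (v : ℂ) ≠ starRingEnd ℂ z := fun v hv h => hz v hv (by
    rw [← Complex.conj_conj z, ← h, Complex.conj_ofReal])
  refine Matrix.norm_le_of_forall_apply_le (Real.exp_pos _).le fun i j => ?_
  rw [fundZ_eq_conjTranspose hG hz hw, Matrix.conjTranspose_apply, norm_star]
  exact norm_fundY_apply_le hG hz' hw j i

/-- The transition matrix `Y(ξ)⁻¹ Y(w)`. -/
def fundR (G : ℝ → Matrix n n ℂ) (a : ℝ) (z : ℂ) (ξ w : ℝ) : Matrix n n ℂ :=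
  fundZ G a z ξ * fundY G a z w

lemma norm_fundR_le (hG : IsSkewKernel G a b) (hz : ∀ v ∈ Icc a b, (v : ℂ) ≠ z)
    {ξ w : ℝ} (hξ : ξ ∈ Icc a b) (hw : w ∈ Icc a b) : ‖fundR G a z ξ w‖ ≤ fundBound n ^ 2 := by
  rw [sq]
  exact (norm_mul_le _ _).trans (mul_le_mul (norm_fundZ_le hG hz hξ) (norm_fundY_le hG hz hw)
    (norm_nonneg _) fundBound_nonneg)

lemma fundR_left (G : ℝ → Matrix n n ℂ) (a : ℝ) (z : ℂ) (w : ℝ) :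
    fundR G a z a w = fundY G a z w := by rw [fundR, fundZ_self, one_mul]

lemma fundR_self (hG : ContinuousOn G (Icc a b)) (hz : ∀ v ∈ Icc a b, (v : ℂ) ≠ z)
    {v : ℝ} (hv : v ∈ Icc a b) : fundR G a z v v = 1 := fundZ_mul_fundY hG hz hv

lemma fundR_mul_fundR (hG : ContinuousOn G (Icc a b)) (hz : ∀ v ∈ Icc a b, (v : ℂ) ≠ z)
    {u v w : ℝ} (hv : v ∈ Icc a b) : fundR G a z u v * fundR G a z v w = fundR G a z u w := by
  rw [fundR, fundR, mul_assoc, ← mul_assoc (fundY G a z v), fundY_mul_fundZ hG hz hv, one_mul,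
    fundR]

lemma hasDerivWithinAt_fundR_right (hG : ContinuousOn G (Icc a b))
    (hz : ∀ v ∈ Icc a b, (v : ℂ) ≠ z) (ξ : ℝ) {v : ℝ} (hv : v ∈ Icc a b) :
    HasDerivWithinAt (fundR G a z ξ) (-(((v : ℂ) - z)⁻¹ • (fundR G a z ξ v * G v)))
      (Icc a b) v := by
  have h := (hasDerivWithinAt_fundY hG hz hv).const_mul (fundZ G a z ξ)
  convert! h using 1
  simp [fundR, mul_assoc]

lemma hasDerivWithinAt_fundR_left (hG : ContinuousOn G (Icc a b))
    (hz : ∀ v ∈ Icc a b, (v : ℂ) ≠ z) (w : ℝ) {v : ℝ} (hv : v ∈ Icc a b) :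
    HasDerivWithinAt (fun v => fundR G a z v w) (((v : ℂ) - z)⁻¹ • (G v * fundR G a z v w))
      (Icc a b) v := by
  have h := (hasDerivWithinAt_fundZ hG hz hv).mul_const (fundY G a z w)
  convert! h using 1
  simp [fundR, mul_assoc]

lemma continuousOn_fundR_right (hG : ContinuousOn G (Icc a b))
    (hz : ∀ v ∈ Icc a b, (v : ℂ) ≠ z) (ξ : ℝ) : ContinuousOn (fundR G a z ξ) (Icc a b) :=
  fun _ hv => (hasDerivWithinAt_fundR_right hG hz ξ hv).continuousWithinAt

lemma continuousOn_fundR_left (hG : ContinuousOn G (Icc a b))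
    (hz : ∀ v ∈ Icc a b, (v : ℂ) ≠ z) (w : ℝ) :
    ContinuousOn (fun v => fundR G a z v w) (Icc a b) :=
  fun _ hv => (hasDerivWithinAt_fundR_left hG hz w hv).continuousWithinAt

/-- The transition matrices for two spectral parameters. -/
lemma fundR_sub_fundR (hG : ContinuousOn G (Icc a b)) {z₁ z₂ : ℂ}
    (hz₁ : ∀ v ∈ Icc a b, (v : ℂ) ≠ z₁) (hz₂ : ∀ v ∈ Icc a b, (v : ℂ) ≠ z₂)
    {ξ w : ℝ} (hξ : ξ ∈ Icc a b) (hw : w ∈ Icc a b) :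
    fundR G a z₁ ξ w - fundR G a z₂ ξ w = ∫ v in ξ..w, (((v : ℂ) - z₂)⁻¹ - ((v : ℂ) - z₁)⁻¹) •
      (fundR G a z₁ ξ v * G v * fundR G a z₂ v w) := by
  rw [integral_eq_sub_of_hasDerivWithinAt_Icc
    (F := fun v => fundR G a z₁ ξ v * fundR G a z₂ v w) (f := fun v : ℝ =>
      (((v : ℂ) - z₂)⁻¹ - ((v : ℂ) - z₁)⁻¹) • (fundR G a z₁ ξ v * G v * fundR G a z₂ v w))
    (a := a) (b := b) ?_ ?_ hξ hw]
  · rw [fundR_self hG hz₂ hw, fundR_self hG hz₁ hξ, mul_one, one_mul]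
  · intro v hv
    have h := (hasDerivWithinAt_fundR_right hG hz₁ ξ hv).mul
      (hasDerivWithinAt_fundR_left hG hz₂ w hv)
    convert! h using 1
    simp only [neg_mul, smul_mul_assoc, mul_smul_comm, sub_smul, mul_assoc]
    abel
  · exact ((continuousOn_cauchyKernel hz₂).sub (continuousOn_cauchyKernel hz₁)).smul
      (((continuousOn_fundR_right hG hz₁ ξ).mul hG).mul (continuousOn_fundR_left hG hz₂ w))

/-- Lipschitz dependence on the spectral parameter. The distance `ρ` is required only from the
points between `ξ` and `w`: elsewhere on `[a, b]` the parameters may approach the interval, which is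
what allows boundary values on either side of a real point. -/
lemma norm_fundR_sub_le (hG : IsSkewKernel G a b) {z₁ z₂ : ℂ}
    (hz₁ : ∀ v ∈ Icc a b, (v : ℂ) ≠ z₁) (hz₂ : ∀ v ∈ Icc a b, (v : ℂ) ≠ z₂)
    {ξ w : ℝ} (hξ : ξ ∈ Icc a b) (hw : w ∈ Icc a b) {g ρ : ℝ} (hg : ∀ v ∈ Icc a b, ‖G v‖ ≤ g)
    (hρ : 0 < ρ) (h₁ : ∀ v ∈ uIcc ξ w, ρ ≤ ‖(v : ℂ) - z₁‖)
    (h₂ : ∀ v ∈ uIcc ξ w, ρ ≤ ‖(v : ℂ) - z₂‖) :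
    ‖fundR G a z₁ ξ w - fundR G a z₂ ξ w‖ ≤
      ρ⁻¹ ^ 2 * (fundBound n ^ 2 * g * fundBound n ^ 2) * (b - a) * ‖z₁ - z₂‖ := by
  have hg0 : 0 ≤ g := (norm_nonneg _).trans (hg ξ hξ)
  have hsub : uIcc ξ w ⊆ Icc a b := uIcc_subset_Icc hξ hw
  rw [fundR_sub_fundR hG.cont hz₁ hz₂ hξ hw]
  refine (intervalIntegral.norm_integral_le_of_norm_le_const
    (C := ‖z₁ - z₂‖ * ρ⁻¹ ^ 2 * (fundBound n ^ 2 * g * fundBound n ^ 2)) fun v hv => ?_).trans ?_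
  · have hv' := uIoc_subset_uIcc hv
    have hva := hsub hv'
    rw [norm_smul]
    have e : ((v : ℂ) - z₂)⁻¹ - ((v : ℂ) - z₁)⁻¹ =
        (z₂ - z₁) * (((v : ℂ) - z₂)⁻¹ * ((v : ℂ) - z₁)⁻¹) := by
      have := sub_ne_zero.2 (hz₁ v hva)
      have := sub_ne_zero.2 (hz₂ v hva)
      field_simp
      ring
    rw [e, norm_mul, norm_mul, norm_inv, norm_inv, norm_sub_rev, sq ρ⁻¹]
    have i₁ : ‖(v : ℂ) - z₁‖⁻¹ ≤ ρ⁻¹ := inv_anti₀ hρ (h₁ v hv')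
    have i₂ : ‖(v : ℂ) - z₂‖⁻¹ ≤ ρ⁻¹ := inv_anti₀ hρ (h₂ v hv')
    have e2 : ‖fundR G a z₁ ξ v * G v * fundR G a z₂ v w‖ ≤
        fundBound n ^ 2 * g * fundBound n ^ 2 := by
      refine (norm_mul_le _ _).trans (mul_le_mul ((norm_mul_le _ _).trans
        (mul_le_mul (norm_fundR_le hG hz₁ hξ hva) (hg v hva) (norm_nonneg _) (by positivity)))
        (norm_fundR_le hG hz₂ hva hw) (norm_nonneg _) (by positivity))
    gcongr
  · have : |w - ξ| ≤ b - a := abs_sub_le_iff.2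
      ⟨by linarith [hw.2, hξ.1], by linarith [hw.1, hξ.2]⟩
    calc _ ≤ ‖z₁ - z₂‖ * ρ⁻¹ ^ 2 * (fundBound n ^ 2 * g * fundBound n ^ 2) * (b - a) := by gcongr
      _ = _ := by ring

end Fundamental

/-! ### Boundary values of transition matrices at real points, approached from the lower half-plane
-/

section BoundaryValues

open Set NormedSpace
open scoped Matrix.Norms.Operator

variable {n : Type*} [Fintype n] [DecidableEq n]

instance Matrix.instPseudoMetrizableSpace :
    TopologicalSpace.PseudoMetrizableSpace (Matrix n n ℂ) :=
  inferInstanceAs (TopologicalSpace.PseudoMetrizableSpace (n → n → ℂ))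

lemma conjTranspose_exp_real_smul_skew {M : Matrix n n ℂ} (hM : Mᴴ = -M) (t : ℝ) :
    (exp ((t : ℂ) • M))ᴴ = exp (-((t : ℂ) • M)) := by
  rw [← Matrix.exp_conjTranspose, Matrix.conjTranspose_smul, hM]
  simp

lemma exp_real_smul_skew_mem_unitary {M : Matrix n n ℂ} (hM : Mᴴ = -M) (t : ℝ) :
    exp ((t : ℂ) • M) ∈ Matrix.unitaryGroup n ℂ := by
  rw [Matrix.mem_unitaryGroup_iff, Matrix.star_eq_conjTranspose,
    conjTranspose_exp_real_smul_skew hM, Matrix.exp_neg]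
  exact Matrix.mul_nonsing_inv _ ((Matrix.isUnit_iff_isUnit_det _).1 (Matrix.isUnit_exp _))

lemma continuous_exp_smul (M : Matrix n n ℂ) : Continuous fun z : ℂ => exp (z • M) :=
  (NormedSpace.exp_continuous).comp (continuous_id.smul continuous_const)

lemma exp_add_smul (M : Matrix n n ℂ) (z w : ℂ) :
    exp ((z + w) • M) = exp (z • M) * exp (w • M) := by
  rw [add_smul, Matrix.exp_add_of_commute _ _ ((Commute.refl M).smul_left z |>.smul_right w)]

lemma exp_smul_mul_exp_neg_smul (M : Matrix n n ℂ) (z : ℂ) :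
    exp (z • M) * exp ((-z) • M) = 1 := by
  rw [← exp_add_smul]; simp

/-- The factor exp (Re z • M) is unitary and the factor exp (i Im z • M) ranges over a compact set.
In the applications `z` is plus or minus a logarithm, so that |Im z| ≤ π while Re z is unbounded. -/
lemma exists_norm_exp_smul_le {M : Matrix n n ℂ} (hM : Mᴴ = -M) :
    ∃ K : ℝ, 0 ≤ K ∧ ∀ z : ℂ, |z.im| ≤ Real.pi → ‖exp (z • M)‖ ≤ K := by
  obtain ⟨C, hC⟩ := (isCompact_Icc (a := -Real.pi) (b := Real.pi)).exists_bound_of_continuousOn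
    (f := fun t : ℝ => exp (((t : ℂ) * Complex.I) • M))
    ((continuous_exp_smul M).comp (by fun_prop)).continuousOn
  have hC0 : 0 ≤ C := (norm_nonneg _).trans (hC 0 ⟨by linarith [Real.pi_pos], Real.pi_pos.le⟩)
  refine ⟨(Fintype.card n * 1) * C, by positivity, fun z hz => ?_⟩
  conv_lhs => rw [← Complex.re_add_im z, exp_add_smul]
  refine (norm_mul_le _ _).trans ?_
  gcongr
  · exact Matrix.norm_le_of_forall_apply_le zero_le_one
      (entry_norm_bound_of_unitary (exp_real_smul_skew_mem_unitary hM z.re))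
  · exact hC _ (abs_le.1 hz)

lemma hasDerivWithinAt_exp_smul (M : Matrix n n ℂ) {l : ℝ → ℂ} {l' : ℂ} {s : Set ℝ} {v : ℝ}
    (hl : HasDerivWithinAt l l' s v) :
    HasDerivWithinAt (fun v => exp (l v • M)) (l' • (M * exp (l v • M))) s v :=
  (hasDerivAt_exp_smul_const' (𝕂 := ℂ) M (l v)).scomp_hasDerivWithinAt (𝕜 := ℝ) v hl

variable {G : ℝ → Matrix n n ℂ} {a b : ℝ}

/-- Comparison of the transition matrix with the one for a constant coefficient. -/
lemma fundR_mul_exp (hG : ContinuousOn G (Icc a b)) {z : ℂ} (hz : ∀ v ∈ Icc a b, (v : ℂ) ≠ z)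
    {l : ℝ → ℂ} (hl : ∀ v ∈ Icc a b, HasDerivWithinAt l (((v : ℂ) - z)⁻¹) (Icc a b) v)
    (M : Matrix n n ℂ) {ξ w : ℝ} (hξ : ξ ∈ Icc a b) (hw : w ∈ Icc a b) :
    fundR G a z ξ w * exp (l w • M) = exp (l ξ • M) - ∫ v in ξ..w, ((v : ℂ) - z)⁻¹ •
      (fundR G a z ξ v * (G v - M) * exp (l v • M)) := by
  have hlc : ContinuousOn l (Icc a b) := fun v hv => (hl v hv).continuousWithinAt
  have h := integral_eq_sub_of_hasDerivWithinAt_Icc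
    (F := fun v => -(fundR G a z ξ v * exp (l v • M)))
    (f := fun v : ℝ => ((v : ℂ) - z)⁻¹ • (fundR G a z ξ v * (G v - M) * exp (l v • M)))
    (a := a) (b := b) (fun v hv => ?_) ?_ hξ hw
  · rw [h, fundR_self hG hz hξ, one_mul]; abel
  · have h := ((hasDerivWithinAt_fundR_right hG hz ξ hv).mul
      (hasDerivWithinAt_exp_smul M (hl v hv))).neg
    convert! h using 1
    simp only [neg_mul, smul_mul_assoc, mul_smul_comm, mul_sub, sub_mul, smul_sub, mul_assoc]
    abel
  · exact (continuousOn_cauchyKernel hz).smul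
      (((continuousOn_fundR_right hG hz ξ).mul (hG.sub continuousOn_const)).mul
        ((continuous_exp_smul M).comp_continuousOn hlc))

lemma hasDerivAt_log_sub {z : ℂ} (hz : z.im < 0) (v : ℝ) :
    HasDerivAt (fun v : ℝ => Complex.log ((v : ℂ) - z)) (((v : ℂ) - z)⁻¹) v := by
  have h : HasDerivAt (fun v : ℝ => (v : ℂ) - z) 1 v :=
    (Complex.ofRealCLM.hasDerivAt (x := v)).sub_const z
  have := h.clog_real (x := v) (f := fun v : ℝ => (v : ℂ) - z)
    (Complex.mem_slitPlane_iff.2 (Or.inr (by simpa using hz.ne)))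
  simpa using this

lemma log_ofReal_sub_of_lt {v w : ℝ} (h : v < w) :
    Complex.log ((v : ℂ) - w) = Real.log (w - v) + Real.pi * Complex.I := by
  have h1 : ((v : ℂ) - w) = -((w - v : ℝ) : ℂ) := by push_cast; ring
  rw [h1, Complex.log, norm_neg, Complex.norm_real, Real.norm_of_nonneg (by linarith),
    ← Complex.ofReal_neg, Complex.arg_ofReal_of_neg (by linarith)]

lemma hasDerivAt_log_sub_ofReal {v w : ℝ} (h : v < w) :
    HasDerivAt (fun v : ℝ => Complex.log ((v : ℂ) - w)) (((v : ℂ) - w)⁻¹) v := by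
  have h1 : HasDerivAt (fun v : ℝ => ((Real.log (w - v) : ℝ) : ℂ) + Real.pi * Complex.I)
      (((v : ℂ) - w)⁻¹) v := by
    have h2 : HasDerivAt (fun v : ℝ => Real.log (w - v)) (-1 / (w - v)) v :=
      ((hasDerivAt_id v).const_sub w).log (by simp; linarith)
    convert! (h2.ofReal_comp).add_const (Real.pi * Complex.I) using 1
    have : (w : ℂ) - v ≠ 0 := by
      rw [← Complex.ofReal_sub]; exact_mod_cast (sub_pos.2 h).ne'
    have h3 : (v : ℂ) - w ≠ 0 := by rw [← neg_ne_zero]; simpa using this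
    push_cast
    field_simp
    ring
  refine h1.congr_of_eventuallyEq ?_
  filter_upwards [gt_mem_nhds h] with u hu using log_ofReal_sub_of_lt hu

/-- The point `w + ε (σ - i)`, which approaches `w` nontangentially from below. -/
def lowerPt (w σ ε : ℝ) : ℂ := w + ε * (σ - Complex.I)

lemma lowerPt_im (w σ ε : ℝ) : (lowerPt w σ ε).im = -ε := by simp [lowerPt]

lemma lowerPt_re (w σ ε : ℝ) : (lowerPt w σ ε).re = w + ε * σ := by simp [lowerPt]

lemma tendsto_lowerPt (w σ : ℝ) : Tendsto (lowerPt w σ) (𝓝[>] 0) (𝓝[{z | z.im < 0}] (w : ℂ)) := by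
  refine tendsto_nhdsWithin_iff.2 ⟨?_, ?_⟩
  · have h : Continuous (lowerPt w σ) := by unfold lowerPt; fun_prop
    simpa [lowerPt] using (h.tendsto 0).mono_left nhdsWithin_le_nhds
  · filter_upwards [self_mem_nhdsWithin] with ε hε
    simpa [lowerPt_im] using hε

/-- This is the nontangential condition: the constant √(1 + σ²) is the reciprocal of the sine of the
angle between the ray and the real axis. -/
lemma abs_sub_le_norm_sub_lowerPt (v w σ ε : ℝ) :
    |v - w| ≤ √(1 + σ ^ 2) * ‖(v : ℂ) - lowerPt w σ ε‖ := by
  refine abs_le_of_sq_le_sq ?_ (by positivity)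
  rw [mul_pow, Real.sq_sqrt (by positivity), ← Complex.normSq_eq_norm_sq, Complex.normSq_apply]
  simp only [Complex.sub_re, Complex.sub_im, lowerPt_re, lowerPt_im, Complex.ofReal_re,
    Complex.ofReal_im]
  -- The difference of the two sides is exactly this square.
  nlinarith [sq_nonneg ((v - w - ε * σ) * σ - ε)]

lemma intervalIntegrable_abs_sub_rpow {α : ℝ} (hα : 0 < α) (w c d : ℝ) :
    IntervalIntegrable (fun v : ℝ => |v - w| ^ (α - 1)) volume c d := by
  have h := (intervalIntegral.intervalIntegrable_cpow' (a := c - w) (b := d - w)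
    (r := ((α - 1 : ℝ) : ℂ)) (by simpa using hα)).norm.comp_sub_right w
  simp only [Complex.norm_cpow_real, Complex.norm_real, Real.norm_eq_abs, sub_add_cancel] at h
  exact h

/-- For `z` below the axis, `v - z` lies in the upper half-plane, from which the principal logarithm
is continuous up to the negative axis. Thus the branch with argument π is the correct one for `v <
w`. -/
lemma tendsto_log_sub_lowerPt {v w : ℝ} (hv : v ≠ w) (σ : ℝ) :
    Tendsto (fun ε => Complex.log ((v : ℂ) - lowerPt w σ ε)) (𝓝[>] 0)
      (𝓝 (Complex.log ((v : ℂ) - w))) := by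
  have h : Tendsto (fun ε => (v : ℂ) - lowerPt w σ ε) (𝓝[>] 0) (𝓝[{z | 0 ≤ z.im}] ((v : ℂ) - w)) := by
    refine tendsto_nhdsWithin_iff.2 ⟨tendsto_const_nhds.sub
      ((tendsto_lowerPt w σ).mono_right nhdsWithin_le_nhds), ?_⟩
    filter_upwards [self_mem_nhdsWithin] with ε hε
    simpa [lowerPt_im] using (le_of_lt hε)
  refine Tendsto.comp (g := Complex.log) ?_ h
  rcases hv.lt_or_gt with hv | hv
  · exact Complex.continuousWithinAt_log_of_re_neg_of_im_zero (by simpa using hv) (by simp)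
  · refine (continuousAt_clog (Or.inl (by simpa using hv))).tendsto.mono_left nhdsWithin_le_nhds

lemma abs_im_log_le (z : ℂ) : |(Complex.log z).im| ≤ Real.pi := by
  rw [Complex.log_im]; exact Complex.abs_arg_le_pi z

/-- The transition matrix between points to the left of `w` is continuous up to `w`. -/
lemma tendsto_fundR_left (hG : IsSkewKernel G a b) {w ξ v : ℝ} (hw : w ≤ b)
    (hξ : ξ ∈ Ico a w) (hv : v ∈ Ico a w) :
    Tendsto (fun z => fundR G a z ξ v) (𝓝[{z | z.im < 0}] (w : ℂ)) (𝓝 (fundR G a w ξ v)) := by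
  set c := max ξ v with hc
  have hcw : c < w := max_lt hξ.2 hv.2
  have hGc := hG.mono (hcw.le.trans hw)
  obtain ⟨g, hg⟩ := isCompact_Icc.exists_bound_of_continuousOn hGc.cont
  have hξc : ξ ∈ Icc a c := ⟨hξ.1, le_max_left _ _⟩
  have hvc : v ∈ Icc a c := ⟨hv.1, le_max_right _ _⟩
  set ρ := (w - c) / 2 with hρ
  have hρ0 : 0 < ρ := by rw [hρ]; linarith
  have hdist : ∀ t ∈ Icc a c, 2 * ρ ≤ ‖(t : ℂ) - w‖ := fun t ht => by
    rw [← Complex.ofReal_sub, Complex.norm_real, Real.norm_eq_abs]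
    refine le_trans ?_ (neg_le_abs _)
    rw [hρ]; linarith [ht.2]
  have hwne : ∀ t ∈ Icc a c, (t : ℂ) ≠ w := fun t ht h => by
    have := hdist t ht; rw [h, sub_self, norm_zero] at this; linarith
  refine tendsto_iff_norm_sub_tendsto_zero.2 ?_
  set K := ρ⁻¹ ^ 2 * (fundBound n ^ 2 * g * fundBound n ^ 2) * (c - a) with hK
  have hlim : Tendsto (fun z : ℂ => K * ‖z - w‖) (𝓝[{z | z.im < 0}] (w : ℂ)) (𝓝 0) := by
    have h : Continuous fun z : ℂ => K * ‖z - w‖ := by fun_prop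
    simpa using (h.tendsto (w : ℂ)).mono_left nhdsWithin_le_nhds
  refine squeeze_zero' (Eventually.of_forall fun _ => norm_nonneg _) ?_ hlim
  filter_upwards [self_mem_nhdsWithin,
    mem_nhdsWithin_of_mem_nhds (Metric.ball_mem_nhds (w : ℂ) hρ0)] with z hz hzb
  refine norm_fundR_sub_le hGc (fun t _ => ofReal_ne_of_im_ne_zero (ne_of_lt hz) t) hwne hξc hvc hg
    hρ0 (fun t ht => ?_) (fun t ht => ?_)
  · have h1 := hdist t (uIcc_subset_Icc hξc hvc ht)
    have h2 : ‖z - w‖ < ρ := by simpa [dist_eq_norm] using hzb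
    have h3 := norm_sub_norm_le ((t : ℂ) - w) (z - w)
    have h4 : ((t : ℂ) - w) - (z - w) = t - z := by ring
    rw [h4] at h3
    linarith
  · linarith [hdist t (uIcc_subset_Icc hξc hvc ht)]

/-- The transition matrix between points to the right of `w` has a boundary value at `w`. -/
lemma exists_tendsto_fundR_right (hG : IsSkewKernel G a b) {w ξ v : ℝ} (hw : a ≤ w)
    (hξ : ξ ∈ Ioc w b) (hv : v ∈ Ioc w b) :
    ∃ R, Tendsto (fun z => fundR G a z ξ v) (𝓝[{z | z.im < 0}] (w : ℂ)) (𝓝 R) := by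
  obtain ⟨g, hg⟩ := isCompact_Icc.exists_bound_of_continuousOn hG.cont
  have hξc : ξ ∈ Icc a b := ⟨hw.trans hξ.1.le, hξ.2⟩
  have hvc : v ∈ Icc a b := ⟨hw.trans hv.1.le, hv.2⟩
  set c := min ξ v with hc
  have hcw : w < c := lt_min hξ.1 hv.1
  set ρ := (c - w) / 2 with hρ
  have hρ0 : 0 < ρ := by rw [hρ]; linarith
  set K := ρ⁻¹ ^ 2 * (fundBound n ^ 2 * g * fundBound n ^ 2) * (b - a) with hK
  have hg0 : 0 ≤ g := (norm_nonneg _).trans (hg ξ hξc)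
  have hba : 0 ≤ b - a := by linarith [hξc.1, hξc.2]
  have hK0 : 0 ≤ K := by positivity
  have hfar : ∀ z : ℂ, ‖z - w‖ < ρ → ∀ t ∈ uIcc ξ v, ρ ≤ ‖(t : ℂ) - z‖ := fun z hz t ht => by
    have h1 : 2 * ρ ≤ ‖(t : ℂ) - w‖ := by
      rw [← Complex.ofReal_sub, Complex.norm_real, Real.norm_eq_abs]
      refine le_trans ?_ (le_abs_self _)
      have : c ≤ t := ht.1
      rw [hρ]; linarith
    have h3 := norm_sub_norm_le ((t : ℂ) - w) (z - w)
    have h4 : ((t : ℂ) - w) - (z - w) = t - z := by ring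
    rw [h4] at h3
    linarith
  have hne : (𝓝[{z : ℂ | z.im < 0}] (w : ℂ)).NeBot := (tendsto_lowerPt w 0).neBot
  -- There is no candidate for the limit: the fundamental matrix starts at `a`, so at `z = w` its
  -- coefficient would be singular inside the interval. Only the Cauchy criterion is available.
  refine CompleteSpace.complete (f := map (fun z => fundR G a z ξ v)
    (𝓝[{z : ℂ | z.im < 0}] (w : ℂ))) (Metric.cauchy_iff.2 ⟨inferInstance, fun ε hε => ?_⟩)
  set δ := min ρ (ε / (2 * K + 1)) / 2 with hδ
  have hδ0 : 0 < δ := by rw [hδ]; positivity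
  refine ⟨_, image_mem_map (inter_mem_nhdsWithin {z : ℂ | z.im < 0}
    (Metric.ball_mem_nhds (w : ℂ) hδ0)), ?_⟩
  rintro _ ⟨z₁, ⟨h1, h1'⟩, rfl⟩ _ ⟨z₂, ⟨h2, h2'⟩, rfl⟩
  rw [dist_eq_norm]
  have hδρ : δ < ρ := by
    have := min_le_left ρ (ε / (2 * K + 1)); rw [hδ]; linarith
  have e1 : ‖z₁ - w‖ < δ := by simpa [dist_eq_norm] using h1'
  have e2 : ‖z₂ - w‖ < δ := by simpa [dist_eq_norm] using h2'
  refine (norm_fundR_sub_le hG (fun t _ => ofReal_ne_of_im_ne_zero (ne_of_lt h1) t)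
    (fun t _ => ofReal_ne_of_im_ne_zero (ne_of_lt h2) t) hξc hvc hg hρ0
    (hfar _ (e1.trans hδρ)) (hfar _ (e2.trans hδρ))).trans_lt ?_
  have e3 : ‖z₁ - z₂‖ ≤ ε / (2 * K + 1) := by
    have h := norm_sub_le (z₁ - w) (z₂ - w)
    have h4 : (z₁ - w) - (z₂ - w) = z₁ - z₂ := by ring
    rw [h4] at h
    have := min_le_right ρ (ε / (2 * K + 1))
    have : 2 * δ ≤ ε / (2 * K + 1) := by rw [hδ]; linarith
    linarith
  calc K * ‖z₁ - z₂‖ ≤ K * (ε / (2 * K + 1)) := by gcongr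
    _ < ε := by
      rw [mul_div_assoc', div_lt_iff₀ (by positivity)]
      nlinarith

/-- `G` is Hölder continuous at `w`. -/
def HolderAt (G : ℝ → Matrix n n ℂ) (a b w : ℝ) : Prop :=
  ∃ C α : ℝ, 0 < α ∧ ∀ v ∈ Icc a b, ‖G v - G w‖ ≤ C * |v - w| ^ α

/-- The regularized boundary value of the transition matrix at `w`. -/
def regLimit (G : ℝ → Matrix n n ℂ) (w : ℝ) (R : ℝ → Matrix n n ℂ) (ξ : ℝ) : Matrix n n ℂ :=
  exp (Complex.log ((ξ : ℂ) - w) • G w) - ∫ v in ξ..w, ((v : ℂ) - w)⁻¹ •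
    (R v * (G v - G w) * exp (Complex.log ((v : ℂ) - w) • G w))

/-- The kernel 1/(v - w) is not integrable. Comparison with the constant coefficient `G w`
(`fundR_mul_exp`) replaces `G v` by `G v - G w`, so Hölder continuity bounds the integrand by a
multiple of |v - w|^(α - 1), uniformly along the ray, and dominated convergence applies. The limit
does not contain `σ`, because the limits `R v` do not. -/
lemma tendsto_fundR_mul_exp (hG : IsSkewKernel G a b) {w ξ : ℝ} (hw : w ∈ Icc a b)
    (hH : HolderAt G a b w) (hξ : ξ ∈ Icc a b) (hne : ξ ≠ w) (σ : ℝ) {R : ℝ → Matrix n n ℂ}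
    (hR : ∀ v ∈ uIcc ξ w, v ≠ w →
      Tendsto (fun z => fundR G a z ξ v) (𝓝[{z | z.im < 0}] (w : ℂ)) (𝓝 (R v))) :
    Tendsto (fun ε => fundR G a (lowerPt w σ ε) ξ w *
      exp (Complex.log ((w : ℂ) - lowerPt w σ ε) • G w)) (𝓝[>] 0) (𝓝 (regLimit G w R ξ)) := by
  obtain ⟨C, α, hα, hC⟩ := hH
  obtain ⟨K, hK0, hK⟩ := exists_norm_exp_smul_le (hG.skew w hw)
  have hsub : uIcc ξ w ⊆ Icc a b := uIcc_subset_Icc hξ hw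
  have hexp : ∀ v : ℝ, v ≠ w → Tendsto (fun ε => exp (Complex.log ((v : ℂ) - lowerPt w σ ε) • G w))
      (𝓝[>] 0) (𝓝 (exp (Complex.log ((v : ℂ) - w) • G w))) := fun v hv =>
    ((continuous_exp_smul (G w)).tendsto _).comp (tendsto_log_sub_lowerPt hv σ)
  have hz : ∀ ε : ℝ, 0 < ε → (lowerPt w σ ε).im < 0 := fun ε hε => by
    rw [lowerPt_im]; linarith
  have hz' : ∀ ε : ℝ, 0 < ε → ∀ v ∈ Icc a b, (v : ℂ) ≠ lowerPt w σ ε := fun ε hε v _ =>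
    ofReal_ne_of_im_ne_zero (hz ε hε).ne v
  have heq : ∀ᶠ ε in 𝓝[>] (0 : ℝ), exp (Complex.log ((ξ : ℂ) - lowerPt w σ ε) • G w) -
      ∫ v in ξ..w, ((v : ℂ) - lowerPt w σ ε)⁻¹ • (fundR G a (lowerPt w σ ε) ξ v * (G v - G w) *
        exp (Complex.log ((v : ℂ) - lowerPt w σ ε) • G w)) =
      fundR G a (lowerPt w σ ε) ξ w * exp (Complex.log ((w : ℂ) - lowerPt w σ ε) • G w) := by
    filter_upwards [self_mem_nhdsWithin] with ε hε
    exact (fundR_mul_exp hG.cont (hz' ε hε)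
      (fun v _ => (hasDerivAt_log_sub (hz ε hε) v).hasDerivWithinAt) (G w) hξ hw).symm
  refine Tendsto.congr' heq ((hexp ξ hne).sub ?_)
  refine intervalIntegral.tendsto_integral_filter_of_dominated_convergence
    (fun v => √(1 + σ ^ 2) * (fundBound n ^ 2 * C * K) * |v - w| ^ (α - 1)) ?_ ?_ ?_ ?_
  · filter_upwards [self_mem_nhdsWithin] with ε hε
    refine (ContinuousOn.mono ?_ (uIoc_subset_uIcc.trans hsub)).aestronglyMeasurable
      measurableSet_uIoc
    exact (continuousOn_cauchyKernel (hz' ε hε)).smul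
      (((continuousOn_fundR_right hG.cont (hz' ε hε) ξ).mul
        (hG.cont.sub continuousOn_const)).mul ((continuous_exp_smul _).comp_continuousOn
        (fun v _ => (hasDerivAt_log_sub (hz ε hε) v).continuousAt.continuousWithinAt)))
  · filter_upwards [self_mem_nhdsWithin] with ε hε
    filter_upwards [compl_mem_ae_iff.2 (measure_singleton w)] with v hvw hv
    have hva := hsub (uIoc_subset_uIcc hv)
    have h0 : 0 < |v - w| := abs_pos.2 (sub_ne_zero.2 hvw)
    have hn : 0 < ‖(v : ℂ) - lowerPt w σ ε‖ := norm_pos_iff.2 (sub_ne_zero.2 (hz' ε hε v hva))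
    have h1 : ‖(v : ℂ) - lowerPt w σ ε‖⁻¹ ≤ √(1 + σ ^ 2) * |v - w|⁻¹ := by
      rw [← div_eq_mul_inv, le_div_iff₀ h0, inv_mul_le_iff₀ hn, mul_comm]
      exact abs_sub_le_norm_sub_lowerPt v w σ ε
    have h2 : 0 ≤ C * |v - w| ^ α := (norm_nonneg _).trans (hC v hva)
    rw [norm_smul, norm_inv]
    calc _ ≤ (√(1 + σ ^ 2) * |v - w|⁻¹) * (fundBound n ^ 2 * (C * |v - w| ^ α) * K) := by
          gcongr
          refine (norm_mul_le _ _).trans (mul_le_mul ((norm_mul_le _ _).trans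
            (mul_le_mul (norm_fundR_le hG (hz' ε hε) hξ hva) (hC v hva) (norm_nonneg _)
              (by positivity))) (hK _ (abs_im_log_le _)) (norm_nonneg _) (by positivity))
      _ = _ := by
          rw [Real.rpow_sub_one h0.ne']
          field_simp
  · exact (intervalIntegrable_abs_sub_rpow hα w ξ w).const_mul _
  · filter_upwards [compl_mem_ae_iff.2 (measure_singleton w)] with v hvw hv
    have hvw' : v ≠ w := hvw
    have h1 : Tendsto (fun ε => ((v : ℂ) - lowerPt w σ ε)⁻¹) (𝓝[>] 0) (𝓝 (((v : ℂ) - w)⁻¹)) :=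
      (tendsto_const_nhds.sub ((tendsto_lowerPt w σ).mono_right nhdsWithin_le_nhds)).inv₀
        (sub_ne_zero.2 (by exact_mod_cast hvw'))
    exact h1.smul ((((hR v (uIoc_subset_uIcc hv) hvw').comp (tendsto_lowerPt w σ)).mul
      tendsto_const_nhds).mul (hexp v hvw'))

/-- The regularized transition matrix has a nontangential limit which does not depend on the
direction. -/
lemma exists_tendsto_fundR_mul_exp (hG : IsSkewKernel G a b) {w ξ : ℝ} (hw : w ∈ Icc a b)
    (hH : HolderAt G a b w) (hξ : ξ ∈ Icc a b) (hne : ξ ≠ w) :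
    ∃ A : Matrix n n ℂ, ∀ σ, Tendsto (fun ε => fundR G a (lowerPt w σ ε) ξ w *
      exp (Complex.log ((w : ℂ) - lowerPt w σ ε) • G w)) (𝓝[>] 0) (𝓝 A) := by
  have h : ∀ v, ∃ R, v ∈ uIcc ξ w → v ≠ w →
      Tendsto (fun z => fundR G a z ξ v) (𝓝[{z | z.im < 0}] (w : ℂ)) (𝓝 R) := fun v => by
    by_cases hv : v ∈ uIcc ξ w ∧ v ≠ w
    · rcases hne.lt_or_gt with hξw | hξw
      · have hv' := hv.1
        rw [uIcc_of_le hξw.le] at hv'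
        exact ⟨_, fun _ _ => tendsto_fundR_left hG hw.2 ⟨hξ.1, hξw⟩
          ⟨hξ.1.trans hv'.1, lt_of_le_of_ne hv'.2 hv.2⟩⟩
      · have hv' := hv.1
        rw [uIcc_of_ge hξw.le] at hv'
        obtain ⟨R, hR⟩ := exists_tendsto_fundR_right hG hw.1 ⟨hξw, hξ.2⟩
          ⟨lt_of_le_of_ne hv'.1 hv.2.symm, hv'.2.trans hξ.2⟩
        exact ⟨R, fun _ _ => hR⟩
    · exact ⟨0, fun h1 h2 => absurd ⟨h1, h2⟩ hv⟩
  choose R hR using h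
  exact ⟨_, fun σ => tendsto_fundR_mul_exp hG hw hH hξ hne σ fun v hv hvw => hR v hv hvw⟩

/-- To the left of `w` the limit can be computed on the real axis. -/
lemma tendsto_fundR_mul_exp_left (hG : IsSkewKernel G a b) {w ξ : ℝ} (hw : w ∈ Icc a b)
    (hH : HolderAt G a b w) (hξ : ξ ∈ Ico a w) :
    ∃ A : Matrix n n ℂ, (∀ σ, Tendsto (fun ε => fundR G a (lowerPt w σ ε) ξ w *
        exp (Complex.log ((w : ℂ) - lowerPt w σ ε) • G w)) (𝓝[>] 0) (𝓝 A)) ∧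
      Tendsto (fun δ => fundR G a w ξ (w - δ) *
        exp ((Real.log δ + Real.pi * Complex.I) • G w)) (𝓝[>] 0) (𝓝 A) := by
  have hξ' : ξ ∈ Icc a b := ⟨hξ.1, hξ.2.le.trans hw.2⟩
  refine ⟨_, fun σ => tendsto_fundR_mul_exp hG hw hH hξ' hξ.2.ne σ
    (R := fun v => fundR G a w ξ v) fun v hv hvw => ?_, ?_⟩
  · rw [uIcc_of_le hξ.2.le] at hv
    exact tendsto_fundR_left hG hw.2 hξ ⟨hξ.1.trans hv.1, lt_of_le_of_ne hv.2 hvw⟩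
  · obtain ⟨C, α, hα, hC⟩ := hH
    obtain ⟨K, hK0, hK⟩ := exists_norm_exp_smul_le (hG.skew w hw)
    have hwne : ∀ c < w, ∀ t ∈ Icc a c, (t : ℂ) ≠ w := fun c hc t ht => by
      exact_mod_cast (ht.2.trans_lt hc).ne
    have heq : ∀ᶠ δ in 𝓝[>] (0 : ℝ), exp (Complex.log ((ξ : ℂ) - w) • G w) -
        ∫ v in ξ..(w - δ), ((v : ℂ) - w)⁻¹ • (fundR G a w ξ v * (G v - G w) *
          exp (Complex.log ((v : ℂ) - w) • G w)) =
        fundR G a w ξ (w - δ) * exp ((Real.log δ + Real.pi * Complex.I) • G w) := by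
      filter_upwards [Ioo_mem_nhdsGT (sub_pos.2 hξ.2)] with δ hδ
      have hδ1 : w - δ < w := by linarith [hδ.1]
      have hGc := hG.mono (hδ1.le.trans hw.2)
      rw [← fundR_mul_exp hGc.cont (hwne _ hδ1) (l := fun v : ℝ => Complex.log ((v : ℂ) - w))
        (fun v hv => (hasDerivAt_log_sub_ofReal (hv.2.trans_lt hδ1)).hasDerivWithinAt) (G w)
        ⟨hξ.1, by linarith [hδ.2]⟩ ⟨by linarith [hδ.2, hξ.1], le_rfl⟩,
        log_ofReal_sub_of_lt hδ1, sub_sub_cancel]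
    -- On the real axis the same singular integrand is truncated at `w - δ`. Its integrability makes
    -- the primitive continuous up to `w`, so the limit is the value obtained along the rays.
    refine Tendsto.congr' heq (tendsto_const_nhds.sub ?_)
    set F : ℝ → Matrix n n ℂ := fun v => ((v : ℂ) - w)⁻¹ • (fundR G a w ξ v * (G v - G w) *
      exp (Complex.log ((v : ℂ) - w) • G w)) with hF
    have hmeas : AEStronglyMeasurable F (volume.restrict (uIoc ξ w)) := by
      rw [uIoc_of_le hξ.2.le, ← restrict_Ioo_eq_restrict_Ioc]
      refine ContinuousOn.aestronglyMeasurable (fun v hv => ?_) measurableSet_Ioo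
      have hvc : (v + w) / 2 < w := by linarith [hv.2]
      have hvm : v ∈ Icc a ((v + w) / 2) := ⟨hξ.1.trans hv.1.le, by linarith [hv.2]⟩
      have hmem : Icc a ((v + w) / 2) ∈ 𝓝 v :=
        Icc_mem_nhds (hξ.1.trans_lt hv.1) (by linarith [hv.2])
      have hGc := hG.mono (hvc.le.trans hw.2)
      refine ContinuousAt.continuousWithinAt ?_
      exact ((continuousOn_cauchyKernel (hwne _ hvc)).continuousAt hmem).smul
        ((((continuousOn_fundR_right hGc.cont (hwne _ hvc) ξ).continuousAt hmem).mul
          ((hGc.cont.continuousAt hmem).sub continuousAt_const)).mul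
          ((continuous_exp_smul _).continuousAt.comp
            (hasDerivAt_log_sub_ofReal hv.2).continuousAt))
    have hle : (fun v => ‖F v‖) ≤ᵐ[volume.restrict (uIoc ξ w)]
        fun v => fundBound n ^ 2 * C * K * |v - w| ^ (α - 1) := by
      rw [uIoc_of_le hξ.2.le, ← restrict_Ioo_eq_restrict_Ioc]
      filter_upwards [ae_restrict_mem measurableSet_Ioo] with v hv
      have hGc := hG.mono (hv.2.le.trans hw.2)
      have hva : v ∈ Icc a v := ⟨hξ.1.trans hv.1.le, le_rfl⟩
      have hvb : v ∈ Icc a b := ⟨hva.1, hv.2.le.trans hw.2⟩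
      have h0 : 0 < |v - w| := abs_pos.2 (sub_ne_zero.2 hv.2.ne)
      have h2 : 0 ≤ C * |v - w| ^ α := (norm_nonneg _).trans (hC v hvb)
      simp only [hF]
      rw [norm_smul, norm_inv, ← Complex.ofReal_sub, Complex.norm_real, Real.norm_eq_abs]
      calc _ ≤ |v - w|⁻¹ * (fundBound n ^ 2 * (C * |v - w| ^ α) * K) := by
            gcongr
            refine (norm_mul_le _ _).trans (mul_le_mul ((norm_mul_le _ _).trans
              (mul_le_mul (norm_fundR_le hGc (hwne _ hv.2) ⟨hξ.1, hv.1.le⟩ hva) (hC v hvb)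
                (norm_nonneg _) (by positivity))) (hK _ (abs_im_log_le _)) (norm_nonneg _)
                (by positivity))
        _ = _ := by
            rw [Real.rpow_sub_one h0.ne']
            field_simp
    have hint := IntervalIntegrable.mono_fun' (f := F)
      ((intervalIntegrable_abs_sub_rpow hα w ξ w).const_mul _) hmeas hle
    have hcont := intervalIntegral.continuousOn_primitive_interval' hint left_mem_uIcc
    have ht : Tendsto (fun δ : ℝ => w - δ) (𝓝[>] 0) (𝓝[uIcc ξ w] w) := by
      refine tendsto_nhdsWithin_iff.2 ⟨?_, ?_⟩
      · have h : Continuous fun δ : ℝ => w - δ := by fun_prop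
        simpa using (h.tendsto 0).mono_left nhdsWithin_le_nhds
      · filter_upwards [Ioo_mem_nhdsGT (sub_pos.2 hξ.2)] with δ hδ
        rw [uIcc_of_le hξ.2.le]
        exact ⟨by linarith [hδ.2], by linarith [hδ.1]⟩
    exact (hcont w right_mem_uIcc).tendsto.comp ht

/-- Bounded inverses prevent the limit from degenerating: `A₀ * B i` tends to 1, hence `A₀` has
nonzero determinant. -/
lemma tendsto_inv_of_bounded {ι : Type*} {l : Filter ι} [l.NeBot] {A B : ι → Matrix n n ℂ}
    {A₀ : Matrix n n ℂ} {K : ℝ} (hA : Tendsto A l (𝓝 A₀)) (hAB : ∀ᶠ i in l, A i * B i = 1)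
    (hB : ∀ᶠ i in l, ‖B i‖ ≤ K) : IsUnit A₀ ∧ Tendsto B l (𝓝 A₀⁻¹) := by
  have h1 : Tendsto (fun i => A₀ * B i) l (𝓝 1) := by
    refine tendsto_iff_norm_sub_tendsto_zero.2 ?_
    have h2 : Tendsto (fun i => ‖A₀ - A i‖ * K) l (𝓝 0) := by
      have := ((tendsto_const_nhds (x := A₀)).sub hA).norm.mul_const K
      simpa using this
    refine squeeze_zero' (Eventually.of_forall fun _ => norm_nonneg _) ?_ h2
    filter_upwards [hAB, hB] with i h3 h4
    rw [← h3, ← sub_mul]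
    exact (norm_mul_le _ _).trans (by gcongr)
  have h2 : Tendsto (fun i => (A₀ * B i).det) l (𝓝 1) := by
    have h3 := ((continuous_id.matrix_det).tendsto (1 : Matrix n n ℂ)).comp h1
    rw [id, Matrix.det_one] at h3
    exact h3
  have hdet : IsUnit A₀.det := by
    obtain ⟨i, hi⟩ := (h2.eventually_ne one_ne_zero).exists
    rw [Matrix.det_mul] at hi
    exact isUnit_iff_ne_zero.2 (left_ne_zero_of_mul hi)
  refine ⟨(Matrix.isUnit_iff_isUnit_det _).2 hdet, ?_⟩
  have h3 := (tendsto_const_nhds (x := A₀⁻¹)).mul h1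
  rw [mul_one] at h3
  refine h3.congr fun i => ?_
  rw [← mul_assoc, Matrix.nonsing_inv_mul _ hdet, one_mul]

/-- The transition matrix across `w` has a nontangential boundary value at `w`. -/
lemma exists_tendsto_fundR_across (hG : IsSkewKernel G a b) {w ξ v : ℝ} (hw : w ∈ Icc a b)
    (hH : HolderAt G a b w) (hξ : ξ ∈ Icc a b) (hne : ξ ≠ w) (hv : v ∈ Icc a b) (hvw : v ≠ w) :
    ∃ A : Matrix n n ℂ, ∀ σ,
      Tendsto (fun ε => fundR G a (lowerPt w σ ε) ξ v) (𝓝[>] 0) (𝓝 A) := by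
  obtain ⟨A, hA⟩ := exists_tendsto_fundR_mul_exp hG hw hH hξ hne
  obtain ⟨A₂, hA₂⟩ := exists_tendsto_fundR_mul_exp hG hw hH hv hvw
  obtain ⟨K, hK0, hK⟩ := exists_norm_exp_smul_le (hG.skew w hw)
  refine ⟨A * A₂⁻¹, fun σ => ?_⟩
  have hz : ∀ ε : ℝ, 0 < ε → ∀ v ∈ Icc a b, (v : ℂ) ≠ lowerPt w σ ε := fun ε hε v _ =>
    ofReal_ne_of_im_ne_zero (by rw [lowerPt_im]; linarith) v
  -- The transition matrix is split at `w` into the regularized matrix from `ξ` and the inverse of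
  -- the regularized matrix from `v`. The two exponentials of log(w - z), which have no limit by
  -- themselves, cancel in the product.
  have h := tendsto_inv_of_bounded (K := K * fundBound n ^ 2) (hA₂ σ)
    (B := fun ε => exp ((-Complex.log ((w : ℂ) - lowerPt w σ ε)) • G w) *
      fundR G a (lowerPt w σ ε) w v) ?_ ?_
  · refine ((hA σ).mul h.2).congr' ?_
    filter_upwards [self_mem_nhdsWithin] with ε hε
    rw [mul_assoc, ← mul_assoc (exp _) (exp _), exp_smul_mul_exp_neg_smul, one_mul,
      fundR_mul_fundR hG.cont (hz ε hε) hw]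
  · filter_upwards [self_mem_nhdsWithin] with ε hε
    rw [mul_assoc, ← mul_assoc (exp _) (exp _), exp_smul_mul_exp_neg_smul, one_mul,
      fundR_mul_fundR hG.cont (hz ε hε) hw, fundR_self hG.cont (hz ε hε) hv]
  · filter_upwards [self_mem_nhdsWithin] with ε hε
    refine (norm_mul_le _ _).trans ?_
    gcongr
    · exact hK _ (by rw [Complex.neg_im, abs_neg]; exact abs_im_log_le _)
    · exact norm_fundR_le hG (hz ε hε) hw hv

end BoundaryValues

/-! ### The matrix Gamma function as a Poisson average of phases -/

section GammaIdentity

open Set NormedSpace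
open scoped Matrix.Norms.Operator

variable {n : Type*} [Fintype n] [DecidableEq n]

lemma arg_I_sub_ofReal (t : ℝ) :
    Complex.arg (Complex.I - (t : ℂ)) = Real.pi / 2 + Real.arctan t := by
  have hr : 0 < √(1 + t ^ 2) := by positivity
  have h : Complex.I - (t : ℂ) = (√(1 + t ^ 2) : ℝ) *
      (Complex.cos ((Real.pi / 2 + Real.arctan t : ℝ) : ℂ) +
        Complex.sin ((Real.pi / 2 + Real.arctan t : ℝ) : ℂ) * Complex.I) := by
    rw [← Complex.ofReal_cos, ← Complex.ofReal_sin, add_comm (Real.pi / 2), Real.cos_add_pi_div_two,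
      Real.sin_add_pi_div_two, Real.sin_arctan, Real.cos_arctan]
    have hr' : (√(1 + t ^ 2) : ℂ) ≠ 0 := by exact_mod_cast hr.ne'
    push_cast
    field_simp
    ring
  rw [h, Complex.arg_mul_cos_add_sin_mul_I hr]
  have h1 := Real.arctan_lt_pi_div_two t
  have h2 := Real.neg_pi_div_two_lt_arctan t
  constructor <;> linarith

/-- Euler's reflection formula at the point iμ. -/
lemma Gamma_one_add_mul_Gamma_one_sub {μ : ℝ} (hμ : μ ≠ 0) :
    Complex.Gamma (1 + Complex.I * μ) * Complex.Gamma (1 - Complex.I * μ) =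
      ((Real.pi * μ / Real.sinh (Real.pi * μ) : ℝ) : ℂ) := by
  have h0 : Complex.I * μ ≠ 0 := mul_ne_zero Complex.I_ne_zero (by exact_mod_cast hμ)
  rw [add_comm, Complex.Gamma_add_one _ h0, mul_assoc, Complex.Gamma_mul_Gamma_one_sub,
    show (Real.pi : ℂ) * (Complex.I * μ) = (Real.pi * μ : ℂ) * Complex.I by ring,
    Complex.sin_mul_I]
  have h1 : Complex.sinh (Real.pi * μ) ≠ 0 := by
    rw [← Complex.ofReal_mul, ← Complex.ofReal_sinh]
    exact_mod_cast Real.sinh_ne_zero.2 (mul_ne_zero Real.pi_ne_zero hμ)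
  push_cast
  field_simp

lemma integrable_exp_arctan_div (μ : ℝ) :
    Integrable fun t : ℝ => Real.exp (2 * μ * Real.arctan t) * (1 + t ^ 2)⁻¹ := by
  refine integrable_inv_one_add_sq.bdd_mul (c := Real.exp (|μ| * Real.pi)) ?_ ?_
  · exact (by fun_prop : Continuous fun t : ℝ =>
      Real.exp (2 * μ * Real.arctan t)).aestronglyMeasurable
  · refine Eventually.of_forall fun t => ?_
    rw [Real.norm_eq_abs, Real.abs_exp, Real.exp_le_exp]
    have h1 : |Real.arctan t| ≤ Real.pi / 2 := abs_le.2
      ⟨(Real.neg_pi_div_two_lt_arctan t).le, (Real.arctan_lt_pi_div_two t).le⟩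
    calc 2 * μ * Real.arctan t ≤ |2 * μ * Real.arctan t| := le_abs_self _
      _ = 2 * |μ| * |Real.arctan t| := by rw [abs_mul, abs_mul]; simp
      _ ≤ 2 * |μ| * (Real.pi / 2) := by gcongr
      _ = |μ| * Real.pi := by ring

/-- An antiderivative is exp (2μ arctan t) / (2μ), so the integral is sinh(πμ)/μ, which the
reflection formula writes with Gamma values. The case μ = 0 is the area under 1/(1 + t²). -/
lemma integral_exp_arctan_div (μ : ℝ) :
    ((∫ t : ℝ, Real.exp (2 * μ * Real.arctan t) * (1 + t ^ 2)⁻¹ : ℝ) : ℂ) =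
      Real.pi * (Complex.Gamma (1 + Complex.I * μ) * Complex.Gamma (1 - Complex.I * μ))⁻¹ := by
  rcases eq_or_ne μ 0 with rfl | hμ
  · simp [Complex.Gamma_one]
  have h := integral_of_hasDerivAt_of_tendsto
    (f := fun t => Real.exp (2 * μ * Real.arctan t) / (2 * μ)) (fun t => ?_)
    (integrable_exp_arctan_div μ)
    (m := Real.exp (2 * μ * (-(Real.pi / 2))) / (2 * μ))
    (n := Real.exp (2 * μ * (Real.pi / 2)) / (2 * μ)) ?_ ?_
  · rw [h, Gamma_one_add_mul_Gamma_one_sub hμ, Real.sinh_eq]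
    rw [← Complex.ofReal_inv, ← Complex.ofReal_mul]
    congr 1
    have : Real.exp (Real.pi * μ) - Real.exp (-(Real.pi * μ)) ≠ 0 := by
      have := Real.sinh_ne_zero.2 (mul_ne_zero Real.pi_ne_zero hμ)
      rw [Real.sinh_eq] at this
      intro h0; rw [h0] at this; simp at this
    have hpi := Real.pi_ne_zero
    rw [show 2 * μ * (Real.pi / 2) = Real.pi * μ by ring,
      show 2 * μ * (-(Real.pi / 2)) = -(Real.pi * μ) by ring]
    field_simp
  · have h := (((Real.hasDerivAt_arctan t).const_mul (2 * μ)).exp).div_const (2 * μ)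
    convert! h using 1
    field_simp
  · exact ((Real.continuous_exp.tendsto _).comp ((tendsto_nhdsWithin_iff.1
      Real.tendsto_arctan_atBot).1.const_mul (2 * μ))).div_const _
  · exact ((Real.continuous_exp.tendsto _).comp ((tendsto_nhdsWithin_iff.1
      Real.tendsto_arctan_atTop).1.const_mul (2 * μ))).div_const _

/-- The spectral theorem for skew-Hermitian matrices, with the exponentials. -/
lemma exists_diagonalization_of_skew {M : Matrix n n ℂ} (hM : Mᴴ = -M) :
    ∃ (V : Matrix n n ℂ) (μ : n → ℝ), V * Vᴴ = 1 ∧ Vᴴ * V = 1 ∧ ∀ z : ℂ,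
      exp (z • M) = V * Matrix.diagonal (fun k => Complex.exp (z * (Complex.I * μ k))) * Vᴴ := by
  have hH : ((-Complex.I) • M).IsHermitian := by
    rw [Matrix.IsHermitian, Matrix.conjTranspose_smul, hM]; simp
  set V : Matrix n n ℂ := (hH.eigenvectorUnitary : Matrix n n ℂ) with hV
  have h1 : V * Vᴴ = 1 := Unitary.coe_mul_star_self hH.eigenvectorUnitary
  have h2 : Vᴴ * V = 1 := Unitary.coe_star_mul_self hH.eigenvectorUnitary
  refine ⟨V, hH.eigenvalues, h1, h2, fun z => ?_⟩
  have hs := hH.spectral_theorem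
  rw [Unitary.conjStarAlgAut_apply] at hs
  have hM' : M = V * Matrix.diagonal (fun k => Complex.I * (hH.eigenvalues k : ℂ)) * Vᴴ := by
    calc M = Complex.I • ((-Complex.I) • M) := by rw [smul_smul]; simp
      _ = Complex.I • (V * Matrix.diagonal (RCLike.ofReal ∘ hH.eigenvalues) * Vᴴ) :=
        congrArg (Complex.I • ·) hs
      _ = _ := by
        rw [← Matrix.smul_mul, ← Matrix.mul_smul, ← Matrix.diagonal_smul]
        rfl
  have hinv : V⁻¹ = Vᴴ := Matrix.inv_eq_right_inv h1
  conv_lhs => rw [hM', ← Matrix.smul_mul, ← Matrix.mul_smul, ← Matrix.diagonal_smul, ← hinv,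
    Matrix.exp_conj _ _ (IsUnit.of_mul_eq_one _ h1), Matrix.exp_diagonal, hinv]
  congr 3
  ext k
  rw [Pi.coe_exp, Complex.exp_eq_exp_ℂ]
  rfl

lemma integral_conj_diagonal {X : Type*} [MeasurableSpace X] {ν : Measure X} (V W : Matrix n n ℂ)
    {d : X → n → ℂ} (hd : ∀ k, Integrable (fun x => d x k) ν) (i j : n) :
    Integrable (fun x => (V * Matrix.diagonal (d x) * W) i j) ν ∧
    ∫ x, (V * Matrix.diagonal (d x) * W) i j ∂ν = (V * Matrix.diagonal (fun k => ∫ x, d x k ∂ν) * W) i j := by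
  have e : ∀ d : n → ℂ, (V * Matrix.diagonal d * W) i j = ∑ k, V i k * d k * W k j := fun d => by
    rw [Matrix.mul_apply]
    simp only [Matrix.mul_diagonal]
  have hi : ∀ k ∈ Finset.univ, Integrable (fun x => V i k * d x k * W k j) ν := fun k _ =>
    ((hd k).const_mul _).mul_const _
  simp only [e]
  refine ⟨integrable_finsetSum _ hi, ?_⟩
  rw [integral_finsetSum _ hi]
  simp only [integral_const_mul, integral_mul_const]

lemma gamma_integrand_eq (μ : ℝ) {x : ℝ} (hx : 0 < x) :
    (Real.exp (-x) : ℂ) * (x : ℂ) ^ ((1 + Complex.I * μ : ℂ) - 1) =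
      (Real.exp (-x) : ℂ) * Complex.exp ((Real.log x : ℂ) * (Complex.I * μ)) := by
  rw [add_sub_cancel_left, Complex.cpow_def_of_ne_zero (by exact_mod_cast hx.ne'),
    Complex.ofReal_log hx.le]

lemma integrableOn_gamma_integrand (μ : ℝ) :
    IntegrableOn (fun x : ℝ => (Real.exp (-x) : ℂ) *
      Complex.exp ((Real.log x : ℂ) * (Complex.I * μ))) (Ioi 0) := by
  refine (Complex.GammaIntegral_convergent (s := 1 + Complex.I * μ) (by simp)).congr_fun
    (fun x hx => ?_) measurableSet_Ioi
  simpa using gamma_integrand_eq μ hx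

lemma integral_gamma_integrand (μ : ℝ) :
    ∫ x in Ioi (0 : ℝ), (Real.exp (-x) : ℂ) * Complex.exp ((Real.log x : ℂ) * (Complex.I * μ)) =
      Complex.Gamma (1 + Complex.I * μ) := by
  rw [Complex.Gamma_eq_integral (by simp), Complex.GammaIntegral]
  exact (setIntegral_congr_fun measurableSet_Ioi fun x hx => gamma_integrand_eq μ hx).symm

lemma smul_conj_diagonal_apply (c : ℂ) (V W : Matrix n n ℂ) (d : n → ℂ) (i j : n) :
    c * (V * Matrix.diagonal d * W) i j = (V * Matrix.diagonal (fun k => c * d k) * W) i j := by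
  have : Matrix.diagonal (fun k => c * d k) = c • Matrix.diagonal d := by
    rw [← Matrix.diagonal_smul]; rfl
  rw [this, Matrix.mul_smul, Matrix.smul_mul, Matrix.smul_apply, smul_eq_mul]

lemma integrableOn_gammaOneAdd {M : Matrix n n ℂ} (hM : Mᴴ = -M) (i j : n) :
    IntegrableOn (fun x : ℝ => (Real.exp (-x) : ℂ) * (exp ((Real.log x : ℂ) • M)) i j)
      (Ioi 0) := by
  obtain ⟨V, μ, -, -, hV⟩ := exists_diagonalization_of_skew hM
  simp only [hV, smul_conj_diagonal_apply]
  exact (integral_conj_diagonal V Vᴴ (fun k => integrableOn_gamma_integrand (μ k)) i j).1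

/-- Compared term by term in the series. The matrix `P` need not be invertible; it will be the
projection onto a block. -/
lemma exp_intertwine {M N P : Matrix n n ℂ} (h : P * M = N * P) : P * exp M = exp N * P := by
  have hp : ∀ k : ℕ, P * M ^ k = N ^ k * P := fun k => by
    induction k with
    | zero => simp
    | succ k ih => rw [pow_succ, ← mul_assoc, ih, mul_assoc, h, ← mul_assoc, ← pow_succ]
  have h1 := (NormedSpace.exp_series_hasSum_exp' (𝕂 := ℂ) M).mul_left P
  have h2 := (NormedSpace.exp_series_hasSum_exp' (𝕂 := ℂ) N).mul_right P
  refine h1.unique ?_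
  convert! h2 using 1
  ext1 k
  rw [mul_smul_comm, smul_mul_assoc, hp]

/-- A matrix that intertwines two matrices intertwines their Gamma functions. -/
lemma gammaOneAdd_intertwine {M N P : Matrix n n ℂ} (hM : Mᴴ = -M) (hN : Nᴴ = -N)
    (h : P * M = N * P) : P * gammaOneAdd M = gammaOneAdd N * P := by
  have hc : ∀ z : ℂ, P * exp (z • M) = exp (z • N) * P := fun z =>
    exp_intertwine (by rw [mul_smul_comm, h, smul_mul_assoc])
  ext i j
  rw [Matrix.mul_apply, Matrix.mul_apply]
  simp only [gammaOneAdd, Matrix.of_apply]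
  simp only [← integral_const_mul, ← integral_mul_const]
  rw [← integral_finsetSum _ fun k _ => (integrableOn_gammaOneAdd hM k j).const_mul _,
    ← integral_finsetSum _ fun k _ => (integrableOn_gammaOneAdd hN i k).mul_const _]
  refine integral_congr_ae (Eventually.of_forall fun x => ?_)
  have h := congrFun (congrFun (hc (Real.log x)) i) j
  rw [Matrix.mul_apply, Matrix.mul_apply] at h
  simp only
  calc _ = (Real.exp (-x) : ℂ) * ∑ k, P i k * exp ((Real.log x : ℂ) • M) k j := by
        rw [Finset.mul_sum]; exact Finset.sum_congr rfl fun k _ => by ring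
    _ = _ := by
        rw [h, Finset.mul_sum]; exact Finset.sum_congr rfl fun k _ => by ring

/-- The matrix Gamma function commutes with everything that commutes with its argument. -/
lemma commute_gammaOneAdd {M P : Matrix n n ℂ} (hM : Mᴴ = -M) (hP : Commute P M) :
    Commute P (gammaOneAdd M) :=
  gammaOneAdd_intertwine hM hM hP.eq

lemma conj_diagonal_mul {V W : Matrix n n ℂ} (hV : W * V = 1) (d₁ d₂ : n → ℂ) :
    (V * Matrix.diagonal d₁ * W) * (V * Matrix.diagonal d₂ * W) = V * Matrix.diagonal (fun k => d₁ k * d₂ k) * W := by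
  rw [← Matrix.diagonal_mul_diagonal]
  calc _ = V * Matrix.diagonal d₁ * (W * V) * Matrix.diagonal d₂ * W := by simp only [mul_assoc]
    _ = _ := by rw [hV]; simp only [mul_assoc, one_mul]

/-- Poisson averages of the boundary phases produce the matrix Gamma function. -/
theorem isUnit_gammaOneAdd_and_integral {M : Matrix n n ℂ} (hM : Mᴴ = -M) :
    IsUnit (gammaOneAdd M) ∧ ∀ i j,
      Integrable (fun t : ℝ => ((Real.pi * (1 + t ^ 2) : ℝ) : ℂ)⁻¹ *
        exp ((-2 * Complex.I * Complex.arg (Complex.I - t)) • M) i j) ∧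
      ∫ t : ℝ, ((Real.pi * (1 + t ^ 2) : ℝ) : ℂ)⁻¹ *
        exp ((-2 * Complex.I * Complex.arg (Complex.I - t)) • M) i j =
      (exp ((-Real.pi * Complex.I) • M) * ((gammaOneAdd M)⁻¹ * ((gammaOneAdd M)⁻¹)ᴴ)) i j := by
  obtain ⟨V, μ, h1, h2, hV⟩ := exists_diagonalization_of_skew hM
  have hG : gammaOneAdd M = V * Matrix.diagonal (fun k => Complex.Gamma (1 + Complex.I * μ k)) * Vᴴ := by
    ext i j
    simp only [gammaOneAdd, Matrix.of_apply, hV, smul_conj_diagonal_apply]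
    rw [(integral_conj_diagonal V Vᴴ (fun k => integrableOn_gamma_integrand (μ k)) i j).2]
    simp only [integral_gamma_integrand]
  have hne : ∀ k, Complex.Gamma (1 + Complex.I * μ k) ≠ 0 := fun k =>
    Complex.Gamma_ne_zero_of_re_pos (by simp)
  have hmul : gammaOneAdd M *
      (V * Matrix.diagonal (fun k => (Complex.Gamma (1 + Complex.I * μ k))⁻¹) * Vᴴ) = 1 := by
    rw [hG, conj_diagonal_mul h2]
    simp only [mul_inv_cancel₀ (hne _)]
    rw [Matrix.diagonal_one, mul_one, h1]
  refine ⟨IsUnit.of_mul_eq_one _ hmul, fun i j => ?_⟩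
  have hinv := Matrix.inv_eq_right_inv hmul
  have hstar : ((gammaOneAdd M)⁻¹)ᴴ =
      V * Matrix.diagonal (fun k => (Complex.Gamma (1 - Complex.I * μ k))⁻¹) * Vᴴ := by
    rw [hinv, Matrix.conjTranspose_mul, Matrix.conjTranspose_mul, Matrix.conjTranspose_conjTranspose,
      Matrix.diagonal_conjTranspose, mul_assoc]
    congr 3
    ext k
    rw [Pi.star_apply, Complex.star_def, map_inv₀, ← Complex.Gamma_conj]
    simp [sub_eq_add_neg]
  -- In an eigenbasis `M` is iμ, and arg(i - t) = π/2 + arctan t, so the phase becomes the real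
  -- factor e^{πμ} e^{2μ arctan t}. The first factor is the eigenvalue of exp (-πi M); the second
  -- one is averaged.
  have hscal : ∀ (t : ℝ) (k : n), ((Real.pi * (1 + t ^ 2) : ℝ) : ℂ)⁻¹ *
      Complex.exp ((-2 * Complex.I * Complex.arg (Complex.I - t)) * (Complex.I * μ k)) =
      (Real.pi : ℂ)⁻¹ * Complex.exp (Real.pi * μ k) *
        ((Real.exp (2 * μ k * Real.arctan t) * (1 + t ^ 2)⁻¹ : ℝ) : ℂ) := fun t k => by
    rw [arg_I_sub_ofReal,
      show (-2 * Complex.I * ((Real.pi / 2 + Real.arctan t : ℝ) : ℂ)) * (Complex.I * μ k) =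
        Real.pi * μ k + ((2 * μ k * Real.arctan t : ℝ) : ℂ) by
          generalize Real.arctan t = θ
          push_cast
          linear_combination (-2 * ((Real.pi : ℂ) / 2 + θ) * μ k) * Complex.I_sq,
      Complex.exp_add]
    push_cast
    rw [mul_inv]
    ring
  have hint : ∀ k, Integrable (fun t : ℝ => ((Real.pi * (1 + t ^ 2) : ℝ) : ℂ)⁻¹ *
      Complex.exp ((-2 * Complex.I * Complex.arg (Complex.I - t)) * (Complex.I * μ k))) :=
    fun k => by
      simp only [hscal]
      exact ((integrable_exp_arctan_div (μ k)).ofReal).const_mul _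
  have hval : ∀ k, ∫ t : ℝ, ((Real.pi * (1 + t ^ 2) : ℝ) : ℂ)⁻¹ *
      Complex.exp ((-2 * Complex.I * Complex.arg (Complex.I - t)) * (Complex.I * μ k)) =
      Complex.exp (Real.pi * μ k) * ((Complex.Gamma (1 + Complex.I * μ k))⁻¹ *
        (Complex.Gamma (1 - Complex.I * μ k))⁻¹) := fun k => by
    simp only [hscal]
    rw [integral_const_mul, integral_complex_ofReal, integral_exp_arctan_div, mul_inv]
    have : (Real.pi : ℂ) ≠ 0 := by exact_mod_cast Real.pi_ne_zero
    field_simp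
  simp only [hV, smul_conj_diagonal_apply]
  refine ⟨(integral_conj_diagonal V Vᴴ hint i j).1, ?_⟩
  rw [(integral_conj_diagonal V Vᴴ hint i j).2, hstar, hinv, conj_diagonal_mul h2,
    conj_diagonal_mul h2]
  simp only [hval]
  have : ∀ k, Complex.exp (-Real.pi * Complex.I * (Complex.I * μ k)) =
      Complex.exp (Real.pi * μ k) := fun k => by
    congr 1
    linear_combination (-(Real.pi : ℂ) * μ k) * Complex.I_sq
  simp only [this]

end GammaIdentity

/-! ### Plancherel theorems -/

section Plancherel

open FourierTransform SchwartzMap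
open scoped ContDiff

variable {F : Type*} [NormedAddCommGroup F] [InnerProductSpace ℂ F] [CompleteSpace F]

/-- The `L²` Fourier transform of an integrable function is given by the Fourier integral. -/
lemma Lp_fourier_ae_eq {f : ℝ → F} (hf : Integrable f) (hf2 : MemLp f 2) :
    ((𝓕 (hf2.toLp f) : Lp F 2 (volume : Measure ℝ)) : ℝ → F) =ᵐ[volume] 𝓕 f := by
  have hcont : Continuous (𝓕 f) := VectorFourier.fourierIntegral_continuous
    Real.continuous_fourierChar (by fun_prop) hf
  refine ae_eq_of_integral_contDiff_smul_eq
    ((Lp.memLp _).locallyIntegrable (by norm_num)) hcont.locallyIntegrable fun g hg hgc => ?_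
  have hg₁ : HasCompactSupport (Complex.ofRealCLM ∘ g) := hgc.comp_left rfl
  have hg₂ : ContDiff ℝ ∞ (Complex.ofRealCLM ∘ g) := by fun_prop
  set G : 𝓢(ℝ, ℂ) := hg₁.toSchwartzMap hg₂ with hG
  have hGg : ∀ x, G x = (g x : ℂ) := fun x => rfl
  -- Both functions are tested against a smooth compactly supported `g`: the distributional
  -- transform handles the `L²` side, and the symmetry of the Fourier integral handles the pointwise
  -- side.
  have h1 := congrArg (fun T : 𝓢'(ℝ, F) => T G)
    (Lp.fourier_toTemperedDistribution_eq (hf2.toLp f))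
  simp only [TemperedDistribution.fourier_apply, Lp.toTemperedDistribution_apply] at h1
  have h2 : ∫ x, (𝓕 G) x • (hf2.toLp f : ℝ → F) x = ∫ x, (𝓕 (G : ℝ → ℂ)) x • f x := by
    refine integral_congr_ae ?_
    filter_upwards [hf2.coeFn_toLp] with x hx
    rw [hx, SchwartzMap.fourier_coe]
  have h3 : ∫ x, (𝓕 (G : ℝ → ℂ)) x • f x = ∫ x, G x • 𝓕 f x := by
    have := VectorFourier.integral_fourierIntegral_smul_eq_flip (L := innerₗ ℝ)
      (μ := volume) (ν := volume) (f := (G : ℝ → ℂ)) (g := f)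
      Real.continuous_fourierChar (by fun_prop) G.integrable hf
    rw [flip_innerₗ] at this
    exact this
  rw [h2, h3] at h1
  simp only [hGg, Complex.coe_smul] at h1
  exact h1.symm

lemma L2_integral_norm_sq {α : Type*} [MeasurableSpace α] {μ : Measure α} (g : Lp F 2 μ) :
    ∫ x, ‖(g : α → F) x‖ ^ 2 ∂μ = ‖g‖ ^ 2 := by
  have h1 := L2.inner_def (𝕜 := ℂ) g g
  have h2 : (∫ x, inner ℂ ((g : α → F) x) ((g : α → F) x) ∂μ) =
      ((∫ x, ‖(g : α → F) x‖ ^ 2 ∂μ : ℝ) : ℂ) := by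
    rw [← integral_complex_ofReal]
    refine integral_congr_ae (Eventually.of_forall fun x => ?_)
    simp [inner_self_eq_norm_sq_to_K]
  rw [h2, inner_self_eq_norm_sq_to_K] at h1
  exact (Complex.ofReal_injective (by simpa using h1)).symm

/-- Plancherel's theorem for functions in `L¹ ∩ L²`. -/
theorem plancherel_of_integrable {f : ℝ → F} (hf : Integrable f) (hf2 : MemLp f 2) :
    Integrable (fun s => ‖𝓕 f s‖ ^ 2) ∧ ∫ s, ‖𝓕 f s‖ ^ 2 = ∫ x, ‖f x‖ ^ 2 := by
  have h := Lp_fourier_ae_eq hf hf2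
  have hm : MemLp (𝓕 f) 2 := (memLp_congr_ae h).1 (Lp.memLp _)
  refine ⟨(memLp_two_iff_integrable_sq_norm hm.1).1 hm, ?_⟩
  have e1 : ∫ s, ‖𝓕 f s‖ ^ 2 = ‖𝓕 (hf2.toLp f)‖ ^ 2 := by
    rw [← L2_integral_norm_sq]
    refine integral_congr_ae ?_
    filter_upwards [h] with x hx
    rw [hx]
  have e2 : ∫ s, ‖f s‖ ^ 2 = ‖hf2.toLp f‖ ^ 2 := by
    rw [← L2_integral_norm_sq]
    refine integral_congr_ae ?_
    filter_upwards [hf2.coeFn_toLp] with x hx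
    rw [hx]
  rw [e1, e2, Lp.norm_fourier_eq]

lemma norm_cexp_laplace (τ ε x : ℝ) :
    ‖Complex.exp (-Complex.I * (τ - Complex.I * ε) * x)‖ = Real.exp (-ε * x) := by
  rw [Complex.norm_exp]
  congr 1
  simp [Complex.mul_re, Complex.mul_im]

lemma integrableOn_exp_neg_mul {δ : ℝ} (hδ : 0 < δ) :
    IntegrableOn (fun x : ℝ => Real.exp (-δ * x)) (Set.Ioi 0) :=
  integrableOn_exp_mul_Ioi (by linarith) 0

lemma integrableOn_laplace {E : Type*} [NormedAddCommGroup E] [NormedSpace ℂ E] {u : ℝ → E}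
    (hu : Continuous u) {C δ ε : ℝ} (hδε : δ < ε)
    (hb : ∀ x, 0 ≤ x → ‖u x‖ ≤ C * Real.exp (δ * x)) (τ : ℝ) :
    IntegrableOn (fun x : ℝ => Complex.exp (-Complex.I * (τ - Complex.I * ε) * x) • u x)
      (Set.Ioi 0) := by
  refine Integrable.mono' ((integrableOn_exp_neg_mul (sub_pos.2 hδε)).const_mul C) ?_ ?_
  · exact (by fun_prop : Continuous fun x : ℝ =>
      Complex.exp (-Complex.I * (τ - Complex.I * ε) * x) • u x).aestronglyMeasurable
  · filter_upwards [ae_restrict_mem measurableSet_Ioi] with x hx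
    rw [norm_smul, norm_cexp_laplace]
    calc _ ≤ Real.exp (-ε * x) * (C * Real.exp (δ * x)) := by
          gcongr; exact hb x (le_of_lt hx)
      _ = _ := by
          rw [mul_left_comm, ← Real.exp_add]
          congr 2; ring

lemma integrableOn_exp_mul_sq {E : Type*} [NormedAddCommGroup E] {u : ℝ → E}
    (hu : Continuous u) {C δ ε : ℝ} (hδε : δ < ε)
    (hb : ∀ x, 0 ≤ x → ‖u x‖ ≤ C * Real.exp (δ * x)) :
    IntegrableOn (fun x : ℝ => Real.exp (-2 * ε * x) * ‖u x‖ ^ 2) (Set.Ioi 0) := by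
  have h2 : 0 < 2 * (ε - δ) := by linarith
  refine Integrable.mono' ((integrableOn_exp_neg_mul h2).const_mul (C ^ 2)) ?_ ?_
  · exact (by fun_prop : Continuous fun x : ℝ =>
      Real.exp (-2 * ε * x) * ‖u x‖ ^ 2).aestronglyMeasurable
  · filter_upwards [ae_restrict_mem measurableSet_Ioi] with x hx
    rw [Real.norm_of_nonneg (by positivity)]
    calc _ ≤ Real.exp (-2 * ε * x) * (C * Real.exp (δ * x)) ^ 2 := by
          gcongr; exact hb x (le_of_lt hx)
      _ = _ := by
          rw [mul_pow, mul_left_comm, ← Real.exp_nat_mul, ← Real.exp_add]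
          congr 2; push_cast; ring

/-- Plancherel's theorem for the Laplace transform on the line `Im z = - ε`. -/
theorem plancherel_laplace {u : ℝ → F} (hu : Continuous u) {C δ ε : ℝ} (hδε : δ < ε)
    (hb : ∀ x, 0 ≤ x → ‖u x‖ ≤ C * Real.exp (δ * x)) :
    Integrable (fun τ : ℝ => ‖∫ x in Set.Ioi (0 : ℝ),
      Complex.exp (-Complex.I * (τ - Complex.I * ε) * x) • u x‖ ^ 2) ∧
    ∫ τ : ℝ, ‖∫ x in Set.Ioi (0 : ℝ),
      Complex.exp (-Complex.I * (τ - Complex.I * ε) * x) • u x‖ ^ 2 =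
      2 * Real.pi * ∫ x in Set.Ioi (0 : ℝ), Real.exp (-2 * ε * x) * ‖u x‖ ^ 2 := by
  -- The damping e^{-εx} is absorbed into the function. The Laplace integral at τ - iε is then a
  -- Fourier integral at frequency τ/(2π), and this rescaling produces the factor 2π.
  set f : ℝ → F := (Set.Ioi 0).indicator fun x =>
    Complex.exp (-Complex.I * ((0 : ℝ) - Complex.I * ε) * x) • u x with hf
  have hf1 : Integrable f :=
    (integrable_indicator_iff measurableSet_Ioi).2 (integrableOn_laplace hu hδε hb 0)
  have hsq : (fun x => ‖f x‖ ^ 2) =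
      (Set.Ioi 0).indicator fun x => Real.exp (-2 * ε * x) * ‖u x‖ ^ 2 := by
    ext x
    by_cases hx : x ∈ Set.Ioi (0 : ℝ)
    · simp only [hf, Set.indicator_of_mem hx]
      rw [norm_smul, norm_cexp_laplace, mul_pow, ← Real.exp_nat_mul]
      congr 2; push_cast; ring
    · simp only [hf, Set.indicator_of_notMem hx]
      simp
  have hf2 : MemLp f 2 := by
    rw [memLp_two_iff_integrable_sq_norm hf1.1, hsq, integrable_indicator_iff measurableSet_Ioi]
    exact integrableOn_exp_mul_sq hu hδε hb
  have hF : ∀ τ : ℝ, ∫ x in Set.Ioi (0 : ℝ),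
      Complex.exp (-Complex.I * (τ - Complex.I * ε) * x) • u x = 𝓕 f (τ / (2 * Real.pi)) := by
    intro τ
    rw [Real.fourier_real_eq_integral_exp_smul, ← integral_indicator measurableSet_Ioi]
    congr 1
    ext x
    by_cases hx : x ∈ Set.Ioi (0 : ℝ)
    · simp only [hf, Set.indicator_of_mem hx]
      rw [smul_smul, ← Complex.exp_add]
      congr 2
      have : (Real.pi : ℂ) ≠ 0 := by exact_mod_cast Real.pi_ne_zero
      push_cast
      field_simp
      ring
    · simp only [hf, Set.indicator_of_notMem hx, smul_zero]
  obtain ⟨h1, h2⟩ := plancherel_of_integrable hf1 hf2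
  simp only [hF]
  refine ⟨h1.comp_div (by positivity), ?_⟩
  rw [Measure.integral_comp_div (fun s => ‖𝓕 f s‖ ^ 2), h2, hsq,
    integral_indicator measurableSet_Ioi, abs_of_pos (by positivity), smul_eq_mul]

/-- Abel means of a function that converges at infinity. -/
theorem tendsto_abel_mean {f : ℝ → ℝ} (hf : Continuous f) {l C : ℝ} (hb : ∀ x, 0 ≤ x → |f x| ≤ C)
    (hl : Tendsto f atTop (𝓝 l)) :
    Tendsto (fun ε => 2 * ε * ∫ x in Set.Ioi (0 : ℝ), Real.exp (-2 * ε * x) * f x)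
      (𝓝[>] 0) (𝓝 l) := by
  -- The substitution y = εx frees the weight from ε, and the function at y/ε tends to its limit at
  -- infinity.
  have h1 : Tendsto (fun ε : ℝ => ∫ y in Set.Ioi (0 : ℝ), 2 * Real.exp (-2 * y) * f (ε⁻¹ * y))
      (𝓝[>] 0) (𝓝 (∫ y in Set.Ioi (0 : ℝ), 2 * Real.exp (-2 * y) * l)) := by
    refine tendsto_integral_filter_of_dominated_convergence
      (fun y => 2 * Real.exp (-2 * y) * C) (Eventually.of_forall fun ε => ?_) ?_ ?_ ?_
    · exact (by fun_prop : Continuous fun y : ℝ =>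
        2 * Real.exp (-2 * y) * f (ε⁻¹ * y)).aestronglyMeasurable
    · filter_upwards [self_mem_nhdsWithin] with ε hε
      filter_upwards [ae_restrict_mem measurableSet_Ioi] with y hy
      have hε' : 0 < ε := hε
      have hy' : 0 < y := hy
      rw [norm_mul, Real.norm_of_nonneg (by positivity)]
      gcongr
      exact hb _ (by positivity)
    · exact ((integrableOn_exp_neg_mul two_pos).const_mul 2).mul_const C
    · filter_upwards [ae_restrict_mem measurableSet_Ioi] with y hy
      exact (hl.comp (tendsto_inv_nhdsGT_zero.atTop_mul_const hy)).const_mul _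
  have h2 : ∫ y in Set.Ioi (0 : ℝ), 2 * Real.exp (-2 * y) * l = l := by
    rw [integral_mul_const, integral_const_mul, integral_exp_mul_Ioi (a := -2) (by norm_num) 0]
    simp
  rw [h2] at h1
  refine h1.congr' ?_
  filter_upwards [self_mem_nhdsWithin] with ε hε
  have hε' : 0 < ε := hε
  have h3 := integral_comp_mul_left_Ioi (E := ℝ) (fun y : ℝ => 2 * Real.exp (-2 * y) * f (ε⁻¹ * y)) 0 hε'
  rw [mul_zero, smul_eq_mul, inv_mul_eq_div, eq_div_iff hε'.ne'] at h3
  have h4 : ∀ x : ℝ, 2 * Real.exp (-2 * (ε * x)) * f (ε⁻¹ * (ε * x)) =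
      2 * (Real.exp (-2 * ε * x) * f x) := fun x => by
    rw [inv_mul_cancel_left₀ hε'.ne']
    ring_nf
  simp only [h4, integral_const_mul] at h3
  rw [← h3]
  ring

end Plancherel

/-! ### One-parameter groups generated by bounded operators -/

section Flow

open Complex (I)

variable {H E : Type*} [NormedAddCommGroup H] [InnerProductSpace ℂ H] [CompleteSpace H]
  [NormedAddCommGroup E] [InnerProductSpace ℂ E] [CompleteSpace E]

lemma HasDerivAt.complexClm_apply {c : ℝ → H →L[ℂ] H} {c' : H →L[ℂ] H} {u : ℝ → H} {u' : H}
    {x : ℝ} (hc : HasDerivAt c c' x) (hu : HasDerivAt u u' x) :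
    HasDerivAt (fun y => c y (u y)) (c' (u x) + c x u') x := by
  have h1 : HasDerivAt (fun y => (c y).restrictScalars ℝ) (c'.restrictScalars ℝ) x :=
    (ContinuousLinearMap.restrictScalarsL ℂ H H ℝ ℝ).hasFDerivAt.comp_hasDerivAt x hc
  exact h1.clm_apply hu

/-- The group `e^{ixB}` generated by a bounded operator. -/
def flow (B : H →L[ℂ] H) (x : ℝ) : H →L[ℂ] H := NormedSpace.exp ((I * (x : ℂ)) • B)

lemma flow_zero (B : H →L[ℂ] H) : flow B 0 = 1 := by
  simp [flow]

lemma flow_commute (B : H →L[ℂ] H) (x : ℝ) (h : H) : flow B x (B h) = B (flow B x h) := by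
  let : NormedAlgebra ℚ (H →L[ℂ] H) := NormedAlgebra.restrictScalars ℚ ℂ _
  have h1 : Commute (flow B x) B := ((Commute.refl B).smul_left _).exp_left
  exact congrArg (fun T : H →L[ℂ] H => T h) h1.eq

lemma hasDerivAt_flow (B : H →L[ℂ] H) (h : H) (x : ℝ) :
    HasDerivAt (fun x => flow B x h) (I • B (flow B x h)) x := by
  have h1 := hasDerivAt_exp_smul_const' (𝕂 := ℝ) (I • B) x
  have h2 : (fun u : ℝ => NormedSpace.exp (u • (I • B))) = flow B := by
    ext1 u
    unfold flow
    rw [mul_comm, ← smul_smul, Complex.coe_smul]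
  have h3 : NormedSpace.exp (x • (I • B)) = flow B x := congrFun h2 x
  rw [h2, h3] at h1
  have h4 := h1.complexClm_apply (hasDerivAt_const x h)
  simpa using h4

lemma continuous_flow (B : H →L[ℂ] H) (h : H) : Continuous fun x => flow B x h :=
  continuous_iff_continuousAt.2 fun x => (hasDerivAt_flow B h x).continuousAt

/-- The norm of `e^{ixB}` grows more slowly than any exponential as `x → ∞`. -/
def SubexpGrowth (B : H →L[ℂ] H) : Prop :=
  ∀ ε : ℝ, 0 < ε → ∃ C : ℝ, ∀ x : ℝ, 0 ≤ x → ‖flow B x‖ ≤ C * Real.exp (ε * x)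

lemma SubexpGrowth.apply {B : H →L[ℂ] H} (hB : SubexpGrowth B) {ε : ℝ} (hε : 0 < ε) (h : H) :
    ∃ C : ℝ, ∀ x : ℝ, 0 ≤ x → ‖flow B x h‖ ≤ C * Real.exp (ε * x) := by
  obtain ⟨C, hC⟩ := hB ε hε
  refine ⟨C * ‖h‖, fun x hx => ((flow B x).le_opNorm h).trans ?_⟩
  calc _ ≤ C * Real.exp (ε * x) * ‖h‖ := by gcongr; exact hC x hx
    _ = _ := by ring

/-! #### The resolvent as a Laplace transform -/

lemma integrableOn_laplace_flow {B : H →L[ℂ] H} (hB : SubexpGrowth B) {ε : ℝ} (hε : 0 < ε)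
    (τ : ℝ) (h : H) :
    IntegrableOn (fun x : ℝ => Complex.exp (-I * (τ - I * ε) * x) • flow B x h) (Set.Ioi 0) := by
  obtain ⟨C, hC⟩ := hB.apply (half_pos hε) h
  exact integrableOn_laplace (continuous_flow B h) (half_lt_self hε) hC τ

/-- With z = τ - iε, the integrand is -i times the derivative of e^{-izx} e^{ixB} u, and
subexponential growth removes the boundary term at infinity. The formula serves twice: it solves (B
- z) u = f, and it shows that the solution is unique. -/
lemma laplace_flow_sub_smul {B : H →L[ℂ] H} (hB : SubexpGrowth B) {ε : ℝ} (hε : 0 < ε) (τ : ℝ)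
    (u : H) :
    ∫ x in Set.Ioi (0 : ℝ), Complex.exp (-I * (τ - I * ε) * x) •
      flow B x (B u - ((τ : ℂ) - I * ε) • u) = I • u := by
  have hd : ∀ x : ℝ, HasDerivAt (fun x : ℝ => Complex.exp (-I * (τ - I * ε) * x) • flow B x u)
      (I • (Complex.exp (-I * (τ - I * ε) * x) •
        flow B x (B u - ((τ : ℂ) - I * ε) • u))) x := by
    intro x
    have h1 : HasDerivAt (fun x : ℝ => Complex.exp (-I * (τ - I * ε) * x))
        (Complex.exp (-I * (τ - I * ε) * x) * (-I * (τ - I * ε))) x := by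
      have := ((hasDerivAt_id (x : ℂ)).const_mul (-I * (τ - I * ε))).cexp.comp_ofReal
      simpa using this
    convert! h1.smul (hasDerivAt_flow B u x) using 1
    rw [map_sub, map_smul, flow_commute]
    module
  have hlim : Tendsto (fun x : ℝ => Complex.exp (-I * (τ - I * ε) * x) • flow B x u) atTop
      (𝓝 0) := by
    obtain ⟨C, hC⟩ := hB.apply (half_pos hε) u
    rw [tendsto_zero_iff_norm_tendsto_zero]
    refine squeeze_zero' (Eventually.of_forall fun x => norm_nonneg _) (g := fun x =>
      C * Real.exp (-((ε / 2) * x))) ?_ ?_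
    · filter_upwards [eventually_ge_atTop 0] with x hx
      rw [norm_smul, norm_cexp_laplace]
      calc _ ≤ Real.exp (-ε * x) * (C * Real.exp (ε / 2 * x)) := by gcongr; exact hC x hx
        _ = _ := by
          rw [mul_left_comm, ← Real.exp_add]
          congr 2; ring
    · rw [← mul_zero C]
      refine Tendsto.const_mul C (Real.tendsto_exp_neg_atTop_nhds_zero.comp ?_)
      exact tendsto_id.const_mul_atTop (half_pos hε)
  have h2 := integral_Ioi_of_hasDerivAt_of_tendsto' (a := 0) (fun x _ => hd x)
    ((integrableOn_laplace_flow hB hε τ _).smul I) hlim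
  rw [integral_smul] at h2
  simp only [Complex.ofReal_zero, mul_zero, Complex.exp_zero, one_smul, flow_zero, zero_sub] at h2
  have h3 := congrArg (fun v => (-I) • v) h2
  rw [smul_smul, show (-I) * I = 1 by rw [neg_mul, Complex.I_mul_I, neg_neg], one_smul] at h3
  rw [h3]
  simp

/-- The equation `(B - z) u = f` is solvable in the lower half-plane. -/
lemma exists_resolvent {B : H →L[ℂ] H} (hB : SubexpGrowth B) {ε : ℝ} (hε : 0 < ε) (τ : ℝ)
    (f : H) : ∃ u, B u - ((τ : ℂ) - I * ε) • u = f := by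
  refine ⟨-I • ∫ x in Set.Ioi (0 : ℝ), Complex.exp (-I * (τ - I * ε) * x) • flow B x f, ?_⟩
  have h1 := laplace_flow_sub_smul hB hε τ f
  set T : H →L[ℂ] H := B - ((τ : ℂ) - I * ε) • 1 with hT
  have hTa : ∀ v, T v = B v - ((τ : ℂ) - I * ε) • v := fun v => by simp [hT]
  have hTf : ∀ x, T (flow B x f) = flow B x (B f - ((τ : ℂ) - I * ε) • f) := fun x => by
    rw [hTa, map_sub, map_smul, flow_commute]
  rw [← hTa, map_smul, ← ContinuousLinearMap.integral_comp_comm _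
    (integrableOn_laplace_flow hB hε τ f)]
  simp only [map_smul, hTf]
  rw [h1, smul_smul]
  simp

/-- Plancherel's theorem for the observed resolvent. -/
lemma plancherel_resolvent {B : H →L[ℂ] H} (hB : SubexpGrowth B) (Φ : H →L[ℂ] E) {ε : ℝ}
    (hε : 0 < ε) {f : H} {u : ℝ → H} (hu : ∀ τ : ℝ, B (u τ) - ((τ : ℂ) - I * ε) • u τ = f) :
    Integrable (fun τ => ‖Φ (u τ)‖ ^ 2) ∧ ∫ τ, ‖Φ (u τ)‖ ^ 2 =
      2 * Real.pi * ∫ x in Set.Ioi (0 : ℝ), Real.exp (-2 * ε * x) * ‖Φ (flow B x f)‖ ^ 2 := by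
  obtain ⟨C, hC⟩ := hB.apply (half_pos hε) f
  have hc : ∀ x, 0 ≤ x → ‖Φ (flow B x f)‖ ≤ ‖Φ‖ * C * Real.exp (ε / 2 * x) := fun x hx => by
    refine (Φ.le_opNorm _).trans ?_
    rw [mul_assoc]
    gcongr
    exact hC x hx
  have h := plancherel_laplace (Φ.continuous.comp (continuous_flow B f)) (half_lt_self hε) hc
  have key : ∀ τ : ℝ, ‖∫ x in Set.Ioi (0 : ℝ), Complex.exp (-I * (τ - I * ε) * x) •
      (Φ ∘ fun x => flow B x f) x‖ = ‖Φ (u τ)‖ := fun τ => by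
    have h1 := laplace_flow_sub_smul hB hε τ (u τ)
    rw [hu τ] at h1
    have h2 := congrArg Φ h1
    rw [← ContinuousLinearMap.integral_comp_comm _ (integrableOn_laplace_flow hB hε τ f)] at h2
    simp only [map_smul] at h2
    simp only [Function.comp_apply]
    rw [h2, norm_smul, Complex.norm_I, one_mul]
  simp only [key] at h
  exact h

/-! #### Energy identities -/

/-- Only i(B - B*) survives in the derivative, and this equals -Φ* 𝓛 Φ. -/
lemma hasDerivAt_inner_flow {B : H →L[ℂ] H} {Φ : H →L[ℂ] E} {𝓛 : E →L[ℂ] E}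
    (hB : B - B.adjoint = I • (Φ.adjoint ∘L 𝓛 ∘L Φ)) (g h : H) (x : ℝ) :
    HasDerivAt (fun x => inner ℂ (flow B x g) (flow B x h))
      (-inner ℂ (Φ (flow B x g)) (𝓛 (Φ (flow B x h)))) x := by
  have h1 := (hasDerivAt_flow B g x).inner ℂ (hasDerivAt_flow B h x)
  convert! h1 using 1
  have h2 : B (flow B x h) = B.adjoint (flow B x h) + I • Φ.adjoint (𝓛 (Φ (flow B x h))) := by
    have := congrArg (fun T : H →L[ℂ] H => T (flow B x h)) hB
    simp only [_root_.sub_apply, _root_.smul_apply,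
      ContinuousLinearMap.comp_apply] at this
    rw [← this]; abel
  rw [inner_smul_left, inner_smul_right, h2, inner_add_right, inner_smul_right,
    ContinuousLinearMap.adjoint_inner_right, ContinuousLinearMap.adjoint_inner_right]
  simp only [Complex.conj_I]
  linear_combination (-inner ℂ (Φ (flow B x g)) (𝓛 (Φ (flow B x h)))) * Complex.I_sq

/-- A dissipative operator generates a contraction semigroup with square integrable
observations. -/
lemma flow_of_dissipative {B : H →L[ℂ] H} {Φ : H →L[ℂ] E}
    (hB : B - B.adjoint = I • (Φ.adjoint ∘L Φ)) (h : H) :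
    (∀ x, 0 ≤ x → ‖flow B x h‖ ≤ ‖h‖) ∧
      ∀ X, 0 ≤ X → ∫ x in (0 : ℝ)..X, ‖Φ (flow B x h)‖ ^ 2 ≤ ‖h‖ ^ 2 := by
  have hB' : B - B.adjoint = I • (Φ.adjoint ∘L (ContinuousLinearMap.id ℂ E) ∘L Φ) := by
    rw [hB, ContinuousLinearMap.id_comp]
  have hd : ∀ x, HasDerivAt (fun x => ‖flow B x h‖ ^ 2) (-‖Φ (flow B x h)‖ ^ 2) x := by
    intro x
    have h1 := Complex.reCLM.hasFDerivAt.comp_hasDerivAt x (hasDerivAt_inner_flow hB' h h x)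
    convert! h1 using 1
    · ext y
      simp [inner_self_eq_norm_sq_to_K, ← Complex.ofReal_pow]
    · simp [inner_self_eq_norm_sq_to_K, ← Complex.ofReal_pow]
  have hc : Continuous fun x => ‖Φ (flow B x h)‖ ^ 2 := by
    have := continuous_flow B h
    fun_prop
  have key : ∀ X, ∫ x in (0 : ℝ)..X, ‖Φ (flow B x h)‖ ^ 2 = ‖h‖ ^ 2 - ‖flow B X h‖ ^ 2 := by
    intro X
    have := intervalIntegral.integral_eq_sub_of_hasDerivAt (a := 0) (b := X) (fun x _ => hd x)
      (hc.neg.intervalIntegrable _ _)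
    rw [intervalIntegral.integral_neg, flow_zero] at this
    simp only [one_apply_eq_self] at this
    linarith
  constructor
  · intro X hX
    have h1 : 0 ≤ ∫ x in (0 : ℝ)..X, ‖Φ (flow B x h)‖ ^ 2 :=
      intervalIntegral.integral_nonneg hX fun x _ => sq_nonneg _
    rw [key] at h1
    exact le_of_sq_le_sq (by linarith) (norm_nonneg _)
  · intro X hX
    rw [key]
    linarith [sq_nonneg ‖flow B X h‖]

lemma subexpGrowth_of_dissipative {B : H →L[ℂ] H} {Φ : H →L[ℂ] E}
    (hB : B - B.adjoint = I • (Φ.adjoint ∘L Φ)) : SubexpGrowth B := by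
  refine fun ε hε => ⟨1, fun x hx => ?_⟩
  refine (ContinuousLinearMap.opNorm_le_bound _ zero_le_one fun h => ?_).trans
    (le_mul_of_one_le_right zero_le_one (Real.one_le_exp (by positivity)))
  rw [one_mul]
  exact (flow_of_dissipative hB h).1 x hx

/-- Weighted energy estimates yield growth estimates. -/
lemma subexpGrowth_of_weights {B : H →L[ℂ] H}
    (hw : ∀ ε : ℝ, 0 < ε → ∃ T T' : H →L[ℂ] H, (∀ y, T' (T y) = y) ∧
      ∀ y, (inner ℂ (T y) (I • T (B y))).re ≤ ε * ‖T y‖ ^ 2) : SubexpGrowth B := by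
  intro ε hε
  obtain ⟨T, T', hT, hTB⟩ := hw ε hε
  refine ⟨‖T'‖ * ‖T‖, fun x hx => ContinuousLinearMap.opNorm_le_bound _ (by positivity) fun h => ?_⟩
  -- The estimate is made in the norm ‖T y‖, in which the growth rate of the group is at most ε; the
  -- left inverse `T'` returns to the original norm.
  have hd : ∀ x, HasDerivAt (fun x => Real.exp (-2 * ε * x) * ‖T (flow B x h)‖ ^ 2)
      (Real.exp (-2 * ε * x) * (2 * (inner ℂ (T (flow B x h)) (I • T (B (flow B x h)))).re
        - 2 * ε * ‖T (flow B x h)‖ ^ 2)) x := by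
    intro x
    have h1 : HasDerivAt (fun x => T (flow B x h)) (I • T (B (flow B x h))) x := by
      have := (T.restrictScalars ℝ).hasFDerivAt.comp_hasDerivAt x (hasDerivAt_flow B h x)
      simpa [Function.comp_def] using this
    have h2 := Complex.reCLM.hasFDerivAt.comp_hasDerivAt x (h1.inner ℂ h1)
    have h3 : HasDerivAt (fun x => ‖T (flow B x h)‖ ^ 2)
        (2 * (inner ℂ (T (flow B x h)) (I • T (B (flow B x h)))).re) x := by
      convert! h2 using 1
      · ext y
        simp [inner_self_eq_norm_sq_to_K, ← Complex.ofReal_pow]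
      · rw [← inner_conj_symm (I • T (B (flow B x h)))]
        simp only [Complex.reCLM_apply, Complex.add_re, Complex.conj_re]
        ring
    have h4 : HasDerivAt (fun x => Real.exp (-2 * ε * x))
        (Real.exp (-2 * ε * x) * (-2 * ε)) x := by
      simpa using ((hasDerivAt_id x).const_mul (-2 * ε)).exp
    convert! h4.mul h3 using 1
    ring
  have hanti : Antitone fun x => Real.exp (-2 * ε * x) * ‖T (flow B x h)‖ ^ 2 := by
    refine antitone_of_hasDerivAt_nonpos hd fun x => ?_
    refine mul_nonpos_of_nonneg_of_nonpos (Real.exp_pos _).le ?_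
    nlinarith [hTB (flow B x h)]
  have h1 := hanti hx
  simp only [mul_zero, Real.exp_zero, one_mul, flow_zero, one_apply_eq_self] at h1
  have h2 : ‖T (flow B x h)‖ ≤ Real.exp (ε * x) * ‖T h‖ := by
    refine le_of_sq_le_sq ?_ (by positivity)
    calc ‖T (flow B x h)‖ ^ 2
        = Real.exp (2 * ε * x) * (Real.exp (-2 * ε * x) * ‖T (flow B x h)‖ ^ 2) := by
          rw [← mul_assoc, ← Real.exp_add]; ring_nf; simp
      _ ≤ Real.exp (2 * ε * x) * ‖T h‖ ^ 2 := by gcongr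
      _ = _ := by rw [mul_pow, ← Real.exp_nat_mul]; congr 2; push_cast; ring
  calc ‖flow B x h‖ = ‖T' (T (flow B x h))‖ := by rw [hT]
    _ ≤ ‖T'‖ * (Real.exp (ε * x) * (‖T‖ * ‖h‖)) := by
      refine (T'.le_opNorm _).trans ?_
      gcongr
      refine h2.trans ?_
      gcongr
      exact T.le_opNorm h
    _ = _ := by ring

/-- Perturbations `C` with `C B₀ⁿ C = 0` for all `n` preserve subexponential growth. -/
lemma SubexpGrowth.add_of_nilpotent {B₀ C : H →L[ℂ] H} (h₀ : SubexpGrowth B₀)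
    (hC : ∀ x h, C (flow B₀ x (C h)) = 0) : SubexpGrowth (B₀ + C) := by
  have hz : ∀ (s : ℝ) (h : H) (x : ℝ), HasDerivAt (fun x => flow B₀ (s - x) (flow (B₀ + C) x h))
      (flow B₀ (s - x) (I • C (flow (B₀ + C) x h))) x := by
    intro s h x
    have h1 := hasDerivAt_exp_smul_const' (𝕂 := ℝ) (I • B₀) (s - x)
    have h2 : (fun u : ℝ => NormedSpace.exp (u • (I • B₀))) = flow B₀ := by
      ext1 u
      unfold flow
      rw [mul_comm, ← smul_smul, Complex.coe_smul]
    have h3 : NormedSpace.exp ((s - x) • (I • B₀)) = flow B₀ (s - x) := congrFun h2 _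
    rw [h2, h3] at h1
    have h4 : HasDerivAt (fun x => flow B₀ (s - x)) (-((I • B₀) * flow B₀ (s - x))) x := by
      have := h1.scomp x ((hasDerivAt_id x).const_sub s)
      rw [neg_one_smul] at this
      exact this
    convert! h4.complexClm_apply (hasDerivAt_flow (B₀ + C) h x) using 1
    simp only [_root_.neg_apply, mul_apply_eq_comp,
      _root_.smul_apply, _root_.add_apply, smul_add, map_add,
      map_smul, flow_commute]
    abel
  -- After `C` is applied, the function that interpolates between the two groups has derivative
  -- zero, because `C` annihilates the orbit of the range of `C` under `B₀`. Hence the Duhamel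
  -- integrand involves the unperturbed group only.
  have hCy : ∀ (x : ℝ) (h : H), C (flow (B₀ + C) x h) = C (flow B₀ x h) := by
    intro x h
    have hd : ∀ y, HasDerivAt (fun y => C (flow B₀ (x - y) (flow (B₀ + C) y h))) 0 y := by
      intro y
      have := (C.restrictScalars ℝ).hasFDerivAt.comp_hasDerivAt y (hz x h y)
      simpa [Function.comp_def, hC] using this
    have h1 := is_const_of_deriv_eq_zero (fun y => (hd y).differentiableAt)
      (fun y => (hd y).deriv) x 0
    simpa [flow_zero] using h1
  intro ε hε
  obtain ⟨K, hK⟩ := h₀ (ε / 2) (half_pos hε)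
  have hK0 : 0 ≤ K := by
    have := hK 0 le_rfl
    simp only [mul_zero, Real.exp_zero, mul_one] at this
    exact (norm_nonneg _).trans this
  -- The Duhamel integrand is at most K² ‖C‖ e^{εx/2} ‖h‖ on an interval of length x, and the factor
  -- x is absorbed by x ≤ (2/ε) e^{εx/2}.
  refine ⟨K + K * ‖C‖ * K * (2 / ε), fun x hx =>
    ContinuousLinearMap.opNorm_le_bound _ (by positivity) fun h => ?_⟩
  have hb : ∀ y ∈ Set.Ico 0 x, ‖flow B₀ (x - y) (I • C (flow (B₀ + C) y h))‖ ≤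
      K * ‖C‖ * K * Real.exp (ε / 2 * x) * ‖h‖ := by
    intro y hy
    rw [map_smul, norm_smul, Complex.norm_I, one_mul, hCy]
    calc _ ≤ K * Real.exp (ε / 2 * (x - y)) * (‖C‖ * (K * Real.exp (ε / 2 * y) * ‖h‖)) := by
          refine ((flow B₀ (x - y)).le_opNorm _).trans ?_
          gcongr
          · exact hK _ (by linarith [hy.2])
          · refine (C.le_opNorm _).trans ?_
            gcongr
            refine ((flow B₀ y).le_opNorm _).trans ?_
            gcongr
            exact hK _ hy.1
      _ = K * ‖C‖ * K * (Real.exp (ε / 2 * (x - y)) * Real.exp (ε / 2 * y)) * ‖h‖ := by ring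
      _ = _ := by rw [← Real.exp_add]; congr 3; ring
  have h1 := norm_image_sub_le_of_norm_deriv_le_segment' (f := fun y =>
    flow B₀ (x - y) (flow (B₀ + C) y h)) (fun y _ => (hz x h y).hasDerivWithinAt) hb x
    (Set.right_mem_Icc.2 hx)
  simp only [sub_self, flow_zero, one_apply_eq_self, sub_zero] at h1
  have h2 : ‖flow B₀ x h‖ ≤ K * Real.exp (ε / 2 * x) * ‖h‖ :=
    ((flow B₀ x).le_opNorm _).trans (by gcongr; exact hK x hx)
  have h3 : Real.exp (ε / 2 * x) ≤ Real.exp (ε * x) := Real.exp_le_exp.2 (by nlinarith)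
  have h4 : Real.exp (ε / 2 * x) * x ≤ 2 / ε * Real.exp (ε * x) := by
    have h5 : ε / 2 * x ≤ Real.exp (ε / 2 * x) := by linarith [Real.add_one_le_exp (ε / 2 * x)]
    have h6 : Real.exp (ε * x) = Real.exp (ε / 2 * x) * Real.exp (ε / 2 * x) := by
      rw [← Real.exp_add]; congr 1; ring
    rw [h6, mul_left_comm]
    gcongr
    calc x = 2 / ε * (ε / 2 * x) := by field_simp
      _ ≤ _ := by gcongr
  calc ‖flow (B₀ + C) x h‖ ≤ ‖flow (B₀ + C) x h - flow B₀ x h‖ + ‖flow B₀ x h‖ := by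
        simpa using norm_add_le (flow (B₀ + C) x h - flow B₀ x h) (flow B₀ x h)
    _ ≤ K * ‖C‖ * K * (Real.exp (ε / 2 * x) * x) * ‖h‖ + K * Real.exp (ε / 2 * x) * ‖h‖ := by
        refine add_le_add (h1.trans (le_of_eq (by ring))) h2
    _ ≤ K * ‖C‖ * K * (2 / ε * Real.exp (ε * x)) * ‖h‖ + K * Real.exp (ε * x) * ‖h‖ := by
        gcongr
    _ = _ := by ring

/-! #### Existence of the limit of the energy -/

/-- Bounded observability of the flow of `B`, by comparison with a dissipative operator. -/
theorem exists_observability_bound {B D : H →L[ℂ] H} {Φ : H →L[ℂ] E} {K : E →L[ℂ] E}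
    (hB : SubexpGrowth B) (hBD : B = D + I • (Φ.adjoint ∘L K ∘L Φ))
    (hD : D - D.adjoint = I • (Φ.adjoint ∘L Φ))
    (hΘ : ∃ C : ℝ, ∀ τ ε : ℝ, 0 < ε → ∀ u e, B u - ((τ : ℂ) - I * ε) • u = Φ.adjoint e →
      ‖Φ u‖ ≤ C * ‖e‖) :
    ∃ C : ℝ, 0 ≤ C ∧ ∀ h, IntegrableOn (fun x => ‖Φ (flow B x h)‖ ^ 2) (Set.Ioi 0) ∧
      ∫ x in Set.Ioi (0 : ℝ), ‖Φ (flow B x h)‖ ^ 2 ≤ C * ‖h‖ ^ 2 := by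
  obtain ⟨C₀, hC₀⟩ := hΘ
  -- `M` bounds the factor in Φ (B - z)⁻¹ = (1 - i Θ K) Φ (D - z)⁻¹, where Θ = Φ (B - z)⁻¹ Φ* is the
  -- transfer function, bounded by `C₀`.
  set M : ℝ := 1 + |C₀| * ‖K‖ with hM
  have hDg := subexpGrowth_of_dissipative hD
  refine ⟨M ^ 2, sq_nonneg _, fun h => ?_⟩
  have hcB : Continuous fun x => ‖Φ (flow B x h)‖ ^ 2 := by
    have := continuous_flow B h
    fun_prop
  have hcD : Continuous fun x => ‖Φ (flow D x h)‖ ^ 2 := by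
    have := continuous_flow D h
    fun_prop
  have hDint : IntegrableOn (fun x => ‖Φ (flow D x h)‖ ^ 2) (Set.Ioi 0) := by
    refine integrableOn_Ioi_of_intervalIntegral_norm_bounded (‖h‖ ^ 2) 0
      (fun i : ℝ => (hcD.integrableOn_Icc.mono_set Set.Ioc_subset_Icc_self)) tendsto_id ?_
    filter_upwards [eventually_ge_atTop 0] with X hX
    simpa using (flow_of_dissipative hD h).2 X hX
  have hDle : ∫ x in Set.Ioi (0 : ℝ), ‖Φ (flow D x h)‖ ^ 2 ≤ ‖h‖ ^ 2 := by
    refine le_of_tendsto (intervalIntegral_tendsto_integral_Ioi 0 hDint tendsto_id) ?_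
    filter_upwards [eventually_ge_atTop 0] with X hX
    exact (flow_of_dissipative hD h).2 X hX
  have hw : ∀ ε : ℝ, 0 < ε → IntegrableOn (fun x : ℝ =>
      Real.exp (-2 * ε * x) * ‖Φ (flow B x h)‖ ^ 2) (Set.Ioi 0) ∧
      ∫ x in Set.Ioi (0 : ℝ), Real.exp (-2 * ε * x) * ‖Φ (flow B x h)‖ ^ 2 ≤ M ^ 2 * ‖h‖ ^ 2 := by
    intro ε hε
    choose u hu using fun τ => exists_resolvent hB hε τ h
    choose v hv using fun τ => exists_resolvent hDg hε τ h
    obtain ⟨iu, eu⟩ := plancherel_resolvent hB Φ hε hu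
    obtain ⟨iv, ev⟩ := plancherel_resolvent hDg Φ hε hv
    have hle : ∀ τ, ‖Φ (u τ)‖ ≤ M * ‖Φ (v τ)‖ := by
      intro τ
      have h1 : B (u τ - v τ) - ((τ : ℂ) - I * ε) • (u τ - v τ) =
          Φ.adjoint (-(I • K (Φ (v τ)))) := by
        have h2 : B (v τ) = D (v τ) + I • Φ.adjoint (K (Φ (v τ))) := by rw [hBD]; simp
        rw [map_neg, map_smul, map_sub, smul_sub, h2]
        calc _ = (B (u τ) - ((τ : ℂ) - I * ε) • u τ) - (D (v τ) - ((τ : ℂ) - I * ε) • v τ) -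
              I • Φ.adjoint (K (Φ (v τ))) := by abel
          _ = _ := by rw [hu, hv]; abel
      have h2 := hC₀ τ ε hε _ _ h1
      rw [norm_neg, norm_smul, Complex.norm_I, one_mul] at h2
      calc ‖Φ (u τ)‖ = ‖Φ (u τ - v τ) + Φ (v τ)‖ := by rw [map_sub, sub_add_cancel]
        _ ≤ |C₀| * (‖K‖ * ‖Φ (v τ)‖) + ‖Φ (v τ)‖ := by
          refine (norm_add_le _ _).trans (add_le_add_left (h2.trans ?_) _)
          gcongr
          · exact le_abs_self _
          · exact K.le_opNorm _
        _ = _ := by rw [hM]; ring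
    have h3 : ∫ τ, ‖Φ (u τ)‖ ^ 2 ≤ M ^ 2 * ∫ τ, ‖Φ (v τ)‖ ^ 2 := by
      rw [← integral_const_mul]
      refine integral_mono iu (iv.const_mul _) fun τ => ?_
      simp only
      rw [← mul_pow]
      exact pow_le_pow_left₀ (norm_nonneg _) (hle τ) 2
    obtain ⟨C, hC⟩ := hB.apply (half_pos hε) h
    have hi : IntegrableOn (fun x : ℝ => Real.exp (-2 * ε * x) * ‖Φ (flow B x h)‖ ^ 2)
        (Set.Ioi 0) := by
      refine integrableOn_exp_mul_sq (u := fun x => Φ (flow B x h)) (C := ‖Φ‖ * C)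
        (Φ.continuous.comp (continuous_flow B h)) (half_lt_self hε) fun x hx => ?_
      refine (Φ.le_opNorm _).trans ?_
      rw [mul_assoc]
      gcongr
      exact hC x hx
    refine ⟨hi, ?_⟩
    rw [eu, ev, mul_left_comm] at h3
    refine (le_of_mul_le_mul_left h3 (by positivity)).trans ?_
    gcongr
    refine le_trans ?_ hDle
    refine setIntegral_mono_on ?_ hDint measurableSet_Ioi fun x hx => ?_
    · refine integrableOn_exp_mul_sq (u := fun x => Φ (flow D x h)) (C := ‖Φ‖ * ‖h‖) (δ := 0)
        (Φ.continuous.comp (continuous_flow D h)) hε fun x hx => ?_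
      simp only [zero_mul, Real.exp_zero, mul_one]
      exact (Φ.le_opNorm _).trans (by gcongr; exact (flow_of_dissipative hD h).1 x hx)
    · refine mul_le_of_le_one_left (sq_nonneg _) (Real.exp_le_one_iff.2 ?_)
      have : 0 < x := hx
      nlinarith [mul_pos hε this]
  -- The weighted bound does not depend on ε, so on a bounded interval the weight is removed by
  -- letting ε tend to zero.
  have hX : ∀ X : ℝ, 0 ≤ X → ∫ x in (0 : ℝ)..X, ‖Φ (flow B x h)‖ ^ 2 ≤ M ^ 2 * ‖h‖ ^ 2 := by
    intro X hX
    have h1 : ∀ ε : ℝ, 0 < ε → ∫ x in (0 : ℝ)..X, ‖Φ (flow B x h)‖ ^ 2 ≤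
        Real.exp (2 * ε * X) * (M ^ 2 * ‖h‖ ^ 2) := by
      intro ε hε
      obtain ⟨hi, hle⟩ := hw ε hε
      calc ∫ x in (0 : ℝ)..X, ‖Φ (flow B x h)‖ ^ 2
          ≤ ∫ x in (0 : ℝ)..X, Real.exp (2 * ε * X) *
            (Real.exp (-2 * ε * x) * ‖Φ (flow B x h)‖ ^ 2) := by
            refine intervalIntegral.integral_mono_on hX (hcB.intervalIntegrable _ _)
              (Continuous.intervalIntegrable (by fun_prop) _ _) fun x hx => ?_
            rw [← mul_assoc, ← Real.exp_add]
            refine le_mul_of_one_le_left (sq_nonneg _) (Real.one_le_exp ?_)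
            nlinarith [hx.2]
        _ = Real.exp (2 * ε * X) * ∫ x in Set.Ioc 0 X,
            (Real.exp (-2 * ε * x) * ‖Φ (flow B x h)‖ ^ 2) := by
            rw [intervalIntegral.integral_const_mul, intervalIntegral.integral_of_le hX]
        _ ≤ _ := by
            gcongr
            refine le_trans (setIntegral_mono_set hi (Eventually.of_forall fun x => by positivity)
              Set.Ioc_subset_Ioi_self.eventuallyLE) hle
    have h2 : Tendsto (fun ε : ℝ => Real.exp (2 * ε * X) * (M ^ 2 * ‖h‖ ^ 2)) (𝓝[>] 0)
        (𝓝 (Real.exp (2 * 0 * X) * (M ^ 2 * ‖h‖ ^ 2))) :=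
      ((by fun_prop : Continuous fun ε : ℝ =>
        Real.exp (2 * ε * X) * (M ^ 2 * ‖h‖ ^ 2)).tendsto 0).mono_left nhdsWithin_le_nhds
    simp only [mul_zero, zero_mul, Real.exp_zero, one_mul] at h2
    refine ge_of_tendsto h2 ?_
    filter_upwards [self_mem_nhdsWithin] with ε hε using h1 ε hε
  have hint : IntegrableOn (fun x => ‖Φ (flow B x h)‖ ^ 2) (Set.Ioi 0) := by
    refine integrableOn_Ioi_of_intervalIntegral_norm_bounded (M ^ 2 * ‖h‖ ^ 2) 0
      (fun i : ℝ => (hcB.integrableOn_Icc.mono_set Set.Ioc_subset_Icc_self)) tendsto_id ?_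
    filter_upwards [eventually_ge_atTop 0] with X hX'
    simpa using hX X hX'
  refine ⟨hint, le_of_tendsto (intervalIntegral_tendsto_integral_Ioi 0 hint tendsto_id) ?_⟩
  filter_upwards [eventually_ge_atTop 0] with X hX' using hX X hX'

/-- If the observations are square integrable, the energy has a limit. -/
theorem tendsto_inner_flow {B : H →L[ℂ] H} {Φ : H →L[ℂ] E} {𝓛 : E →L[ℂ] E}
    (hB : B - B.adjoint = I • (Φ.adjoint ∘L 𝓛 ∘L Φ))
    (hΦ : ∀ h, IntegrableOn (fun x => ‖Φ (flow B x h)‖ ^ 2) (Set.Ioi 0)) (g h : H) :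
    IntegrableOn (fun x => inner ℂ (Φ (flow B x g)) (𝓛 (Φ (flow B x h)))) (Set.Ioi 0) ∧
      Tendsto (fun x => inner ℂ (flow B x g) (flow B x h)) atTop (𝓝 (inner ℂ g h -
        ∫ x in Set.Ioi (0 : ℝ), inner ℂ (Φ (flow B x g)) (𝓛 (Φ (flow B x h))))) := by
  have hcg := continuous_flow B g
  have hch := continuous_flow B h
  have hc : Continuous fun x => inner ℂ (Φ (flow B x g)) (𝓛 (Φ (flow B x h))) := by
    fun_prop
  have hi : IntegrableOn (fun x => inner ℂ (Φ (flow B x g)) (𝓛 (Φ (flow B x h)))) (Set.Ioi 0) := by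
    refine Integrable.mono' (((hΦ g).add (hΦ h)).const_mul ‖𝓛‖)
      hc.aestronglyMeasurable (Eventually.of_forall fun x => ?_)
    refine (norm_inner_le_norm _ _).trans ?_
    have h1 := 𝓛.le_opNorm (Φ (flow B x h))
    simp only [Pi.add_apply]
    calc _ ≤ ‖Φ (flow B x g)‖ * (‖𝓛‖ * ‖Φ (flow B x h)‖) := by gcongr
      _ = ‖𝓛‖ * (‖Φ (flow B x g)‖ * ‖Φ (flow B x h)‖) := by ring
      _ ≤ _ := by
        gcongr
        nlinarith [sq_nonneg (‖Φ (flow B x g)‖ - ‖Φ (flow B x h)‖),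
          sq_nonneg (‖Φ (flow B x g)‖), sq_nonneg (‖Φ (flow B x h)‖)]
  refine ⟨hi, ?_⟩
  have h1 := (intervalIntegral_tendsto_integral_Ioi 0 hi tendsto_id).const_sub (inner ℂ g h)
  refine h1.congr fun X => ?_
  have := intervalIntegral.integral_eq_sub_of_hasDerivAt (a := 0) (b := X)
    (fun x _ => hasDerivAt_inner_flow hB g h x) (hc.neg.intervalIntegrable _ _)
  rw [intervalIntegral.integral_neg, flow_zero] at this
  simp only [one_apply_eq_self] at this
  simp only [id]
  linear_combination this

/-- The limit of the energy is the limit of weighted square integrals of the resolvent. -/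
theorem tendsto_resolvent_mean {B : H →L[ℂ] H} (hB : SubexpGrowth B) {f : H} {l C : ℝ}
    (hb : ∀ x, 0 ≤ x → ‖flow B x f‖ ^ 2 ≤ C)
    (hl : Tendsto (fun x => ‖flow B x f‖ ^ 2) atTop (𝓝 l)) {u : ℝ → ℝ → H}
    (hu : ∀ ε τ : ℝ, 0 < ε → B (u ε τ) - ((τ : ℂ) - I * ε) • u ε τ = f) :
    Tendsto (fun ε : ℝ => ε / Real.pi * ∫ τ, ‖u ε τ‖ ^ 2) (𝓝[>] 0) (𝓝 l) := by
  have hc : Continuous fun x => ‖flow B x f‖ ^ 2 := by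
    have := continuous_flow B f
    fun_prop
  refine (tendsto_abel_mean hc (fun x hx => by rw [abs_of_nonneg (sq_nonneg _)]; exact hb x hx)
    hl).congr' ?_
  filter_upwards [self_mem_nhdsWithin] with ε hε
  have h1 := (plancherel_resolvent hB (ContinuousLinearMap.id ℂ H) hε
    (u := u ε) (f := f) fun τ => hu ε τ hε).2
  simp only [ContinuousLinearMap.id_apply] at h1
  rw [h1]
  field_simp

end Flow

/-! ### The structure of the model operator -/

lemma Integrable.star_apply {α : Type*} [MeasurableSpace α] {μ : Measure α} {f : α → ℂ}
    (hf : Integrable f μ) : Integrable (fun x => star (f x)) μ :=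
  hf.mono (continuous_star.comp_aestronglyMeasurable hf.1) (Eventually.of_forall fun x => by simp)

/-- Integration by parts for primitives of integrable functions. -/
lemma integral_primitive_mul_add {μ : Measure ℝ} [SFinite μ] [NullSingletonClass μ] {F G : ℝ → ℂ}
    (hF : Integrable F μ) (hG : Integrable G μ) :
    ∫ w, (∫ ξ in Set.Iic w, F ξ ∂μ) * G w ∂μ + ∫ w, F w * (∫ ξ in Set.Iic w, G ξ ∂μ) ∂μ =
      (∫ w, F w ∂μ) * ∫ w, G w ∂μ := by
  -- By Fubini's theorem the two terms are integrals of one product over two closed triangles. They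
  -- cover the plane, and they overlap in the diagonal, a null set for a measure without atoms.
  have hm : MeasurableSet {x : ℝ × ℝ | x.2 ≤ x.1} := measurableSet_le measurable_snd measurable_fst
  have hm' : MeasurableSet {x : ℝ × ℝ | x.1 ≤ x.2} := measurableSet_le measurable_fst measurable_snd
  have hP : Integrable (fun x : ℝ × ℝ => F x.2 * G x.1) (μ.prod μ) := by
    simpa [mul_comm] using hG.mul_prod hF
  have h1 : ∫ w, (∫ ξ in Set.Iic w, F ξ ∂μ) * G w ∂μ =
      ∫ x, {x : ℝ × ℝ | x.2 ≤ x.1}.indicator (fun x => F x.2 * G x.1) x ∂(μ.prod μ) := by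
    rw [integral_prod _ (hP.indicator hm)]
    refine integral_congr_ae (Eventually.of_forall fun w => ?_)
    simp only
    rw [← integral_mul_const, ← integral_indicator measurableSet_Iic]
    rfl
  have h2 : ∫ w, F w * (∫ ξ in Set.Iic w, G ξ ∂μ) ∂μ =
      ∫ x, {x : ℝ × ℝ | x.1 ≤ x.2}.indicator (fun x => F x.2 * G x.1) x ∂(μ.prod μ) := by
    rw [integral_prod_symm _ (hP.indicator hm')]
    refine integral_congr_ae (Eventually.of_forall fun w => ?_)
    simp only
    rw [← integral_const_mul, ← integral_indicator measurableSet_Iic]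
    rfl
  rw [h1, h2, ← integral_add (hP.indicator hm) (hP.indicator hm'), mul_comm, ← integral_prod_mul]
  refine integral_congr_ae ?_
  have hd : ∀ᵐ x ∂(μ.prod μ), x.1 ≠ x.2 := by
    refine (Measure.ae_prod_iff_ae_ae (p := fun x : ℝ × ℝ => x.1 ≠ x.2)
      (measurableSet_eq_fun measurable_fst measurable_snd).compl).2
      (Eventually.of_forall fun w => ?_)
    have : ∀ᵐ ξ ∂μ, ξ ≠ w := by simp [ae_iff]
    filter_upwards [this] with ξ hξ using hξ.symm
  filter_upwards [hd] with x hx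
  rcases lt_or_gt_of_ne hx with h | h
  · simp [Set.indicator, h.le, not_le.2 h, mul_comm]
  · simp [Set.indicator, h.le, not_le.2 h, mul_comm]

/-- Right multiplication of row vectors by a matrix. -/
def rowAct {n : Type*} [Fintype n] [DecidableEq n] (M : Matrix n n ℂ) :
    EuclideanSpace ℂ n →L[ℂ] EuclideanSpace ℂ n := Matrix.toEuclideanCLM (𝕜 := ℂ) Mᵀ

section RowAct

variable {n : Type*} [Fintype n] [DecidableEq n]

lemma rowAct_apply (M : Matrix n n ℂ) (x : EuclideanSpace ℂ n) :
    rowAct M x = WithLp.toLp 2 (x.ofLp ᵥ* M) := by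
  rw [← Matrix.mulVec_transpose]
  rfl

lemma adjoint_rowAct (M : Matrix n n ℂ) : (rowAct M).adjoint = rowAct Mᴴ := by
  unfold rowAct
  rw [← ContinuousLinearMap.star_eq_adjoint, ← map_star]
  rfl

lemma rowAct_add (M N : Matrix n n ℂ) : rowAct (M + N) = rowAct M + rowAct N := by
  simp [rowAct]

lemma rowAct_one : rowAct (1 : Matrix n n ℂ) = ContinuousLinearMap.id ℂ _ := by
  simp [rowAct]; rfl

end RowAct

namespace TriangularModel

variable {p r s : ℕ} (D : TriangularModel p r s)

lemma inner_row (x : Fin r ⊕ Fin s → ℂ) (w : ℝ) (g : EuclideanSpace ℂ (Fin p)) :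
    inner ℂ g (WithLp.toLp 2 (x ᵥ* (D.Pi w)ᴴ)) = x ⬝ᵥ star (g.ofLp ᵥ* D.Pi w) := by
  rw [EuclideanSpace.inner_eq_star_dotProduct, Matrix.star_vecMul, Matrix.dotProduct_mulVec]

lemma left_mem : D.a ∈ Set.Icc D.a D.b := ⟨le_rfl, D.a_lt_b.le⟩

lemma right_mem : D.b ∈ Set.Icc D.a D.b := ⟨D.a_lt_b.le, le_rfl⟩

lemma aestronglyMeasurable_row {c : ℝ → Fin r ⊕ Fin s → ℂ} (hc : AEStronglyMeasurable c D.μ) :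
    AEStronglyMeasurable
      (fun w => (WithLp.toLp 2 (c w ᵥ* (D.Pi w)ᴴ) : EuclideanSpace ℂ (Fin p))) D.μ := by
  refine (PiLp.continuous_toLp 2 _).comp_aestronglyMeasurable ?_
  refine (aemeasurable_pi_lambda _ fun i => ?_).aestronglyMeasurable
  simp only [Matrix.vecMul, dotProduct, Matrix.conjTranspose_apply]
  refine Finset.aemeasurable_fun_sum _ fun j _ => ?_
  exact ((aemeasurable_pi_iff.1 hc.aemeasurable) j).mul
    (continuous_star.comp_aestronglyMeasurable (D.measurable_Pi i j)).aemeasurable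

lemma memLp_row {c : ℝ → Fin r ⊕ Fin s → ℂ} (hc : AEStronglyMeasurable c D.μ) {C : ℝ}
    (hb : ∀ w ∈ Set.Icc D.a D.b, ‖c w‖ ≤ C) :
    MemLp (fun w => (WithLp.toLp 2 (c w ᵥ* (D.Pi w)ᴴ) : EuclideanSpace ℂ (Fin p))) 2 D.μ := by
  obtain ⟨A, hA, hA'⟩ := D.norm_toLp_vecMul_le 1
  refine MemLp.of_bound (D.aestronglyMeasurable_row hc) (A * C) ?_
  filter_upwards [ae_restrict_mem measurableSet_Icc] with w hw
  have := hA' w hw (c w)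
  rw [Matrix.one_mul] at this
  exact this.trans (by gcongr; exact hb w hw)

/-- The element `w ↦ c(w) Π*(w)` of `H`. -/
def row {c : ℝ → Fin r ⊕ Fin s → ℂ} (hc : ContinuousOn c (Set.Icc D.a D.b)) : D.H :=
  MemLp.toLp (fun w => (WithLp.toLp 2 (c w ᵥ* (D.Pi w)ᴴ) : EuclideanSpace ℂ (Fin p))) <| by
    obtain ⟨C, hC⟩ := isCompact_Icc.exists_bound_of_continuousOn hc
    exact D.memLp_row (hc.aestronglyMeasurable measurableSet_Icc) hC

lemma coeFn_row {c : ℝ → Fin r ⊕ Fin s → ℂ} (hc : ContinuousOn c (Set.Icc D.a D.b)) :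
    (D.row hc : ℝ → EuclideanSpace ℂ (Fin p)) =ᵐ[D.μ]
      fun w => WithLp.toLp 2 (c w ᵥ* (D.Pi w)ᴴ) := MemLp.coeFn_toLp _

lemma channelInt_apply (f : D.H) {c d : ℝ} (hc : c ∈ Set.Icc D.a D.b) (hd : d ∈ Set.Icc D.a D.b)
    (j : Fin r ⊕ Fin s) :
    D.channelInt f c d j =
      ∫ ξ in c..d, (((f : ℝ → EuclideanSpace ℂ (Fin p)) ξ).ofLp ᵥ* D.Pi ξ) j :=
  ((ContinuousLinearMap.proj (R := ℂ) (φ := fun _ : Fin r ⊕ Fin s => ℂ) j).intervalIntegral_comp_comm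
    (D.intervalIntegrable_vecMul f hc hd)).symm

lemma integrable_vecMul_apply (f : D.H) (j : Fin r ⊕ Fin s) :
    Integrable (fun ξ => (((f : ℝ → EuclideanSpace ℂ (Fin p)) ξ).ofLp ᵥ* D.Pi ξ) j) D.μ :=
  (ContinuousLinearMap.proj (R := ℂ) (φ := fun _ : Fin r ⊕ Fin s => ℂ) j).integrable_comp
    (D.integrable_vecMul f)

lemma Phi_apply (f : D.H) (j : Fin r ⊕ Fin s) :
    D.Phi f j = ∫ ξ, (((f : ℝ → EuclideanSpace ℂ (Fin p)) ξ).ofLp ᵥ* D.Pi ξ) j ∂D.μ := by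
  rw [integral_Icc_eq_integral_Ioc, ← intervalIntegral.integral_of_le D.a_lt_b.le]
  exact D.channelInt_apply f D.left_mem D.right_mem j

lemma channelInt_left_apply (f : D.H) {w : ℝ} (hw : w ∈ Set.Icc D.a D.b) (j : Fin r ⊕ Fin s) :
    D.channelInt f D.a w j =
      ∫ ξ in Set.Iic w, (((f : ℝ → EuclideanSpace ℂ (Fin p)) ξ).ofLp ᵥ* D.Pi ξ) j ∂D.μ := by
  rw [D.channelInt_apply f D.left_mem hw, intervalIntegral.integral_of_le hw.1,
    ← integral_Icc_eq_integral_Ioc, Measure.restrict_restrict measurableSet_Iic]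
  congr 2
  ext x
  simp only [Set.mem_Icc, Set.mem_inter_iff, Set.mem_Iic]
  constructor
  · rintro ⟨h1, h2⟩; exact ⟨h2, h1, h2.trans hw.2⟩
  · rintro ⟨h1, h2, h3⟩; exact ⟨h2, h1⟩

lemma continuousOn_channelInt (f : D.H) :
    ContinuousOn (fun w => D.channelInt f D.a w) (Set.Icc D.a D.b) := by
  have huIcc : Set.uIcc D.a D.b = Set.Icc D.a D.b := Set.uIcc_of_le D.a_lt_b.le
  have := intervalIntegral.continuousOn_primitive_interval'
    (D.intervalIntegrable_vecMul f D.left_mem D.right_mem) (a := D.a) (by rw [huIcc]; exact D.left_mem)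
  rw [huIcc] at this
  exact this

lemma adjoint_Phi (e : EuclideanSpace ℂ (Fin r ⊕ Fin s)) :
    D.Phi.adjoint e = D.row (c := fun _ => e.ofLp) continuousOn_const := by
  refine ext_inner_left ℂ fun f => ?_
  rw [ContinuousLinearMap.adjoint_inner_right, L2.inner_def,
    EuclideanSpace.inner_eq_star_dotProduct]
  have h1 : ∫ w, inner ℂ ((f : ℝ → EuclideanSpace ℂ (Fin p)) w)
      ((D.row (c := fun _ => e.ofLp) continuousOn_const : ℝ → EuclideanSpace ℂ (Fin p)) w) ∂D.μ =
      ∫ w, ∑ j, e j * star ((((f : ℝ → EuclideanSpace ℂ (Fin p)) w).ofLp ᵥ* D.Pi w) j) ∂D.μ := by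
    refine integral_congr_ae ?_
    filter_upwards [D.coeFn_row (c := fun _ => e.ofLp) continuousOn_const] with w hw
    rw [hw, inner_row]
    rfl
  rw [h1, integral_finsetSum]
  · refine Finset.sum_congr rfl fun j _ => ?_
    rw [integral_const_mul, Pi.star_apply, D.Phi_apply f j]
    congr 1
    exact (integral_conj (𝕜 := ℂ)).symm
  · intro j _
    exact (Integrable.star_apply (D.integrable_vecMul_apply f j)).const_mul _

/-- The matrix `J = J₁ - J₂`. -/
def J (_D : TriangularModel p r s) : Matrix (Fin r ⊕ Fin s) (Fin r ⊕ Fin s) ℂ :=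
  blockJ₁ r s - blockJ₂ r s

lemma J_eq_diagonal : D.J = Matrix.diagonal (Sum.elim (fun _ => 1) fun _ => -1) := by
  unfold J blockJ₁ blockJ₂
  ext (i | i) (j | j) <;> simp [Matrix.diagonal, Matrix.one_apply, apply_ite]

lemma L_eq : D.L = D.J + D.S + D.Sᴴ := rfl

/-- The model operator as a sum of a Volterra part and a part of finite rank. -/
lemma modelFun_eq (f : D.H) {w : ℝ} (hw : w ∈ Set.Icc D.a D.b) :
    D.modelFun f w = (w : ℂ) • (f : ℝ → EuclideanSpace ℂ (Fin p)) w +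
      Complex.I • WithLp.toLp 2
        ((D.channelInt f D.a w ᵥ* D.J + (D.Phi f).ofLp ᵥ* D.S) ᵥ* (D.Pi w)ᴴ) := by
  -- With the integral from `w` to `b` written as a difference, the terms with `S` and `S*` under
  -- the integral from `a` to `w` cancel those of `L`. What remains is `J` in the Volterra part and
  -- a finite rank term with `S`.
  have h1 : D.channelInt f w D.b = (D.Phi f).ofLp - D.channelInt f D.a w := by
    have : D.channelInt f D.a D.b - D.channelInt f D.a w = D.channelInt f w D.b :=
      intervalIntegral.integral_interval_sub_left
        (D.intervalIntegrable_vecMul f D.left_mem D.right_mem)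
        (D.intervalIntegrable_vecMul f D.left_mem hw)
    exact this.symm
  unfold modelFun
  rw [h1, L_eq]
  simp only [← Matrix.vecMul_vecMul, Matrix.vecMul_add, Matrix.add_vecMul, Matrix.sub_vecMul,
    WithLp.toLp_add, WithLp.toLp_sub, smul_add, smul_sub]
  abel

lemma inner_modelFun (f g : D.H) {w : ℝ} (hw : w ∈ Set.Icc D.a D.b) :
    inner ℂ ((g : ℝ → EuclideanSpace ℂ (Fin p)) w) (D.modelFun f w) =
      w * inner ℂ ((g : ℝ → EuclideanSpace ℂ (Fin p)) w) ((f : ℝ → EuclideanSpace ℂ (Fin p)) w) +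
      Complex.I * ((D.channelInt f D.a w ᵥ* D.J) ⬝ᵥ
          star (((g : ℝ → EuclideanSpace ℂ (Fin p)) w).ofLp ᵥ* D.Pi w) +
        ((D.Phi f).ofLp ᵥ* D.S) ⬝ᵥ
          star (((g : ℝ → EuclideanSpace ℂ (Fin p)) w).ofLp ᵥ* D.Pi w)) := by
  rw [D.modelFun_eq f hw, inner_add_right, inner_smul_right, inner_smul_right, inner_row,
    add_dotProduct]

/-- The non-selfadjoint part of the model operator. -/
lemma B_sub_adjoint :
    D.B - D.B.adjoint = Complex.I • (D.Phi.adjoint ∘L rowAct D.L ∘L D.Phi) := by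
  ext1 f
  refine ext_inner_left ℂ fun g => ?_
  simp only [_root_.sub_apply, _root_.smul_apply, ContinuousLinearMap.comp_apply]
  rw [inner_sub_right, ContinuousLinearMap.adjoint_inner_right, inner_smul_right,
    ContinuousLinearMap.adjoint_inner_right, rowAct_apply]
  set F : ℝ → Fin r ⊕ Fin s → ℂ :=
    fun w => ((f : ℝ → EuclideanSpace ℂ (Fin p)) w).ofLp ᵥ* D.Pi w with hF
  set G : ℝ → Fin r ⊕ Fin s → ℂ :=
    fun w => ((g : ℝ → EuclideanSpace ℂ (Fin p)) w).ofLp ᵥ* D.Pi w with hG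
  have hFi : ∀ j, Integrable (fun w => F w j) D.μ := D.integrable_vecMul_apply f
  have hGi : ∀ j, Integrable (fun w => G w j) D.μ := D.integrable_vecMul_apply g
  have hGs : ∀ j, Integrable (fun w => star (G w j)) D.μ := fun j => Integrable.star_apply (hGi j)
  set ε : Fin r ⊕ Fin s → ℂ := Sum.elim (fun _ => 1) fun _ => -1 with hε
  have hεs : ∀ j, star (ε j) = ε j := by rintro (j | j) <;> simp [hε]
  have hprim : ∀ (h : D.H) (j : Fin r ⊕ Fin s), AEStronglyMeasurable
      (fun w => D.channelInt h D.a w j) D.μ := fun h j =>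
    ((continuous_apply j).comp_continuousOn (D.continuousOn_channelInt h)).aestronglyMeasurable
      measurableSet_Icc
  have hbd : ∀ h : D.H, ∃ C, ∀ w ∈ Set.Icc D.a D.b, ∀ j, ‖D.channelInt h D.a w j‖ ≤ C := fun h => by
    obtain ⟨C, hC⟩ := isCompact_Icc.exists_bound_of_continuousOn (D.continuousOn_channelInt h)
    exact ⟨C, fun w hw j => (norm_le_pi_norm _ j).trans (hC w hw)⟩
  have hmul : ∀ (h : D.H) (j : Fin r ⊕ Fin s) (k : ℝ → ℂ), Integrable k D.μ →
      Integrable (fun w => D.channelInt h D.a w j * k w) D.μ := fun h j k hk => by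
    obtain ⟨C, hC⟩ := hbd h
    refine hk.bdd_mul (c := C) (hprim h j) ?_
    filter_upwards [ae_restrict_mem measurableSet_Icc] with w hw using hC w hw j
  have hw0 : Integrable (fun w : ℝ => (w : ℂ) * inner ℂ ((g : ℝ → EuclideanSpace ℂ (Fin p)) w)
      ((f : ℝ → EuclideanSpace ℂ (Fin p)) w)) D.μ := by
    obtain ⟨C, hC⟩ := isCompact_Icc.exists_bound_of_continuousOn
      (Complex.continuous_ofReal.continuousOn (s := Set.Icc D.a D.b))
    refine (L2.integrable_inner g f).bdd_mul (c := C)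
      Complex.continuous_ofReal.aestronglyMeasurable ?_
    filter_upwards [ae_restrict_mem measurableSet_Icc] with w hw using hC w hw
  have hdot : ∀ (c : Fin r ⊕ Fin s → ℂ) (K : ℝ → Fin r ⊕ Fin s → ℂ), (∀ j, Integrable
      (fun w => K w j) D.μ) → Integrable (fun w => c ⬝ᵥ star (K w)) D.μ ∧
      ∫ w, c ⬝ᵥ star (K w) ∂D.μ = c ⬝ᵥ star (fun j => ∫ w, K w j ∂D.μ) := by
    intro c K hK
    have h1 : ∀ j ∈ Finset.univ, Integrable (fun w => c j * star (K w j)) D.μ := fun j _ =>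
      (Integrable.star_apply (hK j)).const_mul _
    refine ⟨integrable_finsetSum _ h1, ?_⟩
    simp only [dotProduct, Pi.star_apply]
    rw [integral_finsetSum _ h1]
    refine Finset.sum_congr rfl fun j _ => ?_
    rw [integral_const_mul]
    congr 1
    exact integral_conj (𝕜 := ℂ)
  have hJ : ∀ x y : Fin r ⊕ Fin s → ℂ, (x ᵥ* D.J) ⬝ᵥ star y = ∑ j, ε j * (x j * star (y j)) := by
    intro x y
    rw [J_eq_diagonal]
    simp only [dotProduct, Matrix.vecMul_diagonal, Pi.star_apply]
    exact Finset.sum_congr rfl fun j _ => by ring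
  have hJi : ∀ (h : D.H) (K : ℝ → Fin r ⊕ Fin s → ℂ), (∀ j, Integrable
      (fun w => K w j) D.μ) →
      Integrable (fun w => (D.channelInt h D.a w ᵥ* D.J) ⬝ᵥ star (K w)) D.μ ∧
      ∫ w, (D.channelInt h D.a w ᵥ* D.J) ⬝ᵥ star (K w) ∂D.μ =
        ∑ j, ε j * ∫ w, D.channelInt h D.a w j * star (K w j) ∂D.μ := by
    intro h K hK
    have h1 : ∀ j ∈ Finset.univ, Integrable
        (fun w => ε j * (D.channelInt h D.a w j * star (K w j))) D.μ := fun j _ =>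
      (hmul h j _ (Integrable.star_apply (hK j))).const_mul _
    simp only [hJ]
    refine ⟨integrable_finsetSum _ h1, ?_⟩
    rw [integral_finsetSum _ h1]
    exact Finset.sum_congr rfl fun j _ => integral_const_mul _ _
  have hPhi : ∀ h : D.H, (fun j => ∫ w, (((h : ℝ → EuclideanSpace ℂ (Fin p)) w).ofLp ᵥ* D.Pi w) j
      ∂D.μ) = (D.Phi h).ofLp := fun h => by ext j; exact (D.Phi_apply h j).symm
  have key : ∀ (f g : D.H), Integrable (fun w : ℝ => (w : ℂ) *
        inner ℂ ((g : ℝ → EuclideanSpace ℂ (Fin p)) w)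
          ((f : ℝ → EuclideanSpace ℂ (Fin p)) w)) D.μ → inner ℂ g (D.B f) =
      ∫ w, (w : ℂ) * inner ℂ ((g : ℝ → EuclideanSpace ℂ (Fin p)) w)
        ((f : ℝ → EuclideanSpace ℂ (Fin p)) w) ∂D.μ + Complex.I *
        (∑ j, ε j * ∫ w, D.channelInt f D.a w j *
          star ((((g : ℝ → EuclideanSpace ℂ (Fin p)) w).ofLp ᵥ* D.Pi w) j) ∂D.μ +
          ((D.Phi f).ofLp ᵥ* D.S) ⬝ᵥ star (D.Phi g).ofLp) := by
    intro f g hfg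
    obtain ⟨i1, e1⟩ := hJi f _ (D.integrable_vecMul_apply g)
    obtain ⟨i2, e2⟩ := hdot ((D.Phi f).ofLp ᵥ* D.S) _ (D.integrable_vecMul_apply g)
    rw [hPhi] at e2
    have i12 := i1.add i2
    simp only [Pi.add_def] at i12
    rw [← e1, ← e2, ← integral_add i1 i2, ← integral_const_mul,
      ← integral_add hfg (i12.const_mul _), L2.inner_def]
    refine integral_congr_ae ?_
    filter_upwards [D.B_apply f, ae_restrict_mem measurableSet_Icc] with w hw hw'
    rw [hw, D.inner_modelFun f g hw']
  have hw1 : Integrable (fun w : ℝ => (w : ℂ) * inner ℂ ((f : ℝ → EuclideanSpace ℂ (Fin p)) w)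
      ((g : ℝ → EuclideanSpace ℂ (Fin p)) w)) D.μ := by
    refine (Integrable.star_apply hw0).congr (Eventually.of_forall fun w => ?_)
    simp only
    rw [star_mul', ← inner_conj_symm (𝕜 := ℂ) ((f : ℝ → EuclideanSpace ℂ (Fin p)) w)]
    simp
  have k1 := key f g hw0
  have k2 := key g f hw1
  have k3 : inner ℂ (D.B g) f = (starRingEnd ℂ) (inner ℂ f (D.B g)) := (inner_conj_symm _ _).symm
  rw [k3, k2, k1]
  simp only [map_add, map_mul, Complex.conj_I, map_sum]
  have c1 : (starRingEnd ℂ) (∫ w : ℝ, (w : ℂ) * inner ℂ ((f : ℝ → EuclideanSpace ℂ (Fin p)) w)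
      ((g : ℝ → EuclideanSpace ℂ (Fin p)) w) ∂D.μ) =
      ∫ w : ℝ, (w : ℂ) * inner ℂ ((g : ℝ → EuclideanSpace ℂ (Fin p)) w)
      ((f : ℝ → EuclideanSpace ℂ (Fin p)) w) ∂D.μ := by
    rw [← integral_conj]
    refine integral_congr_ae (Eventually.of_forall fun w => ?_)
    simp only [map_mul, Complex.conj_ofReal, inner_conj_symm]
  have c2 : ∀ j, (starRingEnd ℂ) (∫ w, D.channelInt g D.a w j * star (F w j) ∂D.μ) =
      ∫ w, F w j * (∫ ξ in Set.Iic w, star (G ξ j) ∂D.μ) ∂D.μ := by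
    intro j
    rw [← integral_conj]
    refine integral_congr_ae ?_
    filter_upwards [ae_restrict_mem measurableSet_Icc] with w hw
    rw [D.channelInt_left_apply g hw, map_mul, ← integral_conj, mul_comm]
    simp [hF, hG]
  have c3 : ∀ j, (∫ w, D.channelInt f D.a w j * star (G w j) ∂D.μ) =
      ∫ w, (∫ ξ in Set.Iic w, F ξ j ∂D.μ) * star (G w j) ∂D.μ := by
    intro j
    refine integral_congr_ae ?_
    filter_upwards [ae_restrict_mem measurableSet_Icc] with w hw
    rw [D.channelInt_left_apply f hw]
  -- The Volterra part and its adjoint add up, by integration by parts, to a product of channel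
  -- values; with the signs `ε j` this is the `J` part of `L`. The parts `S` and `S*` come from the
  -- finite rank term and its adjoint.
  have c4 : ∀ j, (∫ w, D.channelInt f D.a w j * star (G w j) ∂D.μ) +
      (starRingEnd ℂ) (∫ w, D.channelInt g D.a w j * star (F w j) ∂D.μ) =
      D.Phi f j * star (D.Phi g j) := by
    intro j
    rw [c2, c3, integral_primitive_mul_add (hFi j) (hGs j), D.Phi_apply f, D.Phi_apply g]
    congr 1
    exact integral_conj (𝕜 := ℂ)
  have c5 : (starRingEnd ℂ) (((D.Phi g).ofLp ᵥ* D.S) ⬝ᵥ star (D.Phi f).ofLp) =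
      ((D.Phi f).ofLp ᵥ* D.Sᴴ) ⬝ᵥ star (D.Phi g).ofLp := by
    rw [starRingEnd_apply, ← Matrix.dotProduct_star, Matrix.star_vecMul, Matrix.dotProduct_mulVec]
  rw [c1, c5]
  have c6 : inner ℂ (D.Phi g) (WithLp.toLp 2 ((D.Phi f).ofLp ᵥ* D.L)) =
      (∑ j, ε j * ∫ w, D.channelInt f D.a w j * star (G w j) ∂D.μ) +
      (∑ j, (starRingEnd ℂ) (ε j) *
        (starRingEnd ℂ) (∫ w, D.channelInt g D.a w j * star (F w j) ∂D.μ)) +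
      ((D.Phi f).ofLp ᵥ* D.S) ⬝ᵥ star (D.Phi g).ofLp +
      ((D.Phi f).ofLp ᵥ* D.Sᴴ) ⬝ᵥ star (D.Phi g).ofLp := by
    rw [EuclideanSpace.inner_eq_star_dotProduct, L_eq, Matrix.vecMul_add, Matrix.vecMul_add,
      add_dotProduct, add_dotProduct, hJ, ← Finset.sum_add_distrib]
    congr 2
    refine Finset.sum_congr rfl fun j _ => ?_
    rw [← c4, starRingEnd_apply (ε j), hεs, mul_add]
  rw [c6]
  ring

end TriangularModel

/-! ### Growth of the group generated by the model operator -/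

namespace TriangularModel

open Complex (I)

variable {p r s : ℕ} (D : TriangularModel p r s)

/-- The Volterra part of the model operator. -/
def volterra : D.H →L[ℂ] D.H := D.B - I • (D.Phi.adjoint ∘L rowAct D.S ∘L D.Phi)

lemma B_eq : D.B = D.volterra + I • (D.Phi.adjoint ∘L rowAct D.S ∘L D.Phi) := by
  simp [volterra]

lemma volterra_apply (f : D.H) : (D.volterra f : ℝ → EuclideanSpace ℂ (Fin p)) =ᵐ[D.μ]
    fun w => (w : ℂ) • (f : ℝ → EuclideanSpace ℂ (Fin p)) w +
      I • WithLp.toLp 2 (D.channelInt f D.a w ᵥ* (D.J * (D.Pi w)ᴴ)) := by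
  have h0 : D.volterra f = D.B f - I • D.Phi.adjoint (rowAct D.S (D.Phi f)) := rfl
  rw [h0, adjoint_Phi]
  set R := D.row (c := fun _ => (rowAct D.S (D.Phi f)).ofLp) continuousOn_const with hR
  filter_upwards [Lp.coeFn_sub (D.B f) (I • R), Lp.coeFn_smul I R, D.B_apply f,
    D.coeFn_row (c := fun _ => (rowAct D.S (D.Phi f)).ofLp) continuousOn_const,
    ae_restrict_mem measurableSet_Icc] with w h1 h2 h3 h4 h5
  rw [h1, Pi.sub_apply, h2, Pi.smul_apply, h3, h4, D.modelFun_eq f h5, rowAct_apply]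
  simp only [Matrix.add_vecMul, WithLp.toLp_add, smul_add, Matrix.vecMul_vecMul]
  abel

/-- Multiplication by `e^{-κw}`. -/
def weight (κ : ℝ) : D.H →L[ℂ] D.H :=
  (ContinuousLinearMap.lsmul ℂ ℂ : ℂ →L[ℂ] EuclideanSpace ℂ (Fin p) →L[ℂ] _).holderL
    D.μ ⊤ 2 2 (MemLp.toLp (fun w : ℝ => (Real.exp (-κ * w) : ℂ)) (by
      refine memLp_top_of_bound (C := Real.exp (|κ| * (|D.a| + |D.b|)))
        (by fun_prop : Continuous fun w : ℝ => (Real.exp (-κ * w) : ℂ)).aestronglyMeasurable ?_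
      filter_upwards [ae_restrict_mem measurableSet_Icc] with w hw
      rw [Complex.norm_real, Real.norm_eq_abs, Real.abs_exp, Real.exp_le_exp]
      refine (le_abs_self _).trans ?_
      rw [abs_mul, abs_neg]
      gcongr
      exact (abs_le_max_abs_abs hw.1 hw.2).trans
        (max_le (le_add_of_nonneg_right (abs_nonneg _)) (le_add_of_nonneg_left (abs_nonneg _)))))

lemma weight_apply (κ : ℝ) (f : D.H) : (D.weight κ f : ℝ → EuclideanSpace ℂ (Fin p)) =ᵐ[D.μ]
    fun w => (Real.exp (-κ * w) : ℂ) • (f : ℝ → EuclideanSpace ℂ (Fin p)) w := by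
  unfold weight
  refine ((ContinuousLinearMap.lsmul ℂ ℂ : ℂ →L[ℂ] EuclideanSpace ℂ (Fin p) →L[ℂ] _).coeFn_holder
    (r := 2) _ f).trans ?_
  filter_upwards [MemLp.coeFn_toLp (μ := D.μ) (p := ⊤)
    (f := fun w : ℝ => (Real.exp (-κ * w) : ℂ)) _] with w hw
  rw [hw]
  rfl

lemma weight_neg_weight (κ : ℝ) (f : D.H) : D.weight (-κ) (D.weight κ f) = f := by
  refine Lp.ext ?_
  filter_upwards [D.weight_apply (-κ) (D.weight κ f), D.weight_apply κ f] with w h1 h2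
  rw [h1, h2, smul_smul, ← Complex.ofReal_mul, ← Real.exp_add]
  simp

/-- Conjugation by the weight turns the primitive into an integral with kernel e^{-κ(w - ξ)}, ξ ≤ w.
The square of this kernel has integral at most 1/(2κ), and the Cauchy–Schwarz inequality applies. -/
lemma weighted_channelInt_le {κ : ℝ} (hκ : 0 < κ) (f : D.H) {w : ℝ} (hw : w ∈ Set.Icc D.a D.b) :
    Real.exp (-κ * w) * ‖D.channelInt f D.a w‖ ≤ p * ((1 / (2 * κ)) ^ ((1 : ℝ) / 2) *
      ‖D.weight κ f‖) := by
  have hsub : Set.Ioc D.a w ⊆ Set.Icc D.a D.b := fun x hx => ⟨hx.1.le, hx.2.trans hw.2⟩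
  set T := D.weight κ f with hT
  set n : ℝ → ℝ := fun ξ => ‖(T : ℝ → EuclideanSpace ℂ (Fin p)) ξ‖ with hn
  have hTm : MemLp n 2 (volume.restrict (Set.Ioc D.a w)) :=
    (Lp.memLp T).norm.mono_measure (Measure.restrict_mono hsub le_rfl)
  have hem : MemLp (fun ξ => Real.exp (-κ * (w - ξ))) 2 (volume.restrict (Set.Ioc D.a w)) := by
    refine MemLp.of_bound (C := 1)
      (by fun_prop : Continuous fun ξ => Real.exp (-κ * (w - ξ))).aestronglyMeasurable ?_
    filter_upwards [ae_restrict_mem measurableSet_Ioc] with ξ hξ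
    rw [Real.norm_eq_abs, Real.abs_exp, Real.exp_le_one_iff]
    nlinarith [hξ.2]
  have hae : ∀ᵐ ξ ∂(volume.restrict (Set.Ioc D.a w)), n ξ =
      Real.exp (-κ * ξ) * ‖(f : ℝ → EuclideanSpace ℂ (Fin p)) ξ‖ := by
    have := ae_mono (Measure.restrict_mono hsub le_rfl) (D.weight_apply κ f)
    filter_upwards [this] with ξ hξ
    rw [hn]
    simp only
    rw [hT, hξ, norm_smul, Complex.norm_real, Real.norm_eq_abs, Real.abs_exp]
  have h1 : Real.exp (-κ * w) * ‖D.channelInt f D.a w‖ ≤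
      p * ∫ ξ in Set.Ioc D.a w, Real.exp (-κ * (w - ξ)) * n ξ := by
    have h2 : ‖D.channelInt f D.a w‖ ≤
        ∫ ξ in Set.Ioc D.a w, ‖((f : ℝ → EuclideanSpace ℂ (Fin p)) ξ).ofLp ᵥ* D.Pi ξ‖ := by
      rw [← intervalIntegral.integral_of_le hw.1]
      exact intervalIntegral.norm_integral_le_integral_norm hw.1
    refine (mul_le_mul_of_nonneg_left h2 (Real.exp_pos _).le).trans ?_
    rw [← integral_const_mul, ← integral_const_mul]
    refine integral_mono_ae (((D.integrable_vecMul f).norm.mono_measure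
      (Measure.restrict_mono hsub le_rfl)).const_mul _)
      ((hem.integrable_mul hTm).const_mul _) ?_
    filter_upwards [hae, ae_restrict_mem measurableSet_Ioc] with ξ hξ hξ'
    rw [hξ]
    calc _ ≤ Real.exp (-κ * w) * (p * ‖(f : ℝ → EuclideanSpace ℂ (Fin p)) ξ‖) := by
          gcongr; exact D.norm_vecMul_Pi_le (hsub hξ') _
      _ = p * ((Real.exp (-κ * (w - ξ)) * Real.exp (-κ * ξ)) *
          ‖(f : ℝ → EuclideanSpace ℂ (Fin p)) ξ‖) := by
        rw [← Real.exp_add]; ring_nf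
      _ = _ := by ring
  refine h1.trans ?_
  gcongr
  have h3 := integral_mul_le_Lp_mul_Lq_of_nonneg (μ := volume.restrict (Set.Ioc D.a w))
    (p := 2) (q := 2) (f := fun ξ => Real.exp (-κ * (w - ξ))) (g := n)
    (by constructor <;> norm_num) (Eventually.of_forall fun _ => (Real.exp_pos _).le)
    (Eventually.of_forall fun _ => norm_nonneg _) (by simpa using hem) (by simpa using hTm)
  refine h3.trans ?_
  have e1 : ∫ ξ in Set.Ioc D.a w, Real.exp (-κ * (w - ξ)) ^ (2 : ℝ) ≤ 1 / (2 * κ) := by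
    have e2 : ∀ ξ : ℝ, Real.exp (-κ * (w - ξ)) ^ (2 : ℝ) =
        Real.exp (-2 * κ * w) * Real.exp ((2 * κ) * ξ) := fun ξ => by
      rw [Real.rpow_two, ← Real.exp_nat_mul, ← Real.exp_add]
      congr 1; push_cast; ring
    simp only [e2]
    rw [← intervalIntegral.integral_of_le hw.1, intervalIntegral.integral_const_mul,
      intervalIntegral.integral_comp_mul_left (fun x => Real.exp x) (by positivity), integral_exp,
      smul_eq_mul]
    have e3 : Real.exp (-2 * κ * w) * Real.exp (2 * κ * w) = 1 := by
      rw [← Real.exp_add]; ring_nf; simp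
    rw [mul_left_comm, mul_sub, e3, one_div]
    refine mul_le_of_le_one_right (by positivity) ?_
    linarith [mul_pos (Real.exp_pos (-2 * κ * w)) (Real.exp_pos (2 * κ * D.a))]
  have e4 : ∫ ξ in Set.Ioc D.a w, n ξ ^ (2 : ℝ) ≤ ‖T‖ ^ 2 := by
    rw [← L2_integral_norm_sq T]
    simp only [Real.rpow_two]
    exact setIntegral_mono_set ((Lp.memLp T).integrable_norm_pow (by norm_num))
      (Eventually.of_forall fun _ => sq_nonneg _) hsub.eventuallyLE
  gcongr
  calc _ ≤ (‖T‖ ^ 2) ^ ((1 : ℝ) / 2) := by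
        refine Real.rpow_le_rpow (integral_nonneg fun _ => by positivity) e4 (by norm_num)
    _ = ‖T‖ := by
        rw [← Real.sqrt_eq_rpow, Real.sqrt_sq (norm_nonneg _)]

/-- Multiplication by the real variable `w` contributes nothing to the energy. After conjugation
with e^{-κw} the integral part has norm of order κ^(-1/2), which is below ε for large κ. -/
lemma subexpGrowth_volterra : SubexpGrowth D.volterra := by
  refine subexpGrowth_of_weights fun ε hε => ?_
  obtain ⟨A, hA, hA'⟩ := D.norm_toLp_vecMul_le D.J
  set c : ℝ := D.μ.real Set.univ ^ ((1 : ℝ) / 2) with hc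
  have hc0 : 0 ≤ c := by positivity
  set M : ℝ := A * p * c with hM
  have hM0 : 0 ≤ M := by positivity
  have hlim : ∃ κ : ℝ, 0 < κ ∧ M * (1 / (2 * κ)) ^ ((1 : ℝ) / 2) ≤ ε := by
    -- This κ makes √(1/(2κ)) equal to ε/(M + 1).
    refine ⟨((M + 1) / ε) ^ 2 / 2, by positivity, ?_⟩
    rw [← Real.sqrt_eq_rpow, mul_div_cancel₀ _ (two_ne_zero), Real.sqrt_div zero_le_one,
      Real.sqrt_one, Real.sqrt_sq (by positivity), one_div_div, mul_div_assoc',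
      div_le_iff₀ (by positivity)]
    nlinarith
  obtain ⟨κ, hκ, hκε⟩ := hlim
  refine ⟨D.weight κ, D.weight (-κ), D.weight_neg_weight κ, fun y => ?_⟩
  set T := D.weight κ y with hT
  obtain ⟨_, rfl, hL1⟩ := D.integral_norm_le T
  rw [← hc] at hL1
  rw [L2.inner_def, ← RCLike.re_eq_complex_re, ← integral_re (L2.integrable_inner _ _)]
  set κ' : ℝ := (1 / (2 * κ)) ^ ((1 : ℝ) / 2) with hκ'
  have hκ0 : 0 ≤ κ' := by positivity
  calc _ ≤ ∫ w, (A * (p * (κ' * ‖T‖))) * ‖(T : ℝ → EuclideanSpace ℂ (Fin p)) w‖ ∂D.μ := by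
        refine integral_mono_ae (L2.integrable_inner _ _).re
          ((D.integrable_Lp T).norm.const_mul _) ?_
        filter_upwards [Lp.coeFn_smul I (D.weight κ (D.volterra y)), D.weight_apply κ y,
          D.weight_apply κ (D.volterra y), D.volterra_apply y,
          ae_restrict_mem measurableSet_Icc] with w h1 h2 h3 h4 h5
        rw [h1, Pi.smul_apply, h3, h4]
        have e1 : (Real.exp (-κ * w) : ℂ) • (w : ℂ) • (y : ℝ → EuclideanSpace ℂ (Fin p)) w =
            (w : ℂ) • (T : ℝ → EuclideanSpace ℂ (Fin p)) w := by rw [hT, h2, smul_comm]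
        rw [smul_add, e1, smul_add, inner_add_right, inner_smul_right, inner_smul_right,
          inner_self_eq_norm_sq_to_K, map_add]
        have e2 : RCLike.re (I * ((w : ℂ) *
            ((‖(T : ℝ → EuclideanSpace ℂ (Fin p)) w‖ : ℂ)) ^ 2)) = 0 := by
          have : ∀ w n : ℝ, (I * ((w : ℂ) * (n : ℂ) ^ 2)).re = 0 := fun w n => by
            rw [Complex.I_mul_re, neg_eq_zero, ← Complex.ofReal_pow, ← Complex.ofReal_mul,
              Complex.ofReal_im]
          exact this _ _
        refine (add_le_add_left (le_of_eq e2) _).trans ?_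
        rw [zero_add]
        refine (RCLike.re_le_norm _).trans ((norm_inner_le_norm _ _).trans ?_)
        rw [mul_comm]
        gcongr
        rw [norm_smul, norm_smul, norm_smul, Complex.norm_I, one_mul, one_mul, Complex.norm_real,
          Real.norm_eq_abs, Real.abs_exp]
        calc _ ≤ Real.exp (-κ * w) * (A * ‖D.channelInt y D.a w‖) := by
              gcongr; exact hA' w h5 _
          _ = A * (Real.exp (-κ * w) * ‖D.channelInt y D.a w‖) := by ring
          _ ≤ _ := mul_le_mul_of_nonneg_left (D.weighted_channelInt_le hκ y h5) hA
    _ = (A * (p * (κ' * ‖T‖))) * ∫ w, ‖(T : ℝ → EuclideanSpace ℂ (Fin p)) w‖ ∂D.μ :=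
        integral_const_mul _ _
    _ ≤ (A * (p * (κ' * ‖T‖))) * (c * ‖T‖) := by gcongr
    _ = M * κ' * ‖T‖ ^ 2 := by rw [hM]; ring
    _ ≤ _ := by gcongr

end TriangularModel

/-- Linear observations that vanish on all powers vanish on the flow. -/
lemma apply_flow_eq_zero {H F : Type*} [NormedAddCommGroup H] [InnerProductSpace ℂ H]
    [CompleteSpace H] [NormedAddCommGroup F] [NormedSpace ℂ F] {B : H →L[ℂ] H} {A : H →L[ℂ] F}
    {h : H} (hA : ∀ n : ℕ, A ((B ^ n) h) = 0) (x : ℝ) : A (flow B x h) = 0 := by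
  let : NormedAlgebra ℚ (H →L[ℂ] H) := NormedAlgebra.restrictScalars ℚ ℂ _
  have h1 := NormedSpace.exp_series_hasSum_exp' (𝕂 := ℂ) ((Complex.I * (x : ℂ)) • B)
  have h2 := ((A ∘L ContinuousLinearMap.apply ℂ H h).hasSum h1)
  refine h2.unique ?_
  convert! hasSum_zero with n
  change A (((n.factorial : ℂ)⁻¹ • ((Complex.I * (x : ℂ)) • B) ^ n) h) = 0
  rw [smul_pow, _root_.smul_apply, _root_.smul_apply, map_smul, map_smul, hA, smul_zero, smul_zero]

/-! ### The finite rank part of the model is nilpotent relative to the Volterra part -/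

namespace TriangularModel

open Complex (I)

variable {p r s : ℕ} (D : TriangularModel p r s)

lemma S_eq : D.S = blockJ₂ r s * D.S ∧ D.S = D.S * blockJ₁ r s := by
  constructor <;> simp [S, blockJ₁, blockJ₂, Matrix.fromBlocks_multiply]

lemma S_mul_J₂ : D.S * blockJ₂ r s = 0 := by
  simp [S, blockJ₂, Matrix.fromBlocks_multiply]

lemma J₁_mul_S : blockJ₁ r s * D.S = 0 := by
  simp [S, blockJ₁, Matrix.fromBlocks_multiply]

lemma S_mul_S : D.S * D.S = 0 := by
  simp [S, Matrix.fromBlocks_multiply]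

lemma J_mul_S : D.J * D.S = -D.S := by
  simp [S, J, blockJ₁, blockJ₂, Matrix.fromBlocks_multiply, sub_mul]

lemma blockJ_add (r s : ℕ) : blockJ₁ r s + blockJ₂ r s = 1 := by
  simp [blockJ₁, blockJ₂, Matrix.fromBlocks_add]

lemma blockJ₁_mul_self (r s : ℕ) : blockJ₁ r s * blockJ₁ r s = blockJ₁ r s := by
  simp [blockJ₁, Matrix.fromBlocks_multiply]

lemma blockJ₂_mul_self (r s : ℕ) : blockJ₂ r s * blockJ₂ r s = blockJ₂ r s := by
  simp [blockJ₂, Matrix.fromBlocks_multiply]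

lemma blockJ₁_mul_blockJ₂ (r s : ℕ) : blockJ₁ r s * blockJ₂ r s = 0 := by
  simp [blockJ₁, blockJ₂, Matrix.fromBlocks_multiply]

lemma blockJ₂_mul_blockJ₁ (r s : ℕ) : blockJ₂ r s * blockJ₁ r s = 0 := by
  simp [blockJ₁, blockJ₂, Matrix.fromBlocks_multiply]

lemma commute_PiSq_J₁ {w : ℝ} (hw : w ∈ Set.Icc D.a D.b) : Commute (D.PiSq w) (blockJ₁ r s) :=
  D.commute_J₁ w hw

lemma commute_PiSq_J₂ {w : ℝ} (hw : w ∈ Set.Icc D.a D.b) : Commute (D.PiSq w) (blockJ₂ r s) := by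
  have h : blockJ₂ r s = 1 - blockJ₁ r s := by rw [← blockJ_add r s]; abel
  rw [h]
  exact (Commute.one_right _).sub_right (D.commute_PiSq_J₁ hw)

/-- The elements of `H` that are supported in the first block. -/
def IsFirst (f : D.H) : Prop :=
  ∀ᵐ w ∂D.μ, ((f : ℝ → EuclideanSpace ℂ (Fin p)) w).ofLp ᵥ* D.Pi w ᵥ* blockJ₂ r s = 0

lemma channelInt_vecMul_J₂ {f : D.H} (hf : D.IsFirst f) {w : ℝ} (hw : w ∈ Set.Icc D.a D.b) :
    D.channelInt f D.a w ᵥ* blockJ₂ r s = 0 := by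
  have h1 := (Matrix.vecMulLinear (blockJ₂ r s)).toContinuousLinearMap.intervalIntegral_comp_comm
    (D.intervalIntegrable_vecMul f D.left_mem hw)
  refine h1.symm.trans (intervalIntegral.integral_zero_ae ?_)
  have h2 := (ae_restrict_iff' measurableSet_Icc).1 hf
  filter_upwards [h2] with ξ hξ hξ'
  exact hξ ((Set.uIoc_subset_uIcc.trans (Set.uIcc_subset_Icc D.left_mem hw)) hξ')

lemma vecMul_row_J₂ {c : Fin r ⊕ Fin s → ℂ} (hc : c ᵥ* blockJ₂ r s = 0) {w : ℝ}
    (hw : w ∈ Set.Icc D.a D.b) : c ᵥ* (D.Pi w)ᴴ ᵥ* D.Pi w ᵥ* blockJ₂ r s = 0 := by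
  rw [Matrix.vecMul_vecMul, Matrix.vecMul_vecMul, ← Matrix.mul_assoc]
  have := (D.commute_PiSq_J₂ hw).eq
  unfold PiSq at this
  rw [this, ← Matrix.vecMul_vecMul, hc, Matrix.zero_vecMul]

/-- Both Π̃ and `J` commute with `J₂`, so the Volterra part does not mix the two channel blocks. -/
lemma isFirst_volterra {f : D.H} (hf : D.IsFirst f) : D.IsFirst (D.volterra f) := by
  unfold IsFirst
  filter_upwards [D.volterra_apply f, hf, ae_restrict_mem measurableSet_Icc] with w h1 h2 h3
  rw [h1]
  simp only [WithLp.ofLp_add, WithLp.ofLp_smul, Matrix.add_vecMul, Matrix.smul_vecMul, h2,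
    smul_zero, zero_add]
  rw [← Matrix.vecMul_vecMul, D.vecMul_row_J₂ _ h3, smul_zero]
  have : D.J * blockJ₂ r s = blockJ₂ r s * D.J := by
    simp [J, blockJ₁, blockJ₂, Matrix.fromBlocks_multiply, sub_mul, mul_sub]
  rw [Matrix.vecMul_vecMul, this, ← Matrix.vecMul_vecMul, D.channelInt_vecMul_J₂ hf h3,
    Matrix.zero_vecMul]

lemma isFirst_adjoint_Phi (h : D.H) : D.IsFirst (D.Phi.adjoint (rowAct D.S (D.Phi h))) := by
  unfold IsFirst
  rw [adjoint_Phi]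
  filter_upwards [D.coeFn_row (c := fun _ => (rowAct D.S (D.Phi h)).ofLp) continuousOn_const,
    ae_restrict_mem measurableSet_Icc] with w h1 h2
  rw [h1]
  refine D.vecMul_row_J₂ ?_ h2
  rw [rowAct_apply, Matrix.vecMul_vecMul, S_mul_J₂, Matrix.vecMul_zero]

lemma rowAct_S_Phi {f : D.H} (hf : D.IsFirst f) : rowAct D.S (D.Phi f) = 0 := by
  rw [rowAct_apply, (S_eq D).1, ← Matrix.vecMul_vecMul]
  have : (D.Phi f).ofLp ᵥ* blockJ₂ r s = 0 := D.channelInt_vecMul_J₂ hf D.right_mem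
  rw [this, Matrix.zero_vecMul]
  rfl

/-- Since S J₂ = 0, the finite rank part C = i Φ* S Φ maps into the elements of the first block. The
Volterra part V preserves them, and C annihilates them because S = J₂ S. Hence C Vⁿ C = 0 for all n,
and C does not affect the growth. -/
lemma subexpGrowth_B : SubexpGrowth D.B := by
  rw [B_eq]
  refine D.subexpGrowth_volterra.add_of_nilpotent fun x h => ?_
  refine apply_flow_eq_zero (fun n => ?_) x
  have h1 : ∀ n : ℕ, D.IsFirst ((D.volterra ^ n) (D.Phi.adjoint (rowAct D.S (D.Phi h)))) := by
    intro n
    induction n with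
    | zero => exact D.isFirst_adjoint_Phi h
    | succ k ih =>
      rw [pow_succ']
      exact D.isFirst_volterra ih
  have h2 := D.rowAct_S_Phi (h1 n)
  simp only [_root_.smul_apply, ContinuousLinearMap.comp_apply, map_smul, h2, map_zero, smul_zero]

end TriangularModel

/-! ### The resolvent of the model operator -/

section VecMul

open Set
open scoped Matrix.Norms.Operator

variable {n : Type*} [Fintype n] [DecidableEq n]

lemma HasDerivWithinAt.vecMul {c : ℝ → n → ℂ} {c' : n → ℂ} {Y : ℝ → Matrix n n ℂ}
    {Y' : Matrix n n ℂ} {s : Set ℝ} {v : ℝ} (hc : HasDerivWithinAt c c' s v)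
    (hY : HasDerivWithinAt Y Y' s v) :
    HasDerivWithinAt (fun v => c v ᵥ* Y v) (c' ᵥ* Y v + c v ᵥ* Y') s v := by
  rw [hasDerivWithinAt_pi] at hc ⊢
  rw [Matrix.hasDerivWithinAt_iff] at hY
  intro j
  have h := HasDerivWithinAt.fun_sum (u := Finset.univ) fun i _ => (hc i).mul (hY i j)
  convert! h using 1
  simp [Matrix.vecMul, dotProduct, Finset.sum_add_distrib]

lemma norm_vecMul_le (x : n → ℂ) (M : Matrix n n ℂ) :
    ‖x ᵥ* M‖ ≤ Fintype.card n * ‖x‖ * ‖M‖ := by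
  refine (pi_norm_le_iff_of_nonneg (by positivity)).2 fun j => ?_
  refine (norm_sum_le _ _).trans ?_
  rw [mul_assoc, ← nsmul_eq_mul, ← Finset.card_univ]
  refine Finset.sum_le_card_nsmul _ _ _ fun i _ => ?_
  rw [norm_mul]
  refine mul_le_mul (norm_le_pi_norm x i) ?_ (norm_nonneg _) (norm_nonneg _)
  rw [← coe_nnnorm, ← coe_nnnorm, NNReal.coe_le_coe, Matrix.linfty_opNNNorm_def]
  refine le_trans ?_ (Finset.le_sup (f := fun i => ∑ j, ‖M i j‖₊) (Finset.mem_univ i))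
  exact Finset.single_le_sum (f := fun j => ‖M i j‖₊) (fun _ _ => zero_le) (Finset.mem_univ j)

lemma continuous_vecMul : Continuous fun x : (n → ℂ) × Matrix n n ℂ => x.1 ᵥ* x.2 := by
  refine continuous_pi fun j => ?_
  simp only [Matrix.vecMul, dotProduct]
  refine continuous_finsetSum _ fun i _ => ?_
  exact ((continuous_apply i).comp continuous_fst).mul
    ((continuous_apply_apply i j).comp continuous_snd)

lemma ContinuousOn.vecMul {X : Type*} [TopologicalSpace X] {c : X → n → ℂ} {M : X → Matrix n n ℂ}
    {s : Set X}
    (hc : ContinuousOn c s) (hM : ContinuousOn M s) : ContinuousOn (fun v => c v ᵥ* M v) s :=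
  continuous_vecMul.comp_continuousOn (hc.prodMk hM)

variable {G : ℝ → Matrix n n ℂ} {a b : ℝ} {z : ℂ}

lemma commute_fundY (hG : ContinuousOn G (Icc a b)) (hz : ∀ v ∈ Icc a b, (v : ℂ) ≠ z)
    {M : Matrix n n ℂ} (hM : ∀ v ∈ Icc a b, Commute (G v) M) {w : ℝ} (hw : w ∈ Icc a b) :
    Commute (fundY G a z w) M := by
  have hsub : Icc a w ⊆ Icc a b := Icc_subset_Icc_right hw.2
  have hc := (continuousOn_cauchyKernel_smul hG hz).neg.mono hsub
  refine mul_mulIntRight_eq_of_intertwine hw.1 hc hc fun v hv => ?_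
  have := (hM v (hsub hv)).eq
  simp [this]

lemma commute_fundZ (hG : ContinuousOn G (Icc a b)) (hz : ∀ v ∈ Icc a b, (v : ℂ) ≠ z)
    {M : Matrix n n ℂ} (hM : ∀ v ∈ Icc a b, Commute (G v) M) {w : ℝ} (hw : w ∈ Icc a b) :
    Commute (fundZ G a z w) M := by
  have hsub : Icc a w ⊆ Icc a b := Icc_subset_Icc_right hw.2
  have hc := (continuousOn_cauchyKernel_smul hG hz).mono hsub
  refine mul_mulIntLeft_eq_of_intertwine hw.1 hc hc fun v hv => ?_
  have := (hM v (hsub hv)).eq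
  simp [this]

/-- The vector in front of the fundamental matrix in the solution of the inhomogeneous equation
`Ψ' = g' - Ψ G / (w - z)`, `Ψ a = c`. -/
def varCoeff (G : ℝ → Matrix n n ℂ) (a : ℝ) (z : ℂ) (dg : ℝ → n → ℂ) (w : ℝ) : n → ℂ :=
  ∫ ξ in a..w, dg ξ ᵥ* fundZ G a z ξ

lemma continuousOn_vecMul_fundZ (hG : ContinuousOn G (Icc a b)) (hz : ∀ v ∈ Icc a b, (v : ℂ) ≠ z)
    {dg : ℝ → n → ℂ} (hdg : ContinuousOn dg (Icc a b)) :
    ContinuousOn (fun ξ => dg ξ ᵥ* fundZ G a z ξ) (Icc a b) :=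
  hdg.vecMul (continuousOn_fundZ hG hz)

lemma hasDerivWithinAt_varCoeff (hG : ContinuousOn G (Icc a b))
    (hz : ∀ v ∈ Icc a b, (v : ℂ) ≠ z) {dg : ℝ → n → ℂ} (hdg : ContinuousOn dg (Icc a b)) {w : ℝ}
    (hw : w ∈ Icc a b) :
    HasDerivWithinAt (varCoeff G a z dg) (dg w ᵥ* fundZ G a z w) (Icc a b) w := by
  have hc := continuousOn_vecMul_fundZ hG hz hdg
  have : Fact (w ∈ Icc a b) := ⟨hw⟩
  exact intervalIntegral.integral_hasDerivWithinAt_right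
    ((hc.mono (by rw [uIcc_of_le hw.1]; exact Icc_subset_Icc_right hw.2)).intervalIntegrable)
    (hc.stronglyMeasurableAtFilter_nhdsWithin measurableSet_Icc w) (hc w hw)

lemma hasDerivWithinAt_varSolution (hG : ContinuousOn G (Icc a b))
    (hz : ∀ v ∈ Icc a b, (v : ℂ) ≠ z) {dg : ℝ → n → ℂ} (hdg : ContinuousOn dg (Icc a b))
    (c : n → ℂ) {w : ℝ} (hw : w ∈ Icc a b) :
    HasDerivWithinAt (fun w => (c + varCoeff G a z dg w) ᵥ* fundY G a z w)
      (dg w - ((w : ℂ) - z)⁻¹ • ((c + varCoeff G a z dg w) ᵥ* fundY G a z w ᵥ* G w))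
      (Icc a b) w := by
  have h := ((hasDerivWithinAt_varCoeff hG hz hdg hw).const_add c).vecMul
    (hasDerivWithinAt_fundY hG hz hw)
  convert! h using 1
  rw [Matrix.vecMul_vecMul (dg w), fundZ_mul_fundY hG hz hw, Matrix.vecMul_one, Matrix.vecMul_neg,
    Matrix.vecMul_smul, Matrix.vecMul_vecMul, sub_eq_add_neg]

end VecMul

/-! ### The explicit resolvent of the model operator and the bound of its transfer function -/

namespace TriangularModel

open Complex (I)
open Set
open scoped Matrix.Norms.Operator

variable {p r s : ℕ} (D : TriangularModel p r s)

/-- The kernel `G = i Π̃ J` of the fundamental system. -/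
def G (w : ℝ) : Matrix (Fin r ⊕ Fin s) (Fin r ⊕ Fin s) ℂ := I • (D.PiSq w * D.J)

lemma commute_PiSq_J {w : ℝ} (hw : w ∈ Icc D.a D.b) : Commute (D.PiSq w) D.J :=
  (D.commute_PiSq_J₁ hw).sub_right (D.commute_PiSq_J₂ hw)

lemma commute_J₁_J : Commute D.J (blockJ₁ r s) := by
  unfold J Commute SemiconjBy
  simp [blockJ₁, blockJ₂, Matrix.fromBlocks_multiply, sub_mul, mul_sub]

lemma commute_J₂_J : Commute D.J (blockJ₂ r s) := by
  unfold J Commute SemiconjBy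
  simp [blockJ₁, blockJ₂, Matrix.fromBlocks_multiply, sub_mul, mul_sub]

lemma commute_G_J₁ {w : ℝ} (hw : w ∈ Icc D.a D.b) : Commute (D.G w) (blockJ₁ r s) :=
  ((D.commute_PiSq_J₁ hw).mul_left D.commute_J₁_J).smul_left I

lemma commute_G_J₂ {w : ℝ} (hw : w ∈ Icc D.a D.b) : Commute (D.G w) (blockJ₂ r s) :=
  ((D.commute_PiSq_J₂ hw).mul_left D.commute_J₂_J).smul_left I

lemma commute_PiSq_G {w : ℝ} (hw : w ∈ Icc D.a D.b) : Commute (D.PiSq w) (D.G w) :=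
  ((Commute.refl _).mul_right (D.commute_PiSq_J hw)).smul_right I

lemma J_mul_J : D.J * D.J = 1 := by
  simp [J, blockJ₁, blockJ₂, Matrix.fromBlocks_multiply, sub_mul, mul_sub, Matrix.fromBlocks_add]

lemma conjTranspose_J : D.Jᴴ = D.J := by
  simp [J, blockJ₁, blockJ₂, Matrix.fromBlocks_conjTranspose]

lemma conjTranspose_PiSq (w : ℝ) : (D.PiSq w)ᴴ = D.PiSq w := by
  simp [PiSq, Matrix.conjTranspose_mul]

lemma norm_PiSq_sub_le : ∃ C α : ℝ, 0 ≤ C ∧ 0 < α ∧ ∀ v ∈ Icc D.a D.b, ∀ w ∈ Icc D.a D.b,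
    ‖D.PiSq v - D.PiSq w‖ ≤ C * |v - w| ^ α := by
  obtain ⟨C, hC, α, hα, -, h⟩ := D.holder
  refine ⟨Fintype.card (Fin r ⊕ Fin s) * C, α, by positivity, hα, fun v hv w hw => ?_⟩
  rw [mul_assoc]
  exact Matrix.norm_le_of_forall_apply_le (by positivity) fun i j => h v hv w hw i j

lemma continuousOn_PiSq : ContinuousOn D.PiSq (Icc D.a D.b) := by
  obtain ⟨C, α, hC, hα, h⟩ := D.norm_PiSq_sub_le
  intro w hw
  refine tendsto_iff_norm_sub_tendsto_zero.2 ?_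
  have h1 : Tendsto (fun v : ℝ => C * |v - w| ^ α) (𝓝[Icc D.a D.b] w) (𝓝 (C * |w - w| ^ α)) := by
    refine Tendsto.mono_left (Continuous.tendsto ?_ w) nhdsWithin_le_nhds
    exact continuous_const.mul ((continuous_abs.comp (continuous_id.sub continuous_const)).rpow_const
      fun _ => Or.inr hα.le)
  rw [sub_self, abs_zero, Real.zero_rpow hα.ne', mul_zero] at h1
  refine squeeze_zero' (Eventually.of_forall fun _ => norm_nonneg _) ?_ h1
  filter_upwards [self_mem_nhdsWithin] with v hv using h v hv w hw

lemma holderAt_G {w : ℝ} (hw : w ∈ Icc D.a D.b) : HolderAt D.G D.a D.b w := by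
  obtain ⟨C, α, hC, hα, h⟩ := D.norm_PiSq_sub_le
  refine ⟨C * ‖D.J‖, α, hα, fun v hv => ?_⟩
  have : D.G v - D.G w = I • ((D.PiSq v - D.PiSq w) * D.J) := by
    simp [G, sub_mul, smul_sub]
  rw [this, norm_smul, Complex.norm_I, one_mul]
  refine (norm_mul_le _ _).trans ?_
  rw [mul_right_comm]
  gcongr
  exact h v hv w hw

lemma sum_sq_vecMul_conjTranspose_Pi_le {w : ℝ} (hw : w ∈ Icc D.a D.b)
    (x : Fin r ⊕ Fin s → ℂ) :
    ‖(WithLp.toLp 2 (x ᵥ* (D.Pi w)ᴴ) : EuclideanSpace ℂ (Fin p))‖ ≤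
      ‖(WithLp.toLp 2 x : EuclideanSpace ℂ (Fin r ⊕ Fin s))‖ := by
  have h1 : ∑ i, ∑ j, ‖D.Pi w i j‖ ^ 2 = 1 := by
    have h := congrArg Complex.re (D.trace_eq_one w hw)
    rw [Finset.sum_comm, ← Complex.one_re, ← h]
    simp only [Matrix.trace, Matrix.diag, Matrix.mul_apply, Complex.re_sum,
      Matrix.conjTranspose_apply]
    refine Finset.sum_congr rfl fun j _ => Finset.sum_congr rfl fun i _ => ?_
    rw [← Complex.normSq_eq_norm_sq, Complex.normSq_apply]
    simp [Complex.mul_re]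
  refine le_of_sq_le_sq ?_ (norm_nonneg _)
  rw [EuclideanSpace.norm_sq_eq, EuclideanSpace.norm_sq_eq]
  calc ∑ i, ‖(x ᵥ* (D.Pi w)ᴴ) i‖ ^ 2
      ≤ ∑ i, (∑ j, ‖x j‖ ^ 2) * ∑ j, ‖D.Pi w i j‖ ^ 2 := by
        refine Finset.sum_le_sum fun i _ => ?_
        refine le_trans ?_ (Finset.sum_mul_sq_le_sq_mul_sq _ _ _)
        have h2 : ‖(x ᵥ* (D.Pi w)ᴴ) i‖ ≤ ∑ j, ‖x j‖ * ‖D.Pi w i j‖ := by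
          change ‖∑ j, x j * (D.Pi w)ᴴ j i‖ ≤ _
          refine (norm_sum_le _ _).trans (le_of_eq (Finset.sum_congr rfl fun j _ => ?_))
          rw [norm_mul, Matrix.conjTranspose_apply, norm_star]
        exact pow_le_pow_left₀ (norm_nonneg _) h2 2
    _ = _ := by rw [← Finset.mul_sum, h1, mul_one]

/-- Skewness needs that Π̃ commutes with `J`. The bound holds because tr Π̃ = 1 makes x ↦ x Π* a
contraction, and `J` preserves the norm. -/
lemma isSkewKernel_G : IsSkewKernel D.G D.a D.b where
  cont := (D.continuousOn_PiSq.mul continuousOn_const).const_smul I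
  skew w hw := by
    rw [G, Matrix.conjTranspose_smul, Matrix.conjTranspose_mul, conjTranspose_J,
      conjTranspose_PiSq, ← (D.commute_PiSq_J hw).eq]
    simp
  bound w hw x := by
    have h1 : (x ᵥ* D.G w) ⬝ᵥ star x = I * inner ℂ
        (WithLp.toLp 2 (x ᵥ* D.J ᵥ* (D.Pi w)ᴴ) : EuclideanSpace ℂ (Fin p))
        (WithLp.toLp 2 (x ᵥ* (D.Pi w)ᴴ)) := by
      rw [inner_row, G, Matrix.vecMul_smul, smul_dotProduct, smul_eq_mul, PiSq]
      congr 1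
      simp only [Matrix.star_vecMul, Matrix.conjTranspose_conjTranspose, Matrix.conjTranspose_mul,
        Matrix.dotProduct_mulVec, Matrix.vecMul_vecMul, conjTranspose_J, Matrix.mul_assoc]
    have h2 : ‖(WithLp.toLp 2 (x ᵥ* D.J) : EuclideanSpace ℂ (Fin r ⊕ Fin s))‖ =
        ‖(WithLp.toLp 2 x : EuclideanSpace ℂ (Fin r ⊕ Fin s))‖ := by
      rw [EuclideanSpace.norm_eq, EuclideanSpace.norm_eq]
      congr 1
      refine Finset.sum_congr rfl fun j _ => ?_
      change ‖(x ᵥ* D.J) j‖ ^ 2 = ‖x j‖ ^ 2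
      rw [J_eq_diagonal, Matrix.vecMul_diagonal]
      rcases j with j | j <;> simp
    rw [h1, norm_mul, Complex.norm_I, one_mul]
    refine (norm_inner_le_norm _ _).trans ?_
    have h3 := D.sum_sq_vecMul_conjTranspose_Pi_le hw x
    have h4 := D.sum_sq_vecMul_conjTranspose_Pi_le hw (x ᵥ* D.J)
    rw [h2] at h4
    calc _ ≤ ‖(WithLp.toLp 2 x : EuclideanSpace ℂ (Fin r ⊕ Fin s))‖ *
          ‖(WithLp.toLp 2 x : EuclideanSpace ℂ (Fin r ⊕ Fin s))‖ := by gcongr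
      _ = _ := by rw [← sq, EuclideanSpace.norm_sq_eq]

/-- The boundary vector in the resolvent formula. -/
def resCoeff (g dg : ℝ → Fin r ⊕ Fin s → ℂ) (z : ℂ) : Fin r ⊕ Fin s → ℂ :=
  (g D.b - (g D.a + varCoeff D.G D.a z dg D.b) ᵥ* fundY D.G D.a z D.b) ᵥ* D.S

/-- The function `Ψ` for which `(w - z)⁻¹ Ψ(w) Π*(w)` is the value of the resolvent at `g Π*`. -/
def resPsi (g dg : ℝ → Fin r ⊕ Fin s → ℂ) (z : ℂ) (w : ℝ) : Fin r ⊕ Fin s → ℂ :=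
  (g D.a + D.resCoeff g dg z + varCoeff D.G D.a z dg w) ᵥ* fundY D.G D.a z w

lemma resCoeff_vecMul_S (g dg : ℝ → Fin r ⊕ Fin s → ℂ) (z : ℂ) :
    D.resCoeff g dg z ᵥ* D.S = 0 := by
  rw [resCoeff, Matrix.vecMul_vecMul, S_mul_S, Matrix.vecMul_zero]

variable {g dg : ℝ → Fin r ⊕ Fin s → ℂ} {z : ℂ}

/-- The fundamental matrix commutes with `J₁`, while S = S J₁ and J₁ S = 0, so S Y S = 0. This is
why the vector `resCoeff` is explicit: the unknown finite rank term drops out of its own equation.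
-/
lemma resCoeff_vecMul_fundY_vecMul_S (hz : ∀ v ∈ Icc D.a D.b, (v : ℂ) ≠ z) :
    D.resCoeff g dg z ᵥ* fundY D.G D.a z D.b ᵥ* D.S = 0 := by
  have h := (commute_fundY D.isSkewKernel_G.cont hz (fun v hv => D.commute_G_J₁ hv)
    D.right_mem).eq
  have e : D.S * (fundY D.G D.a z D.b * D.S) = 0 := by
    calc D.S * (fundY D.G D.a z D.b * D.S)
        = (D.S * blockJ₁ r s) * (fundY D.G D.a z D.b * D.S) := by rw [← (S_eq D).2]
      _ = D.S * ((blockJ₁ r s * fundY D.G D.a z D.b) * D.S) := by simp only [Matrix.mul_assoc]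
      _ = 0 := by rw [← h, Matrix.mul_assoc (fundY _ _ _ _), J₁_mul_S, Matrix.mul_zero,
                    Matrix.mul_zero]
  rw [resCoeff, Matrix.vecMul_vecMul, Matrix.vecMul_vecMul, e, Matrix.vecMul_zero]

lemma hasDerivWithinAt_resPsi (hz : ∀ v ∈ Icc D.a D.b, (v : ℂ) ≠ z)
    (hdg : ContinuousOn dg (Icc D.a D.b)) {w : ℝ} (hw : w ∈ Icc D.a D.b) :
    HasDerivWithinAt (D.resPsi g dg z)
      (dg w - ((w : ℂ) - z)⁻¹ • (D.resPsi g dg z w ᵥ* D.G w)) (Icc D.a D.b) w :=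
  hasDerivWithinAt_varSolution D.isSkewKernel_G.cont hz hdg _ hw

lemma continuousOn_resPsi (hz : ∀ v ∈ Icc D.a D.b, (v : ℂ) ≠ z)
    (hdg : ContinuousOn dg (Icc D.a D.b)) : ContinuousOn (D.resPsi g dg z) (Icc D.a D.b) :=
  fun _ hw => (D.hasDerivWithinAt_resPsi hz hdg hw).continuousWithinAt

lemma continuousOn_resolvent (hz : ∀ v ∈ Icc D.a D.b, (v : ℂ) ≠ z)
    (hdg : ContinuousOn dg (Icc D.a D.b)) :
    ContinuousOn (fun w : ℝ => ((w : ℂ) - z)⁻¹ • D.resPsi g dg z w) (Icc D.a D.b) :=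
  (continuousOn_cauchyKernel hz).smul (D.continuousOn_resPsi hz hdg)

/-- The resolvent of the model operator applied to `g Π*`. -/
def resolvent (hz : ∀ v ∈ Icc D.a D.b, (v : ℂ) ≠ z) (hdg : ContinuousOn dg (Icc D.a D.b)) : D.H :=
  D.row (D.continuousOn_resolvent (g := g) hz hdg)

/-- The equation of Ψ says that (g - Ψ)' = (v - z)⁻¹ Ψ G, which is i times the channel density of
the candidate multiplied by `J`. The integral is therefore elementary. -/
lemma channelInt_resolvent (hz : ∀ v ∈ Icc D.a D.b, (v : ℂ) ≠ z)
    (hg : ∀ v ∈ Icc D.a D.b, HasDerivWithinAt g (dg v) (Icc D.a D.b) v)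
    (hdg : ContinuousOn dg (Icc D.a D.b)) {w : ℝ} (hw : w ∈ Icc D.a D.b) :
    I • (D.channelInt (D.resolvent (g := g) hz hdg) D.a w ᵥ* D.J) =
      g w + D.resCoeff g dg z - D.resPsi g dg z w := by
  have h1 := (Matrix.vecMulLinear D.J).toContinuousLinearMap.intervalIntegral_comp_comm
    (D.intervalIntegrable_vecMul (D.resolvent (g := g) hz hdg) D.left_mem hw)
  have h2 : D.channelInt (D.resolvent (g := g) hz hdg) D.a w ᵥ* D.J =
      ∫ v in D.a..w, (((D.resolvent (g := g) hz hdg : ℝ → EuclideanSpace ℂ (Fin p)) v).ofLp ᵥ*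
        D.Pi v) ᵥ* D.J := h1.symm
  have h3 : ∫ v in D.a..w, ((v : ℂ) - z)⁻¹ • (D.resPsi g dg z v ᵥ* D.G v) =
      (g w - D.resPsi g dg z w) - (g D.a - D.resPsi g dg z D.a) := by
    refine integral_eq_sub_of_hasDerivWithinAt_Icc
      (F := fun v => g v - D.resPsi g dg z v) (fun v hv => ?_) ?_ D.left_mem hw
    · have := (hg v hv).fun_sub (D.hasDerivWithinAt_resPsi (g := g) hz hdg hv)
      rw [sub_sub_cancel] at this
      exact this
    · exact (continuousOn_cauchyKernel hz).smul (ContinuousOn.vecMul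
        (D.continuousOn_resPsi hz hdg) D.isSkewKernel_G.cont)
  have h4 : D.resPsi g dg z D.a = g D.a + D.resCoeff g dg z := by
    simp [resPsi, varCoeff, fundY_self]
  rw [h2, ← intervalIntegral.integral_smul]
  have h5 : ∫ v in D.a..w, I • ((((D.resolvent (g := g) hz hdg : ℝ → EuclideanSpace ℂ (Fin p))
      v).ofLp ᵥ* D.Pi v) ᵥ* D.J) = ∫ v in D.a..w, ((v : ℂ) - z)⁻¹ • (D.resPsi g dg z v ᵥ* D.G v) := by
    refine intervalIntegral.integral_congr_ae ?_
    have := (ae_restrict_iff' measurableSet_Icc).1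
      (D.coeFn_row (D.continuousOn_resolvent (g := g) hz hdg))
    filter_upwards [this] with v hv hv'
    unfold resolvent
    rw [hv ((uIoc_subset_uIcc.trans (uIcc_subset_Icc D.left_mem hw)) hv')]
    simp only [G, PiSq, Matrix.smul_vecMul, Matrix.vecMul_smul, Matrix.vecMul_vecMul,
      Matrix.mul_assoc]
    rw [smul_comm]
  rw [h5, h3, h4]
  abel

/-- The explicit form of the resolvent of the model operator. -/
theorem B_resolvent (hz : ∀ v ∈ Icc D.a D.b, (v : ℂ) ≠ z)
    (hg : ∀ v ∈ Icc D.a D.b, HasDerivWithinAt g (dg v) (Icc D.a D.b) v)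
    (hdg : ContinuousOn dg (Icc D.a D.b)) (hgc : ContinuousOn g (Icc D.a D.b)) :
    D.B (D.resolvent (g := g) hz hdg) - z • D.resolvent (g := g) hz hdg = D.row hgc := by
  set u := D.resolvent (g := g) hz hdg with hu
  have hPhi : I • ((D.Phi u).ofLp ᵥ* D.J) =
      g D.b + D.resCoeff g dg z - D.resPsi g dg z D.b :=
    D.channelInt_resolvent hz hg hdg D.right_mem
  -- The consistency condition that determines `resCoeff`: it must cancel the finite rank term i
  -- Φ(u) S. The sign comes from J S = -S.
  have hS : D.resCoeff g dg z + I • ((D.Phi u).ofLp ᵥ* D.S) = 0 := by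
    have h1 : I • ((D.Phi u).ofLp ᵥ* D.S) =
        -((g D.b + D.resCoeff g dg z - D.resPsi g dg z D.b) ᵥ* D.S) := by
      rw [← hPhi, Matrix.smul_vecMul, Matrix.vecMul_vecMul, J_mul_S, Matrix.vecMul_neg, smul_neg,
        neg_neg]
    have h2 : D.resPsi g dg z D.b ᵥ* D.S =
        (g D.a + varCoeff D.G D.a z dg D.b) ᵥ* fundY D.G D.a z D.b ᵥ* D.S := by
      have : g D.a + D.resCoeff g dg z + varCoeff D.G D.a z dg D.b =
          (g D.a + varCoeff D.G D.a z dg D.b) + D.resCoeff g dg z := by abel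
      rw [resPsi, this, Matrix.add_vecMul, Matrix.add_vecMul, D.resCoeff_vecMul_fundY_vecMul_S hz,
        add_zero]
    rw [h1, Matrix.sub_vecMul, Matrix.add_vecMul, resCoeff_vecMul_S, add_zero, h2,
      ← Matrix.sub_vecMul]
    exact add_neg_cancel _
  refine Lp.ext ?_
  filter_upwards [Lp.coeFn_sub (D.B u) (z • u), Lp.coeFn_smul z u, D.B_apply u,
    D.coeFn_row (D.continuousOn_resolvent (g := g) hz hdg), D.coeFn_row hgc,
    ae_restrict_mem measurableSet_Icc] with w h1 h2 h3 h4 h5 h6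
  have h4' : (u : ℝ → EuclideanSpace ℂ (Fin p)) w = _ := h4
  rw [h1, Pi.sub_apply, h2, Pi.smul_apply, h3, h5, D.modelFun_eq u h6, add_sub_right_comm,
    ← sub_smul, h4']
  rw [← WithLp.toLp_smul, ← WithLp.toLp_smul, ← WithLp.toLp_add, Matrix.smul_vecMul, smul_smul,
    mul_inv_cancel₀ (sub_ne_zero.2 (hz w h6)), one_smul, ← Matrix.smul_vecMul,
    ← Matrix.add_vecMul, smul_add, D.channelInt_resolvent hz hg hdg h6]
  congr 2
  calc _ = g w + (D.resCoeff g dg z + I • ((D.Phi u).ofLp ᵥ* D.S)) := by abel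
    _ = g w := by rw [hS, add_zero]

lemma norm_toLp_le (x : Fin r ⊕ Fin s → ℂ) :
    ‖(WithLp.toLp 2 x : EuclideanSpace ℂ (Fin r ⊕ Fin s))‖ ≤
      Fintype.card (Fin r ⊕ Fin s) * ‖x‖ := by
  rw [EuclideanSpace.norm_eq]
  refine Real.sqrt_le_iff.2 ⟨by positivity, ?_⟩
  refine (Finset.sum_sq_le_sq_sum_of_nonneg fun i _ => norm_nonneg _).trans ?_
  have h : ∑ i, ‖x i‖ ≤ Fintype.card (Fin r ⊕ Fin s) * ‖x‖ := by
    refine (Finset.sum_le_card_nsmul _ _ ‖x‖ fun i _ => norm_le_pi_norm x i).trans ?_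
    simp
  exact pow_le_pow_left₀ (Finset.sum_nonneg fun i _ => norm_nonneg _) h 2

lemma norm_ofLp_le (x : EuclideanSpace ℂ (Fin r ⊕ Fin s)) : ‖x.ofLp‖ ≤ ‖x‖ :=
  (pi_norm_le_iff_of_nonneg (norm_nonneg _)).2 fun j => PiLp.norm_apply_le x j

/-- The transfer function of the model is bounded in the lower half-plane. -/
lemma exists_transfer_bound : ∃ C : ℝ, ∀ τ ε : ℝ, 0 < ε → ∀ u e,
    D.B u - ((τ : ℂ) - I * ε) • u = D.Phi.adjoint e → ‖D.Phi u‖ ≤ C * ‖e‖ := by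
  set N : ℝ := (Fintype.card (Fin r ⊕ Fin s) : ℝ) with hN
  set F := fundBound (Fin r ⊕ Fin s) with hF
  have hN0 : 0 ≤ N := by positivity
  have hF0 : 0 ≤ F := fundBound_nonneg
  set A : ℝ := N * (1 + N * F) * ‖D.S‖ with hA
  have hA0 : 0 ≤ A := by positivity
  refine ⟨N * (N * ((1 + A) + N * (1 + A) * F) * ‖D.J‖), fun τ ε hε u e hu => ?_⟩
  set z : ℂ := (τ : ℂ) - I * ε with hz
  have hzim : z.im ≠ 0 := by simp [hz, hε.ne']
  have hz' : ∀ v ∈ Icc D.a D.b, (v : ℂ) ≠ z := fun v _ => ofReal_ne_of_im_ne_zero hzim v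
  -- The element Φ* e is the row with the constant coefficient e, so the derivative of `g` is zero
  -- and no integral term appears in Ψ.
  set g : ℝ → Fin r ⊕ Fin s → ℂ := fun _ => e.ofLp with hg
  have hgd : ∀ v ∈ Icc D.a D.b, HasDerivWithinAt g ((fun _ => 0 : ℝ → Fin r ⊕ Fin s → ℂ) v)
      (Icc D.a D.b) v := fun v _ => hasDerivWithinAt_const _ _ _
  have hdg : ContinuousOn (fun _ => 0 : ℝ → Fin r ⊕ Fin s → ℂ) (Icc D.a D.b) := continuousOn_const
  have h1 := D.B_resolvent hz' hgd hdg continuousOn_const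
  -- Uniqueness in the lower half-plane: both solutions have the same Laplace integral.
  have h2 : u = D.resolvent (g := g) hz' hdg := by
    have e1 := laplace_flow_sub_smul D.subexpGrowth_B hε τ u
    have e2 := laplace_flow_sub_smul D.subexpGrowth_B hε τ (D.resolvent (g := g) hz' hdg)
    rw [← hz, hu, adjoint_Phi] at e1
    rw [← hz, h1] at e2
    exact smul_right_injective _ Complex.I_ne_zero (e1.symm.trans e2)
  have hv0 : ∀ w, varCoeff D.G D.a z (fun _ => 0) w = 0 := fun w => by simp [varCoeff]
  have hq : ‖D.resCoeff g (fun _ => 0) z‖ ≤ A * ‖e‖ := by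
    rw [resCoeff, hv0, add_zero]
    refine (norm_vecMul_le _ _).trans ?_
    have e1 : ‖g D.b - g D.a ᵥ* fundY D.G D.a z D.b‖ ≤ (1 + N * F) * ‖e‖ := by
      refine (norm_sub_le _ _).trans ?_
      have e2 := norm_vecMul_le (g D.a) (fundY D.G D.a z D.b)
      have e3 := norm_fundY_le D.isSkewKernel_G hz' D.right_mem
      have e4 : ‖g D.a‖ ≤ ‖e‖ := norm_ofLp_le e
      calc _ ≤ ‖e‖ + N * ‖e‖ * F := by
            refine add_le_add e4 (e2.trans ?_)
            gcongr
        _ = _ := by ring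
    calc _ ≤ N * ((1 + N * F) * ‖e‖) * ‖D.S‖ := by gcongr
      _ = _ := by rw [hA]; ring
  have hc : ‖e.ofLp + D.resCoeff g (fun _ => 0) z‖ ≤ (1 + A) * ‖e‖ := by
    refine (norm_add_le _ _).trans ?_
    have := norm_ofLp_le e
    linarith
  have hΦ : I • ((D.Phi u).ofLp ᵥ* D.J) = (e.ofLp + D.resCoeff g (fun _ => 0) z) -
      (e.ofLp + D.resCoeff g (fun _ => 0) z) ᵥ* fundY D.G D.a z D.b := by
    rw [h2]
    have := D.channelInt_resolvent hz' hgd hdg D.right_mem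
    refine this.trans ?_
    rw [resPsi, hv0, add_zero]
  have hΦ2 : ‖(D.Phi u).ofLp ᵥ* D.J‖ ≤ ((1 + A) + N * (1 + A) * F) * ‖e‖ := by
    have e1 : ‖(D.Phi u).ofLp ᵥ* D.J‖ = ‖I • ((D.Phi u).ofLp ᵥ* D.J)‖ := by
      rw [norm_smul, Complex.norm_I, one_mul]
    rw [e1, hΦ]
    refine (norm_sub_le _ _).trans ?_
    have e2 := norm_vecMul_le (e.ofLp + D.resCoeff g (fun _ => 0) z) (fundY D.G D.a z D.b)
    have e3 := norm_fundY_le D.isSkewKernel_G hz' D.right_mem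
    calc _ ≤ (1 + A) * ‖e‖ + N * ((1 + A) * ‖e‖) * F := by
          refine add_le_add hc (e2.trans ?_)
          gcongr
      _ = _ := by ring
  have hΦ3 : (D.Phi u).ofLp = (D.Phi u).ofLp ᵥ* D.J ᵥ* D.J := by
    rw [Matrix.vecMul_vecMul, J_mul_J, Matrix.vecMul_one]
  have hΦ4 : ‖(D.Phi u).ofLp‖ ≤ N * (((1 + A) + N * (1 + A) * F) * ‖e‖) * ‖D.J‖ := by
    rw [hΦ3]
    refine (norm_vecMul_le _ _).trans ?_
    gcongr
  calc ‖D.Phi u‖ ≤ N * ‖(D.Phi u).ofLp‖ := norm_toLp_le _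
    _ ≤ N * (N * (((1 + A) + N * (1 + A) * F) * ‖e‖) * ‖D.J‖) := by gcongr
    _ = _ := by ring

/-- The observations of the flow are square integrable. -/
theorem exists_observation_bound : ∃ C : ℝ, 0 ≤ C ∧ ∀ h,
    IntegrableOn (fun x => ‖D.Phi (flow D.B x h)‖ ^ 2) (Ioi 0) ∧
      ∫ x in Ioi (0 : ℝ), ‖D.Phi (flow D.B x h)‖ ^ 2 ≤ C * ‖h‖ ^ 2 := by
  -- With this choice L = 1 + K + K*, because J₁ + J₂ = 1. Removing i Φ* K Φ leaves an operator
  -- whose non-selfadjoint part is exactly i Φ* Φ.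
  set K := D.S - blockJ₂ r s with hK
  refine exists_observability_bound (D := D.B - I • (D.Phi.adjoint ∘L rowAct K ∘L D.Phi))
    (K := rowAct K) D.subexpGrowth_B (by simp) ?_ D.exists_transfer_bound
  have h1 : (I • (D.Phi.adjoint ∘L rowAct K ∘L D.Phi)).adjoint =
      -(I • (D.Phi.adjoint ∘L rowAct Kᴴ ∘L D.Phi)) := by
    rw [LinearIsometryEquiv.map_smulₛₗ, ContinuousLinearMap.adjoint_comp,
      ContinuousLinearMap.adjoint_comp, ContinuousLinearMap.adjoint_adjoint, adjoint_rowAct,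
      Complex.conj_I, neg_smul, ContinuousLinearMap.comp_assoc]
  have h2 : D.L = 1 + K + Kᴴ := by
    have : (blockJ₂ r s)ᴴ = blockJ₂ r s := by simp [blockJ₂, Matrix.fromBlocks_conjTranspose]
    rw [hK, Matrix.conjTranspose_sub, this, ← blockJ_add r s, L]
    abel
  rw [map_sub, h1]
  have h3 := D.B_sub_adjoint
  rw [h2, rowAct_add, rowAct_add, rowAct_one] at h3
  simp only [ContinuousLinearMap.add_comp, ContinuousLinearMap.comp_add, smul_add,
    ContinuousLinearMap.id_comp] at h3
  calc _ = (D.B - D.B.adjoint) - I • (D.Phi.adjoint ∘L rowAct K ∘L D.Phi) -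
        I • (D.Phi.adjoint ∘L rowAct Kᴴ ∘L D.Phi) := by abel
    _ = _ := by rw [h3]; abel

end TriangularModel

/-! ### Resolvent means on horizontal lines -/

section Lines

open Set
open Complex (I)
open scoped Matrix.Norms.Operator

variable {n : Type*} [Fintype n] [DecidableEq n] {G : ℝ → Matrix n n ℂ} {a b ε : ℝ}

lemma continuousOn_prod_of_norm_sub_le {E : Type*} [SeminormedAddCommGroup E] {f : ℝ × ℝ → E}
    {t : Set ℝ} {K : ℝ} (hK : 0 ≤ K) (hc : ∀ τ, ContinuousOn (fun w => f (τ, w)) t)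
    (hl : ∀ τ₁ τ₂, ∀ w ∈ t, ‖f (τ₁, w) - f (τ₂, w)‖ ≤ K * |τ₁ - τ₂|) :
    ContinuousOn f (univ ×ˢ t) := by
  refine continuousOn_prod_of_continuousOn_lipschitzOnWith f K.toNNReal (fun τ _ => hc τ)
    fun w hw => LipschitzOnWith.of_dist_le_mul fun τ₁ _ τ₂ _ => ?_
  rw [Real.coe_toNNReal _ hK, dist_eq_norm, Real.dist_eq]
  exact hl τ₁ τ₂ w hw

lemma ofReal_ne_line (hε : 0 < ε) (τ v : ℝ) : (v : ℂ) ≠ (τ : ℂ) - I * ε :=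
  ofReal_ne_of_im_ne_zero (by simp [hε.ne']) v

/-- The constant degenerates as ε tends to zero. It serves only for joint continuity on a fixed
line, hence for measurability and Fubini's theorem. -/
lemma exists_lipschitz_fundR (hG : IsSkewKernel G a b) (hab : a ≤ b) (hε : 0 < ε) :
    ∃ K : ℝ, 0 ≤ K ∧ ∀ τ₁ τ₂ : ℝ, ∀ ξ ∈ Icc a b, ∀ w ∈ Icc a b,
      ‖fundR G a ((τ₁ : ℂ) - I * ε) ξ w - fundR G a ((τ₂ : ℂ) - I * ε) ξ w‖ ≤
        K * |τ₁ - τ₂| := by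
  obtain ⟨g, hg⟩ := isCompact_Icc.exists_bound_of_continuousOn hG.cont
  have hg0 : 0 ≤ g := (norm_nonneg _).trans (hg a ⟨le_rfl, hab⟩)
  have hba : 0 ≤ b - a := sub_nonneg.2 hab
  have hd : ∀ τ v : ℝ, ε ≤ ‖(v : ℂ) - ((τ : ℂ) - I * ε)‖ := fun τ v => by
    refine le_trans ?_ (Complex.abs_im_le_norm _)
    simp [abs_of_pos hε]
  refine ⟨ε⁻¹ ^ 2 * (fundBound n ^ 2 * g * fundBound n ^ 2) * (b - a), by positivity,
    fun τ₁ τ₂ ξ hξ w hw => ?_⟩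
  have h := norm_fundR_sub_le hG (fun v _ => ofReal_ne_line hε τ₁ v)
    (fun v _ => ofReal_ne_line hε τ₂ v) hξ hw hg hε (fun v _ => hd τ₁ v) (fun v _ => hd τ₂ v)
  refine h.trans (le_of_eq ?_)
  rw [sub_sub_sub_cancel_right, ← Complex.ofReal_sub, Complex.norm_real, Real.norm_eq_abs]

lemma continuousOn_fundY_line (hG : IsSkewKernel G a b) (hab : a ≤ b) (hε : 0 < ε) :
    ContinuousOn (fun x : ℝ × ℝ => fundY G a ((x.1 : ℂ) - I * ε) x.2) (univ ×ˢ Icc a b) := by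
  obtain ⟨K, hK0, hK⟩ := exists_lipschitz_fundR hG hab hε
  have h1 : ∀ τ : ℝ, ContinuousOn (fun w => fundY G a ((τ : ℂ) - I * ε) w) (Icc a b) :=
    fun τ => continuousOn_fundY hG.cont fun v _ => ofReal_ne_line hε τ v
  have h2 : ∀ τ₁ τ₂ : ℝ, ∀ w ∈ Icc a b,
      ‖fundY G a ((τ₁ : ℂ) - I * ε) w - fundY G a ((τ₂ : ℂ) - I * ε) w‖ ≤ K * |τ₁ - τ₂| := by
    intro τ₁ τ₂ w hw
    have := hK τ₁ τ₂ a ⟨le_rfl, hab⟩ w hw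
    rwa [fundR_left, fundR_left] at this
  exact continuousOn_prod_of_norm_sub_le
    (f := fun x : ℝ × ℝ => fundY G a ((x.1 : ℂ) - I * ε) x.2) hK0 h1 h2

lemma norm_varCoeff_le (hG : IsSkewKernel G a b) {z : ℂ} (hz : ∀ v ∈ Icc a b, (v : ℂ) ≠ z)
    {dg : ℝ → n → ℂ} {c : ℝ} (hc : ∀ v ∈ Icc a b, ‖dg v‖ ≤ c) {w : ℝ} (hw : w ∈ Icc a b) :
    ‖varCoeff G a z dg w‖ ≤ Fintype.card n * c * fundBound n * (b - a) := by
  have hc0 : 0 ≤ c := (norm_nonneg _).trans (hc w hw)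
  have h0 : (0 : ℝ) ≤ Fintype.card n * c * fundBound n := by
    have := fundBound_nonneg (n := n)
    positivity
  refine (intervalIntegral.norm_integral_le_of_norm_le_const (C := Fintype.card n * c * fundBound n)
    fun v hv => ?_).trans ?_
  · rw [uIoc_of_le hw.1] at hv
    have hv' : v ∈ Icc a b := ⟨hv.1.le, hv.2.trans hw.2⟩
    refine (norm_vecMul_le _ _).trans ?_
    have := norm_fundZ_le hG hz hv'
    gcongr
    exact hc v hv'
  · rw [abs_of_nonneg (sub_nonneg.2 hw.1)]
    gcongr
    exact hw.2

lemma continuousOn_varCoeff_line (hG : IsSkewKernel G a b) (hab : a ≤ b) (hε : 0 < ε)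
    {dg : ℝ → n → ℂ} (hdg : ContinuousOn dg (Icc a b)) :
    ContinuousOn (fun x : ℝ × ℝ => varCoeff G a ((x.1 : ℂ) - I * ε) dg x.2)
      (univ ×ˢ Icc a b) := by
  obtain ⟨K, hK0, hK⟩ := exists_lipschitz_fundR hG hab hε
  obtain ⟨c, hc⟩ := isCompact_Icc.exists_bound_of_continuousOn hdg
  have hc0 : 0 ≤ c := (norm_nonneg _).trans (hc a ⟨le_rfl, hab⟩)
  have hba : 0 ≤ b - a := sub_nonneg.2 hab
  have hz := fun (τ : ℝ) (v : ℝ) (_ : v ∈ Icc a b) => ofReal_ne_line hε τ v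
  have hL0 : 0 ≤ Fintype.card n * c * K * (b - a) := by positivity
  refine continuousOn_prod_of_continuousOn_lipschitzOnWith _
    (Fintype.card n * c * K * (b - a)).toNNReal
    (fun τ _ w hw => (hasDerivWithinAt_varCoeff hG.cont (hz τ) hdg hw).continuousWithinAt)
    fun w hw => LipschitzOnWith.of_dist_le_mul fun τ₁ _ τ₂ _ => ?_
  have hi : ∀ τ : ℝ, IntervalIntegrable (fun ξ => dg ξ ᵥ* fundZ G a ((τ : ℂ) - I * ε) ξ)
      volume a w := fun τ => ContinuousOn.intervalIntegrable (by
    rw [uIcc_of_le hw.1]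
    exact (continuousOn_vecMul_fundZ hG.cont (hz τ) hdg).mono (Icc_subset_Icc_right hw.2))
  rw [Real.coe_toNNReal _ hL0, dist_eq_norm, Real.dist_eq]
  simp only [varCoeff]
  rw [← intervalIntegral.integral_sub (hi τ₁) (hi τ₂)]
  refine (intervalIntegral.norm_integral_le_of_norm_le_const
    (C := Fintype.card n * c * (K * |τ₁ - τ₂|)) fun v hv => ?_).trans ?_
  · rw [uIoc_of_le hw.1] at hv
    have hv' : v ∈ Icc a b := ⟨hv.1.le, hv.2.trans hw.2⟩
    rw [← Matrix.vecMul_sub]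
    refine (norm_vecMul_le _ _).trans ?_
    have h1 : ∀ z, fundZ G a z v = fundR G a z v a := fun z => by
      rw [fundR, fundY_self, mul_one]
    have h2 := hK τ₁ τ₂ v hv' a ⟨le_rfl, hab⟩
    rw [← h1, ← h1] at h2
    gcongr
    exact hc v hv'
  · rw [abs_of_nonneg (sub_nonneg.2 hw.1)]
    calc _ ≤ Fintype.card n * c * (K * |τ₁ - τ₂|) * (b - a) := by
          gcongr; exact hw.2
      _ = _ := by ring

end Lines

namespace TriangularModel

open Complex (I)
open Set
open scoped Matrix.Norms.Operator

variable {p r s : ℕ} (D : TriangularModel p r s) {g dg : ℝ → Fin r ⊕ Fin s → ℂ} {ε : ℝ}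

/-- The quadratic form of `Π̃(w)`. -/
def rowForm (x : Fin r ⊕ Fin s → ℂ) (w : ℝ) : ℝ := ((x ᵥ* D.PiSq w) ⬝ᵥ star x).re

lemma rowForm_eq_norm_sq (x : Fin r ⊕ Fin s → ℂ) (w : ℝ) :
    D.rowForm x w = ‖(WithLp.toLp 2 (x ᵥ* (D.Pi w)ᴴ) : EuclideanSpace ℂ (Fin p))‖ ^ 2 := by
  have h1 : inner ℂ (WithLp.toLp 2 (x ᵥ* (D.Pi w)ᴴ) : EuclideanSpace ℂ (Fin p))
      (WithLp.toLp 2 (x ᵥ* (D.Pi w)ᴴ)) = (x ᵥ* D.PiSq w) ⬝ᵥ star x := by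
    rw [inner_row, PiSq]
    simp only [Matrix.star_vecMul, Matrix.conjTranspose_conjTranspose, Matrix.conjTranspose_mul,
      Matrix.dotProduct_mulVec, Matrix.vecMul_vecMul]
  rw [rowForm, ← h1, inner_self_eq_norm_sq_to_K]
  norm_cast

lemma rowForm_nonneg (x : Fin r ⊕ Fin s → ℂ) (w : ℝ) : 0 ≤ D.rowForm x w := by
  rw [rowForm_eq_norm_sq]; positivity

lemma rowForm_le {w : ℝ} (hw : w ∈ Icc D.a D.b) (x : Fin r ⊕ Fin s → ℂ) :
    D.rowForm x w ≤ (Fintype.card (Fin r ⊕ Fin s) * ‖x‖) ^ 2 := by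
  rw [rowForm_eq_norm_sq]
  exact pow_le_pow_left₀ (norm_nonneg _)
    ((D.sum_sq_vecMul_conjTranspose_Pi_le hw x).trans (norm_toLp_le x)) 2

lemma rowForm_smul (c : ℂ) (x : Fin r ⊕ Fin s → ℂ) (w : ℝ) :
    D.rowForm (c • x) w = ‖c‖ ^ 2 * D.rowForm x w := by
  rw [rowForm_eq_norm_sq, rowForm_eq_norm_sq, Matrix.smul_vecMul, WithLp.toLp_smul, norm_smul,
    mul_pow]

lemma continuousOn_rowForm {X : Type*} [TopologicalSpace X] {x : X → Fin r ⊕ Fin s → ℂ}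
    {w : X → ℝ} {t : Set X} (hx : ContinuousOn x t) (hw : ContinuousOn w t)
    (hwt : MapsTo w t (Icc D.a D.b)) : ContinuousOn (fun y => D.rowForm (x y) (w y)) t := by
  have h1 : ContinuousOn (fun y => D.PiSq (w y)) t := D.continuousOn_PiSq.comp hw hwt
  have h2 : ContinuousOn (fun y => x y ᵥ* D.PiSq (w y)) t :=
    hx.vecMul h1
  refine Complex.continuous_re.comp_continuousOn ?_
  simp only [dotProduct]
  refine continuousOn_finsetSum _ fun j _ => ?_
  exact ((continuous_apply j).comp_continuousOn h2).mul
    (continuous_star.comp_continuousOn ((continuous_apply j).comp_continuousOn hx))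

lemma continuousOn_resPsi_line (hε : 0 < ε) (hdg : ContinuousOn dg (Icc D.a D.b)) :
    ContinuousOn (fun x : ℝ × ℝ => D.resPsi g dg ((x.1 : ℂ) - I * ε) x.2)
      (univ ×ˢ Icc D.a D.b) := by
  have hY := continuousOn_fundY_line D.isSkewKernel_G D.a_lt_b.le hε
  have hV := continuousOn_varCoeff_line D.isSkewKernel_G D.a_lt_b.le hε hdg
  have hb : ContinuousOn (fun x : ℝ × ℝ => ((x.1, D.b) : ℝ × ℝ)) (univ ×ˢ Icc D.a D.b) :=
    (by fun_prop : Continuous fun x : ℝ × ℝ => ((x.1, D.b) : ℝ × ℝ)).continuousOn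
  have hm : MapsTo (fun x : ℝ × ℝ => ((x.1, D.b) : ℝ × ℝ)) (univ ×ˢ Icc D.a D.b)
      (univ ×ˢ Icc D.a D.b) := fun x _ => ⟨mem_univ _, D.right_mem⟩
  have hYb : ContinuousOn (fun x : ℝ × ℝ => fundY D.G D.a ((x.1 : ℂ) - I * ε) D.b)
      (univ ×ˢ Icc D.a D.b) := hY.comp hb hm
  have hVb : ContinuousOn (fun x : ℝ × ℝ => varCoeff D.G D.a ((x.1 : ℂ) - I * ε) dg D.b)
      (univ ×ˢ Icc D.a D.b) := hV.comp hb hm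
  have h1 : ContinuousOn (fun x : ℝ × ℝ =>
      g D.a + varCoeff D.G D.a ((x.1 : ℂ) - I * ε) dg D.b) (univ ×ˢ Icc D.a D.b) :=
    continuousOn_const.add hVb
  have h2 : ContinuousOn (fun x : ℝ × ℝ => g D.b - (g D.a +
      varCoeff D.G D.a ((x.1 : ℂ) - I * ε) dg D.b) ᵥ* fundY D.G D.a ((x.1 : ℂ) - I * ε) D.b)
      (univ ×ˢ Icc D.a D.b) := continuousOn_const.sub (h1.vecMul hYb)
  have hS : ContinuousOn (fun _ : ℝ × ℝ => D.S) (univ ×ˢ Icc D.a D.b) := continuousOn_const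
  have hq : ContinuousOn (fun x : ℝ × ℝ => D.resCoeff g dg ((x.1 : ℂ) - I * ε))
      (univ ×ˢ Icc D.a D.b) := h2.vecMul hS
  have h3 : ContinuousOn (fun x : ℝ × ℝ => g D.a + D.resCoeff g dg ((x.1 : ℂ) - I * ε) +
      varCoeff D.G D.a ((x.1 : ℂ) - I * ε) dg x.2) (univ ×ˢ Icc D.a D.b) :=
    (continuousOn_const.add hq).add hV
  exact h3.vecMul hY

/-- The bound is independent of `z`, because the bounds of the fundamental matrices are. It is the
dominating constant in all later passages to the limit. -/
lemma exists_norm_resPsi_le (hdg : ContinuousOn dg (Icc D.a D.b)) :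
    ∃ C : ℝ, 0 ≤ C ∧ ∀ z : ℂ, (∀ v ∈ Icc D.a D.b, (v : ℂ) ≠ z) → ∀ w ∈ Icc D.a D.b,
      ‖D.resPsi g dg z w‖ ≤ C := by
  obtain ⟨c, hc⟩ := isCompact_Icc.exists_bound_of_continuousOn hdg
  have hc0 : 0 ≤ c := (norm_nonneg _).trans (hc _ D.left_mem)
  set N : ℝ := (Fintype.card (Fin r ⊕ Fin s) : ℝ) with hN
  set F := fundBound (Fin r ⊕ Fin s) with hF
  have hN0 : 0 ≤ N := by positivity
  have hF0 : 0 ≤ F := fundBound_nonneg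
  have hba : 0 ≤ D.b - D.a := sub_nonneg.2 D.a_lt_b.le
  set V : ℝ := N * c * F * (D.b - D.a) with hV
  have hV0 : 0 ≤ V := by positivity
  set A : ℝ := N * (‖g D.b‖ + N * (‖g D.a‖ + V) * F) * ‖D.S‖ with hA
  have hA0 : 0 ≤ A := by positivity
  refine ⟨N * (‖g D.a‖ + A + V) * F, by positivity, fun z hz w hw => ?_⟩
  have hY : ∀ w ∈ Icc D.a D.b, ‖fundY D.G D.a z w‖ ≤ F := fun w hw =>
    norm_fundY_le D.isSkewKernel_G hz hw
  have hv : ∀ w ∈ Icc D.a D.b, ‖varCoeff D.G D.a z dg w‖ ≤ V := fun w hw =>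
    norm_varCoeff_le D.isSkewKernel_G hz hc hw
  have hq : ‖D.resCoeff g dg z‖ ≤ A := by
    refine (norm_vecMul_le _ _).trans ?_
    have h1 : ‖(g D.a + varCoeff D.G D.a z dg D.b) ᵥ* fundY D.G D.a z D.b‖ ≤
        N * (‖g D.a‖ + V) * F := by
      refine (norm_vecMul_le _ _).trans ?_
      have h2 := (norm_add_le (g D.a) (varCoeff D.G D.a z dg D.b)).trans
        (add_le_add_right (hv _ D.right_mem) _)
      have := hY _ D.right_mem
      gcongr
    have h3 := (norm_sub_le (g D.b) ((g D.a + varCoeff D.G D.a z dg D.b) ᵥ* fundY D.G D.a z D.b)).trans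
      (add_le_add_right h1 _)
    rw [hA]
    gcongr
  refine (norm_vecMul_le _ _).trans ?_
  have h4 : ‖g D.a + D.resCoeff g dg z + varCoeff D.G D.a z dg w‖ ≤ ‖g D.a‖ + A + V :=
    (norm_add_le _ _).trans (add_le_add ((norm_add_le _ _).trans (add_le_add_right hq _)) (hv w hw))
  have := hY w hw
  gcongr

lemma norm_sq_resolvent (hε : 0 < ε) (hdg : ContinuousOn dg (Icc D.a D.b)) (τ : ℝ) :
    ‖D.resolvent (g := g) (z := (τ : ℂ) - I * ε) (fun v _ => ofReal_ne_line hε τ v) hdg‖ ^ 2 =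
      ∫ w, ((w - τ) ^ 2 + ε ^ 2)⁻¹ * D.rowForm (D.resPsi g dg ((τ : ℂ) - I * ε) w) w ∂D.μ := by
  rw [← L2_integral_norm_sq]
  refine integral_congr_ae ?_
  filter_upwards [D.coeFn_row (D.continuousOn_resolvent (g := g)
    (z := (τ : ℂ) - I * ε) (fun v _ => ofReal_ne_line hε τ v) hdg)] with w hw
  unfold resolvent
  rw [hw, ← rowForm_eq_norm_sq, rowForm_smul]
  congr 1
  rw [norm_inv, inv_pow, ← Complex.normSq_eq_norm_sq, Complex.normSq_apply]
  congr 1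
  simp
  ring

/-- The Poisson kernel of the half-plane at height one. -/
def poisson (σ : ℝ) : ℝ := (Real.pi * (1 + σ ^ 2))⁻¹

lemma poisson_nonneg (σ : ℝ) : 0 ≤ poisson σ := by
  unfold poisson
  have := Real.pi_pos
  positivity

lemma integrable_poisson : Integrable poisson := by
  unfold poisson
  simp only [mul_inv]
  exact integrable_inv_one_add_sq.const_mul _

lemma integral_poisson : ∫ σ, poisson σ = 1 := by
  unfold poisson
  simp only [mul_inv]
  rw [integral_const_mul, integral_univ_inv_one_add_sq, inv_mul_cancel₀ Real.pi_ne_zero]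

lemma inv_add_sq_eq (hε : 0 < ε) (w σ : ℝ) :
    ((w - (ε * σ + w)) ^ 2 + ε ^ 2)⁻¹ = Real.pi * (ε⁻¹ ^ 2 * poisson σ) := by
  unfold poisson
  have := Real.pi_ne_zero
  have h2 : 1 + σ ^ 2 ≠ 0 := by positivity
  have h3 : (w - (ε * σ + w)) ^ 2 + ε ^ 2 ≠ 0 := by positivity
  field_simp
  ring

lemma integrable_inv_add_sq (hε : 0 < ε) (w : ℝ) :
    Integrable fun τ : ℝ => ((w - τ) ^ 2 + ε ^ 2)⁻¹ := by
  have h := (integrable_poisson.const_mul (Real.pi * ε⁻¹ ^ 2)).comp_div hε.ne' |>.comp_sub_right w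
  refine h.congr (Eventually.of_forall fun τ => ?_)
  simp only
  have := inv_add_sq_eq hε w ((τ - w) / ε)
  rw [mul_div_cancel₀ _ hε.ne', sub_add_cancel] at this
  rw [this]
  ring

/-- Weighted square integrals of the resolvent on horizontal lines, in rescaled variables. -/
theorem resolvent_mean_eq (hε : 0 < ε) (hdg : ContinuousOn dg (Icc D.a D.b)) :
    Integrable (fun w => ∫ σ, poisson σ *
      D.rowForm (D.resPsi g dg (lowerPt w σ ε) w) w) D.μ ∧
    ε / Real.pi * ∫ τ : ℝ, ‖D.resolvent (g := g) (z := (τ : ℂ) - I * ε)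
      (fun v _ => ofReal_ne_line hε τ v) hdg‖ ^ 2 =
    ∫ w, (∫ σ, poisson σ * D.rowForm (D.resPsi g dg (lowerPt w σ ε) w) w) ∂D.μ := by
  obtain ⟨C, hC0, hC⟩ := D.exists_norm_resPsi_le (g := g) hdg
  set M : ℝ := (Fintype.card (Fin r ⊕ Fin s) * C) ^ 2 with hM
  set F : ℝ → ℝ → ℝ := fun τ w => ((w - τ) ^ 2 + ε ^ 2)⁻¹ *
    D.rowForm (D.resPsi g dg ((τ : ℂ) - I * ε) w) w with hF
  have hF0 : ∀ τ w, 0 ≤ F τ w := fun τ w => mul_nonneg (by positivity) (D.rowForm_nonneg _ _)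
  have hFM : ∀ τ, ∀ w ∈ Icc D.a D.b, F τ w ≤ ((w - τ) ^ 2 + ε ^ 2)⁻¹ * M := fun τ w hw => by
    refine mul_le_mul_of_nonneg_left ((D.rowForm_le hw _).trans ?_) (by positivity)
    rw [hM]
    gcongr
    exact hC _ (fun v _ => ofReal_ne_line hε τ v) w hw
  have hFc : ContinuousOn (Function.uncurry F) (univ ×ˢ Icc D.a D.b) := by
    refine ContinuousOn.mul ?_ (D.continuousOn_rowForm (D.continuousOn_resPsi_line hε hdg)
      continuous_snd.continuousOn fun x hx => hx.2)
    refine Continuous.continuousOn (Continuous.inv₀ (by fun_prop) fun x => ?_)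
    positivity
  have hmeas : AEStronglyMeasurable (Function.uncurry F) (volume.prod D.μ) := by
    have := hFc.aestronglyMeasurable (μ := (volume : Measure ℝ).prod volume)
      (MeasurableSet.univ.prod measurableSet_Icc)
    rwa [← Measure.prod_restrict, Measure.restrict_univ] at this
  have hsec : ∀ w ∈ Icc D.a D.b, Integrable (fun τ => F τ w) := fun w hw => by
    refine Integrable.mono' ((integrable_inv_add_sq hε w).mul_const M) ?_
      (Eventually.of_forall fun τ => ?_)
    · refine Continuous.aestronglyMeasurable ?_
      have h1 : ContinuousOn (fun τ : ℝ => Function.uncurry F (τ, w)) univ :=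
        hFc.comp (by fun_prop) fun τ _ => ⟨mem_univ _, hw⟩
      exact continuousOn_univ.1 h1
    · rw [Real.norm_of_nonneg (hF0 τ w)]
      exact hFM τ w hw
  -- The substitution τ = w + εσ turns |w - z|⁻² dτ into (π/ε) times the Poisson measure in σ, and τ
  -- - iε becomes w + ε(σ - i).
  have hval : ∀ w, ∫ τ, F τ w =
      Real.pi * ε⁻¹ * ∫ σ, poisson σ * D.rowForm (D.resPsi g dg (lowerPt w σ ε) w) w := fun w => by
    have h1 : ∫ τ, F τ w = ε * ∫ σ, F (ε * σ + w) w := by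
      rw [Measure.integral_comp_mul_left (fun τ => F (τ + w) w), integral_add_right_eq_self
        (fun τ => F τ w), abs_of_pos (inv_pos.2 hε), smul_eq_mul, mul_inv_cancel_left₀ hε.ne']
    rw [h1, ← integral_const_mul, ← integral_const_mul]
    refine integral_congr_ae (Eventually.of_forall fun σ => ?_)
    have h2 : (((ε * σ + w : ℝ) : ℂ) - I * ε) = lowerPt w σ ε := by
      unfold lowerPt; push_cast; ring
    simp only [hF]
    rw [h2, inv_add_sq_eq hε]
    field_simp
  have hint : Integrable (Function.uncurry F) (volume.prod D.μ) := by
    refine (integrable_prod_iff' hmeas).2 ⟨?_, ?_⟩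
    · filter_upwards [ae_restrict_mem measurableSet_Icc] with w hw using hsec w hw
    · have h1 := hmeas.norm.prod_swap.integral_prod_right'
      refine Integrable.of_bound (C := Real.pi * ε⁻¹ * M) h1 ?_
      filter_upwards [ae_restrict_mem measurableSet_Icc] with w hw
      rw [Real.norm_of_nonneg (integral_nonneg fun _ => norm_nonneg _)]
      calc _ ≤ ∫ τ, ((w - τ) ^ 2 + ε ^ 2)⁻¹ * M := by
            refine integral_mono (hsec w hw).norm
              ((integrable_inv_add_sq hε w).mul_const M) fun τ => ?_
            change ‖F τ w‖ ≤ _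
            rw [Real.norm_of_nonneg (hF0 τ w)]
            exact hFM τ w hw
        _ = _ := by
            rw [integral_mul_const]
            congr 1
            have h2 : ∫ τ : ℝ, ((w - τ) ^ 2 + ε ^ 2)⁻¹ =
                ε * ∫ σ : ℝ, ((w - (ε * σ + w)) ^ 2 + ε ^ 2)⁻¹ := by
              rw [Measure.integral_comp_mul_left (fun τ => ((w - (τ + w)) ^ 2 + ε ^ 2)⁻¹),
                integral_add_right_eq_self (fun τ => ((w - τ) ^ 2 + ε ^ 2)⁻¹),
                abs_of_pos (inv_pos.2 hε), smul_eq_mul, mul_inv_cancel_left₀ hε.ne']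
            rw [h2]
            simp only [inv_add_sq_eq hε]
            rw [integral_const_mul, integral_const_mul, integral_poisson]
            field_simp
  constructor
  · have h1 := hint.integral_prod_right
    simp only [Function.uncurry_apply_pair, hval] at h1
    have h2 := h1.const_mul (Real.pi * ε⁻¹)⁻¹
    have : Real.pi * ε⁻¹ ≠ 0 := mul_ne_zero Real.pi_ne_zero (inv_ne_zero hε.ne')
    simpa only [inv_mul_cancel_left₀ this] using h2
  · simp only [D.norm_sq_resolvent hε hdg]
    have h1 := integral_integral_swap hint
    simp only [hF] at h1
    rw [h1]
    have h2 : ∀ w, ∫ τ : ℝ, ((w - τ) ^ 2 + ε ^ 2)⁻¹ *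
        D.rowForm (D.resPsi g dg ((τ : ℂ) - I * ε) w) w = _ := hval
    simp only [h2]
    rw [integral_const_mul, ← mul_assoc]
    have : ε / Real.pi * (Real.pi * ε⁻¹) = 1 := by
      have := Real.pi_ne_zero
      field_simp
    rw [this, one_mul]

end TriangularModel

/-! ### Boundary values of the resolvent -/

lemma Filter.Tendsto.vecMul {ι n : Type*} [Fintype n] {l : Filter ι} {c : ι → n → ℂ} {c₀ : n → ℂ}
    {M : ι → Matrix n n ℂ} {M₀ : Matrix n n ℂ} (hc : Tendsto c l (𝓝 c₀)) (hM : Tendsto M l (𝓝 M₀)) :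
    Tendsto (fun i => c i ᵥ* M i) l (𝓝 (c₀ ᵥ* M₀)) := by
  rw [tendsto_pi_nhds] at hc ⊢
  intro j
  simp only [Matrix.vecMul, dotProduct]
  refine tendsto_finsetSum _ fun i _ => (hc i).mul ?_
  exact (((continuous_apply_apply i j).tendsto M₀).comp hM :)

section BoundaryIntegrals

open Set
open scoped Matrix.Norms.Operator

variable {n : Type*} [Fintype n] [DecidableEq n] {G : ℝ → Matrix n n ℂ} {a b : ℝ}

lemma ofReal_ne_lowerPt {w σ ε : ℝ} (hε : 0 < ε) (v : ℝ) : (v : ℂ) ≠ lowerPt w σ ε :=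
  ofReal_ne_of_im_ne_zero (by rw [lowerPt_im]; linarith) v

/-- Dominated convergence for integrals of row vectors against bounded matrix functions. -/
lemma tendsto_integral_vecMul {dg : ℝ → n → ℂ} (hdg : ContinuousOn dg (Icc a b))
    {R : ℝ → ℝ → Matrix n n ℂ} {R₀ : ℝ → Matrix n n ℂ} {F c d : ℝ} (hcd : c ≤ d)
    (hsub : Icc c d ⊆ Icc a b) (hRc : ∀ ε, 0 < ε → ContinuousOn (R ε) (Icc c d))
    (hRb : ∀ ε, 0 < ε → ∀ ξ ∈ Icc c d, ‖R ε ξ‖ ≤ F)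
    (hlim : ∀ᵐ ξ, ξ ∈ Ioc c d → Tendsto (fun ε => R ε ξ) (𝓝[>] 0) (𝓝 (R₀ ξ))) :
    IntervalIntegrable (fun ξ => dg ξ ᵥ* R₀ ξ) volume c d ∧
      Tendsto (fun ε => ∫ ξ in c..d, dg ξ ᵥ* R ε ξ) (𝓝[>] 0) (𝓝 (∫ ξ in c..d, dg ξ ᵥ* R₀ ξ)) := by
  obtain ⟨k, hk⟩ := isCompact_Icc.exists_bound_of_continuousOn hdg
  have hbound : ∀ ε, 0 < ε → ∀ ξ ∈ Icc c d, ‖dg ξ ᵥ* R ε ξ‖ ≤ Fintype.card n * k * F := by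
    intro ε hε ξ hξ
    have hk0 : 0 ≤ k := (norm_nonneg _).trans (hk ξ (hsub hξ))
    refine (norm_vecMul_le _ _).trans ?_
    have := hk ξ (hsub hξ)
    have := hRb ε hε ξ hξ
    gcongr
  have hmeas : ∀ ε, 0 < ε →
      AEStronglyMeasurable (fun ξ => dg ξ ᵥ* R ε ξ) (volume.restrict (Ioc c d)) := fun ε hε => by
    have h1 : ContinuousOn (fun ξ => dg ξ ᵥ* R ε ξ) (Icc c d) := (hdg.mono hsub).vecMul (hRc ε hε)
    exact (h1.mono Ioc_subset_Icc_self).aestronglyMeasurable measurableSet_Ioc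
  have hlim' : ∀ᵐ ξ, ξ ∈ Ioc c d →
      Tendsto (fun ε => dg ξ ᵥ* R ε ξ) (𝓝[>] 0) (𝓝 (dg ξ ᵥ* R₀ ξ)) := by
    filter_upwards [hlim] with ξ h hξ
    exact tendsto_const_nhds.vecMul (h hξ)
  -- Continuity of the boundary value `R₀` in ξ is not assumed. Measurability comes from convergence
  -- along ε = 1/(k + 1).
  have hmeas₀ : AEStronglyMeasurable (fun ξ => dg ξ ᵥ* R₀ ξ) (volume.restrict (Ioc c d)) := by
    have hu : Tendsto (fun k : ℕ => 1 / ((k : ℝ) + 1)) atTop (𝓝[>] 0) :=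
      tendsto_nhdsWithin_iff.2 ⟨tendsto_one_div_add_atTop_nhds_zero_nat,
        Eventually.of_forall fun k => Set.mem_Ioi.2 (by positivity)⟩
    refine aestronglyMeasurable_of_tendsto_ae atTop
      (f := fun (k : ℕ) ξ => dg ξ ᵥ* R (1 / ((k : ℝ) + 1)) ξ)
      (fun k => hmeas _ (by positivity)) ?_
    rw [ae_restrict_iff' measurableSet_Ioc]
    filter_upwards [hlim'] with ξ h hξ
    exact (h hξ).comp hu
  have hb₀ : ∀ᵐ ξ, ξ ∈ Ioc c d → ‖dg ξ ᵥ* R₀ ξ‖ ≤ Fintype.card n * k * F := by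
    filter_upwards [hlim'] with ξ h hξ
    refine le_of_tendsto (h hξ).norm ?_
    filter_upwards [self_mem_nhdsWithin] with ε hε
    exact hbound ε hε ξ (Ioc_subset_Icc_self hξ)
  constructor
  · rw [intervalIntegrable_iff_integrableOn_Ioc_of_le hcd]
    exact Integrable.of_bound hmeas₀ _ ((ae_restrict_iff' measurableSet_Ioc).2 hb₀)
  · refine intervalIntegral.tendsto_integral_filter_of_dominated_convergence
      (fun _ => Fintype.card n * k * F) ?_ ?_ intervalIntegrable_const ?_
    · filter_upwards [self_mem_nhdsWithin] with ε hε
      rw [uIoc_of_le hcd]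
      exact hmeas ε hε
    · filter_upwards [self_mem_nhdsWithin] with ε hε
      refine Eventually.of_forall fun ξ hξ => ?_
      rw [uIoc_of_le hcd] at hξ
      exact hbound ε hε ξ (Ioc_subset_Icc_self hξ)
    · rwa [uIoc_of_le hcd]

lemma ae_ne_volume (w : ℝ) : ∀ᵐ ξ : ℝ, ξ ≠ w := by
  rw [ae_iff]; simp

/-- Up to `w` only transition matrices to the left of `w` occur. They are continuous up to the real
point, so the limit is the same integral at `z = w`; the singular end point is a null set. -/
lemma tendsto_varCoeff_lowerPt (hG : IsSkewKernel G a b) {dg : ℝ → n → ℂ}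
    (hdg : ContinuousOn dg (Icc a b)) {w : ℝ} (hw : w ∈ Ioc a b) (σ : ℝ) :
    IntervalIntegrable (fun ξ => dg ξ ᵥ* fundZ G a w ξ) volume a w ∧
      Tendsto (fun ε => varCoeff G a (lowerPt w σ ε) dg w) (𝓝[>] 0) (𝓝 (varCoeff G a w dg w)) := by
  refine tendsto_integral_vecMul hdg (R := fun ε => fundZ G a (lowerPt w σ ε))
    (R₀ := fundZ G a w) (F := fundBound n) hw.1.le
    (Icc_subset_Icc_right hw.2) (fun ε hε => ?_) (fun ε hε ξ hξ => ?_) ?_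
  · exact (continuousOn_fundZ hG.cont fun v _ => ofReal_ne_lowerPt hε v).mono
      (Icc_subset_Icc_right hw.2)
  · exact norm_fundZ_le hG (fun v _ => ofReal_ne_lowerPt hε v) ⟨hξ.1, hξ.2.trans hw.2⟩
  · filter_upwards [ae_ne_volume w] with ξ hne hξ
    have h := (tendsto_fundR_left hG hw.2 (ξ := ξ) (v := a) ⟨hξ.1.le, lt_of_le_of_ne hξ.2 hne⟩
      ⟨le_rfl, hw.1⟩).comp (tendsto_lowerPt w σ)
    have h1 : ∀ z, fundR G a z ξ a = fundZ G a z ξ := fun z => by rw [fundR, fundY_self, mul_one]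
    rw [h1] at h
    exact h.congr fun ε => h1 _

lemma tendsto_integral_fundR_across (hG : IsSkewKernel G a b) {dg : ℝ → n → ℂ}
    (hdg : ContinuousOn dg (Icc a b)) {w : ℝ} (hw : w ∈ Ioo a b) (hH : HolderAt G a b w)
    (σ : ℝ) {R : ℝ → Matrix n n ℂ}
    (hR : ∀ ξ ∈ Icc a b, ξ ≠ w → ∀ σ,
      Tendsto (fun ε => fundR G a (lowerPt w σ ε) ξ b) (𝓝[>] 0) (𝓝 (R ξ))) :
    IntervalIntegrable (fun ξ => dg ξ ᵥ* R ξ) volume a b ∧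
      Tendsto (fun ε => ∫ ξ in a..b, dg ξ ᵥ* fundR G a (lowerPt w σ ε) ξ b) (𝓝[>] 0)
        (𝓝 (∫ ξ in a..b, dg ξ ᵥ* R ξ)) := by
  have hab : a ≤ b := hw.1.le.trans hw.2.le
  refine tendsto_integral_vecMul hdg (R := fun ε ξ => fundR G a (lowerPt w σ ε) ξ b)
    (F := fundBound n ^ 2) hab subset_rfl (fun ε hε => ?_) (fun ε hε ξ hξ => ?_) ?_
  · exact continuousOn_fundR_left hG.cont (fun v _ => ofReal_ne_lowerPt hε v) b
  · exact norm_fundR_le hG (fun v _ => ofReal_ne_lowerPt hε v) hξ ⟨hab, le_rfl⟩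
  · filter_upwards [ae_ne_volume w] with ξ hne hξ
    exact hR ξ (Ioc_subset_Icc_self hξ) hne σ

lemma integral_vecMul {f : ℝ → n → ℂ} {c d : ℝ} (hf : IntervalIntegrable f volume c d)
    (M : Matrix n n ℂ) : (∫ ξ in c..d, f ξ) ᵥ* M = ∫ ξ in c..d, f ξ ᵥ* M :=
  ((Matrix.vecMulLinear M).toContinuousLinearMap.intervalIntegral_comp_comm hf).symm

lemma varCoeff_vecMul_fundY (hG : IsSkewKernel G a b) (hab : a ≤ b) {z : ℂ}
    (hz : ∀ v ∈ Icc a b, (v : ℂ) ≠ z) {dg : ℝ → n → ℂ} (hdg : ContinuousOn dg (Icc a b)) :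
    varCoeff G a z dg b ᵥ* fundY G a z b = ∫ ξ in a..b, dg ξ ᵥ* fundR G a z ξ b := by
  have h1 := continuousOn_vecMul_fundZ hG.cont hz hdg
  rw [varCoeff, integral_vecMul (h1.mono (by rw [uIcc_of_le hab])).intervalIntegrable]
  simp only [Matrix.vecMul_vecMul, fundR]

end BoundaryIntegrals

/-! ### Diagonal blocks of multiplicative integrals, exponentials and Gamma functions -/

section Blocks

open Set
open scoped Matrix.Norms.Operator

variable {n : Type*} [Fintype n] [DecidableEq n]

/-- `M₂ = M P` is the diagonal block of `M` cut out by the projection `P`. -/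
structure IsBlock (P M M₂ : Matrix n n ℂ) : Prop where
  proj : P * P = P
  mul_left : P * M = M₂
  mul_right : M * P = M₂

namespace IsBlock

variable {P M M₂ : Matrix n n ℂ}

lemma left (h : IsBlock P M M₂) : P * M₂ = M₂ := by
  rw [← h.mul_left, ← mul_assoc, h.proj]

lemma right (h : IsBlock P M M₂) : M₂ * P = M₂ := by
  rw [← h.mul_right, mul_assoc, h.proj]

lemma smul (h : IsBlock P M M₂) (c : ℂ) : IsBlock P (c • M) (c • M₂) where
  proj := h.proj
  mul_left := by rw [mul_smul_comm, h.mul_left]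
  mul_right := by rw [smul_mul_assoc, h.mul_right]

lemma neg (h : IsBlock P M M₂) : IsBlock P (-M) (-M₂) where
  proj := h.proj
  mul_left := by rw [mul_neg, h.mul_left]
  mul_right := by rw [neg_mul, h.mul_right]

lemma intertwine (h : IsBlock P M M₂) : P * M = M₂ * P := by rw [h.mul_left, h.right]

lemma exp_mul (h : IsBlock P M M₂) :
    NormedSpace.exp M₂ * P = P * NormedSpace.exp M := (exp_intertwine h.intertwine).symm

lemma mul_exp (h : IsBlock P M M₂) :
    P * NormedSpace.exp M₂ = NormedSpace.exp M * P :=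
  exp_intertwine (by rw [h.mul_right, h.left])

lemma compl_mul_exp (h : IsBlock P M M₂) : (1 - P) * NormedSpace.exp M₂ = 1 - P := by
  have := exp_intertwine (P := 1 - P) (M := M₂) (N := 0) (by rw [sub_mul, h.left]; simp)
  rwa [NormedSpace.exp_zero, one_mul] at this

lemma gammaOneAdd_inv_mul (h : IsBlock P M M₂) (hM : Mᴴ = -M) (hM₂ : M₂ᴴ = -M₂) :
    (gammaOneAdd M₂)⁻¹ * P = P * (gammaOneAdd M)⁻¹ := by
  have h1 := gammaOneAdd_intertwine hM hM₂ h.intertwine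
  have u1 := (Matrix.isUnit_iff_isUnit_det _).1 (isUnit_gammaOneAdd_and_integral hM).1
  have u2 := (Matrix.isUnit_iff_isUnit_det _).1 (isUnit_gammaOneAdd_and_integral hM₂).1
  calc (gammaOneAdd M₂)⁻¹ * P
      = (gammaOneAdd M₂)⁻¹ * (P * gammaOneAdd M) * (gammaOneAdd M)⁻¹ := by
        rw [mul_assoc, mul_assoc, Matrix.mul_nonsing_inv _ u1, mul_one]
    _ = _ := by
        rw [h1, ← mul_assoc, Matrix.nonsing_inv_mul _ u2, one_mul]

end IsBlock

/-- The projection `P` commutes with `M`, so the equation decouples: the compressed coefficient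
vanishes on the complement, where the solution stays 1, and agrees with `M` on the range of `P`. -/
lemma mulIntRight_of_isBlock {P : Matrix n n ℂ} {M M₂ : ℝ → Matrix n n ℂ} {a b : ℝ} (hab : a ≤ b)
    (hM : ContinuousOn M (Icc a b)) (h : ∀ v ∈ Icc a b, IsBlock P (M v) (M₂ v)) :
    mulIntRight M₂ a b = (1 - P) + mulIntRight M a b * P := by
  have hM₂ : ContinuousOn M₂ (Icc a b) :=
    (hM.mul continuousOn_const).congr fun v hv => (h v hv).mul_right.symm
  refine mulIntRight_eq (Y := fun w => (1 - P) + mulIntRight M a w * P) hab hM₂ ?_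
    fun v hv => ?_
  · simp [mulIntRight_self]
  · have h1 := ((hasDerivWithinAt_mulIntRight hM hv).mul_const P).const_add (1 - P)
    convert! h1 using 1
    rw [add_mul, sub_mul, one_mul, (h v hv).left, sub_self, zero_add, mul_assoc, (h v hv).left,
      mul_assoc, (h v hv).mul_right]

lemma mulIntLeft_of_isBlock {P : Matrix n n ℂ} {M M₂ : ℝ → Matrix n n ℂ} {a b : ℝ} (hab : a ≤ b)
    (hM : ContinuousOn M (Icc a b)) (h : ∀ v ∈ Icc a b, IsBlock P (M v) (M₂ v)) :
    mulIntLeft M₂ a b = (1 - P) + P * mulIntLeft M a b := by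
  have hM₂ : ContinuousOn M₂ (Icc a b) :=
    (hM.mul continuousOn_const).congr fun v hv => (h v hv).mul_right.symm
  refine mulIntLeft_eq (Y := fun w => (1 - P) + P * mulIntLeft M a w) hab hM₂ ?_
    fun v hv => ?_
  · simp [mulIntLeft_self]
  · have h1 := ((hasDerivWithinAt_mulIntLeft hM hv).const_mul P).const_add (1 - P)
    convert! h1 using 1
    rw [mul_add, mul_sub, mul_one, (h v hv).right, sub_self, zero_add, ← mul_assoc, (h v hv).right,
      ← mul_assoc, (h v hv).mul_left]

end Blocks

/-! ### The factors of the limit operator -/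

namespace TriangularModel

open Complex (I)
open Set
open scoped Matrix.Norms.Operator

variable {p r s : ℕ} (D : TriangularModel p r s)

/-- Since `J` is 1 on the first block and -1 on the second, the blocks of `G` are i Π̃₁ and -i Π̃₂.
These are the constants c₁ = i and c₂ = -i of the theorem. -/
lemma isBlock_G₁ {w : ℝ} (hw : w ∈ Icc D.a D.b) :
    IsBlock (blockJ₁ r s) (D.G w) (I • D.PiSq₁ w) := by
  have h1 := (D.commute_PiSq_J₁ hw).eq
  have h2 : D.J * blockJ₁ r s = blockJ₁ r s := by
    rw [J, sub_mul, blockJ₁_mul_self, blockJ₂_mul_blockJ₁, sub_zero]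
  have h3 : D.G w * blockJ₁ r s = I • D.PiSq₁ w := by
    rw [G, smul_mul_assoc, mul_assoc, h2, PiSq₁, ← h1, mul_assoc, blockJ₁_mul_self]
  exact ⟨blockJ₁_mul_self r s, by rw [← h3, (D.commute_G_J₁ hw).eq], h3⟩

lemma isBlock_G₂ {w : ℝ} (hw : w ∈ Icc D.a D.b) :
    IsBlock (blockJ₂ r s) (D.G w) (-I • D.PiSq₂ w) := by
  have h1 := (D.commute_PiSq_J₂ hw).eq
  have h2 : D.J * blockJ₂ r s = -blockJ₂ r s := by
    rw [J, sub_mul, blockJ₂_mul_self, blockJ₁_mul_blockJ₂, zero_sub]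
  have h3 : D.G w * blockJ₂ r s = -I • D.PiSq₂ w := by
    rw [G, smul_mul_assoc, mul_assoc, h2, PiSq₂, ← h1, mul_assoc, blockJ₂_mul_self, mul_neg,
      smul_neg, neg_smul]
  exact ⟨blockJ₂_mul_self r s, by rw [← h3, (D.commute_G_J₂ hw).eq], h3⟩

lemma one_sub_blockJ₂ (r s : ℕ) : 1 - blockJ₂ r s = blockJ₁ r s :=
  sub_eq_of_eq_add (blockJ_add r s).symm

lemma ofReal_ne_of_lt {c w : ℝ} (h : c < w) {v : ℝ} (hv : v ∈ Icc D.a c) : (v : ℂ) ≠ w :=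
  fun e => (hv.2.trans_lt h).ne (Complex.ofReal_injective e)

variable {P : Matrix (Fin r ⊕ Fin s) (Fin r ⊕ Fin s) ℂ} {c : ℂ}
  {N : ℝ → Matrix (Fin r ⊕ Fin s) (Fin r ⊕ Fin s) ℂ}

lemma leftFactor_eq (h : ∀ v ∈ Icc D.a D.b, IsBlock P (D.G v) (c • N v)) {ξ w : ℝ}
    (hw : w ≤ D.b) (hξ : ξ ∈ Ico D.a w) :
    D.leftFactor c N ξ w = (1 - P) + fundZ D.G D.a w ξ * P := by
  have hG := D.isSkewKernel_G.mono (hξ.2.le.trans hw)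
  have hz := fun v hv => D.ofReal_ne_of_lt hξ.2 (v := v) hv
  have hsub : Icc D.a ξ ⊆ Icc D.a D.b := Icc_subset_Icc_right (hξ.2.le.trans hw)
  have h1 : (fun v : ℝ => (c / ((v : ℂ) - w)) • N v) =
      fun v : ℝ => ((v : ℂ) - w)⁻¹ • (c • N v) := by
    ext1 v; rw [smul_smul, div_eq_inv_mul]
  have hc : Commute (fundZ D.G D.a w ξ) P :=
    commute_fundZ hG.cont hz (fun v hv => by
      rw [Commute, SemiconjBy, (h v (hsub hv)).mul_left, (h v (hsub hv)).mul_right])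
      ⟨hξ.1, le_rfl⟩
  rw [leftFactor, h1, hc.eq]
  exact mulIntLeft_of_isBlock hξ.1 (continuousOn_cauchyKernel_smul hG.cont hz)
    fun v hv => (h v (hsub hv)).smul _

lemma mulIntRight_of_isBlock_G (h : ∀ v ∈ Icc D.a D.b, IsBlock P (D.G v) (c • N v)) {z : ℂ}
    {ξ d : ℝ} (hd : d ≤ D.b) (hξ : ξ ∈ Icc D.a d) (hz : ∀ v ∈ Icc D.a d, (v : ℂ) ≠ z) :
    mulIntRight (fun v : ℝ => (-c / ((v : ℂ) - z)) • N v) ξ d =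
      (1 - P) + fundR D.G D.a z ξ d * P := by
  have hG := D.isSkewKernel_G.mono hd
  have hc := (continuousOn_cauchyKernel_smul hG.cont hz).fun_neg
  have h1 : (fun v : ℝ => (-c / ((v : ℂ) - z)) • N v) =
      fun v : ℝ => -(((v : ℂ) - z)⁻¹ • (c • N v)) := by
    ext1 v; rw [smul_smul, ← neg_smul, div_eq_inv_mul, mul_neg]
  have h2 : fundR D.G D.a z ξ d =
      mulIntRight (fun v : ℝ => -(((v : ℂ) - z)⁻¹ • D.G v)) ξ d := by
    rw [mulIntRight_eq_mul hξ hc, fundR, fundZ, fundY]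
    simp only [neg_neg]
  rw [h1, h2]
  exact mulIntRight_of_isBlock hξ.2 (hc.mono (Icc_subset_Icc_left hξ.1))
    fun v hv => ((h v ⟨hξ.1.trans hv.1, hv.2.trans hd⟩).smul _).neg

lemma integral_inv_sub {w δ : ℝ} (hw : D.a < w) (hδ : δ ∈ Ioo 0 (w - D.a)) :
    ∫ v in D.a..(w - δ), 1 / ((v : ℂ) - w) = (Real.log δ : ℂ) - Real.log (w - D.a) := by
  have h1 : ∀ v : ℝ, 1 / ((v : ℂ) - w) = ((v - w)⁻¹ : ℝ) := fun v => by push_cast; ring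
  simp only [h1]
  rw [intervalIntegral.integral_ofReal, intervalIntegral.integral_comp_sub_right (fun v => v⁻¹),
    integral_inv_of_neg (by linarith) (by linarith [hδ.1]), ← Complex.ofReal_sub,
    Real.log_div (by linarith [hδ.1]) (by linarith), ← Real.log_neg_eq_log (w - δ - w),
    ← Real.log_neg_eq_log (D.a - w)]
  congr 3 <;> ring

/-- The left multiplicative integral up to `w`, regularized by the value of the kernel at `w`. -/
lemma regFactor_eq (h : ∀ v ∈ Icc D.a D.b, IsBlock P (D.G v) (c • N v)) {w : ℝ}
    (hw : w ∈ Ioo D.a D.b) {A : Matrix (Fin r ⊕ Fin s) (Fin r ⊕ Fin s) ℂ}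
    (hA : Tendsto (fun δ : ℝ => fundR D.G D.a w D.a (w - δ) *
      NormedSpace.exp ((Real.log δ + Real.pi * I) • D.G w)) (𝓝[>] 0) (𝓝 A)) :
    D.regFactor c N w = (1 - P) +
      A * NormedSpace.exp ((-(Real.pi * I) - Real.log (w - D.a)) • D.G w) * P := by
  -- The exponent in `regFactor` is log δ - log(w - a), whereas `hA` contains log δ + πi. The
  -- constant difference gives the additional exponential factor.
  refine Tendsto.limUnder_eq (Tendsto.congr' ?_
    (((hA.mul_const _).mul_const P).const_add (1 - P)))
  filter_upwards [Ioo_mem_nhdsGT (sub_pos.2 hw.1)] with δ hδ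
  have hδ1 : w - δ < w := by linarith [hδ.1]
  have hb := h w ⟨hw.1.le, hw.2.le⟩
  rw [D.mulIntRight_of_isBlock_G h (z := w) (hδ1.le.trans hw.2.le) ⟨le_rfl, by linarith [hδ.2]⟩
      fun v hv => D.ofReal_ne_of_lt hδ1 hv, D.integral_inv_sub hw.1 hδ, mul_comm c, ← smul_smul,
    add_mul, (hb.smul _).compl_mul_exp, mul_assoc _ P, (hb.smul _).mul_exp, mul_assoc _ _ P,
    mul_assoc, ← mul_assoc (NormedSpace.exp _), ← exp_add_smul, ← mul_assoc, ← mul_assoc]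
  congr 5
  ring

/-- The matrix in the definition of `T₊` that comes from the Gamma function. -/
def gammaFactor (w : ℝ) : Matrix (Fin r ⊕ Fin s) (Fin r ⊕ Fin s) ℂ :=
  NormedSpace.exp ((-(Real.pi / 2) * I) • D.G w) * (gammaOneAdd (D.G w))⁻¹

lemma commute_gammaOneAdd_inv {w : ℝ} (hw : w ∈ Icc D.a D.b)
    {M : Matrix (Fin r ⊕ Fin s) (Fin r ⊕ Fin s) ℂ} (hM : Commute M (D.G w)) :
    Commute M (gammaOneAdd (D.G w))⁻¹ := by
  have h1 := (commute_gammaOneAdd (D.isSkewKernel_G.skew w hw) hM).eq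
  have u := (Matrix.isUnit_iff_isUnit_det _).1
    (isUnit_gammaOneAdd_and_integral (D.isSkewKernel_G.skew w hw)).1
  calc M * (gammaOneAdd (D.G w))⁻¹
      = (gammaOneAdd (D.G w))⁻¹ * (gammaOneAdd (D.G w) * M) * (gammaOneAdd (D.G w))⁻¹ := by
        rw [← mul_assoc, Matrix.nonsing_inv_mul _ u, one_mul]
    _ = _ := by rw [← h1, mul_assoc, mul_assoc, Matrix.mul_nonsing_inv _ u, mul_one]

/-- On a block all exponentials are functions of `G w`, and their exponents add: -πi - log(w - a)
from the regularization, log(w - a) from the power, and πi/2 from the third factor leave -πi/2, the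
exponent in `gammaFactor`. -/
lemma block_Tplus (h : ∀ v ∈ Icc D.a D.b, IsBlock P (D.G v) (c • N v)) (hP : Pᴴ = P) {w : ℝ}
    (hw : w ∈ Ioo D.a D.b) {A : Matrix (Fin r ⊕ Fin s) (Fin r ⊕ Fin s) ℂ}
    (hA : Tendsto (fun δ : ℝ => fundR D.G D.a w D.a (w - δ) *
      NormedSpace.exp ((Real.log δ + Real.pi * I) • D.G w)) (𝓝[>] 0) (𝓝 A)) :
    P * D.regFactor c N w * NormedSpace.exp ((c * (Real.log (w - D.a) : ℂ)) • N w) *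
      NormedSpace.exp ((Real.pi / 2 * I * c) • N w) * (gammaOneAdd (c • N w))⁻¹ * P =
    A * D.gammaFactor w * P := by
  have hwI : w ∈ Icc D.a D.b := ⟨hw.1.le, hw.2.le⟩
  have hb := h w hwI
  have hGP : ∀ v ∈ Icc D.a D.b, Commute (D.G v) P := fun v hv => by
    rw [Commute, SemiconjBy, (h v hv).mul_left, (h v hv).mul_right]
  have hexp : ∀ t : ℂ, Commute (NormedSpace.exp (t • D.G w)) P := fun t =>
    (((hGP w hwI).smul_left t).symm.exp_right).symm
  have hAP : Commute A P := by
    have h1 := hA.mul_const P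
    have h2 := hA.const_mul P
    refine tendsto_nhds_unique h1 (h2.congr' ?_)
    filter_upwards [Ioo_mem_nhdsGT (sub_pos.2 hw.1)] with δ hδ
    have hδ1 : w - δ < w := by linarith [hδ.1]
    have hG := D.isSkewKernel_G.mono (hδ1.le.trans hw.2.le)
    have h3 : Commute (fundR D.G D.a w D.a (w - δ)) P := by
      rw [fundR_left]
      exact commute_fundY hG.cont (fun v hv => D.ofReal_ne_of_lt hδ1 hv)
        (fun v hv => hGP v ⟨hv.1, hv.2.trans (hδ1.le.trans hw.2.le)⟩)
        ⟨by linarith [hδ.2], le_rfl⟩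
    exact (h3.mul_left (hexp _)).eq.symm
  have hskew := D.isSkewKernel_G.skew w hwI
  have hskew₂ : (c • N w)ᴴ = -(c • N w) := by
    rw [← hb.mul_right, Matrix.conjTranspose_mul, hskew, hP, mul_neg, hb.mul_left, hb.mul_right]
  have e1 : NormedSpace.exp ((c * (Real.log (w - D.a) : ℂ)) • N w) =
      NormedSpace.exp ((Real.log (w - D.a) : ℂ) • (c • N w)) := by rw [smul_smul, mul_comm]
  have e2 : NormedSpace.exp ((Real.pi / 2 * I * c) • N w) =
      NormedSpace.exp ((Real.pi / 2 * I) • (c • N w)) := by rw [smul_smul]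
  rw [D.regFactor_eq h hw hA, e1, e2, mul_add, mul_sub, mul_one, hb.proj, sub_self, zero_add]
  set e := NormedSpace.exp ((-(Real.pi * I) - Real.log (w - D.a)) • D.G w) with he
  calc _ = P * A * e * P * NormedSpace.exp ((Real.log (w - D.a) : ℂ) • (c • N w)) *
        NormedSpace.exp ((Real.pi / 2 * I) • (c • N w)) * ((gammaOneAdd (c • N w))⁻¹ * P) := by
        simp only [mul_assoc]
    _ = P * A * e * P * NormedSpace.exp ((Real.log (w - D.a) : ℂ) • (c • N w)) *
        (NormedSpace.exp ((Real.pi / 2 * I) • (c • N w)) * P) * (gammaOneAdd (D.G w))⁻¹ := by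
        rw [hb.gammaOneAdd_inv_mul hskew hskew₂]; simp only [mul_assoc]
    _ = P * A * e * P * (NormedSpace.exp ((Real.log (w - D.a) : ℂ) • (c • N w)) *
        P) * NormedSpace.exp ((Real.pi / 2 * I) • D.G w) * (gammaOneAdd (D.G w))⁻¹ := by
        rw [(hb.smul _).exp_mul]; simp only [mul_assoc]
    _ = P * A * e * (P * P) * NormedSpace.exp ((Real.log (w - D.a) : ℂ) • D.G w) *
        NormedSpace.exp ((Real.pi / 2 * I) • D.G w) * (gammaOneAdd (D.G w))⁻¹ := by
        rw [(hb.smul _).exp_mul]; simp only [mul_assoc]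
    _ = P * A * P * (e * NormedSpace.exp ((Real.log (w - D.a) : ℂ) • D.G w) *
        NormedSpace.exp ((Real.pi / 2 * I) • D.G w)) * (gammaOneAdd (D.G w))⁻¹ := by
        rw [hb.proj, mul_assoc (P * A) e P, he, (hexp _).eq]; simp only [mul_assoc]
    _ = A * P * (NormedSpace.exp ((-(Real.pi / 2) * I) • D.G w) * (gammaOneAdd (D.G w))⁻¹) := by
        rw [he, ← exp_add_smul, ← exp_add_smul, ← hAP.eq, mul_assoc A P P, hb.proj, mul_assoc]
        congr 5
        ring
    _ = _ := by
        rw [gammaFactor, mul_assoc A, mul_assoc A]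
        congr 1
        exact ((hexp _).mul_left
          (D.commute_gammaOneAdd_inv hwI (hGP w hwI).symm).symm).eq.symm

lemma conjTranspose_blockJ₁ (r s : ℕ) : (blockJ₁ r s)ᴴ = blockJ₁ r s := by
  simp [blockJ₁, Matrix.fromBlocks_conjTranspose]

lemma conjTranspose_blockJ₂ (r s : ℕ) : (blockJ₂ r s)ᴴ = blockJ₂ r s := by
  simp [blockJ₂, Matrix.fromBlocks_conjTranspose]

lemma Tplus_eq {w : ℝ} (hw : w ∈ Ioo D.a D.b) {A : Matrix (Fin r ⊕ Fin s) (Fin r ⊕ Fin s) ℂ}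
    (hA : Tendsto (fun δ : ℝ => fundR D.G D.a w D.a (w - δ) *
      NormedSpace.exp ((Real.log δ + Real.pi * I) • D.G w)) (𝓝[>] 0) (𝓝 A)) :
    D.Tplus w = A * D.gammaFactor w * (D.Pi w)ᴴ := by
  have h1 := D.block_Tplus (fun v hv => D.isBlock_G₁ hv) (conjTranspose_blockJ₁ r s) hw hA
  have h2 := D.block_Tplus (fun v hv => D.isBlock_G₂ hv) (conjTranspose_blockJ₂ r s) hw hA
  have e1 : (Real.pi / 2 * I * I : ℂ) = -(Real.pi : ℂ) / 2 := by
    rw [mul_assoc, Complex.I_mul_I]; ring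
  have e2 : (Real.pi / 2 * I * -I : ℂ) = (Real.pi : ℂ) / 2 := by
    rw [mul_assoc, mul_neg, Complex.I_mul_I]; ring
  rw [e1] at h1
  rw [e2] at h2
  rw [Tplus, h1, h2, ← mul_add, blockJ_add, mul_one]

/-- The vertical approach w - iε is the direction σ = 0. Only the second block of the transition
matrix appears, which suffices because this factor is always followed by S = J₂ S. -/
lemma boundaryFactor_eq {ξ w : ℝ} (hξ : ξ ∈ Icc D.a D.b)
    {R : Matrix (Fin r ⊕ Fin s) (Fin r ⊕ Fin s) ℂ}
    (hR : Tendsto (fun ε => fundR D.G D.a (lowerPt w 0 ε) ξ D.b) (𝓝[>] 0) (𝓝 R)) :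
    D.boundaryFactor ξ w = blockJ₁ r s + R * blockJ₂ r s := by
  refine Tendsto.limUnder_eq (Tendsto.congr' ?_ ((hR.mul_const _).const_add (blockJ₁ r s)))
  filter_upwards [self_mem_nhdsWithin] with ε hε
  have h1 : (w : ℂ) - I * ε = lowerPt w 0 ε := by unfold lowerPt; push_cast; ring
  have h2 := D.mulIntRight_of_isBlock_G (fun v hv => D.isBlock_G₂ hv) (z := lowerPt w 0 ε)
    le_rfl hξ fun v _ => ofReal_ne_lowerPt hε v
  rw [neg_neg, one_sub_blockJ₂] at h2
  rw [h1, h2]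

lemma integral_leftFactor (h : ∀ v ∈ Icc D.a D.b, IsBlock P (D.G v) (c • N v))
    {dg : ℝ → Fin r ⊕ Fin s → ℂ} (hdg : ContinuousOn dg (Icc D.a D.b)) {w : ℝ}
    (hw : w ∈ Ioo D.a D.b) :
    (∫ ξ in D.a..w, dg ξ ᵥ* D.leftFactor c N ξ w) ᵥ* P = varCoeff D.G D.a w dg w ᵥ* P := by
  have hi := (tendsto_varCoeff_lowerPt D.isSkewKernel_G hdg (Ioo_subset_Ioc_self hw) 0).1
  have hae : ∀ᵐ ξ, ξ ∈ uIoc D.a w →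
      dg ξ ᵥ* D.leftFactor c N ξ w = dg ξ ᵥ* (1 - P) + (dg ξ ᵥ* fundZ D.G D.a w ξ) ᵥ* P := by
    filter_upwards [ae_ne_volume w] with ξ hne hξ
    rw [uIoc_of_le hw.1.le] at hξ
    rw [D.leftFactor_eq h hw.2.le ⟨hξ.1.le, lt_of_le_of_ne hξ.2 hne⟩, Matrix.vecMul_add,
      Matrix.vecMul_vecMul]
  have hP : P * P = P := (h D.a D.left_mem).proj
  have hdg' : ContinuousOn dg (uIcc D.a w) :=
    hdg.mono (by rw [uIcc_of_le hw.1.le]; exact Icc_subset_Icc_right hw.2.le)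
  have hc : ContinuousOn (fun ξ => dg ξ ᵥ* (1 - P : Matrix (Fin r ⊕ Fin s) (Fin r ⊕ Fin s) ℂ))
      (uIcc D.a w) := hdg'.vecMul (M := fun _ => 1 - P) continuousOn_const
  have i1 := hc.intervalIntegrable (μ := volume)
  have i2 : IntervalIntegrable (fun ξ => (dg ξ ᵥ* fundZ D.G D.a w ξ) ᵥ* P) volume D.a w := by
    have := (Matrix.vecMulLinear P).toContinuousLinearMap.integrable_comp
      ((intervalIntegrable_iff.1 hi : IntegrableOn _ _ _))
    exact intervalIntegrable_iff.2 this
  rw [intervalIntegral.integral_congr_ae hae, intervalIntegral.integral_add i1 i2,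
    Matrix.add_vecMul, integral_vecMul i1, integral_vecMul i2, varCoeff, integral_vecMul hi]
  simp only [Matrix.vecMul_vecMul, sub_mul, mul_assoc, hP, one_mul, sub_self, Matrix.vecMul_zero,
    intervalIntegral.integral_zero, zero_add]

/-- The vector function `Ŝ₊ f` in terms of the fundamental matrices. -/
lemma hatSplus_eq {f : ℝ → Fin p → ℂ} (hdg : ContinuousOn (deriv (D.tilde f)) (Icc D.a D.b))
    {w : ℝ} (hw : w ∈ Ioo D.a D.b) {R : ℝ → Matrix (Fin r ⊕ Fin s) (Fin r ⊕ Fin s) ℂ}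
    (hR : ∀ ξ ∈ Icc D.a D.b, ξ ≠ w → ∀ σ,
      Tendsto (fun ε => fundR D.G D.a (lowerPt w σ ε) ξ D.b) (𝓝[>] 0) (𝓝 (R ξ))) :
    D.hatSplus f w = varCoeff D.G D.a w (deriv (D.tilde f)) w -
      (∫ ξ in D.a..D.b, deriv (D.tilde f) ξ ᵥ* R ξ) ᵥ* D.S := by
  set dg := deriv (D.tilde f) with hdgdef
  have h1 := D.integral_leftFactor (fun v hv => D.isBlock_G₁ hv) hdg hw
  have h2 := D.integral_leftFactor (fun v hv => D.isBlock_G₂ hv) hdg hw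
  have hi := (tendsto_integral_fundR_across D.isSkewKernel_G hdg hw
    (D.holderAt_G ⟨hw.1.le, hw.2.le⟩) 0 hR).1
  have hae : ∀ᵐ ξ, ξ ∈ uIoc D.a D.b →
      dg ξ ᵥ* D.boundaryFactor ξ w = dg ξ ᵥ* blockJ₁ r s + (dg ξ ᵥ* R ξ) ᵥ* blockJ₂ r s := by
    filter_upwards [ae_ne_volume w] with ξ hne hξ
    rw [uIoc_of_le D.a_lt_b.le] at hξ
    have hξ' := Ioc_subset_Icc_self hξ
    rw [D.boundaryFactor_eq hξ' (hR ξ hξ' hne 0), Matrix.vecMul_add, Matrix.vecMul_vecMul]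
  have i1 : IntervalIntegrable (fun ξ => dg ξ ᵥ* blockJ₁ r s) volume D.a D.b := by
    refine ContinuousOn.intervalIntegrable ?_
    rw [uIcc_of_le D.a_lt_b.le]
    exact hdg.vecMul (M := fun _ => blockJ₁ r s) continuousOn_const
  have i2 : IntervalIntegrable (fun ξ => (dg ξ ᵥ* R ξ) ᵥ* blockJ₂ r s) volume D.a D.b :=
    intervalIntegrable_iff.2 ((Matrix.vecMulLinear (blockJ₂ r s)).toContinuousLinearMap.integrable_comp
      ((intervalIntegrable_iff.1 hi : IntegrableOn _ _ _)))
  have h3 : (∫ ξ in D.a..D.b, dg ξ ᵥ* D.boundaryFactor ξ w) ᵥ* D.S =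
      (∫ ξ in D.a..D.b, dg ξ ᵥ* R ξ) ᵥ* D.S := by
    rw [intervalIntegral.integral_congr_ae hae, intervalIntegral.integral_add i1 i2,
      Matrix.add_vecMul, integral_vecMul i1, integral_vecMul i2, integral_vecMul hi]
    simp only [Matrix.vecMul_vecMul, J₁_mul_S, mul_assoc, ← (S_eq D).1, Matrix.vecMul_zero,
      intervalIntegral.integral_zero, zero_add]
  rw [hatSplus, h1, h2, h3, ← Matrix.vecMul_add, blockJ_add, Matrix.vecMul_one]

end TriangularModel

/-! ### Pointwise limits of the resolvent means -/

namespace TriangularModel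

open Complex (I)
open Set
open scoped Matrix.Norms.Operator

variable {p r s : ℕ} (D : TriangularModel p r s)

lemma conjTranspose_exp_smul_G {w : ℝ} (hw : w ∈ Icc D.a D.b) (t : ℂ) :
    (NormedSpace.exp (t • D.G w))ᴴ = NormedSpace.exp ((-star t) • D.G w) := by
  rw [← Matrix.exp_conjTranspose, Matrix.conjTranspose_smul, D.isSkewKernel_G.skew w hw, smul_neg,
    neg_smul]

lemma commute_exp_smul_G (w : ℝ) {M : Matrix (Fin r ⊕ Fin s) (Fin r ⊕ Fin s) ℂ}
    (hM : Commute M (D.G w)) (t : ℂ) : Commute M (NormedSpace.exp (t • D.G w)) :=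
  (hM.smul_right t).exp_right

/-- The form `x Π̃ x*` after the change of variable `y = x e^{l G}`. -/
lemma rowForm_eq_phase {w : ℝ} (hw : w ∈ Icc D.a D.b) (l : ℂ) (x : Fin r ⊕ Fin s → ℂ) :
    D.rowForm x w = (((x ᵥ* NormedSpace.exp (l • D.G w)) ᵥ*
      (NormedSpace.exp ((-2 * I * l.im) • D.G w) * D.PiSq w)) ⬝ᵥ
        star (x ᵥ* NormedSpace.exp (l • D.G w))).re := by
  have h1 := (D.commute_exp_smul_G w (D.commute_PiSq_G hw) (-star l)).eq
  -- As `G w` is skew, the adjoint of exp (l G) is exp (-l̄ G). Conjugation thus leaves only the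
  -- exponent l - l̄ = 2i Im l: the divergent modulus of the logarithm cancels, and its argument
  -- stays.
  have h2 : NormedSpace.exp (l • D.G w) * (NormedSpace.exp ((-2 * I * l.im) • D.G w) *
      D.PiSq w) * NormedSpace.exp ((-star l) • D.G w) = D.PiSq w := by
    rw [mul_assoc, mul_assoc, h1, ← mul_assoc, ← mul_assoc, ← exp_add_smul, ← exp_add_smul]
    have : l + -2 * I * l.im + -star l = 0 := by
      apply Complex.ext <;> simp
      ring
    rw [this, zero_smul, NormedSpace.exp_zero, one_mul]
  rw [Matrix.star_vecMul, Matrix.dotProduct_mulVec, Matrix.vecMul_vecMul, Matrix.vecMul_vecMul,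
    D.conjTranspose_exp_smul_G hw, ← mul_assoc, h2, rowForm]

lemma vecMul_mul_dotProduct (x : Fin r ⊕ Fin s → ℂ)
    (M K : Matrix (Fin r ⊕ Fin s) (Fin r ⊕ Fin s) ℂ) :
    (x ᵥ* (M * K)) ⬝ᵥ star x = ∑ j, ∑ i, M i j * (x i * (K *ᵥ star x) j) := by
  rw [← Matrix.vecMul_vecMul, ← Matrix.dotProduct_mulVec]
  simp only [dotProduct, Matrix.vecMul, Finset.sum_mul]
  exact Finset.sum_congr rfl fun j _ => Finset.sum_congr rfl fun i _ => by ring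

/-- All factors commute, and exp (-(πi/2) G) is Hermitian, so it is squared to exp (-πi G). The
result has the form produced by the Poisson average. -/
lemma gammaFactor_mul_PiSq {w : ℝ} (hw : w ∈ Icc D.a D.b) :
    D.gammaFactor w * D.PiSq w * (D.gammaFactor w)ᴴ =
      NormedSpace.exp ((-Real.pi * I) • D.G w) *
        ((gammaOneAdd (D.G w))⁻¹ * ((gammaOneAdd (D.G w))⁻¹)ᴴ) * D.PiSq w := by
  set e := NormedSpace.exp ((-(Real.pi / 2) * I) • D.G w) with he
  set T := (gammaOneAdd (D.G w))⁻¹ with hT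
  have heH : eᴴ = e := by
    rw [he, D.conjTranspose_exp_smul_G hw]
    congr 2
    simp
  have hTe : Commute T e := D.commute_exp_smul_G w
    (D.commute_gammaOneAdd_inv hw (Commute.refl _)).symm _
  have hPe : Commute (D.PiSq w) e := D.commute_exp_smul_G w (D.commute_PiSq_G hw) _
  have hPT : Commute (D.PiSq w) T := D.commute_gammaOneAdd_inv hw (D.commute_PiSq_G hw)
  have hTHe : Commute Tᴴ e := by
    have := congrArg Matrix.conjTranspose hTe.eq
    rw [Matrix.conjTranspose_mul, Matrix.conjTranspose_mul, heH] at this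
    exact this.symm
  have hTHP : Commute Tᴴ (D.PiSq w) := by
    have := congrArg Matrix.conjTranspose hPT.eq
    rw [Matrix.conjTranspose_mul, Matrix.conjTranspose_mul, conjTranspose_PiSq] at this
    exact this
  have hee : NormedSpace.exp ((-Real.pi * I) • D.G w) = e * e := by
    rw [he, ← exp_add_smul]
    congr 2
    ring
  rw [gammaFactor, ← he, ← hT, Matrix.conjTranspose_mul, heH, hee]
  calc e * T * D.PiSq w * (Tᴴ * e) = e * (T * (D.PiSq w * Tᴴ) * e) := by simp only [mul_assoc]
    _ = e * (e * (T * (D.PiSq w * Tᴴ))) := by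
        rw [(hTe.mul_left (hPe.mul_left hTHe)).eq]
    _ = _ := by rw [← hTHP.eq]; simp only [mul_assoc]

lemma rowForm_gammaFactor {w : ℝ} (hw : w ∈ Icc D.a D.b) (x : Fin r ⊕ Fin s → ℂ) :
    D.rowForm (x ᵥ* D.gammaFactor w) w =
      ((x ᵥ* (NormedSpace.exp ((-Real.pi * I) • D.G w) *
        ((gammaOneAdd (D.G w))⁻¹ * ((gammaOneAdd (D.G w))⁻¹)ᴴ) * D.PiSq w)) ⬝ᵥ star x).re := by
  rw [rowForm, Matrix.star_vecMul, Matrix.dotProduct_mulVec, Matrix.vecMul_vecMul,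
    Matrix.vecMul_vecMul, ← mul_assoc, D.gammaFactor_mul_PiSq hw]

/-- The Poisson average of the phases produces the Gamma factor. -/
lemma integral_poisson_phase {w : ℝ} (hw : w ∈ Icc D.a D.b) (x : Fin r ⊕ Fin s → ℂ) :
    ∫ σ, poisson σ * ((x ᵥ* (NormedSpace.exp ((-2 * I * Complex.arg (I - σ)) • D.G w) *
      D.PiSq w)) ⬝ᵥ star x).re = D.rowForm (x ᵥ* D.gammaFactor w) w := by
  have h := (isUnit_gammaOneAdd_and_integral (D.isSkewKernel_G.skew w hw)).2
  have h1 : ∀ σ : ℝ, poisson σ * ((x ᵥ* (NormedSpace.exp ((-2 * I * Complex.arg (I - σ)) •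
      D.G w) * D.PiSq w)) ⬝ᵥ star x).re =
      (∑ j, ∑ i, (((Real.pi * (1 + σ ^ 2) : ℝ) : ℂ)⁻¹ *
        NormedSpace.exp ((-2 * I * Complex.arg (I - σ)) • D.G w) i j) *
          (x i * (D.PiSq w *ᵥ star x) j)).re := fun σ => by
    rw [vecMul_mul_dotProduct, poisson, ← Complex.re_ofReal_mul, Finset.mul_sum]
    congr 1
    refine Finset.sum_congr rfl fun j _ => ?_
    rw [Finset.mul_sum]
    refine Finset.sum_congr rfl fun i _ => ?_
    rw [Complex.ofReal_inv]
    ring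
  have hi : ∀ j i, Integrable fun σ : ℝ => (((Real.pi * (1 + σ ^ 2) : ℝ) : ℂ)⁻¹ *
        NormedSpace.exp ((-2 * I * Complex.arg (I - σ)) • D.G w) i j) *
          (x i * (D.PiSq w *ᵥ star x) j) := fun j i => (h i j).1.mul_const _
  simp only [h1]
  rw [D.rowForm_gammaFactor hw, vecMul_mul_dotProduct]
  have h2 := integral_re (integrable_finsetSum Finset.univ fun j _ =>
    integrable_finsetSum Finset.univ fun i _ => hi j i)
  refine h2.trans ?_
  rw [RCLike.re_eq_complex_re]
  congr 1
  rw [integral_finsetSum _ fun j _ => integrable_finsetSum _ fun i _ => hi j i]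
  refine Finset.sum_congr rfl fun j _ => ?_
  rw [integral_finsetSum _ fun i _ => hi j i]
  refine Finset.sum_congr rfl fun i _ => ?_
  rw [integral_mul_const, (h i j).2]

/-- Along a ray w - z = ε(i - σ), whose argument does not depend on ε; the direction survives in the
limit as a phase. -/
lemma log_sub_lowerPt_im {ε : ℝ} (hε : 0 < ε) (w σ : ℝ) :
    (Complex.log ((w : ℂ) - lowerPt w σ ε)).im = Complex.arg (I - σ) := by
  have : (w : ℂ) - lowerPt w σ ε = ε * (I - σ) := by unfold lowerPt; ring
  rw [this, Complex.log_im, Complex.arg_real_mul _ hε]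

lemma lowerPt_eq (w σ ε : ℝ) : lowerPt w σ ε = ((w + ε * σ : ℝ) : ℂ) - I * ε := by
  unfold lowerPt; push_cast; ring

variable {f : ℝ → Fin p → ℂ}

lemma exists_boundary_fundR {w : ℝ} (hw : w ∈ Ioo D.a D.b) :
    ∃ R : ℝ → Matrix (Fin r ⊕ Fin s) (Fin r ⊕ Fin s) ℂ,
      ∀ ξ ∈ Icc D.a D.b, ξ ≠ w → ∀ σ,
        Tendsto (fun ε => fundR D.G D.a (lowerPt w σ ε) ξ D.b) (𝓝[>] 0) (𝓝 (R ξ)) := by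
  have hwI : w ∈ Icc D.a D.b := ⟨hw.1.le, hw.2.le⟩
  have hex : ∀ ξ : ℝ, ∃ R : Matrix (Fin r ⊕ Fin s) (Fin r ⊕ Fin s) ℂ,
      ξ ∈ Icc D.a D.b → ξ ≠ w → ∀ σ,
        Tendsto (fun ε => fundR D.G D.a (lowerPt w σ ε) ξ D.b) (𝓝[>] 0) (𝓝 R) := fun ξ => by
    by_cases h : ξ ∈ Icc D.a D.b ∧ ξ ≠ w
    · obtain ⟨R, hR⟩ := exists_tendsto_fundR_across D.isSkewKernel_G hwI (D.holderAt_G hwI) h.1 h.2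
        D.right_mem hw.2.ne'
      exact ⟨R, fun _ _ => hR⟩
    · exact ⟨0, fun h1 h2 => absurd ⟨h1, h2⟩ h⟩
  choose R hR using hex
  exact ⟨R, hR⟩

/-- The boundary values of the regularized resolvent. -/
lemma exists_tendsto_resPsi (hdg : ContinuousOn (deriv (D.tilde f)) (Icc D.a D.b))
    (ha : D.tilde f D.a = 0) (hb : D.tilde f D.b = 0) {w : ℝ} (hw : w ∈ Ioo D.a D.b) :
    ∃ x : Fin r ⊕ Fin s → ℂ, (∀ σ, Tendsto (fun ε =>
      D.resPsi (D.tilde f) (deriv (D.tilde f)) (lowerPt w σ ε) w ᵥ*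
        NormedSpace.exp (Complex.log ((w : ℂ) - lowerPt w σ ε) • D.G w)) (𝓝[>] 0) (𝓝 x)) ∧
      D.hatSplus f w ᵥ* D.Tplus w = (x ᵥ* D.gammaFactor w) ᵥ* (D.Pi w)ᴴ := by
  set dg := deriv (D.tilde f) with hdgdef
  have hwI : w ∈ Icc D.a D.b := ⟨hw.1.le, hw.2.le⟩
  have hG := D.isSkewKernel_G
  have hH := D.holderAt_G hwI
  obtain ⟨A, hA1, hA2⟩ := tendsto_fundR_mul_exp_left hG hwI hH (ξ := D.a) ⟨le_rfl, hw.1⟩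
  obtain ⟨R, hR⟩ := D.exists_boundary_fundR hw
  -- Because f̃ vanishes at both ends, Ψ(w) is a row vector times the fundamental matrix, and this
  -- row vector consists of the two integrals in `hatSplus_eq`. The row tends to Ŝ₊f(w), and the
  -- regularized matrix tends to `A`.
  refine ⟨D.hatSplus f w ᵥ* A, fun σ => ?_, ?_⟩
  · have h1 := (tendsto_varCoeff_lowerPt hG hdg (Ioo_subset_Ioc_self hw) σ).2
    have h2 := (tendsto_integral_fundR_across hG hdg hw hH σ hR).2
    have h3 : Tendsto (fun ε => (∫ ξ in D.a..D.b, dg ξ ᵥ* fundR D.G D.a (lowerPt w σ ε) ξ D.b) ᵥ*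
        D.S) (𝓝[>] 0) (𝓝 ((∫ ξ in D.a..D.b, dg ξ ᵥ* R ξ) ᵥ* D.S)) :=
      h2.vecMul tendsto_const_nhds
    have h4 := (h1.sub h3).vecMul (hA1 σ)
    rw [← D.hatSplus_eq hdg hw hR] at h4
    refine h4.congr' ?_
    filter_upwards [self_mem_nhdsWithin] with ε hε
    have hz : ∀ v ∈ Icc D.a D.b, (v : ℂ) ≠ lowerPt w σ ε := fun v _ => ofReal_ne_lowerPt hε v
    rw [resPsi, resCoeff, ha, hb, zero_add, zero_sub, zero_add,
      varCoeff_vecMul_fundY hG D.a_lt_b.le hz hdg, Matrix.neg_vecMul, neg_add_eq_sub, fundR_left,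
      Matrix.vecMul_vecMul]
  · rw [D.Tplus_eq hw hA2, Matrix.vecMul_vecMul, Matrix.vecMul_vecMul, Matrix.mul_assoc]

lemma continuousOn_resPsi_lowerPt {g dg : ℝ → Fin r ⊕ Fin s → ℂ}
    (hdg : ContinuousOn dg (Icc D.a D.b)) {ε : ℝ} (hε : 0 < ε) :
    ContinuousOn (fun x : ℝ × ℝ => D.resPsi g dg (lowerPt x.2 x.1 ε) x.2)
      (univ ×ˢ Icc D.a D.b) := by
  have h : ContinuousOn (fun x : ℝ × ℝ => ((x.2 + ε * x.1, x.2) : ℝ × ℝ)) (univ ×ˢ Icc D.a D.b) :=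
    (by fun_prop : Continuous fun x : ℝ × ℝ => ((x.2 + ε * x.1, x.2) : ℝ × ℝ)).continuousOn
  have h2 := (D.continuousOn_resPsi_line (g := g) hε hdg).comp h
    fun x hx => ⟨mem_univ _, hx.2⟩
  refine h2.congr fun x hx => ?_
  simp only [Function.comp_apply, lowerPt_eq]

lemma continuous_rowForm_resPsi {g dg : ℝ → Fin r ⊕ Fin s → ℂ}
    (hdg : ContinuousOn dg (Icc D.a D.b)) {ε : ℝ} (hε : 0 < ε) {w : ℝ} (hw : w ∈ Icc D.a D.b) :
    Continuous fun σ => D.rowForm (D.resPsi g dg (lowerPt w σ ε) w) w := by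
  have h1 : ContinuousOn (fun σ : ℝ => ((σ, w) : ℝ × ℝ)) univ := by fun_prop
  have h2 : ContinuousOn (fun σ : ℝ => D.resPsi g dg (lowerPt w σ ε) w) univ :=
    ContinuousOn.comp (g := fun x : ℝ × ℝ => D.resPsi g dg (lowerPt x.2 x.1 ε) x.2)
      (f := fun σ : ℝ => ((σ, w) : ℝ × ℝ)) (D.continuousOn_resPsi_lowerPt hdg hε) h1
      fun σ _ => ⟨mem_univ _, hw⟩
  have h3 : ContinuousOn (fun σ : ℝ => D.rowForm (D.resPsi g dg (lowerPt w σ ε) w) w) univ :=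
    D.continuousOn_rowForm (x := fun σ => D.resPsi g dg (lowerPt w σ ε) w) (w := fun _ => w) h2
      continuousOn_const fun _ _ => hw
  exact continuousOn_univ.1 h3

lemma tendsto_dotProduct {ι n : Type*} [Fintype n] {l : Filter ι} {x y : ι → n → ℂ} {x₀ y₀ : n → ℂ}
    (hx : Tendsto x l (𝓝 x₀)) (hy : Tendsto y l (𝓝 y₀)) :
    Tendsto (fun i => x i ⬝ᵥ star (y i)) l (𝓝 (x₀ ⬝ᵥ star y₀)) := by
  rw [tendsto_pi_nhds] at hx hy
  exact tendsto_finsetSum _ fun j _ => (hx j).mul ((continuous_star.tendsto _).comp (hy j))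

/-- The Poisson averages converge to the square norm of the limit operator. -/
lemma tendsto_poisson_rowForm (hdg : ContinuousOn (deriv (D.tilde f)) (Icc D.a D.b))
    (ha : D.tilde f D.a = 0) (hb : D.tilde f D.b = 0) {w : ℝ} (hw : w ∈ Ioo D.a D.b) :
    Tendsto (fun ε => ∫ σ, poisson σ *
      D.rowForm (D.resPsi (D.tilde f) (deriv (D.tilde f)) (lowerPt w σ ε) w) w) (𝓝[>] 0)
      (𝓝 (‖(WithLp.toLp 2 (D.hatSplus f w ᵥ* D.Tplus w) : EuclideanSpace ℂ (Fin p))‖ ^ 2)) := by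
  have hwI : w ∈ Icc D.a D.b := ⟨hw.1.le, hw.2.le⟩
  obtain ⟨x, hx1, hx2⟩ := D.exists_tendsto_resPsi hdg ha hb hw
  obtain ⟨C, hC0, hC⟩ := D.exists_norm_resPsi_le (g := D.tilde f) hdg
  rw [hx2, ← D.rowForm_eq_norm_sq, ← D.integral_poisson_phase hwI]
  refine tendsto_integral_filter_of_dominated_convergence
    (fun σ => poisson σ * (Fintype.card (Fin r ⊕ Fin s) * C) ^ 2) ?_ ?_
    (integrable_poisson.mul_const _) (Eventually.of_forall fun σ => ?_)
  · filter_upwards [self_mem_nhdsWithin] with ε hε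
    exact integrable_poisson.aestronglyMeasurable.mul
      (D.continuous_rowForm_resPsi hdg hε hwI).aestronglyMeasurable
  · filter_upwards [self_mem_nhdsWithin] with ε hε
    refine Eventually.of_forall fun σ => ?_
    rw [Real.norm_of_nonneg (mul_nonneg (poisson_nonneg σ) (D.rowForm_nonneg _ _))]
    refine mul_le_mul_of_nonneg_left ((D.rowForm_le hwI _).trans ?_) (poisson_nonneg σ)
    have := hC _ (fun v _ => ofReal_ne_lowerPt (w := w) (σ := σ) hε v) w hwI
    gcongr
  · refine Tendsto.const_mul _ ?_
    -- By `rowForm_eq_phase` with l = log(w - z), the form of Ψ is a form of the convergent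
    -- regularized vector with the fixed phase arg(i - σ).
    have h1 : Tendsto (fun ε => ((D.resPsi (D.tilde f) (deriv (D.tilde f)) (lowerPt w σ ε) w ᵥ*
        NormedSpace.exp (Complex.log ((w : ℂ) - lowerPt w σ ε) • D.G w)) ᵥ*
        (NormedSpace.exp ((-2 * I * Complex.arg (I - σ)) • D.G w) * D.PiSq w))) (𝓝[>] 0)
        (𝓝 (x ᵥ* (NormedSpace.exp ((-2 * I * Complex.arg (I - σ)) • D.G w) * D.PiSq w))) :=
      (hx1 σ).vecMul tendsto_const_nhds
    refine ((Complex.continuous_re.tendsto _).comp (tendsto_dotProduct h1 (hx1 σ))).congr' ?_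
    filter_upwards [self_mem_nhdsWithin] with ε hε
    rw [D.rowForm_eq_phase hwI (Complex.log ((w : ℂ) - lowerPt w σ ε)), log_sub_lowerPt_im hε]
    rfl

end TriangularModel

/-! ### The limit on smooth functions -/

namespace TriangularModel

open Complex (I)
open Set
open scoped Matrix.Norms.Operator

variable {p r s : ℕ} (D : TriangularModel p r s) {f : ℝ → Fin p → ℂ}

lemma continuousOn_exp_smul_G (t : ℂ) :
    ContinuousOn (fun w => NormedSpace.exp (t • D.G w)) (Icc D.a D.b) := by
  have h : ContinuousOn (fun w => t • D.G w) (Icc D.a D.b) := D.isSkewKernel_G.cont.const_smul t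
  exact NormedSpace.exp_continuous.comp_continuousOn h

/-- The exponentials in the integrand are unitary, so e^{-x} dominates. The continuity is used for
the measurability of S̃₊ f. -/
lemma continuousOn_gammaOneAdd_G : ContinuousOn (fun w => gammaOneAdd (D.G w)) (Icc D.a D.b) := by
  refine continuousOn_pi.2 fun i => continuousOn_pi.2 fun j => ?_
  intro w hw
  have hint : IntegrableOn (fun x : ℝ => Real.exp (-x)) (Ioi 0) := by
    simpa using integrableOn_exp_mul_Ioi (a := -1) (by norm_num) 0
  refine continuousWithinAt_of_dominated (bound := fun x => Real.exp (-x)) ?_ ?_ hint ?_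
  · filter_upwards [self_mem_nhdsWithin] with v hv
    exact (integrableOn_gammaOneAdd (D.isSkewKernel_G.skew v hv) i j).aestronglyMeasurable
  · filter_upwards [self_mem_nhdsWithin] with v hv
    refine Eventually.of_forall fun x => ?_
    rw [norm_mul, Complex.norm_real, Real.norm_of_nonneg (Real.exp_nonneg _)]
    exact mul_le_of_le_one_right (Real.exp_nonneg _) (entry_norm_bound_of_unitary
      (exp_real_smul_skew_mem_unitary (D.isSkewKernel_G.skew v hv) _) i j)
  · refine Eventually.of_forall fun x => ?_
    have h1 := D.continuousOn_exp_smul_G (Real.log x) w hw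
    have h2 := (continuous_apply_apply (ρ := fun _ _ => ℂ) i j).continuousAt.comp_continuousWithinAt h1
    exact continuousWithinAt_const.mul h2

lemma continuousOn_gammaFactor : ContinuousOn D.gammaFactor (Icc D.a D.b) := by
  have h1 : ContinuousOn (fun w => (gammaOneAdd (D.G w))⁻¹) (Icc D.a D.b) := by
    simp only [Matrix.nonsing_inv_eq_ringInverse]
    intro w hw
    obtain ⟨u, hu⟩ := (isUnit_gammaOneAdd_and_integral (D.isSkewKernel_G.skew w hw)).1
    have h2 := NormedRing.inverse_continuousAt u
    rw [hu] at h2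
    exact h2.comp_continuousWithinAt (f := fun w => gammaOneAdd (D.G w))
      (D.continuousOn_gammaOneAdd_G w hw)
  exact (D.continuousOn_exp_smul_G _).mul h1

lemma ae_mem_Ioo : ∀ᵐ w ∂D.μ, w ∈ Ioo D.a D.b := by
  rw [μ, ← restrict_Ioo_eq_restrict_Icc]
  exact ae_restrict_mem measurableSet_Ioo

/-- The function `S̃₊ f` is in `H`. -/
lemma memLp_Splus (hdg : ContinuousOn (deriv (D.tilde f)) (Icc D.a D.b))
    (ha : D.tilde f D.a = 0) (hb : D.tilde f D.b = 0) :
    MemLp (fun w => (WithLp.toLp 2 (D.hatSplus f w ᵥ* D.Tplus w) : EuclideanSpace ℂ (Fin p)))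
      2 D.μ := by
  set dg := deriv (D.tilde f) with hdgdef
  have hex : ∀ w, ∃ x : Fin r ⊕ Fin s → ℂ, w ∈ Ioo D.a D.b → (∀ σ, Tendsto (fun ε =>
      D.resPsi (D.tilde f) dg (lowerPt w σ ε) w ᵥ*
        NormedSpace.exp (Complex.log ((w : ℂ) - lowerPt w σ ε) • D.G w)) (𝓝[>] 0) (𝓝 x)) ∧
      D.hatSplus f w ᵥ* D.Tplus w = (x ᵥ* D.gammaFactor w) ᵥ* (D.Pi w)ᴴ := fun w => by
    by_cases hw : w ∈ Ioo D.a D.b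
    · obtain ⟨x, hx⟩ := D.exists_tendsto_resPsi hdg ha hb hw
      exact ⟨x, fun _ => hx⟩
    · exact ⟨0, fun h => absurd h hw⟩
  choose x hx using hex
  -- The definition of S̃₊ f involves pointwise limits at each `w`, so its measurability is not
  -- evident. It follows because `x` is almost everywhere the limit of the regularized resolvents
  -- along σ = 0, which are continuous in `w`.
  have hxm : AEStronglyMeasurable x D.μ := by
    have hu : Tendsto (fun k : ℕ => 1 / ((k : ℝ) + 1)) atTop (𝓝[>] 0) :=
      tendsto_nhdsWithin_iff.2 ⟨tendsto_one_div_add_atTop_nhds_zero_nat,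
        Eventually.of_forall fun k => Set.mem_Ioi.2 (by positivity)⟩
    refine aestronglyMeasurable_of_tendsto_ae atTop
      (f := fun (k : ℕ) w => D.resPsi (D.tilde f) dg (lowerPt w 0 (1 / ((k : ℝ) + 1))) w ᵥ*
        NormedSpace.exp (Complex.log ((w : ℂ) - lowerPt w 0 (1 / ((k : ℝ) + 1))) • D.G w))
      (fun k => ?_) ?_
    · set ε : ℝ := 1 / ((k : ℝ) + 1) with hε
      have hε0 : 0 < ε := by positivity
      have h1 : ContinuousOn (fun w => D.resPsi (D.tilde f) dg (lowerPt w 0 ε) w)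
          (Icc D.a D.b) :=
        ContinuousOn.comp (g := fun x : ℝ × ℝ => D.resPsi (D.tilde f) dg (lowerPt x.2 x.1 ε) x.2)
          (f := fun w : ℝ => (((0 : ℝ), w) : ℝ × ℝ)) (D.continuousOn_resPsi_lowerPt hdg hε0)
          (by fun_prop) fun w hw => ⟨mem_univ _, hw⟩
      have h2 : ContinuousOn (fun w : ℝ => NormedSpace.exp
          (Complex.log ((w : ℂ) - lowerPt w 0 ε) • D.G w)) (Icc D.a D.b) := by
        have h3 : ∀ w : ℝ, (w : ℂ) - lowerPt w 0 ε = ε * I := fun w => by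
          unfold lowerPt; push_cast; ring
        simp only [h3]
        exact D.continuousOn_exp_smul_G _
      exact (h1.vecMul h2).aestronglyMeasurable measurableSet_Icc
    · filter_upwards [D.ae_mem_Ioo] with w hw
      exact ((hx w hw).1 0).comp hu
  have hm : AEStronglyMeasurable (fun w => x w ᵥ* D.gammaFactor w) D.μ :=
    continuous_vecMul.comp_aestronglyMeasurable
      (hxm.prodMk (D.continuousOn_gammaFactor.aestronglyMeasurable measurableSet_Icc))
  obtain ⟨C, hC0, hC⟩ := D.exists_norm_resPsi_le (g := D.tilde f) hdg
  refine MemLp.of_bound ((D.aestronglyMeasurable_row hm).congr ?_)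
    (Fintype.card (Fin r ⊕ Fin s) * C) ?_
  · filter_upwards [D.ae_mem_Ioo] with w hw
    rw [(hx w hw).2]
  · filter_upwards [D.ae_mem_Ioo] with w hw
    refine le_of_sq_le_sq ?_ (by positivity)
    have hwI : w ∈ Icc D.a D.b := ⟨hw.1.le, hw.2.le⟩
    -- The values of S̃₊ f inherit their bound from the Poisson averages, which are bounded through
    -- the uniform bound of Ψ.
    refine le_of_tendsto (D.tendsto_poisson_rowForm hdg ha hb hw) ?_
    filter_upwards [self_mem_nhdsWithin] with ε hε
    calc _ ≤ ∫ σ, poisson σ * (Fintype.card (Fin r ⊕ Fin s) * C) ^ 2 := by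
          refine integral_mono_of_nonneg (Eventually.of_forall fun σ =>
            mul_nonneg (poisson_nonneg σ) (D.rowForm_nonneg _ _)) (integrable_poisson.mul_const _)
            (Eventually.of_forall fun σ => ?_)
          refine mul_le_mul_of_nonneg_left ((D.rowForm_le hwI _).trans ?_) (poisson_nonneg σ)
          have := hC _ (fun v _ => ofReal_ne_lowerPt (w := w) (σ := σ) hε v) w hwI
          gcongr
      _ = _ := by rw [integral_mul_const, integral_poisson, one_mul]

lemma tendsto_integral_poisson_rowForm (hdg : ContinuousOn (deriv (D.tilde f)) (Icc D.a D.b))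
    (ha : D.tilde f D.a = 0) (hb : D.tilde f D.b = 0) :
    Tendsto (fun ε => ∫ w, (∫ σ, poisson σ *
      D.rowForm (D.resPsi (D.tilde f) (deriv (D.tilde f)) (lowerPt w σ ε) w) w) ∂D.μ) (𝓝[>] 0)
      (𝓝 (∫ w, ‖(WithLp.toLp 2 (D.hatSplus f w ᵥ* D.Tplus w) : EuclideanSpace ℂ (Fin p))‖ ^ 2
        ∂D.μ)) := by
  obtain ⟨C, hC0, hC⟩ := D.exists_norm_resPsi_le (g := D.tilde f) hdg
  refine tendsto_integral_filter_of_dominated_convergence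
    (fun _ => (Fintype.card (Fin r ⊕ Fin s) * C) ^ 2) ?_ ?_ (integrable_const _) ?_
  · filter_upwards [self_mem_nhdsWithin] with ε hε
    exact (D.resolvent_mean_eq hε hdg).1.aestronglyMeasurable
  · filter_upwards [self_mem_nhdsWithin] with ε hε
    filter_upwards [ae_restrict_mem measurableSet_Icc] with w hw
    rw [Real.norm_of_nonneg (integral_nonneg fun σ =>
      mul_nonneg (poisson_nonneg σ) (D.rowForm_nonneg _ _))]
    calc _ ≤ ∫ σ, poisson σ * (Fintype.card (Fin r ⊕ Fin s) * C) ^ 2 := by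
          refine integral_mono_of_nonneg (Eventually.of_forall fun σ =>
            mul_nonneg (poisson_nonneg σ) (D.rowForm_nonneg _ _)) (integrable_poisson.mul_const _)
            (Eventually.of_forall fun σ => ?_)
          refine mul_le_mul_of_nonneg_left ((D.rowForm_le hw _).trans ?_) (poisson_nonneg σ)
          have := hC _ (fun v _ => ofReal_ne_lowerPt (w := w) (σ := σ) hε v) w hw
          gcongr
      _ = _ := by rw [integral_mul_const, integral_poisson, one_mul]
  · filter_upwards [D.ae_mem_Ioo] with w hw
    exact D.tendsto_poisson_rowForm hdg ha hb hw

/-- The strong limit of the quadratic form along the group, as a bounded form. -/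
lemma tendsto_inner_flow_B (g h : D.H) :
    IntegrableOn (fun x => inner ℂ (D.Phi (flow D.B x g)) (rowAct D.L (D.Phi (flow D.B x h))))
      (Ioi 0) ∧
      Tendsto (fun x => inner ℂ (flow D.B x g) (flow D.B x h)) atTop (𝓝 (inner ℂ g h -
        ∫ x in Ioi (0 : ℝ), inner ℂ (D.Phi (flow D.B x g)) (rowAct D.L (D.Phi (flow D.B x h))))) := by
  obtain ⟨C, -, hC⟩ := D.exists_observation_bound
  exact tendsto_inner_flow D.B_sub_adjoint (fun h => (hC h).1) g h

lemma tendsto_norm_sq_flow (h : D.H) : Tendsto (fun x => ‖flow D.B x h‖ ^ 2) atTop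
    (𝓝 (inner ℂ h h - ∫ x in Ioi (0 : ℝ),
      inner ℂ (D.Phi (flow D.B x h)) (rowAct D.L (D.Phi (flow D.B x h)))).re) := by
  refine ((Complex.continuous_re.tendsto _).comp (D.tendsto_inner_flow_B h h).2).congr fun x => ?_
  rw [Function.comp_apply, inner_self_eq_norm_sq_to_K]
  norm_cast

/-- A continuous function that converges at infinity is bounded on the half-line; the bound still
depends on `h`. -/
lemma exists_norm_sq_flow_le (h : D.H) : ∃ C : ℝ, ∀ x, 0 ≤ x → ‖flow D.B x h‖ ^ 2 ≤ C := by
  have h1 := D.tendsto_norm_sq_flow h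
  obtain ⟨X, hX⟩ := eventually_atTop.1 (h1.eventually_le_const (lt_add_one _))
  have hc : Continuous fun x => ‖flow D.B x h‖ ^ 2 := by
    have := continuous_flow D.B h
    fun_prop
  obtain ⟨K, hK⟩ := (isCompact_Icc (a := 0) (b := X)).exists_bound_of_continuousOn hc.continuousOn
  refine ⟨max K ((inner ℂ h h - ∫ x in Ioi (0 : ℝ),
    inner ℂ (D.Phi (flow D.B x h)) (rowAct D.L (D.Phi (flow D.B x h)))).re + 1), fun x hx => ?_⟩
  rcases le_total X x with hxX | hxX
  · exact (hX x hxX).trans (le_max_right _ _)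
  · exact ((le_abs_self _).trans (hK x ⟨hx, hxX⟩)).trans (le_max_left _ _)

/-- Smooth functions with compact support inside the interval. -/
structure IsTest (f : ℝ → Fin p → ℂ) : Prop where
  contDiff : ContDiff ℝ ((⊤ : ℕ∞) : WithTop ℕ∞) f
  compact : HasCompactSupport f
  support : tsupport f ⊆ Ioo D.a D.b

lemma tilde_apply_eq_zero {ξ : ℝ} (h : f ξ = 0) : D.tilde f ξ = 0 := by
  rw [tilde, h, Matrix.zero_vecMul]

variable {D}

namespace IsTest

lemma contDiff_tilde (hf : D.IsTest f) : ContDiff ℝ 1 (D.tilde f) := by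
  rw [contDiff_iff_contDiffAt]
  intro ξ
  by_cases hξ : ξ ∈ tsupport f
  · have hmem : Icc D.a D.b ∈ 𝓝 ξ := Icc_mem_nhds (hf.support hξ).1 (hf.support hξ).2
    refine contDiffAt_pi.2 fun j => ?_
    have h1 : (fun ξ => D.tilde f ξ j) = fun ξ => ∑ i, f ξ i * star (D.Q ξ j i) := rfl
    rw [h1]
    refine ContDiffAt.sum fun i _ => ContDiffAt.mul ?_ ?_
    · exact (contDiffAt_pi.1 hf.contDiff.contDiffAt i).of_le (by simp)
    · exact Complex.conjCLE.contDiff.contDiffAt.comp ξ ((D.smooth_Q j i).contDiffAt hmem)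
  · have h1 := notMem_tsupport_iff_eventuallyEq.1 hξ
    have h2 : D.tilde f =ᶠ[𝓝 ξ] fun _ => 0 := h1.mono fun v hv => D.tilde_apply_eq_zero hv
    exact contDiffAt_const.congr_of_eventuallyEq h2

lemma continuousOn_deriv_tilde (hf : D.IsTest f) :
    ContinuousOn (deriv (D.tilde f)) (Icc D.a D.b) :=
  (hf.contDiff_tilde.continuous_deriv le_rfl).continuousOn

lemma hasDerivAt_tilde (hf : D.IsTest f) (ξ : ℝ) :
    HasDerivAt (D.tilde f) (deriv (D.tilde f) ξ) ξ :=
  (hf.contDiff_tilde.differentiable one_ne_zero ξ).hasDerivAt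

lemma tilde_left (hf : D.IsTest f) : D.tilde f D.a = 0 :=
  D.tilde_apply_eq_zero (image_eq_zero_of_notMem_tsupport fun h => lt_irrefl _ (hf.support h).1)

lemma tilde_right (hf : D.IsTest f) : D.tilde f D.b = 0 :=
  D.tilde_apply_eq_zero (image_eq_zero_of_notMem_tsupport fun h => lt_irrefl _ (hf.support h).2)

lemma row_tilde (hf : D.IsTest f) {F : D.H}
    (hF : (F : ℝ → EuclideanSpace ℂ (Fin p)) =ᵐ[D.μ] fun w => WithLp.toLp 2 (f w)) :
    F = D.row (c := D.tilde f) hf.contDiff_tilde.continuous.continuousOn := by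
  refine Lp.ext ?_
  filter_upwards [hF, D.coeFn_row (c := D.tilde f) hf.contDiff_tilde.continuous.continuousOn,
    ae_restrict_mem measurableSet_Icc] with w h1 h2 h3
  rw [h1, h2, tilde, Matrix.vecMul_vecMul, ← Matrix.conjTranspose_mul, D.Pi_mul_Q w h3,
    Matrix.conjTranspose_one, Matrix.vecMul_one]

/-- The group acts asymptotically on smooth functions through the explicit operator `S̃₊`. -/
theorem tendsto_norm_sq_flow (hf : D.IsTest f) {F : D.H}
    (hF : (F : ℝ → EuclideanSpace ℂ (Fin p)) =ᵐ[D.μ] fun w => WithLp.toLp 2 (f w)) :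
    Tendsto (fun x => ‖flow D.B x F‖ ^ 2) atTop (𝓝 (∫ w,
      ‖(WithLp.toLp 2 (D.hatSplus f w ᵥ* D.Tplus w) : EuclideanSpace ℂ (Fin p))‖ ^ 2 ∂D.μ)) := by
  have hdg := hf.continuousOn_deriv_tilde
  have hl := D.tendsto_norm_sq_flow F
  obtain ⟨C, hC⟩ := D.exists_norm_sq_flow_le F
  -- The value 0 for ε ≤ 0 is never used.
  let u : ℝ → ℝ → D.H := fun ε τ => if hε : 0 < ε then D.resolvent (g := D.tilde f)
    (z := (τ : ℂ) - I * ε) (fun v _ => ofReal_ne_line hε τ v) hdg else 0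
  have h1 := tendsto_resolvent_mean D.subexpGrowth_B hC hl (u := u) fun ε τ hε => by
    simp only [u, dif_pos hε]
    rw [hf.row_tilde hF]
    exact D.B_resolvent _ (fun v _ => (hf.hasDerivAt_tilde v).hasDerivWithinAt) hdg _
  have h2 := (D.tendsto_integral_poisson_rowForm hdg hf.tilde_left hf.tilde_right)
  -- The means of the resolvent over horizontal lines are evaluated twice: as Abel means of the
  -- squared norm along the group, and as Poisson averages of the boundary values.
  have h3 := tendsto_nhds_unique (h1.congr' ?_) h2
  · rw [← h3]; exact hl
  · filter_upwards [self_mem_nhdsWithin] with ε hε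
    have h4 := (D.resolvent_mean_eq (g := D.tilde f) hε hdg).2
    simp only [u, dif_pos (show 0 < ε from hε)]
    exact h4

end IsTest

end TriangularModel

/-! ### The limit operator and the space of modes -/

namespace TriangularModel

open Complex (I)
open Set
open scoped Matrix.Norms.Operator

variable {p r s : ℕ} (D : TriangularModel p r s)

variable {D} in
lemma IsTest.add {f g : ℝ → Fin p → ℂ} (hf : D.IsTest f) (hg : D.IsTest g) : D.IsTest (f + g) where
  contDiff := hf.contDiff.add hg.contDiff
  compact := hf.compact.add hg.compact
  support := (tsupport_add f g).trans (union_subset hf.support hg.support)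

variable {D} in
lemma IsTest.smul {f : ℝ → Fin p → ℂ} (hf : D.IsTest f) (c : ℂ) : D.IsTest (c • f) where
  contDiff := contDiff_const.smul hf.contDiff
  compact := hf.compact.smul_left (f := fun _ => c)
  support := (tsupport_smul_subset_right (fun _ => c) f).trans hf.support

/-- The space of smooth functions with compact support inside the interval. -/
def testSpace : Submodule ℂ (ℝ → Fin p → ℂ) where
  carrier := {f | D.IsTest f}
  add_mem' hf hg := IsTest.add hf hg
  zero_mem' := ⟨contDiff_const, HasCompactSupport.zero, by simp [tsupport]⟩
  smul_mem' c _ hf := IsTest.smul hf c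

lemma tilde_add (f g : ℝ → Fin p → ℂ) : D.tilde (f + g) = D.tilde f + D.tilde g := by
  ext1 ξ; simp [tilde, Matrix.add_vecMul]

lemma tilde_smul (c : ℂ) (f : ℝ → Fin p → ℂ) : D.tilde (c • f) = c • D.tilde f := by
  ext1 ξ; simp [tilde, Matrix.smul_vecMul]

variable {D}

lemma IsTest.hatSplus_add {f g : ℝ → Fin p → ℂ} (hf : D.IsTest f) (hg : D.IsTest g) {w : ℝ}
    (hw : w ∈ Ioo D.a D.b) : D.hatSplus (f + g) w = D.hatSplus f w + D.hatSplus g w := by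
  obtain ⟨R, hR⟩ := D.exists_boundary_fundR hw
  have hH := D.holderAt_G (w := w) ⟨hw.1.le, hw.2.le⟩
  have hG := D.isSkewKernel_G
  have hfd := hf.continuousOn_deriv_tilde
  have hgd := hg.continuousOn_deriv_tilde
  have hd : ∀ ξ, deriv (D.tilde (f + g)) ξ = deriv (D.tilde f) ξ + deriv (D.tilde g) ξ := fun ξ => by
    rw [tilde_add]
    exact ((hf.hasDerivAt_tilde ξ).add (hg.hasDerivAt_tilde ξ)).deriv
  rw [D.hatSplus_eq (hf.add hg).continuousOn_deriv_tilde hw hR, D.hatSplus_eq hfd hw hR,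
    D.hatSplus_eq hgd hw hR]
  simp only [varCoeff, hd, Matrix.add_vecMul]
  rw [intervalIntegral.integral_add
      (tendsto_varCoeff_lowerPt hG hfd (Ioo_subset_Ioc_self hw) 0).1
      (tendsto_varCoeff_lowerPt hG hgd (Ioo_subset_Ioc_self hw) 0).1,
    intervalIntegral.integral_add (tendsto_integral_fundR_across hG hfd hw hH 0 hR).1
      (tendsto_integral_fundR_across hG hgd hw hH 0 hR).1, Matrix.add_vecMul]
  abel

lemma IsTest.hatSplus_smul {f : ℝ → Fin p → ℂ} (hf : D.IsTest f) (c : ℂ) {w : ℝ}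
    (hw : w ∈ Ioo D.a D.b) : D.hatSplus (c • f) w = c • D.hatSplus f w := by
  obtain ⟨R, hR⟩ := D.exists_boundary_fundR hw
  have hd : ∀ ξ, deriv (D.tilde (c • f)) ξ = c • deriv (D.tilde f) ξ := fun ξ => by
    rw [tilde_smul]
    exact ((hf.hasDerivAt_tilde ξ).const_smul c).deriv
  rw [D.hatSplus_eq (hf.smul c).continuousOn_deriv_tilde hw hR,
    D.hatSplus_eq hf.continuousOn_deriv_tilde hw hR]
  simp only [varCoeff, hd, Matrix.smul_vecMul, intervalIntegral.integral_smul, smul_sub]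

variable (D)

lemma memLp_test {f : ℝ → Fin p → ℂ} (hf : D.IsTest f) :
    MemLp (fun w => (WithLp.toLp 2 (f w) : EuclideanSpace ℂ (Fin p))) 2 D.μ := by
  have hc : Continuous fun w => (WithLp.toLp 2 (f w) : EuclideanSpace ℂ (Fin p)) :=
    (PiLp.continuous_toLp 2 _).comp hf.contDiff.continuous
  obtain ⟨C, hC⟩ := isCompact_Icc.exists_bound_of_continuousOn (hc.continuousOn (s := Icc D.a D.b))
  refine MemLp.of_bound hc.aestronglyMeasurable C ?_
  filter_upwards [ae_restrict_mem measurableSet_Icc] with w hw using hC w hw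

/-- The embedding of the test functions into `H`. -/
def testEmbed : D.testSpace →ₗ[ℂ] D.H where
  toFun f := (D.memLp_test f.2).toLp _
  map_add' f g := by
    rw [← MemLp.toLp_add]
    exact MemLp.toLp_congr _ _ (Eventually.of_forall fun w => by simp)
  map_smul' c f := by
    rw [RingHom.id_apply, ← MemLp.toLp_const_smul]
    exact MemLp.toLp_congr _ _ (Eventually.of_forall fun w => by simp)

lemma coeFn_testEmbed (f : D.testSpace) :
    (D.testEmbed f : ℝ → EuclideanSpace ℂ (Fin p)) =ᵐ[D.μ] fun w => WithLp.toLp 2 (f.1 w) :=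
  (D.memLp_test f.2).coeFn_toLp

lemma memLp_Splus_test {f : ℝ → Fin p → ℂ} (hf : D.IsTest f) :
    MemLp (fun w => (WithLp.toLp 2 (D.hatSplus f w ᵥ* D.Tplus w) : EuclideanSpace ℂ (Fin p)))
      2 D.μ :=
  D.memLp_Splus hf.continuousOn_deriv_tilde hf.tilde_left hf.tilde_right

/-- The operator `S̃₊` on test functions. -/
def testSplus : D.testSpace →ₗ[ℂ] D.H where
  toFun f := (D.memLp_Splus_test f.2).toLp _
  map_add' f g := by
    rw [← MemLp.toLp_add]
    refine MemLp.toLp_congr _ _ ?_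
    filter_upwards [D.ae_mem_Ioo] with w hw
    have := IsTest.hatSplus_add f.2 g.2 hw
    simp only [Submodule.coe_add, this, Matrix.add_vecMul, WithLp.toLp_add, Pi.add_apply]
  map_smul' c f := by
    rw [RingHom.id_apply, ← MemLp.toLp_const_smul]
    refine MemLp.toLp_congr _ _ ?_
    filter_upwards [D.ae_mem_Ioo] with w hw
    have := IsTest.hatSplus_smul f.2 c hw
    simp only [Submodule.coe_smul, this, Matrix.smul_vecMul, WithLp.toLp_smul, Pi.smul_apply]

lemma tendsto_norm_flow_test (f : D.testSpace) :
    Tendsto (fun x => ‖flow D.B x (D.testEmbed f)‖) atTop (𝓝 ‖D.testSplus f‖) := by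
  have h1 := IsTest.tendsto_norm_sq_flow f.2 (D.coeFn_testEmbed f)
  have h2 : ∫ w, ‖(WithLp.toLp 2 (D.hatSplus f.1 w ᵥ* D.Tplus w) : EuclideanSpace ℂ (Fin p))‖ ^ 2
      ∂D.μ = ‖D.testSplus f‖ ^ 2 := by
    rw [← L2_integral_norm_sq]
    refine integral_congr_ae ?_
    filter_upwards [(D.memLp_Splus_test f.2).coeFn_toLp] with w hw
    rw [← hw]
    rfl
  rw [h2] at h1
  have h3 := (Real.continuous_sqrt.tendsto _).comp h1
  rw [Real.sqrt_sq (norm_nonneg _)] at h3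
  refine h3.congr fun x => ?_
  rw [Function.comp_apply, Real.sqrt_sq (norm_nonneg _)]

/-- Each orbit is bounded on x ≥ 0 because its norm converges; the uniform boundedness principle
gives a common constant. -/
lemma exists_norm_flow_le : ∃ C : ℝ, 0 ≤ C ∧ ∀ x, 0 ≤ x → ∀ h, ‖flow D.B x h‖ ≤ C * ‖h‖ := by
  obtain ⟨C, hC⟩ := banach_steinhaus (g := fun x : Ici (0 : ℝ) => flow D.B x) fun h => by
    obtain ⟨K, hK⟩ := D.exists_norm_sq_flow_le h
    exact ⟨√K, fun x => Real.le_sqrt_of_sq_le (hK x.1 x.2)⟩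
  refine ⟨max C 0, le_max_right _ _, fun x hx h => ?_⟩
  exact (flow D.B x).le_of_opNorm_le ((hC ⟨x, hx⟩).trans (le_max_left _ _)) h

/-- An element `g` orthogonal to the products of a scalar bump function with a constant vector has ∫
φ g = 0 for every bump function φ, hence vanishes almost everywhere. -/
lemma denseRange_testEmbed : DenseRange D.testEmbed := by
  have h0 : (LinearMap.range D.testEmbed).topologicalClosure = ⊤ := by
    rw [Submodule.topologicalClosure_eq_top_iff, Submodule.eq_bot_iff]
    intro g hg
    have hgi : Integrable (g : ℝ → EuclideanSpace ℂ (Fin p)) D.μ := D.integrable_Lp g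
    have h1 : ∀ φ : ℝ → ℝ, ContDiff ℝ ((⊤ : ℕ∞) : WithTop ℕ∞) φ → HasCompactSupport φ →
        tsupport φ ⊆ Ioo D.a D.b →
        ∫ w, φ w • (g : ℝ → EuclideanSpace ℂ (Fin p)) w ∂D.μ = 0 := by
      intro φ h1 h2 h3
      obtain ⟨K, hK⟩ := h2.exists_bound_of_continuous h1.continuous
      have hi : Integrable (fun w => φ w • (g : ℝ → EuclideanSpace ℂ (Fin p)) w) D.μ :=
        hgi.bdd_smul _ h1.continuous.aestronglyMeasurable (Eventually.of_forall hK)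
      refine ext_inner_left ℂ fun e => ?_
      rw [inner_zero_right, ← integral_inner hi]
      have ht : D.IsTest (fun w => (φ w : ℂ) • e.ofLp) := by
        have hsub : tsupport (fun w => (φ w : ℂ) • e.ofLp) ⊆ tsupport φ := by
          refine closure_mono fun w hw => ?_
          contrapose! hw
          simp only [Function.mem_support, not_not] at hw ⊢
          simp [hw]
        refine ⟨?_, h2.mono' (subset_closure.trans hsub), hsub.trans h3⟩
        exact (Complex.ofRealCLM.contDiff.comp h1).smul contDiff_const
      have h4 := (Submodule.mem_orthogonal _ _).1 hg _ ⟨⟨_, ht⟩, rfl⟩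
      rw [L2.inner_def] at h4
      rw [← h4]
      refine integral_congr_ae ?_
      filter_upwards [D.coeFn_testEmbed ⟨_, ht⟩] with w hw
      rw [hw, WithLp.toLp_smul, inner_smul_left, Complex.conj_ofReal, inner_smul_right_eq_smul]
      simp
    have h2 := isOpen_Ioo.ae_eq_zero_of_integral_contDiff_smul_eq_zero
      (hgi.locallyIntegrable.locallyIntegrableOn _) h1
    refine Lp.ext ?_
    filter_upwards [h2, D.ae_mem_Ioo, Lp.coeFn_zero (EuclideanSpace ℂ (Fin p)) 2 D.μ]
      with w h3 h4 h5
    rw [h3 h4, h5, Pi.zero_apply]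
  have h1 := (Submodule.dense_iff_topologicalClosure_eq_top).2 h0
  exact h1

/-- The bounded operator `S̃₊`. -/
def Splus : D.H →L[ℂ] D.H := D.testSplus.extendOfNorm D.testEmbed

/-- Boundedness of S̃₊ on test functions: its norm is the limit of the norms along the group, which
are at most C times the norm of the argument. The explicit formula is never estimated in `L²`. -/
lemma Splus_testEmbed (f : D.testSpace) : D.Splus (D.testEmbed f) = D.testSplus f := by
  obtain ⟨C, -, hC⟩ := D.exists_norm_flow_le
  refine LinearMap.extendOfNorm_eq D.denseRange_testEmbed ⟨C, fun f => ?_⟩ f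
  refine le_of_tendsto (D.tendsto_norm_flow_test f) ?_
  filter_upwards [eventually_ge_atTop 0] with x hx using hC x hx _

lemma isSplus_Splus : D.IsSplus D.Splus := by
  intro f h1 h2 h3 F hF
  have hf : D.IsTest f := ⟨h1, h2, h3⟩
  have e : F = D.testEmbed ⟨f, hf⟩ := Lp.ext (hF.trans (D.coeFn_testEmbed ⟨f, hf⟩).symm)
  rw [e, Splus_testEmbed]
  exact (D.memLp_Splus_test hf).coeFn_toLp

/-- Density of the test functions suffices because the group is uniformly bounded on x ≥ 0 and S̃₊
is bounded. -/
lemma tendsto_norm_flow (h : D.H) :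
    Tendsto (fun x => ‖flow D.B x h‖) atTop (𝓝 ‖D.Splus h‖) := by
  obtain ⟨C, hC0, hC⟩ := D.exists_norm_flow_le
  rw [Metric.tendsto_atTop]
  intro ε hε
  set K := C + ‖D.Splus‖ + 1 with hK
  have hK0 : 0 < K := by positivity
  obtain ⟨f, hf⟩ := D.denseRange_testEmbed.exists_dist_lt h (ε := ε / (2 * K)) (by positivity)
  rw [dist_eq_norm] at hf
  obtain ⟨X, hX⟩ := (Metric.tendsto_atTop.1 (D.tendsto_norm_flow_test f)) (ε / 2) (half_pos hε)
  refine ⟨max X 0, fun x hx => ?_⟩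
  have h1 := hX x ((le_max_left _ _).trans hx)
  have h2 : |‖flow D.B x h‖ - ‖flow D.B x (D.testEmbed f)‖| ≤ C * ‖h - D.testEmbed f‖ := by
    refine (abs_norm_sub_norm_le _ _).trans ?_
    rw [← map_sub]
    exact hC x ((le_max_right _ _).trans hx) _
  have h3 : |‖D.Splus h‖ - ‖D.testSplus f‖| ≤ ‖D.Splus‖ * ‖h - D.testEmbed f‖ := by
    rw [← Splus_testEmbed]
    refine (abs_norm_sub_norm_le _ _).trans ?_
    rw [← map_sub]
    exact D.Splus.le_opNorm _
  have h4 : (C + ‖D.Splus‖) * ‖h - D.testEmbed f‖ < ε / 2 := by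
    calc _ ≤ K * ‖h - D.testEmbed f‖ := by gcongr; linarith
      _ < K * (ε / (2 * K)) := by gcongr
      _ = ε / 2 := by field_simp
  rw [Real.dist_eq] at h1 ⊢
  rw [abs_le] at h2 h3
  rw [abs_lt] at h1 ⊢
  constructor <;> nlinarith

/-- The inner products along the group converge to those of the images under `S̃₊`. -/
theorem tendsto_inner_flow_Splus (g h : D.H) :
    Tendsto (fun x => inner ℂ (flow D.B x g) (flow D.B x h)) atTop
      (𝓝 (inner ℂ (D.Splus g) (D.Splus h))) := by
  -- Polarization: the limits of the norms determine those of the scalar products.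
  have key : ∀ T : D.H →L[ℂ] D.H, inner ℂ (T g) (T h) =
      (((‖T (g + h)‖ : ℂ) ^ 2 - (‖T (g - h)‖ : ℂ) ^ 2 +
        ((‖T (g - I • h)‖ : ℂ) ^ 2 - (‖T (g + I • h)‖ : ℂ) ^ 2) * I) / 4) := fun T => by
    rw [inner_eq_sum_norm_sq_div_four (𝕜 := ℂ)]
    simp only [map_add, map_sub, map_smul]
    rfl
  have hn : ∀ u : D.H, Tendsto (fun x => (‖flow D.B x u‖ : ℂ) ^ 2) atTop
      (𝓝 ((‖D.Splus u‖ : ℂ) ^ 2)) := fun u =>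
    ((Complex.continuous_ofReal.tendsto _).comp (D.tendsto_norm_flow u)).pow 2
  simp only [key]
  exact (((hn _).sub (hn _)).add (((hn _).sub (hn _)).mul_const I)).div_const 4

/-- The same limit is evaluated through S̃₊ and through the energy identity. This is the
conservation law behind the isometry. -/
lemma inner_Splus (g h : D.H) : inner ℂ (D.Splus g) (D.Splus h) = inner ℂ g h -
    ∫ x in Ioi (0 : ℝ), inner ℂ (D.Phi (flow D.B x g)) (rowAct D.L (D.Phi (flow D.B x h))) :=
  tendsto_nhds_unique (D.tendsto_inner_flow_Splus g h) (D.tendsto_inner_flow_B g h).2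

lemma PhiTilde_apply (h : D.H) (x : Fin 3 × (Fin r ⊕ Fin s)) :
    (D.PhiTilde h).ofLp x = (D.Phi ((ContinuousLinearMap.adjoint D.B ^ (x.1 : ℕ)) h)).ofLp x.2 := rfl

/-- The matrix σ_B meets only the block of Φ̃ with the zeroth power of `B*`, which is Φ itself. -/
lemma inner_sigmaBApply (g h : D.H) :
    inner ℂ (D.PhiTilde g) (D.sigmaBApply (D.PhiTilde h)) =
      inner ℂ (D.Phi g) (rowAct D.L (D.Phi h)) := by
  rw [PiLp.inner_apply, PiLp.inner_apply, Fintype.sum_prod_type, Fin.sum_univ_three]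
  have h1 : ∀ x : Fin 3 × (Fin r ⊕ Fin s), (D.sigmaBApply (D.PhiTilde h)).ofLp x =
      if x.1 = 0 then ((D.Phi h).ofLp ᵥ* D.L) x.2 else 0 := by
    intro x
    change ∑ y, (D.PhiTilde h).ofLp y * D.sigmaB y x = _
    rw [Fintype.sum_prod_type, Fin.sum_univ_three]
    split_ifs with hx
    · simp [sigmaB, hx, PhiTilde_apply, Matrix.vecMul, dotProduct]
    · simp [sigmaB, hx]
  simp only [h1, PhiTilde_apply, rowAct_apply]
  simp

/-- Repeated differentiation of Φ e^{ixB} h = 0 brings down the powers of `B`; the induction runs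
over all x so that each identity can be differentiated again. -/
lemma Phi_pow_eq_zero {h : D.H} (hh : ∀ x, D.Phi (flow D.B x h) = 0) (n : ℕ) :
    D.Phi ((D.B ^ n) h) = 0 := by
  have key : ∀ n : ℕ, ∀ x, D.Phi (flow D.B x ((D.B ^ n) h)) = 0 := fun n => by
    induction n with
    | zero => simpa using hh
    | succ n ih =>
      intro x
      have h1 := (D.Phi.restrictScalars ℝ).hasFDerivAt.comp_hasDerivAt x
        (hasDerivAt_flow D.B ((D.B ^ n) h) x)
      have h2 : (D.Phi.restrictScalars ℝ) ∘ (fun x => flow D.B x ((D.B ^ n) h)) = fun _ => 0 :=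
        funext ih
      rw [h2] at h1
      have h3 : D.Phi (I • D.B (flow D.B x ((D.B ^ n) h))) = 0 :=
        h1.unique (hasDerivAt_const x 0)
      rw [map_smul, smul_eq_zero, or_iff_right Complex.I_ne_zero] at h3
      rwa [pow_succ', mul_apply_eq_comp, flow_commute]
  simpa [flow_zero] using key n 0

/-- The map from the principal subspace to the modes is injective. -/
lemma eq_zero_of_mode_eq_zero {h : D.H} (hh : h ∈ D.principal) (h0 : D.mode h = 0) : h = 0 := by
  have h1 : ∀ x, D.Phi (flow D.B x h) = 0 := fun x => by
    have h2 : D.PhiTilde (flow D.B x h) = 0 := congrFun h0 x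
    ext j
    have h3 := congrArg (fun v : D.E => v.ofLp (0, j)) h2
    simpa [PhiTilde_apply] using h3
  have h2 := D.Phi_pow_eq_zero h1
  -- The non-selfadjoint part i Φ* L Φ vanishes on every `B ^ n h`, so `B` and its adjoint agree
  -- along this orbit.
  have h3 : ∀ n : ℕ, ((ContinuousLinearMap.adjoint D.B) ^ n) h = (D.B ^ n) h := fun n => by
    induction n with
    | zero => rfl
    | succ n ih =>
      rw [pow_succ', pow_succ', mul_apply_eq_comp, mul_apply_eq_comp, ih]
      have h4 := congrArg (fun T : D.H →L[ℂ] D.H => T ((D.B ^ n) h)) D.B_sub_adjoint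
      simp only [_root_.sub_apply, _root_.smul_apply, ContinuousLinearMap.comp_apply, h2 n,
        map_zero, smul_zero] at h4
      exact (sub_eq_zero.1 h4).symm
  -- All components Φ B*^k B^n h are then Φ B^(k + n) h = 0. So `h` is orthogonal to the generators
  -- of the principal subspace to which it belongs.
  have h4 : h ∈ D.principalᗮ := by
    rw [principal, Submodule.orthogonal_closure, Submodule.mem_orthogonal]
    intro u hu
    induction hu using Submodule.span_induction with
    | mem u hu =>
      obtain ⟨n, e, rfl⟩ := hu
      rw [← ContinuousLinearMap.adjoint_inner_right, ← ContinuousLinearMap.star_eq_adjoint,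
        star_pow, ContinuousLinearMap.star_eq_adjoint, h3, ContinuousLinearMap.adjoint_inner_left]
      have h5 : D.PhiTilde ((D.B ^ n) h) = 0 := by
        ext x
        rw [PhiTilde_apply, ← h3 n, ← mul_apply_eq_comp, ← pow_add, h3, h2]
        rfl
      rw [h5, inner_zero_right]
    | zero => exact inner_zero_left _
    | add u v _ _ hu hv => rw [inner_add_left, hu, hv, add_zero]
    | smul c u _ hu => rw [inner_smul_left, hu, mul_zero]
  exact Submodule.disjoint_def.1 (Submodule.orthogonal_disjoint D.principal) h hh h4

end TriangularModel

end

/-- `inner ℂ y x` is `(x, y)`, linear in `x`; `ip (D.U h) (D.U g)` is `⟨v_h, v_g⟩`. -/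
theorem theoremt5 {p r s : ℕ} (D : TriangularModel p r s) :
    ∃ Splus : D.H →L[ℂ] D.H, D.IsSplus Splus ∧
      ∃ ip : D.modeSpace → D.modeSpace → ℂ,
        (∀ h g : D.principal,
          Tendsto (fun ξ : ℝ => inner ℂ (D.expB ξ (g : D.H)) (D.expB ξ (h : D.H))) atTop
            (𝓝 (inner ℂ (Splus (g : D.H)) (Splus (h : D.H)))) ∧
          IntegrableOn (fun ξ : ℝ => inner ℂ (D.mode (g : D.H) ξ)
            (D.sigmaBApply (D.mode (h : D.H) ξ))) (Set.Ioi 0) ∧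
          ip (D.U h) (D.U g) = inner ℂ (Splus (g : D.H)) (Splus (h : D.H)) +
            ∫ ξ in Set.Ioi (0 : ℝ), inner ℂ (D.mode (g : D.H) ξ)
              (D.sigmaBApply (D.mode (h : D.H) ξ))) ∧
        IsScalarProduct ip ∧
        ∀ h g : D.principal, ip (D.U h) (D.U g) = inner ℂ (g : D.H) (h : D.H) := by
  have hinj : Function.Injective D.U := by
    rw [← LinearMap.ker_eq_bot, LinearMap.ker_eq_bot']
    intro h hh
    exact Subtype.ext (D.eq_zero_of_mode_eq_zero h.2 (congrArg Subtype.val hh))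
  let e : D.principal ≃ₗ[ℂ] D.modeSpace :=
    LinearEquiv.ofBijective D.U ⟨hinj, D.mode.submoduleMap_surjective D.principal⟩
  have he : ∀ h, e.symm (D.U h) = h := fun h => e.symm_apply_apply h
  have hint : ∀ h g : D.H, (fun ξ : ℝ => inner ℂ (D.mode g ξ) (D.sigmaBApply (D.mode h ξ))) =
      fun ξ => inner ℂ (D.Phi (flow D.B ξ g)) (rowAct D.L (D.Phi (flow D.B ξ h))) :=
    fun h g => funext fun ξ => D.inner_sigmaBApply (flow D.B ξ g) (flow D.B ξ h)
  -- The form on the modes is the scalar product of the principal subspace transported by the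
  -- inverse of Ũ. It is therefore well defined and positive definite, and the content lies in its
  -- equality with limit plus integral, which is `inner_Splus`.
  refine ⟨D.Splus, D.isSplus_Splus, fun x y => inner ℂ (e.symm y : D.H) (e.symm x : D.H),
    fun h g => ⟨D.tendsto_inner_flow_Splus g h, ?_, ?_⟩, ⟨?_, ?_, ?_, ?_, ?_⟩, ?_⟩
  · rw [hint]
    exact (D.tendsto_inner_flow_B g h).1
  · simp only [he]
    rw [hint, D.inner_Splus, sub_add_cancel]
  · intro x y z
    simp only [map_add, Submodule.coe_add, inner_add_right]
  · intro c x y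
    simp only [map_smul, Submodule.coe_smul, inner_smul_right]
  · exact fun x y => (inner_conj_symm _ _).symm
  · exact fun x => inner_self_nonneg (𝕜 := ℂ)
  · intro x hx
    have h1 := inner_self_eq_zero.1 hx
    rwa [Submodule.coe_eq_zero, LinearEquiv.map_eq_zero_iff] at h1
  · intro h g
    simp only [he]
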